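/- \textbf{Setting.} Let $\tilde\Omega\subset\mathbb R^d$ be open and bounded, $q_s,q_t\ge 1$, $\ell\ge\max\{q_s,q_t\}+2$ and $\ell'\in\{\ell-1,\ell\}$. On a time slab $I=(t_0,t_0+\Delta t]$ consider a conforming simplicial mesh $\mathcal T_h$ of $\overline{\tilde\Omega}$ with shape regularity constant $\sigma$ and mesh size $h=\max_T h_T$, a level set function $\phi\in C^0(\tilde\Omega\times I)$ and a discrete level set function $\phi_h$, continuous and piecewise polynomial of degree $q_s$ in space and polynomial of degree $q_t$ in time. $D$, $\nabla$ denote spatial derivatives. Put $\Omega(t)=\{x\in\tilde\Omega:\phi(x,t)<0\}$, $U(t)=\{x\in\tilde\Omega:\operatorname{dist}(x,\partial\Omega(t))<\delta_U\}$, $U=\bigcup_{t\in I}U(t)\times\{t\}$, $\mathcal T_h^U=\{T\in\mathcal T_h: T\times I\subset U\}$, $Q_U=\bigcup_{T\in\mathcal T_h^U}T\times I$, $G=\nabla\phi$. Let $\phi^{\rm lin}(\cdot,t)$ be the piecewise linear nodal interpolant of $\phi_h(\cdot,t)$ and $\Omega^{\rm lin}(t)=\{x\in\tilde\Omega:\phi^{\rm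 lin}(x,t)<0\}$. Assume, with fixed constants: \begin{itemize} \item $\operatorname{dist}(\partial\tilde\Omega,\partial\Omega(t))>\delta_\Omega>0$ for all $t\in I$, and $\Delta t^{q_t+1}\le C h^{1+\epsilon}$ for some $\epsilon>0$; \item $\phi\in C^2(U)$, $0<c_\phi\le|\nabla\phi|\le C_\phi$ on $U$, and $\partial_t\phi,D^2\phi,\partial_t\nabla\phi$ are bounded on $U$; there are $\varepsilon_0,c,C>0$ such that for $t\in I$, $x\in U(t)$, $|\varepsilon|,|\tilde\varepsilon|\le\varepsilon_0$ the point $x+\varepsilon G(x,t)$ lies in $\tilde\Omega$ and $c|\varepsilon-\tilde\varepsilon|\le|\phi(x+\varepsilon G(x,t),t)-\phi(x+\tilde\varepsilon G(x,t),t)|\le C|\varepsilon-\tilde\varepsilon|$; \item $\phi\in C^\ell(Q_U)$ and $\nabla\phi\in C^{\ell'}(Q_U)$ with bounded derivatives (the second is automatic if $\ell'=\ell-1$); \item $\|D^{m_s}\partial_t^{m_t}(\phi-\phi_h)\|_{\infty,T\times I}\le C(h^{q_s+1-m_s}+\Delta t^{q_t+1-m_t})$ for all $T\in\mathcal T_h^U$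 and $(m_s,m_t)\in\{0,\dots,q_s+1\}\times\{0,1\}\cup\{0\}\times\{0,\dots,q_t+1\}$. \end{itemize} For a blending function $b$ and a set $\mathcal T^\Gamma\subset\mathcal T_h^U$ of active elements with union $\Omega^\Gamma$ let $d(x,t)$, $x\in\Omega^\Gamma$, $t\in I$, be the number $\alpha$ of smallest absolute value such that $x+\alpha G(x,t)\in\tilde\Omega$ and $\phi(x+\alpha G(x,t),t)=(1-b(x,t))\phi^{\rm lin}(x,t)+b(x,t)\phi(x,t)$, and put $\Psi^\Gamma(x,t)=x+d(x,t)G(x,t)$. The mapping $\Psi$ is one of the following. \emph{Smooth blending.} $0<w_b<\min\{\delta_\Omega,\delta_U\}$; $b\in C^\ell(\tilde\Omega\times I;[0,1])$ has derivatives up to order $\ell$ bounded by a fixed constant, $b=0$ on all elements cut by $\partial\Omega^{\rm lin}(t)$ for some $t\in I$, $b(x,t)=1$ if $\operatorname{dist}(x,\partial\Omega^{\rm lin}(t))>w_b$; $\mathcal T^\Gamma$ is the set of elements on which $b<1$ somewhere; the approximation bound for $\phi_h$ holds also for $m_s=1$, $0\le m_t\le q_t+1$. Then $\Psi=\Psi^\Gamma$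 on $\Omega^\Gamma$ and $\Psi=\mathrm{id}$ elsewhere. \emph{Finite element blending.} $\ell\ge q_s+q_t+2$, $\Delta t\le C h$, the mesh is quasi-uniform ($h\le\kappa h_T$ for all $T$), $b\equiv0$, and $\mathcal T^\Gamma$ is the set of elements cut by $\partial\Omega^{\rm lin}(t)$ for some $t\in I$. Then $\Psi=\Psi^\Gamma$ on $\Omega^\Gamma$, $\Psi(\cdot,t)=\mathrm{id}+\mathcal E^{\partial\Omega^\Gamma}(\Psi^\Gamma(\cdot,t)-\mathrm{id})$ on the elements outside $\mathcal T^\Gamma$ that meet $\Omega^\Gamma$, and $\Psi=\mathrm{id}$ elsewhere. Here $\mathcal E^{\partial\Omega^\Gamma}w$ is built on each such $T$ as follows: start with the linear interpolant of $w$ at the vertices of $T$ in $\Omega^\Gamma$ (value zero at the other vertices); then for $j=1,\dots,d-1$ add, for every $j$-dimensional face $F$ of $T$ that is a face of an active element, the extension to $T$ of the current residual $u$ on $F$, $$\omega^{r}(u-\Lambda_{q_s}u)\circ Z+\sum_{l=2}^{q_s}\omega^l(\Lambda_lu-\Lambda_{l-1}u)\circ Z,\qquad \omega=\sum_{v\in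 F}\lambda_v,\quad Z=\sum_{v\in F}\tfrac{\lambda_v}{\omega}v$$ (zero where $\omega=0$), with the barycentric coordinates $\lambda_v$ of $T$, the nodal Lagrange interpolation $\Lambda_l$ of degree $l$ on $F$, and a fixed exponent $r\ge q_s+1$. \textbf{Theorem.} There are $C,h_0,\tau_0>0$, depending only on $\tilde\Omega,d,q_s,q_t,\ell,\ell',r$ and the constants in the assumptions (so not on $h$, $\Delta t$, the cut configuration), such that for all $h\le h_0$, $\Delta t\le\tau_0$ the function $d$ is well defined (the number of smallest absolute value exists and is unique), $\Psi(\cdot,t)$ is continuous on $\tilde\Omega$ for every $t\in I$, all derivatives below exist (spatial ones in the interiors of the elements), and $$\max_{t\in I}\|\Psi(\cdot,t)-\mathrm{id}\|_{\infty,\tilde\Omega}\le C(h^2+\Delta t^{q_t+1}),\qquad \max_{x\in\tilde\Omega}\|\partial_t\Psi(x,\cdot)\|_{\infty,I}\le C(h^2+\Delta t^{q_t}).$$ Moreover, for smooth blending $$\max_{t\in I}\|D\Psi(\cdot,t)-I\|_{\infty,\tilde\Omega}\le C(h+\Delta t^{q_t+1}),\qquad \max_{t\in I}\max_{T\in\mathcal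 T_h}\|D^{l_s}\partial_t^{l_t}\Psi(\cdot,t)\|_{\infty,T}\le C$$ for $l_s\le q_s+1$, $l_t\le q_t+1$, $l_s+l_t\le\ell'$; and for finite element blending $$h\max_{t\in I}\|D\Psi(\cdot,t)-I\|_{\infty,\tilde\Omega}\le C(h^2+\Delta t^{q_t+1}),\qquad \max_{t\in I}\max_{T\in\mathcal T_h}\|D^{l_s}\partial_t^{l_t}\Psi(\cdot,t)\|_{\infty,T}\le C$$ for $l_s\le q_s+1$, $l_t\le q_t$. -/

import Mathlib

open Set

noncomputable section

namespace UnfittedSpaceTime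

/-- Euclidean space `ℝ^d`. -/
abbrev Space (d : ℕ) : Type := EuclideanSpace ℝ (Fin d)

/-! ### Mixed space-time derivatives

A space-time function is curried: `f x t` with `x` in space and `t` in time.  Time derivatives are
taken within the (half-open) time interval `I`, so they are one-sided at its right end. -/

section Calculus

variable {d : ℕ} {F : Type*} [NormedAddCommGroup F] [NormedSpace ℝ F]

/-- The mixed derivative `D^{ls} ∂_t^{lt} f` at `(x, t)`. -/
def mixedDeriv (I : Set ℝ) (ls lt : ℕ) (f : Space d → ℝ → F) (x : Space d) (t : ℝ) :
    ContinuousMultilinearMap ℝ (fun _ : Fin ls => Space d) F :=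
  iteratedFDeriv ℝ ls (fun y => iteratedDerivWithin lt (f y) I t) x

/-- On `S × I` the classical derivatives `∂_t^{lt} f` and `D^{ls} ∂_t^{lt} f` exist. -/
def HasMixedDerivOn (S : Set (Space d)) (I : Set ℝ) (ls lt : ℕ) (f : Space d → ℝ → F) : Prop :=
  (∀ x ∈ S, ContDiffOn ℝ lt (f x) I) ∧
    ∀ t ∈ I, ContDiffOn ℝ ls (fun y => iteratedDerivWithin lt (f y) I t) S

end Calculus

variable {d : ℕ}

/-! ### Simplicial meshes -/

/-- The closed simplex with vertex set `s`. -/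
def cell (s : Finset (Space d)) : Set (Space d) := convexHull ℝ (s : Set (Space d))

/-- The spatial domain covered by a set of elements. -/
def region (A : Set (Finset (Space d))) : Set (Space d) := ⋃ s ∈ A, cell s

/-- `K` is a (finite, conforming) triangulation of the closure of `Ω` into `d`-simplices.
The elements of the mesh are the facets of `K`. -/
structure IsMesh (Ω : Set (Space d)) (K : Geometry.SimplicialComplex ℝ (Space d)) : Prop where
  finite : K.faces.Finite
  pure : ∀ s ∈ K.facets, s.card = d + 1
  cover : K.space = closure Ω

/-- The mesh size: the largest element diameter. -/
def meshSize (K : Geometry.SimplicialComplex ℝ (Space d)) : ℝ :=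
  sSup ((fun s => Metric.diam (cell s)) '' K.facets)

/-- Every element contains a ball of radius `diam / σ`. -/
def ShapeRegular (K : Geometry.SimplicialComplex ℝ (Space d)) (σ : ℝ) : Prop :=
  ∀ s ∈ K.facets, ∃ c, Metric.ball c (Metric.diam (cell s) / σ) ⊆ cell s

/-- All element diameters are comparable with the mesh size. -/
def QuasiUniform (K : Geometry.SimplicialComplex ℝ (Space d)) (κ : ℝ) : Prop :=
  ∀ s ∈ K.facets, meshSize K ≤ κ * Metric.diam (cell s)

/-- `w` is the family of barycentric coordinates of `x` with respect to the vertices `s`. -/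
def IsBary (s : Finset (Space d)) (x : Space d) (w : Space d → ℝ) : Prop :=
  (∀ v ∉ s, w v = 0) ∧ ∑ v ∈ s, w v = 1 ∧ ∑ v ∈ s, w v • v = x

open Classical in
/-- The barycentric coordinates of `x` with respect to the (affinely independent) vertices `s`;
they are unique if they exist, and we use the value zero if they do not. -/
def bary (s : Finset (Space d)) (x : Space d) : Space d → ℝ :=
  if h : ∃ w, IsBary s x w then h.choose else 0

open Classical in
/-- Some element that contains `x` (the empty set if there is none). -/
def cellAt (K : Geometry.SimplicialComplex ℝ (Space d)) (x : Space d) : Finset (Space d) :=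
  if h : ∃ s ∈ K.facets, x ∈ cell s then h.choose else ∅

/-- The continuous piecewise linear nodal interpolant `I_h^1 f`. -/
def nodalInterp (K : Geometry.SimplicialComplex ℝ (Space d)) (f : Space d → ℝ) (x : Space d) : ℝ :=
  ∑ v ∈ cellAt K x, bary (cellAt K x) x v * f v

/-- `W_h^k`: continuous functions that are polynomials of degree at most `k` on each element. -/
def MemW (K : Geometry.SimplicialComplex ℝ (Space d)) (k : ℕ) (v : Space d → ℝ) : Prop :=
  ContinuousOn v K.space ∧
    ∀ s ∈ K.facets, ∃ p : MvPolynomial (Fin d) ℝ, p.totalDegree ≤ k ∧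
      ∀ x ∈ cell s, v x = MvPolynomial.eval (fun i => x i) p

/-- `V_h^{ks,kt} = W_h^{ks} ⊗ P^{kt}(I)`. -/
def MemV (K : Geometry.SimplicialComplex ℝ (Space d)) (I : Set ℝ) (ks kt : ℕ)
    (v : Space d → ℝ → ℝ) : Prop :=
  ∃ w : Fin (kt + 1) → Space d → ℝ, (∀ i, MemW K ks (w i)) ∧
    ∀ x ∈ K.space, ∀ t ∈ I, v x t = ∑ i, w i x * t ^ (i : ℕ)

/-! ### Extension from the active elements to their neighbours -/

/-- Nodal interpolation `Λ_l` of degree `l` on the simplex `f`: Lagrange interpolation at the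
points `∑ v, (α v / l) • v`, `|α| = l`, written with barycentric coordinates. -/
def lagrange (l : ℕ) (f : Finset (Space d)) (u : Space d → Space d) (z : Space d) : Space d :=
  ∑ α ∈ f.piAntidiag l,
    (∏ v ∈ f, ∏ i ∈ Finset.range (α v), ((l : ℝ) * bary f z v - i) / ((α v : ℝ) - i)) •
      u (∑ v ∈ f, ((α v : ℝ) / l) • v)

/-- Extension to the simplex `s` of a function `u` given on its face `f` (and zero on the relative
boundary of `f`).  With `ω = ∑_{v ∈ f} λ_v` and `Z = ∑_{v ∈ f} (λ_v / ω) v` this is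
`ω^r (u - Λ_k u) ∘ Z + ∑_{l=2}^k ω^l (Λ_l u - Λ_{l-1} u) ∘ Z` (zero where `ω = 0`). -/
def faceExt (k r : ℕ) (s f : Finset (Space d)) (u : Space d → Space d) (x : Space d) : Space d :=
  let ω : ℝ := ∑ v ∈ f, bary s x v
  let Z : Space d := ω⁻¹ • ∑ v ∈ f, bary s x v • v
  ω ^ r • (u Z - lagrange k f u Z) +
    ∑ l ∈ Finset.Icc 2 k, ω ^ l • (lagrange l f u Z - lagrange (l - 1) f u Z)

open Classical in
/-- Extension to `s` of the values of `w` at those vertices (level `0`), edges (level `1`),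
2-dimensional faces (level `2`), ... of `s` that belong to elements of `A`.  Level `0` is linear
interpolation with the value zero at all other vertices; each further level corrects the
result of the previous one on the faces of the next dimension. -/
def extLevel (A : Set (Finset (Space d))) (k r : ℕ) (s : Finset (Space d))
    (w : Space d → Space d) : ℕ → Space d → Space d
  | 0 => fun x => ∑ v ∈ s with ∃ s' ∈ A, v ∈ s', bary s x v • w v
  | j + 1 => fun x => extLevel A k r s w j x +
      ∑ f ∈ s.powerset with f.card = j + 2 ∧ ∃ s' ∈ A, f ⊆ s',
        faceExt k r s f (fun z => w z - extLevel A k r s w j z) x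

/-- The extension `𝓔^{∂Ω^Γ} w` on the element `s ∉ A` of a function `w` given on `region A`:
all faces of `s` of dimension less than `d` that lie in `region A` are used. -/
def boundaryExt (A : Set (Finset (Space d))) (k r : ℕ) (s : Finset (Space d))
    (w : Space d → Space d) : Space d → Space d :=
  extLevel A k r s w (d - 1)

/-! ### Level set geometry on one time slab -/

/-- Data of one time slab: a mesh, the time interval `(t₀, t₀ + τ]`, a level set function `φ`
and a discrete level set function `φh`. -/
structure Slab (d : ℕ) where
  K : Geometry.SimplicialComplex ℝ (Space d)
  t₀ : ℝ
  τ : ℝ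
  φ : Space d → ℝ → ℝ
  φh : Space d → ℝ → ℝ

namespace Slab

variable (D : Slab d) (Ω : Set (Space d))

/-- The time interval `I_n`. -/
def I : Set ℝ := Ioc D.t₀ (D.t₀ + D.τ)

/-- The mesh size `h`. -/
def h : ℝ := meshSize D.K

/-- The physical domain `Ω(t)` in the background domain `Ω`. -/
def dom (t : ℝ) : Set (Space d) := {x ∈ Ω | D.φ x t < 0}

/-- The neighbourhood `U(t)` of `∂Ω(t)` of size `δ`. -/
def nbhd (δ t : ℝ) : Set (Space d) := {x ∈ Ω | ∃ z ∈ frontier (D.dom Ω t), dist x z < δ}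

/-- The space-time neighbourhood `U`. -/
def nbhdST (δ : ℝ) : Set (Space d × ℝ) := {p | p.2 ∈ D.I ∧ p.1 ∈ D.nbhd Ω δ p.2}

/-- `𝓣_h^U`: the elements contained in `U(t)` for all `t ∈ I_n`. -/
def cellsU (δ : ℝ) : Set (Finset (Space d)) :=
  {s ∈ D.K.facets | ∀ t ∈ D.I, cell s ⊆ D.nbhd Ω δ t}

/-- The search direction `G = ∇φ` (spatial gradient). -/
def G (x : Space d) (t : ℝ) : Space d := gradient (fun y => D.φ y t) x

/-- The spatially piecewise linear level set function `φ^lin = I_h^1 φ_h`. -/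
def φlin (x : Space d) (t : ℝ) : ℝ := nodalInterp D.K (fun y => D.φh y t) x

/-- `Ω^lin(t)`. -/
def domLin (t : ℝ) : Set (Space d) := {x ∈ Ω | D.φlin x t < 0}

/-- Elements cut by `∂Ω^lin(t)` for some `t ∈ I_n`. -/
def cutCells : Set (Finset (Space d)) :=
  {s ∈ D.K.facets | ∃ t ∈ D.I, (frontier (D.domLin Ω t) ∩ cell s).Nonempty}

/-- Elements on which the blending function `b` is somewhere smaller than one. -/
def blendCells (b : Space d → ℝ → ℝ) : Set (Finset (Space d)) :=
  {s ∈ D.K.facets | ∃ t ∈ D.I, ∃ x ∈ cell s ∩ Ω, b x t < 1}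

/-! ### The ideal mapping -/

/-- `α` solves `φ(x + α G(x,t), t) = (1 - b(x,t)) φ^lin(x,t) + b(x,t) φ(x,t)`. -/
def IsRoot (b : Space d → ℝ → ℝ) (x : Space d) (t α : ℝ) : Prop :=
  x + α • D.G x t ∈ Ω ∧
    D.φ (x + α • D.G x t) t = (1 - b x t) * D.φlin x t + b x t * D.φ x t

/-- `α` is a solution of smallest absolute value. -/
def IsSmallestRoot (b : Space d → ℝ → ℝ) (x : Space d) (t α : ℝ) : Prop :=
  D.IsRoot Ω b x t α ∧ ∀ β, D.IsRoot Ω b x t β → |α| ≤ |β|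

open Classical in
/-- The distance function `d(x,t)`. -/
def distFn (b : Space d → ℝ → ℝ) (x : Space d) (t : ℝ) : ℝ :=
  if h : ∃ α, D.IsSmallestRoot Ω b x t α then h.choose else 0

/-- `Ψ^Γ(x,t) = x + d(x,t) G(x,t)`. -/
def ΨΓ (b : Space d → ℝ → ℝ) (x : Space d) (t : ℝ) : Space d :=
  x + D.distFn Ω b x t • D.G x t

open Classical in
/-- The extended ideal mapping with smooth blending: `Ψ^Γ` on the active elements, identity
elsewhere. -/
def ΨSmooth (b : Space d → ℝ → ℝ) (x : Space d) (t : ℝ) : Space d :=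
  if x ∈ region (D.blendCells Ω b) then D.ΨΓ Ω b x t else x

open Classical in
/-- The extended ideal mapping with finite element blending: `Ψ^Γ` (with `b = 0`) on the cut
elements, `id + 𝓔^{∂Ω^Γ}(Ψ^Γ - id)` on their neighbours, identity elsewhere. -/
def ΨFE (k r : ℕ) (x : Space d) (t : ℝ) : Space d :=
  let A := D.cutCells Ω
  if x ∈ region A then D.ΨΓ Ω 0 x t
  else if h : ∃ s ∈ D.K.facets, x ∈ cell s ∧ (cell s ∩ region A).Nonempty then
    x + boundaryExt A k r h.choose (fun y => D.ΨΓ Ω 0 y t - y) x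
  else x

/-- The distance function is well defined on the active elements. -/
def WellPosed (b : Space d → ℝ → ℝ) (A : Set (Finset (Space d))) : Prop :=
  ∀ x ∈ region A, ∀ t ∈ D.I, ∃! α, D.IsSmallestRoot Ω b x t α

end Slab

/-! ### Assumptions -/

/-- The constants on which all bounds may depend. -/
structure Consts where
  /-- separation of `∂Ω(t)` from the boundary of the background domain -/
  δΩ : ℝ
  /-- size of the neighbourhood `U` -/
  δU : ℝ
  /-- bounds for the gradient of `φ` on `U`, and for the other derivatives -/
  cφ : ℝ
  Cφ : ℝ
  C₂ : ℝ
  /-- weak signed distance property -/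
  cw : ℝ
  Cw : ℝ
  ε₀ : ℝ
  /-- bound for the higher derivatives of `φ` and `∇φ` -/
  Cℓ : ℝ
  /-- approximation of `φ` by `φh` -/
  Cap : ℝ
  /-- shape regularity -/
  σ : ℝ
  /-- `τ^(q_t+1) ≤ Cτh * h^(1+ε)` -/
  Cτh : ℝ
  ε : ℝ
  δΩ_pos : 0 < δΩ
  δU_pos : 0 < δU
  cφ_pos : 0 < cφ
  cw_pos : 0 < cw
  ε₀_pos : 0 < ε₀
  σ_pos : 0 < σ
  ε_pos : 0 < ε

/-- The general assumptions on a time slab.  `ℓ` is the regularity of `φ`, `m` that of `∇φ`. -/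
structure Admissible (Ω : Set (Space d)) (qs qt ℓ m : ℕ) (c : Consts) (D : Slab d) : Prop where
  τ_pos : 0 < D.τ
  mesh : IsMesh Ω D.K
  shape : ShapeRegular D.K c.σ
  time_step : D.τ ^ (qt + 1) ≤ c.Cτh * D.h ^ (1 + c.ε)
  separated : ∀ t ∈ D.I, ∀ x ∈ frontier Ω, ∀ z ∈ frontier (D.dom Ω t), c.δΩ < dist x z
  φ_cont : ContinuousOn (Function.uncurry D.φ) (Ω ×ˢ D.I)
  φ_C2 : ContDiffOn ℝ 2 (Function.uncurry D.φ) (D.nbhdST Ω c.δU)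
  φ_bounds : ∀ t ∈ D.I, ∀ x ∈ D.nbhd Ω c.δU t,
    c.cφ ≤ ‖D.G x t‖ ∧ ‖D.G x t‖ ≤ c.Cφ ∧
    |derivWithin (D.φ x) D.I t| ≤ c.C₂ ∧
    ‖iteratedFDeriv ℝ 2 (fun y => D.φ y t) x‖ ≤ c.C₂ ∧
    ‖derivWithin (D.G x) D.I t‖ ≤ c.C₂
  signed_dist : ∀ t ∈ D.I, ∀ x ∈ D.nbhd Ω c.δU t,
    (∀ e : ℝ, |e| ≤ c.ε₀ → x + e • D.G x t ∈ Ω) ∧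
    ∀ e e' : ℝ, |e| ≤ c.ε₀ → |e'| ≤ c.ε₀ →
      c.cw * |e - e'| ≤ |D.φ (x + e • D.G x t) t - D.φ (x + e' • D.G x t) t| ∧
      |D.φ (x + e • D.G x t) t - D.φ (x + e' • D.G x t) t| ≤ c.Cw * |e - e'|
  φ_smooth : ContDiffOn ℝ ℓ (Function.uncurry D.φ) (region (D.cellsU Ω c.δU) ×ˢ D.I)
  φ_smooth_bound : ∀ k ≤ ℓ, ∀ p ∈ region (D.cellsU Ω c.δU) ×ˢ D.I,
    ‖iteratedFDerivWithin ℝ k (Function.uncurry D.φ)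
      (region (D.cellsU Ω c.δU) ×ˢ D.I) p‖ ≤ c.Cℓ
  G_smooth : ContDiffOn ℝ m (Function.uncurry D.G) (region (D.cellsU Ω c.δU) ×ˢ D.I)
  G_smooth_bound : ∀ k ≤ m, ∀ p ∈ region (D.cellsU Ω c.δU) ×ˢ D.I,
    ‖iteratedFDerivWithin ℝ k (Function.uncurry D.G)
      (region (D.cellsU Ω c.δU) ×ˢ D.I) p‖ ≤ c.Cℓ
  φh_mem : MemV D.K D.I qs qt D.φh
  φh_approx : ∀ ms mt : ℕ, (ms ≤ qs + 1 ∧ mt ≤ 1) ∨ (ms = 0 ∧ mt ≤ qt + 1) →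
    ∀ s ∈ D.cellsU Ω c.δU, ∀ x ∈ interior (cell s), ∀ t ∈ D.I,
      ‖mixedDeriv D.I ms mt (fun y u => D.φ y u - D.φh y u) x t‖ ≤
        c.Cap * (D.h ^ (qs + 1 - ms) + D.τ ^ (qt + 1 - mt))

/-- The additional assumptions for smooth blending with blending function `b` of width `wb`. -/
structure SmoothBlending (Ω : Set (Space d)) (qs qt ℓ : ℕ) (c : Consts) (wb Cb : ℝ)
    (D : Slab d) (b : Space d → ℝ → ℝ) : Prop where
  range : ∀ x ∈ Ω, ∀ t ∈ D.I, b x t ∈ Icc (0 : ℝ) 1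
  smooth : ContDiffOn ℝ ℓ (Function.uncurry b) (Ω ×ˢ D.I)
  bound : ∀ k ≤ ℓ, ∀ p ∈ Ω ×ˢ D.I,
    ‖iteratedFDerivWithin ℝ k (Function.uncurry b) (Ω ×ˢ D.I) p‖ ≤ Cb
  zero_on_cut : ∀ x ∈ region (D.cutCells Ω) ∩ Ω, ∀ t ∈ D.I, b x t = 0
  one_far : ∀ t ∈ D.I, ∀ x ∈ Ω,
    ENNReal.ofReal wb < Metric.infEDist x (frontier (D.domLin Ω t)) → b x t = 1
  active : D.blendCells Ω b ⊆ D.cellsU Ω c.δU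
  φh_approx_grad : ∀ mt ≤ qt + 1, ∀ s ∈ D.cellsU Ω c.δU, ∀ x ∈ interior (cell s), ∀ t ∈ D.I,
    ‖mixedDeriv D.I 1 mt (fun y u => D.φ y u - D.φh y u) x t‖ ≤
      c.Cap * (D.h ^ qs + D.τ ^ (qt + 1 - mt))

/-- The additional assumptions for finite element blending. -/
structure FEBlending (Ω : Set (Space d)) (c : Consts) (κ Ccfl : ℝ) (D : Slab d) : Prop where
  cfl : D.τ ≤ Ccfl * D.h
  quasi_uniform : QuasiUniform D.K κ
  active : D.cutCells Ω ⊆ D.cellsU Ω c.δU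

/-! ### The bounds -/

/-- `Ψ` is continuous in space, `|Ψ - id| ≤ C (h² + τ^{qt+1})` and `|∂_t Ψ| ≤ C (h² + τ^{qt})`. -/
structure LowOrderBounds (Ω : Set (Space d)) (qt : ℕ) (D : Slab d) (Ψ : Space d → ℝ → Space d)
    (C : ℝ) : Prop where
  cont : ∀ t ∈ D.I, ContinuousOn (fun x => Ψ x t) Ω
  sub_id : ∀ t ∈ D.I, ∀ x ∈ Ω, ‖Ψ x t - x‖ ≤ C * (D.h ^ 2 + D.τ ^ (qt + 1))
  time_deriv : ∀ x ∈ Ω, ∀ t ∈ D.I, DifferentiableWithinAt ℝ (Ψ x) D.I t ∧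
    ‖derivWithin (Ψ x) D.I t‖ ≤ C * (D.h ^ 2 + D.τ ^ qt)

/-- `weight * |DΨ - I| ≤ bnd` in the interior of every element. -/
def GradBound (D : Slab d) (Ψ : Space d → ℝ → Space d) (weight bnd : ℝ) : Prop :=
  ∀ t ∈ D.I, ∀ s ∈ D.K.facets, ∀ x ∈ interior (cell s),
    DifferentiableAt ℝ (fun y => Ψ y t) x ∧
    weight * ‖fderiv ℝ (fun y => Ψ y t) x - ContinuousLinearMap.id ℝ (Space d)‖ ≤ bnd

/-- On every element `D^{ls} ∂_t^{lt} Ψ` exists and is bounded by `C`. -/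
def HighOrderBound (D : Slab d) (Ψ : Space d → ℝ → Space d) (ls lt : ℕ) (C : ℝ) : Prop :=
  ∀ s ∈ D.K.facets, HasMixedDerivOn (interior (cell s)) D.I ls lt Ψ ∧
    ∀ t ∈ D.I, ∀ x ∈ interior (cell s), ‖mixedDeriv D.I ls lt Ψ x t‖ ≤ C

end UnfittedSpaceTime

end

open UnfittedSpaceTime

/-! With err = φlin − φ, the defining equation of the distance function reads φ(x + d G) = φ + (1 −
b) err, so the mapping is as close to the identity as the interpolation error is to zero. On one
element, Taylor's formula at x together with Σ λ_v (v − x) = 0 gives ∂_t^k err = O(h² + τ^(qt+1−k)).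
Since the gradients of the barycentric coordinates λ_v are O(1/diam), it also gives ∇err = O(h +
τ^(qt+1)). These are `exists_timeDeriv_err_bound` and `exists_fderiv_err_bound`.

Along the rays s ↦ x + s G the level set function is bi-Lipschitz for |s| ≤ ε₀. The intermediate
value theorem yields a root of size |err| / cw, injectivity makes it the root of smallest absolute
value, and the lower Lipschitz constant bounds the slope away from zero. Hence the root is
differentiable (`implicit_hasFDerivWithinAt`). Its derivative consists of the derivative of err and
terms of size h² + τ^(qt+1) (`exists_fderiv_disp_bound`), which gives the low order bounds. The
formula for the derivative contains the root only undifferentiated, so it can be differentiated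
again; this gives the high order bounds (`implicit_u1`). The condition τ^(qt+1) ≤ C h^(1+ε) makes
the displacement o(h), so that displaced points stay where φ is smooth.

Uniformity of the constants is obtained by working with families. The predicates `UB` and `UD`
assert one constant C for a whole family of functions with weights κ (size) and η (length scale),
and they are stable under products, compositions and reciprocals. Taking all admissible local
problems as index set turns this calculus into bounds independent of mesh, time step and cut
configuration.

With smooth blending only glueing remains: where b = 1 the root is zero.

With finite element blending the displacement w has to be extended from active faces f to
neighbouring elements. The projection Z onto f is singular where ω = Σ_{v ∈ f} λ_v vanishes: its
derivatives of order j grow like diam (diam ω)^(−j). The factor ω^r with r ≥ qs + 1 absorbs this up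
to order qs + 1. The remaining powers of 1/diam are removed by splitting w on each active face, by
Taylor's formula at a vertex, into homogeneous polynomials of degree l ≤ qs in the λ_v with
coefficients O(diam^l) and a remainder O(diam^(qs+1)). Lagrange interpolation is exact on
polynomials, so the extension maps polynomials to polynomials of the same degree
(`exists_homPoly_faceExt`), and remainders to remainders (`ExtRegular.extend`). Level 0 of the
extension sets inactive vertices to zero, so its coefficients are the values of w, which must be
O(diam) together with qt time derivatives. This is where τ ≤ C h and quasi-uniformity enter
(`ub_dist_time`). Continuity across elements holds because the extension on a face depends on the
data of that face only (`extLevel_face`). -/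

open UnfittedSpaceTime

/-! ### Families of functions with uniformly bounded weighted derivatives -/

section WeightedFamilies

variable {ι : Type*} {E F F' F'' : Type} [NormedAddCommGroup E] [NormedSpace ℝ E]
  [NormedAddCommGroup F] [NormedSpace ℝ F] [NormedAddCommGroup F'] [NormedSpace ℝ F']
  [NormedAddCommGroup F''] [NormedSpace ℝ F'']

/-- The derivatives of order `j ≤ n` of all members of the family `f` are bounded by
`C κ η⁻ʲ`. -/
def UB (n : ℕ) (S : ι → Set E) (κ η : ι → E → ℝ) (f : ι → E → F) : Prop :=
  (∀ i, ContDiffOn ℝ n (f i) (S i)) ∧ ∃ C, 0 ≤ C ∧ ∀ i, ∀ j ≤ n, ∀ x ∈ S i,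
    ‖iteratedFDerivWithin ℝ j (f i) (S i) x‖ ≤ C * (κ i x * (η i x)⁻¹ ^ j)

/-- The derivatives of order `1 ≤ j ≤ n` of all members of the family `f` are bounded by
`C κ η⁻ʲ`. -/
def UD (n : ℕ) (S : ι → Set E) (κ η : ι → E → ℝ) (f : ι → E → F) : Prop :=
  (∀ i, ContDiffOn ℝ n (f i) (S i)) ∧ ∃ C, 0 ≤ C ∧ ∀ i, ∀ j, 1 ≤ j → j ≤ n → ∀ x ∈ S i,
    ‖iteratedFDerivWithin ℝ j (f i) (S i) x‖ ≤ C * (κ i x * (η i x)⁻¹ ^ j)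

variable {n : ℕ} {S : ι → Set E} {κ κ' η η' : ι → E → ℝ} {f g : ι → E → F}

theorem UB.toUD (h : UB n S κ η f) : UD n S κ η f := by
  obtain ⟨h1, C, hC, h2⟩ := h
  exact ⟨h1, C, hC, fun i j _ hj => h2 i j hj⟩

/-- Since C is common to the whole family, pulling back the index set costs nothing. This is how
bounds pass from problems to pairs such as (problem, time) or (problem, vertex). -/
theorem UB.reindex {ι' : Type*} (σ : ι' → ι) (h : UB n S κ η f) :
    UB n (fun i => S (σ i)) (fun i => κ (σ i)) (fun i => η (σ i)) (fun i => f (σ i)) := by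
  obtain ⟨h1, C, hC, h2⟩ := h
  exact ⟨fun i => h1 _, C, hC, fun i => h2 _⟩

theorem UB.congr (h : UB n S κ η f) (hfg : ∀ i, ∀ x ∈ S i, g i x = f i x) : UB n S κ η g := by
  obtain ⟨h1, C, hC, h2⟩ := h
  refine ⟨fun i => (h1 i).congr (hfg i), C, hC, fun i j hj x hx => ?_⟩
  rw [iteratedFDerivWithin_congr (hfg i) hx]
  exact h2 i j hj x hx

theorem UB.of_le {m : ℕ} (h : UB n S κ η f) (hm : m ≤ n) : UB m S κ η f := by
  obtain ⟨h1, C, hC, h2⟩ := h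
  exact ⟨fun i => (h1 i).of_le (by exact_mod_cast hm), C, hC,
    fun i j hj => h2 i j (hj.trans hm)⟩

theorem UD.of_le {m : ℕ} (h : UD n S κ η f) (hm : m ≤ n) : UD m S κ η f := by
  obtain ⟨h1, C, hC, h2⟩ := h
  exact ⟨fun i => (h1 i).of_le (by exact_mod_cast hm), C, hC,
    fun i j hj1 hj => h2 i j hj1 (hj.trans hm)⟩

/-- Change of the weights. -/
theorem UB.weight (h : UB n S κ η f) (c : ℝ) (hc : 0 ≤ c)
    (hw : ∀ i, ∀ x ∈ S i, ∀ j ≤ n, κ i x * (η i x)⁻¹ ^ j ≤ c * (κ' i x * (η' i x)⁻¹ ^ j)) :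
    UB n S κ' η' f := by
  obtain ⟨h1, C, hC, h2⟩ := h
  refine ⟨h1, C * c, mul_nonneg hC hc, fun i j hj x hx => (h2 i j hj x hx).trans ?_⟩
  rw [mul_assoc]
  exact mul_le_mul_of_nonneg_left (hw i x hx j hj) hC

theorem UB.mono_set {S' : ι → Set E} (h : UB n S κ η f) (hS : ∀ i, UniqueDiffOn ℝ (S i))
    (hS' : ∀ i, UniqueDiffOn ℝ (S' i)) (hsub : ∀ i, S' i ⊆ S i) : UB n S' κ η f := by
  obtain ⟨h1, C, hC, h2⟩ := h
  refine ⟨fun i => (h1 i).mono (hsub i), C, hC, fun i j hj x hx => ?_⟩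
  rw [iteratedFDerivWithin_subset (hsub i) (hS' i) (hS i) ((h1 i).of_le (by exact_mod_cast hj)) hx]
  exact h2 i j hj x (hsub i hx)

theorem UB.bound (h : UB n S κ η f) : ∃ C, 0 ≤ C ∧ ∀ i, ∀ x ∈ S i, ‖f i x‖ ≤ C * κ i x := by
  obtain ⟨-, C, hC, h2⟩ := h
  refine ⟨C, hC, fun i x hx => ?_⟩
  simpa using h2 i 0 (Nat.zero_le _) x hx

theorem ub_zero_iff : UB 0 S κ η f ↔ (∀ i, ContinuousOn (f i) (S i)) ∧
    ∃ C, 0 ≤ C ∧ ∀ i, ∀ x ∈ S i, ‖f i x‖ ≤ C * κ i x := by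
  constructor
  · intro h
    exact ⟨fun i => (h.1 i).continuousOn, h.bound⟩
  · rintro ⟨h1, C, hC, h2⟩
    refine ⟨fun i => contDiffOn_zero.2 (h1 i), C, hC, fun i j hj x hx => ?_⟩
    obtain rfl : j = 0 := by omega
    simpa using h2 i x hx

theorem UB.fderivWithin (h : UB (n + 1) S κ η f) (hS : ∀ i, UniqueDiffOn ℝ (S i)) :
    UB n S (fun i x => κ i x * (η i x)⁻¹) η (fun i => fderivWithin ℝ (f i) (S i)) := by
  obtain ⟨h1, C, hC, h2⟩ := h
  refine ⟨fun i => (h1 i).fderivWithin (hS i) (by norm_cast), C, hC, fun i j hj x hx => ?_⟩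
  rw [norm_iteratedFDerivWithin_fderivWithin (hS i) hx]
  refine (h2 i (j + 1) (by omega) x hx).trans (le_of_eq ?_)
  ring

theorem UD.fderivWithin (h : UD (n + 1) S κ η f) (hS : ∀ i, UniqueDiffOn ℝ (S i)) :
    UB n S (fun i x => κ i x * (η i x)⁻¹) η (fun i => fderivWithin ℝ (f i) (S i)) := by
  obtain ⟨h1, C, hC, h2⟩ := h
  refine ⟨fun i => (h1 i).fderivWithin (hS i) (by norm_cast), C, hC, fun i j hj x hx => ?_⟩
  rw [norm_iteratedFDerivWithin_fderivWithin (hS i) hx]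
  refine (h2 i (j + 1) (by omega) (by omega) x hx).trans (le_of_eq ?_)
  ring

/-- The induction step of the calculus: one order is gained from the derivative, whose size weight
is κ / η. -/
theorem UD.of_fderivWithin (hS : ∀ i, UniqueDiffOn ℝ (S i))
    (hd : ∀ i, DifferentiableOn ℝ (f i) (S i))
    (h : UB n S (fun i x => κ i x * (η i x)⁻¹) η (fun i => _root_.fderivWithin ℝ (f i) (S i))) :
    UD (n + 1) S κ η f := by
  obtain ⟨h1, C, hC, h2⟩ := h
  refine ⟨fun i => ?_, C, hC, fun i j hj1 hj x hx => ?_⟩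
  · have := (contDiffOn_succ_iff_fderivWithin (n := (n : ℕ)) (hS i)).2
      ⟨hd i, fun h => by simp at h, h1 i⟩
    exact_mod_cast this
  · obtain ⟨j, rfl⟩ : ∃ j', j = j' + 1 := ⟨j - 1, by omega⟩
    rw [← norm_iteratedFDerivWithin_fderivWithin (hS i) hx]
    refine (h2 i j (by omega) x hx).trans (le_of_eq ?_)
    ring

theorem UD.toUB (hκ : ∀ i, ∀ x ∈ S i, 0 ≤ κ i x) (hη : ∀ i, ∀ x ∈ S i, 0 < η i x)
    (h : UD n S κ η f) {C' : ℝ} (hb : ∀ i, ∀ x ∈ S i, ‖f i x‖ ≤ C' * κ i x) : UB n S κ η f := by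
  obtain ⟨h1, C, hC, h2⟩ := h
  refine ⟨h1, max C C', le_max_of_le_left hC, fun i j hj x hx => ?_⟩
  rcases Nat.eq_zero_or_pos j with rfl | hj0
  · simp only [norm_iteratedFDerivWithin_zero, pow_zero, mul_one]
    exact (hb i x hx).trans (mul_le_mul_of_nonneg_right (le_max_right _ _) (hκ i x hx))
  · refine (h2 i j hj0 hj x hx).trans (mul_le_mul_of_nonneg_right (le_max_left _ _) ?_)
    have := hκ i x hx
    have := hη i x hx
    positivity

theorem UB.of_fderivWithin (hκ : ∀ i, ∀ x ∈ S i, 0 ≤ κ i x) (hη : ∀ i, ∀ x ∈ S i, 0 < η i x)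
    (hS : ∀ i, UniqueDiffOn ℝ (S i))
    (hd : ∀ i, DifferentiableOn ℝ (f i) (S i)) {C' : ℝ}
    (hb : ∀ i, ∀ x ∈ S i, ‖f i x‖ ≤ C' * κ i x)
    (h : UB n S (fun i x => κ i x * (η i x)⁻¹) η (fun i => _root_.fderivWithin ℝ (f i) (S i))) :
    UB (n + 1) S κ η f :=
  (UD.of_fderivWithin hS hd h).toUB hκ hη hb

theorem UB.add (hS : ∀ i, UniqueDiffOn ℝ (S i)) (hf : UB n S κ η f) (hg : UB n S κ η g) :
    UB n S κ η (fun i x => f i x + g i x) := by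
  obtain ⟨h1, C, hC, h2⟩ := hf
  obtain ⟨h1', C', hC', h2'⟩ := hg
  refine ⟨fun i => (h1 i).add (h1' i), C + C', add_nonneg hC hC', fun i j hj x hx => ?_⟩
  have e := iteratedFDerivWithin_add_apply (i := j)
    (((h1 i).of_le (by exact_mod_cast hj)) x hx) (((h1' i).of_le (by exact_mod_cast hj)) x hx)
    (hS i) hx
  change ‖iteratedFDerivWithin ℝ j (f i + g i) (S i) x‖ ≤ _
  rw [e, add_mul]
  exact (norm_add_le _ _).trans (add_le_add (h2 i j hj x hx) (h2' i j hj x hx))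

theorem UD.add (hS : ∀ i, UniqueDiffOn ℝ (S i)) (hf : UD n S κ η f) (hg : UD n S κ η g) :
    UD n S κ η (fun i x => f i x + g i x) := by
  obtain ⟨h1, C, hC, h2⟩ := hf
  obtain ⟨h1', C', hC', h2'⟩ := hg
  refine ⟨fun i => (h1 i).add (h1' i), C + C', add_nonneg hC hC', fun i j hj1 hj x hx => ?_⟩
  have e := iteratedFDerivWithin_add_apply (i := j)
    (((h1 i).of_le (by exact_mod_cast hj)) x hx) (((h1' i).of_le (by exact_mod_cast hj)) x hx)
    (hS i) hx
  change ‖iteratedFDerivWithin ℝ j (f i + g i) (S i) x‖ ≤ _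
  rw [e, add_mul]
  exact (norm_add_le _ _).trans (add_le_add (h2 i j hj1 hj x hx) (h2' i j hj1 hj x hx))

/-- Treating all summands as one family over pairs (index, summand) makes their constant common, so
only the number of summands has to be bounded uniformly. -/
theorem UB.sum (hS : ∀ i, UniqueDiffOn ℝ (S i)) (hκ : ∀ i, ∀ x ∈ S i, 0 ≤ κ i x)
    (hη : ∀ i, ∀ x ∈ S i, 0 < η i x) {α : Type*} (t : ι → Finset α) (N : ℕ)
    (hN : ∀ i, (t i).card ≤ N) (f : ι → α → E → F)
    (h : UB n (fun p : Σ i, {a // a ∈ t i} => S p.1) (fun p => κ p.1) (fun p => η p.1)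
      (fun p => f p.1 p.2)) :
    UB n S κ η (fun i x => ∑ a ∈ t i, f i a x) := by
  obtain ⟨h1, C, hC, h2⟩ := h
  have h1' : ∀ i, ∀ a ∈ t i, ContDiffOn ℝ n (f i a) (S i) := fun i a ha => h1 ⟨i, a, ha⟩
  have h2' : ∀ i, ∀ a ∈ t i, ∀ j ≤ n, ∀ x ∈ S i,
      ‖iteratedFDerivWithin ℝ j (f i a) (S i) x‖ ≤ C * (κ i x * (η i x)⁻¹ ^ j) :=
    fun i a ha => h2 ⟨i, a, ha⟩
  refine ⟨fun i => ContDiffOn.sum fun a ha => h1' i a ha, N * C, by positivity,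
    fun i j hj x hx => ?_⟩
  rw [iteratedFDerivWithin_fun_sum_apply (hS i) hx
    fun a ha => ((h1' i a ha).of_le (by exact_mod_cast hj)) x hx]
  refine (norm_sum_le_of_le _ fun a ha => h2' i a ha j hj x hx).trans ?_
  rw [Finset.sum_const, nsmul_eq_mul, mul_assoc]
  refine mul_le_mul_of_nonneg_right (by exact_mod_cast hN i) ?_
  have := hκ i x hx
  have := hη i x hx
  positivity

/-- Leibniz' formula: in each term the scales combine to η^(−a) η^(−(j−a)) = η^(−j), and the
binomial coefficients add up to 2^j ≤ 2^n. -/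
theorem UB.bilinear (hS : ∀ i, UniqueDiffOn ℝ (S i)) (B : F →L[ℝ] F' →L[ℝ] F'')
    {κ₁ κ₂ : ι → E → ℝ} {f : ι → E → F} {g : ι → E → F'}
    (hf : UB n S κ₁ η f) (hg : UB n S κ₂ η g) :
    UB n S (fun i x => κ₁ i x * κ₂ i x) η (fun i x => B (f i x) (g i x)) := by
  obtain ⟨h1, C, hC, h2⟩ := hf
  obtain ⟨h1', C', hC', h2'⟩ := hg
  refine ⟨fun i => B.isBoundedBilinearMap.contDiff.comp_contDiffOn ((h1 i).prodMk (h1' i)),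
    ‖B‖ * (2 ^ n * (C * C')), mul_nonneg B.opNorm_nonneg (by positivity), fun i j hj x hx => ?_⟩
  refine (B.norm_iteratedFDerivWithin_le_of_bilinear (h1 i) (h1' i) (hS i) hx
    (by exact_mod_cast hj)).trans ?_
  rw [mul_assoc]
  refine mul_le_mul_of_nonneg_left ?_ B.opNorm_nonneg
  have key : ∀ a ∈ Finset.range (j + 1),
      (j.choose a : ℝ) * ‖iteratedFDerivWithin ℝ a (f i) (S i) x‖ *
        ‖iteratedFDerivWithin ℝ (j - a) (g i) (S i) x‖ ≤
      (j.choose a : ℝ) * (C * C' * (κ₁ i x * κ₂ i x * (η i x)⁻¹ ^ j)) := by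
    intro a ha
    have ha' : a ≤ j := by simpa [Nat.lt_succ_iff] using ha
    have b1 := h2 i a (ha'.trans hj) x hx
    have b2 := h2' i (j - a) (by omega) x hx
    rw [mul_assoc]
    refine mul_le_mul_of_nonneg_left ?_ (by positivity)
    refine (mul_le_mul b1 b2 (norm_nonneg _) ((norm_nonneg _).trans b1)).trans (le_of_eq ?_)
    rw [show (η i x)⁻¹ ^ j = (η i x)⁻¹ ^ a * (η i x)⁻¹ ^ (j - a) by
      rw [← pow_add]; congr 1; omega]
    ring
  refine (Finset.sum_le_sum key).trans ?_
  rw [← Finset.sum_mul]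
  have : (∑ a ∈ Finset.range (j + 1), (j.choose a : ℝ)) = 2 ^ j := by
    exact_mod_cast Nat.sum_range_choose j
  rw [this]
  have h0 : 0 ≤ C * C' * (κ₁ i x * κ₂ i x * (η i x)⁻¹ ^ j) := by
    have b1 := (norm_nonneg _).trans (h2 i j hj x hx)
    have b2 := (norm_nonneg _).trans (h2' i 0 (Nat.zero_le _) x hx)
    simp only [pow_zero, mul_one] at b2
    calc (0 : ℝ) ≤ (C * (κ₁ i x * (η i x)⁻¹ ^ j)) * (C' * κ₂ i x) := mul_nonneg b1 b2
      _ = _ := by ring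
  calc (2 : ℝ) ^ j * (C * C' * (κ₁ i x * κ₂ i x * (η i x)⁻¹ ^ j))
      ≤ 2 ^ n * (C * C' * (κ₁ i x * κ₂ i x * (η i x)⁻¹ ^ j)) :=
        mul_le_mul_of_nonneg_right (pow_le_pow_right₀ (by norm_num) hj) h0
    _ = _ := by ring

theorem UB.smul (hS : ∀ i, UniqueDiffOn ℝ (S i)) {κ₁ κ₂ : ι → E → ℝ} {f : ι → E → ℝ}
    {g : ι → E → F} (hf : UB n S κ₁ η f) (hg : UB n S κ₂ η g) :
    UB n S (fun i x => κ₁ i x * κ₂ i x) η (fun i x => f i x • g i x) :=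
  UB.bilinear hS (ContinuousLinearMap.lsmul ℝ ℝ) hf hg

theorem UB.mul (hS : ∀ i, UniqueDiffOn ℝ (S i)) {κ₁ κ₂ : ι → E → ℝ} {f g : ι → E → ℝ}
    (hf : UB n S κ₁ η f) (hg : UB n S κ₂ η g) :
    UB n S (fun i x => κ₁ i x * κ₂ i x) η (fun i x => f i x * g i x) :=
  UB.smul hS hf hg

theorem UB.clm (hS : ∀ i, UniqueDiffOn ℝ (S i)) (L : F →L[ℝ] F') (hf : UB n S κ η f) :
    UB n S κ η (fun i x => L (f i x)) := by
  obtain ⟨h1, C, hC, h2⟩ := hf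
  refine ⟨fun i => L.contDiff.comp_contDiffOn (h1 i), ‖L‖ * C, by positivity,
    fun i j hj x hx => ?_⟩
  have := L.iteratedFDerivWithin_comp_left (h1 i x hx) (hS i) hx (i := j) (by exact_mod_cast hj)
  change ‖iteratedFDerivWithin ℝ j (L ∘ f i) (S i) x‖ ≤ _
  rw [this, mul_assoc]
  exact (L.norm_compContinuousMultilinearMap_le _).trans
    (mul_le_mul_of_nonneg_left (h2 i j hj x hx) (norm_nonneg _))

theorem UB.neg (hS : ∀ i, UniqueDiffOn ℝ (S i)) (hf : UB n S κ η f) :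
    UB n S κ η (fun i x => -f i x) := by
  simpa using hf.clm hS (-(ContinuousLinearMap.id ℝ F))

theorem UB.sub (hS : ∀ i, UniqueDiffOn ℝ (S i)) (hf : UB n S κ η f) (hg : UB n S κ η g) :
    UB n S κ η (fun i x => f i x - g i x) := by
  simpa [sub_eq_add_neg] using hf.add hS (hg.neg hS)

/-- Functions that do not depend on the variable. -/
theorem UB.const (hκ : ∀ i, ∀ x ∈ S i, 0 ≤ κ i x) (hη : ∀ i, ∀ x ∈ S i, 0 < η i x) (c : ι → F)
    {C : ℝ} (hc : ∀ i, ∀ x ∈ S i, ‖c i‖ ≤ C * κ i x) : UB n S κ η (fun i _ => c i) := by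
  refine UD.toUB hκ hη (C' := C) ⟨fun i => contDiffOn_const, 0, le_rfl, fun i j hj1 hj x hx => ?_⟩ hc
  obtain ⟨j, rfl⟩ : ∃ j', j = j' + 1 := ⟨j - 1, by omega⟩
  rw [iteratedFDerivWithin_succ_const]
  simp

/-- Affine functions. -/
theorem UD.affine (hS : ∀ i, UniqueDiffOn ℝ (S i)) (hκ : ∀ i, ∀ x ∈ S i, 0 ≤ κ i x)
    (hη : ∀ i, ∀ x ∈ S i, 0 < η i x) (L : ι → E →L[ℝ] F) (c : ι → F)
    {C : ℝ} (hc : ∀ i, ∀ x ∈ S i, ‖L i‖ ≤ C * (κ i x * (η i x)⁻¹)) :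
    UD n S κ η (fun i x => L i x + c i) := by
  rcases n with _ | n
  · exact ⟨fun i => contDiffOn_zero.2 (by fun_prop), 0, le_rfl, fun i j h1 h2 => by omega⟩
  refine UD.of_fderivWithin hS (fun i => by fun_prop) ?_
  refine UB.congr (f := fun i _ => L i) (UB.const ?_ hη _ (C := C) hc) ?_
  · intro i x hx
    have := hκ i x hx
    have := hη i x hx
    positivity
  · intro i x hx
    exact (((L i).hasFDerivAt.add_const (c i)).hasFDerivWithinAt).fderivWithin (hS i x hx)

/-- Induction by the chain rule: Dg(f) ∘ Df has size (κ/μ)(μ/η) = κ/η. The size of f never enters,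
which is why f only satisfies `UD`, with the length scale μ of g as its size weight. -/
theorem UB.comp (hS : ∀ i, UniqueDiffOn ℝ (S i)) (hη : ∀ i, ∀ x ∈ S i, 0 < η i x)
    {T : ι → Set F} (hT : ∀ i, UniqueDiffOn ℝ (T i)) {κ μ : ι → F → ℝ}
    (hκ : ∀ i, ∀ y ∈ T i, 0 ≤ κ i y) (hμ : ∀ i, ∀ y ∈ T i, 0 < μ i y) {g : ι → F → F'}
    (hg : UB n T κ μ g) (hf : UD n S (fun i x => μ i (f i x)) η f)
    (hm : ∀ i, Set.MapsTo (f i) (S i) (T i)) :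
    UB n S (fun i x => κ i (f i x)) η (fun i x => g i (f i x)) := by
  induction n generalizing F' κ with
  | zero =>
    rw [ub_zero_iff] at hg ⊢
    obtain ⟨h1, C, hC, h2⟩ := hg
    exact ⟨fun i => (h1 i).comp (hf.1 i).continuousOn (hm i), C, hC,
      fun i x hx => h2 i _ (hm i hx)⟩
  | succ n ih =>
    obtain ⟨C, hC, hb⟩ := hg.bound
    have dg : ∀ i, DifferentiableOn ℝ (g i) (T i) := fun i =>
      (hg.1 i).differentiableOn (by simp)
    have df : ∀ i, DifferentiableOn ℝ (f i) (S i) := fun i =>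
      (hf.1 i).differentiableOn (by simp)
    refine UB.of_fderivWithin (C' := C) (fun i x hx => hκ i _ (hm i hx)) hη hS
      (fun i => (dg i).comp (df i) (hm i)) (fun i x hx => hb i _ (hm i hx)) ?_
    have a1 := ih (κ := fun i y => κ i y * (μ i y)⁻¹)
      (fun i y hy => by have := hκ i y hy; have := hμ i y hy; positivity)
      (hg.fderivWithin hT) (hf.of_le (Nat.le_succ n))
    have a2 := UB.bilinear hS (ContinuousLinearMap.compL ℝ E F F') a1 (hf.fderivWithin hS)
    refine (a2.congr (g := fun i => _root_.fderivWithin ℝ (fun x => g i (f i x)) (S i))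
      fun i x hx => ?_).weight 1 zero_le_one fun i x hx j hj => ?_
    · exact fderivWithin_comp x (dg i _ (hm i hx)) (df i x hx) (hm i) (hS i x hx)
    · have := (hμ i _ (hm i hx)).ne'
      apply le_of_eq
      field_simp

/-- Induction by D(1/f) = −f⁻² Df, of size κ⁻² · κ/η = κ⁻¹/η. The lower bound on |f| is used only
for the order zero estimate. -/
theorem UB.inv (hS : ∀ i, UniqueDiffOn ℝ (S i)) (hη : ∀ i, ∀ x ∈ S i, 0 < η i x)
    (hκ : ∀ i, ∀ x ∈ S i, 0 < κ i x) {f : ι → E → ℝ} (hf : UB n S κ η f) {c : ℝ} (hc : 0 < c)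
    (hlow : ∀ i, ∀ x ∈ S i, c * κ i x ≤ |f i x|) :
    UB n S (fun i x => (κ i x)⁻¹) η (fun i x => (f i x)⁻¹) := by
  have hne : ∀ i, ∀ x ∈ S i, f i x ≠ 0 := fun i x hx h0 => by
    have := hlow i x hx
    rw [h0, abs_zero] at this
    exact absurd this (not_le.2 (mul_pos hc (hκ i x hx)))
  have hb : ∀ i, ∀ x ∈ S i, ‖(f i x)⁻¹‖ ≤ c⁻¹ * (κ i x)⁻¹ := fun i x hx => by
    rw [norm_inv, ← mul_inv]
    exact inv_anti₀ (mul_pos hc (hκ i x hx)) (hlow i x hx)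
  induction n with
  | zero =>
    rw [ub_zero_iff]
    exact ⟨fun i => (hf.1 i).continuousOn.inv₀ (hne i), c⁻¹, by positivity, hb⟩
  | succ n ih =>
    have df : ∀ i, DifferentiableOn ℝ (f i) (S i) := fun i =>
      (hf.1 i).differentiableOn (by simp)
    refine UB.of_fderivWithin (C' := c⁻¹) (fun i x hx => by have := hκ i x hx; positivity) hη hS
      (fun i => (df i).inv (hne i)) hb ?_
    have a1 := ih (hf.of_le (Nat.le_succ n))
    have a2 := UB.smul hS ((UB.mul hS a1 a1).neg hS) (hf.fderivWithin hS)
    refine (a2.congr (g := fun i => _root_.fderivWithin ℝ (fun x => (f i x)⁻¹) (S i))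
      fun i x hx => ?_).weight 1 zero_le_one fun i x hx j hj => ?_
    · have := ((hasDerivAt_inv (hne i x hx)).comp_hasFDerivWithinAt x
        (df i x hx).hasFDerivWithinAt).fderivWithin (hS i x hx)
      change _root_.fderivWithin ℝ ((fun y => y⁻¹) ∘ f i) (S i) x = _
      refine this.trans ?_
      congr 1
      field_simp
    · have := (hκ i x hx).ne'
      apply le_of_eq
      field_simp

end WeightedFamilies

/-! ### Uniformly bounded derivatives: the case of trivial weights. -/

section BoundedFamilies

variable {ι : Type*} {E F F' F'' : Type} [NormedAddCommGroup E] [NormedSpace ℝ E]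
  [NormedAddCommGroup F] [NormedSpace ℝ F] [NormedAddCommGroup F'] [NormedSpace ℝ F']
  [NormedAddCommGroup F''] [NormedSpace ℝ F'']

/-- All derivatives of order at most `n` are uniformly bounded. -/
abbrev U1 (n : ℕ) (S : ι → Set E) (f : ι → E → F) : Prop :=
  UB n S (fun _ _ => 1) (fun _ _ => 1) f

/-- All derivatives of order between `1` and `n` are uniformly bounded. -/
abbrev D1 (n : ℕ) (S : ι → Set E) (f : ι → E → F) : Prop :=
  UD n S (fun _ _ => 1) (fun _ _ => 1) f

variable {n : ℕ} {S : ι → Set E} {f g : ι → E → F}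

theorem u1_iff : U1 n S f ↔ (∀ i, ContDiffOn ℝ n (f i) (S i)) ∧ ∃ C, 0 ≤ C ∧ ∀ i, ∀ j ≤ n,
    ∀ x ∈ S i, ‖iteratedFDerivWithin ℝ j (f i) (S i) x‖ ≤ C := by
  simp [U1, UB]

theorem UB.to_one {κ : ι → E → ℝ} (h : UB n S κ (fun _ _ => 1) f) {c : ℝ} (hc : 0 ≤ c)
    (hκ : ∀ i, ∀ x ∈ S i, κ i x ≤ c) : U1 n S f :=
  h.weight c hc fun i x hx j _ => by simpa using hκ i x hx

theorem U1.fderivWithin (h : U1 (n + 1) S f) (hS : ∀ i, UniqueDiffOn ℝ (S i)) :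
    U1 n S (fun i => fderivWithin ℝ (f i) (S i)) :=
  (UB.fderivWithin h hS).weight 1 zero_le_one (by simp)

theorem U1.of_fderivWithin (hS : ∀ i, UniqueDiffOn ℝ (S i))
    (hd : ∀ i, DifferentiableOn ℝ (f i) (S i)) {C : ℝ} (hb : ∀ i, ∀ x ∈ S i, ‖f i x‖ ≤ C)
    (h : U1 n S (fun i => _root_.fderivWithin ℝ (f i) (S i))) : U1 (n + 1) S f :=
  UB.of_fderivWithin (C' := C) (by simp) (by simp) hS hd (by simpa using hb)
    (UB.weight h 1 zero_le_one (by simp))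

theorem U1.bilinear (hS : ∀ i, UniqueDiffOn ℝ (S i)) (B : F →L[ℝ] F' →L[ℝ] F'')
    {f : ι → E → F} {g : ι → E → F'} (hf : U1 n S f) (hg : U1 n S g) :
    U1 n S (fun i x => B (f i x) (g i x)) :=
  (UB.bilinear hS B hf hg).weight 1 zero_le_one (by simp)

theorem U1.smul (hS : ∀ i, UniqueDiffOn ℝ (S i)) {f : ι → E → ℝ} {g : ι → E → F}
    (hf : U1 n S f) (hg : U1 n S g) : U1 n S (fun i x => f i x • g i x) :=
  (UB.smul hS hf hg).weight 1 zero_le_one (by simp)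

theorem U1.mul (hS : ∀ i, UniqueDiffOn ℝ (S i)) {f g : ι → E → ℝ}
    (hf : U1 n S f) (hg : U1 n S g) : U1 n S (fun i x => f i x * g i x) :=
  U1.smul hS hf hg

theorem U1.const (c : ι → F) {C : ℝ} (hc : ∀ i, ‖c i‖ ≤ C) : U1 n S (fun i _ => c i) :=
  UB.const (C := C) (by simp) (by simp) c (by simpa using fun i _ _ => hc i)

theorem D1.affine (hS : ∀ i, UniqueDiffOn ℝ (S i)) (L : ι → E →L[ℝ] F) (c : ι → F)
    {C : ℝ} (hc : ∀ i, ‖L i‖ ≤ C) : D1 n S (fun i x => L i x + c i) :=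
  UD.affine (C := C) hS (by simp) (by simp) L c (by simpa using fun i _ _ => hc i)

theorem D1.comp {T : ι → Set F} (hS : ∀ i, UniqueDiffOn ℝ (S i)) (hT : ∀ i, UniqueDiffOn ℝ (T i))
    {g : ι → F → F'} (hg : U1 n T g) (hf : D1 n S f)
    (hm : ∀ i, Set.MapsTo (f i) (S i) (T i)) : U1 n S (fun i x => g i (f i x)) :=
  UB.comp hS (by simp) hT (by simp) (by simp) hg hf hm

theorem U1.inv (hS : ∀ i, UniqueDiffOn ℝ (S i)) {f : ι → E → ℝ} (hf : U1 n S f) {c : ℝ}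
    (hc : 0 < c) (hlow : ∀ i, ∀ x ∈ S i, c ≤ |f i x|) : U1 n S (fun i x => (f i x)⁻¹) :=
  (UB.inv hS (by simp) (by simp) hf hc (by simpa using hlow)).weight 1 zero_le_one (by simp)

end BoundedFamilies

/-! ### Time derivatives, slices and mixed derivatives of space-time families. -/

section MixedDerivatives

variable {ι : Type*} {X F : Type} [NormedAddCommGroup X] [NormedSpace ℝ X]
  [NormedAddCommGroup F] [NormedSpace ℝ F]

theorem hasDerivWithinAt_of_uncurry {N : Set X} {I : Set ℝ} {f : X → ℝ → F} {x : X} {t : ℝ}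
    (hx : x ∈ N)
    (h : DifferentiableWithinAt ℝ (Function.uncurry f) (N ×ˢ I) (x, t)) :
    HasDerivWithinAt (f x) (fderivWithin ℝ (Function.uncurry f) (N ×ˢ I) (x, t) (0, 1)) I t := by
  have h1 : HasDerivWithinAt (fun u : ℝ => (x, u)) ((0 : X), (1 : ℝ)) I t :=
    (hasDerivWithinAt_const t I x).prodMk (hasDerivWithinAt_id t I)
  have := h.hasFDerivWithinAt.comp_hasDerivWithinAt (f := fun u : ℝ => (x, u)) t h1
    (fun u hu => ⟨hx, hu⟩)
  exact this

variable {N : ι → Set X} {I : ι → Set ℝ}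

theorem UB.timeDeriv {n : ℕ} {κ : ι → X × ℝ → ℝ} (hN : ∀ i, UniqueDiffOn ℝ (N i))
    (hI : ∀ i, UniqueDiffOn ℝ (I i)) {f : ι → X → ℝ → F}
    (hf : UB (n + 1) (fun i => N i ×ˢ I i) κ (fun _ _ => 1) (fun i => Function.uncurry (f i))) :
    UB n (fun i => N i ×ˢ I i) κ (fun _ _ => 1)
      (fun i => Function.uncurry fun x t => derivWithin (f i x) (I i) t) := by
  have hS : ∀ i, UniqueDiffOn ℝ (N i ×ˢ I i) := fun i => (hN i).prod (hI i)
  have h1 := (hf.fderivWithin hS).clm hS (ContinuousLinearMap.apply ℝ F ((0 : X), (1 : ℝ)))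
  refine (h1.congr (g := fun i => Function.uncurry fun x t => derivWithin (f i x) (I i) t)
    ?_).weight 1 zero_le_one (by simp)
  rintro i ⟨x, t⟩ ⟨hx, ht⟩
  have hd : DifferentiableWithinAt ℝ (Function.uncurry (f i)) (N i ×ˢ I i) (x, t) :=
    (hf.1 i).differentiableOn (by simp) _ ⟨hx, ht⟩
  exact (hasDerivWithinAt_of_uncurry hx hd).derivWithin (hI i t ht)

theorem UB.iterTimeDeriv {n : ℕ} (k : ℕ) {κ : ι → X × ℝ → ℝ} (hN : ∀ i, UniqueDiffOn ℝ (N i))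
    (hI : ∀ i, UniqueDiffOn ℝ (I i)) {f : ι → X → ℝ → F}
    (hf : UB (n + k) (fun i => N i ×ˢ I i) κ (fun _ _ => 1) (fun i => Function.uncurry (f i))) :
    UB n (fun i => N i ×ˢ I i) κ (fun _ _ => 1)
      (fun i => Function.uncurry fun x t => iteratedDerivWithin k (f i x) (I i) t) := by
  induction k generalizing n with
  | zero => simpa using hf
  | succ k ih =>
    have h1 := UB.timeDeriv hN hI (ih (n := n + 1) (by rwa [add_right_comm, add_assoc]))
    refine h1.congr ?_
    rintro i ⟨x, t⟩ -
    simp [Function.uncurry, iteratedDerivWithin_succ]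

/-- The frozen time becomes part of the index, so the bounds are uniform in t as well. -/
theorem U1.slice {n : ℕ} (hN : ∀ i, UniqueDiffOn ℝ (N i))
    (hI : ∀ i, UniqueDiffOn ℝ (I i)) {f : ι → X → ℝ → F}
    (hf : U1 n (fun i => N i ×ˢ I i) (fun i => Function.uncurry (f i))) :
    U1 n (fun p : Σ i, I i => N p.1) (fun p x => f p.1 x p.2) := by
  have h1 := UB.reindex (fun p : Σ i, I i => p.1) hf
  refine D1.comp (f := fun (p : Σ i, I i) (x : X) =>
    ContinuousLinearMap.inl ℝ X ℝ x + ((0 : X), (p.2 : ℝ))) (fun p => hN p.1)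
    (fun p => (hN p.1).prod (hI p.1)) h1 (D1.affine (C := 1) (S := fun p : Σ i, I i => N p.1) (fun p => hN p.1) _ _ ?_) ?_ |>.congr ?_
  · intro p
    exact ContinuousLinearMap.norm_inl_le_one ℝ X ℝ
  · rintro ⟨i, t, ht⟩ x hx
    simpa using ⟨hx, ht⟩
  · rintro ⟨i, t, ht⟩ x hx
    simp [Function.uncurry]

/-- Restriction to one point in space. -/
theorem UB.timeSlice {n : ℕ} (hN : ∀ i, UniqueDiffOn ℝ (N i)) {κ : ι → ℝ}
    (hκ : ∀ i, 0 ≤ κ i)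
    (hI : ∀ i, UniqueDiffOn ℝ (I i)) {f : ι → X → ℝ → F}
    (hf : UB n (fun i => N i ×ˢ I i) (fun i _ => κ i) (fun _ _ => 1)
      (fun i => Function.uncurry (f i))) :
    UB n (fun p : Σ i, N i => I p.1) (fun p _ => κ p.1) (fun _ _ => 1)
      (fun p t => f p.1 p.2 t) := by
  have h1 := UB.reindex (fun p : Σ i, N i => p.1) hf
  refine UB.comp (f := fun (p : Σ i, N i) (t : ℝ) =>
    ContinuousLinearMap.inr ℝ X ℝ t + ((p.2 : X), (0 : ℝ))) (fun p => hI p.1) (by simp)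
    (fun p => (hN p.1).prod (hI p.1)) (fun p _ _ => hκ p.1) (by simp) h1
    (D1.affine (C := 1) (S := fun p : Σ i, N i => I p.1) (fun p => hI p.1) _ _ ?_) ?_ |>.congr ?_
  · intro p
    exact ContinuousLinearMap.norm_inr_le_one ℝ X ℝ
  · rintro ⟨i, x, hx⟩ t ht
    simpa using ⟨hx, ht⟩
  · rintro ⟨i, x, hx⟩ t ht
    simp [Function.uncurry]

end MixedDerivatives

section Mixed

variable {ι : Type*} {d : ℕ} {F : Type} [NormedAddCommGroup F] [NormedSpace ℝ F]

theorem contDiffOn_time {X : Type} [NormedAddCommGroup X] [NormedSpace ℝ X]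
    {N : Set X} {I : Set ℝ} {n : ℕ} {f : X → ℝ → F}
    (hf : ContDiffOn ℝ n (Function.uncurry f) (N ×ˢ I)) {x : X} (hx : x ∈ N) :
    ContDiffOn ℝ n (f x) I :=
  hf.comp (f := fun t : ℝ => (x, t)) (by fun_prop) (fun t ht => ⟨hx, ht⟩)

/-- A mixed derivative is a spatial derivative of a time slice of the iterated time derivative; the
time derivatives use up lt of the ls + lt joint orders, the slice inherits the others. -/
theorem mixedDeriv_bound {N : ι → Set (Space d)} {I : ι → Set ℝ} (hN : ∀ i, IsOpen (N i))
    (hI : ∀ i, UniqueDiffOn ℝ (I i)) {f : ι → Space d → ℝ → F} {ls lt : ℕ}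
    (hf : U1 (ls + lt) (fun i => N i ×ˢ I i) (fun i => Function.uncurry (f i))) :
    ∃ C, 0 ≤ C ∧ ∀ i, HasMixedDerivOn (N i) (I i) ls lt (f i) ∧
      ∀ t ∈ I i, ∀ x ∈ N i, ‖mixedDeriv (I i) ls lt (f i) x t‖ ≤ C := by
  have hN' : ∀ i, UniqueDiffOn ℝ (N i) := fun i => (hN i).uniqueDiffOn
  have h1 := U1.slice (n := ls) hN' hI (UB.iterTimeDeriv lt hN' hI hf)
  obtain ⟨h1, C, hC, h2⟩ := u1_iff.1 h1
  refine ⟨C, hC, fun i => ⟨⟨fun x hx => ?_, fun t ht => h1 ⟨i, t, ht⟩⟩, fun t ht x hx => ?_⟩⟩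
  · exact contDiffOn_time ((hf.1 i).of_le (by exact_mod_cast Nat.le_add_left _ _)) hx
  · have := h2 ⟨i, t, ht⟩ ls le_rfl x hx
    rw [iteratedFDerivWithin_of_isOpen ls (hN i) hx] at this
    exact this

theorem HasMixedDerivOn.congr {S S' : Set (Space d)} {I : Set ℝ} {ls lt : ℕ}
    {f g : Space d → ℝ → F} (h : HasMixedDerivOn S' I ls lt f) (hS : S ⊆ S')
    (hfg : ∀ x ∈ S, ∀ t ∈ I, g x t = f x t) : HasMixedDerivOn S I ls lt g := by
  refine ⟨fun x hx => (h.1 x (hS hx)).congr (hfg x hx), fun t ht => ?_⟩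
  refine ((h.2 t ht).mono hS).congr fun x hx => ?_
  exact iteratedDerivWithin_congr (hfg x hx) ht

theorem mixedDeriv_congr {S : Set (Space d)} (hS : IsOpen S) {I : Set ℝ} {ls lt : ℕ}
    {f g : Space d → ℝ → F} (hfg : ∀ x ∈ S, ∀ t ∈ I, g x t = f x t) {x : Space d} (hx : x ∈ S)
    {t : ℝ} (ht : t ∈ I) : mixedDeriv I ls lt g x t = mixedDeriv I ls lt f x t := by
  unfold mixedDeriv
  refine Filter.EventuallyEq.eq_of_nhds (Filter.EventuallyEq.iteratedFDeriv ℝ ?_ ls)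
  filter_upwards [hS.mem_nhds hx] with y hy
  exact iteratedDerivWithin_congr (hfg y hy) ht

end Mixed

/-! ### The implicit function theorem with one-sided time derivatives. -/

section Implicit

open Filter Topology Asymptotics

variable {X : Type} [NormedAddCommGroup X] [NormedSpace ℝ X]

/-- A quantitative implicit function theorem: the solution `δ` of `φ(x + δ G(x,t), t) = R(x,t)` is
differentiable if the equation determines it in a Lipschitz stable way. -/
theorem implicit_hasFDerivWithinAt {N W : Set X} {I : Set ℝ} {φ R δ : X → ℝ → ℝ} {G : X → ℝ → X}
    (hW : IsOpen W) {ε₀ cw : ℝ} (hcw : 0 < cw) {x : X} {t : ℝ} (hx : x ∈ N) (ht : t ∈ I)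
    (hφ : DifferentiableWithinAt ℝ (Function.uncurry φ) (W ×ˢ I) (x + δ x t • G x t, t))
    (hG : DifferentiableWithinAt ℝ (Function.uncurry G) (N ×ˢ I) (x, t))
    (hR : DifferentiableWithinAt ℝ (Function.uncurry R) (N ×ˢ I) (x, t))
    (hmem : x + δ x t • G x t ∈ W)
    (hroot : ∀ y ∈ N, ∀ u ∈ I, φ (y + δ y u • G y u) u = R y u)
    (hδ : |δ x t| < ε₀)
    (hlow : ∀ y ∈ N, ∀ u ∈ I, ∀ a, |a| ≤ ε₀ →
      cw * |δ y u - a| ≤ |φ (y + δ y u • G y u) u - φ (y + a • G y u) u|) :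
    cw ≤ |fderivWithin ℝ (Function.uncurry φ) (W ×ˢ I) (x + δ x t • G x t, t) (G x t, 0)| ∧
    HasFDerivWithinAt (Function.uncurry δ)
      ((fderivWithin ℝ (Function.uncurry φ) (W ×ˢ I) (x + δ x t • G x t, t) (G x t, 0))⁻¹ •
        (fderivWithin ℝ (Function.uncurry R) (N ×ˢ I) (x, t) -
          (fderivWithin ℝ (Function.uncurry φ) (W ×ˢ I) (x + δ x t • G x t, t)).comp
            (ContinuousLinearMap.id ℝ (X × ℝ) + δ x t • (ContinuousLinearMap.inl ℝ X ℝ).comp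
              (fderivWithin ℝ (Function.uncurry G) (N ×ˢ I) (x, t))))) (N ×ˢ I) (x, t) := by
  set A := fderivWithin ℝ (Function.uncurry φ) (W ×ˢ I) (x + δ x t • G x t, t) with hA
  set G' := fderivWithin ℝ (Function.uncurry G) (N ×ˢ I) (x, t) with hG'
  set R' := fderivWithin ℝ (Function.uncurry R) (N ×ˢ I) (x, t) with hR'
  set α := δ x t with hα
  set a := A (G x t, 0) with ha
  set B : X × ℝ →L[ℝ] X × ℝ := ContinuousLinearMap.id ℝ (X × ℝ) +
    α • (ContinuousLinearMap.inl ℝ X ℝ).comp G' with hB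
  -- W is open, so near the base point only the restriction to times in I matters. The curves and
  -- maps substituted below then need not stay in W.
  have hφ' : HasFDerivWithinAt (Function.uncurry φ) A (Set.univ ×ˢ I) (x + α • G x t, t) := by
    refine hφ.hasFDerivWithinAt.mono_of_mem_nhdsWithin ?_
    have : W ×ˢ I = (W ×ˢ Set.univ) ∩ (Set.univ ×ˢ I) := by ext; simp
    rw [this]
    exact Filter.inter_mem (mem_nhdsWithin_of_mem_nhds
      ((hW.prod isOpen_univ).mem_nhds (by simpa using hmem))) self_mem_nhdsWithin
  -- The lower bound controls the difference quotients of s ↦ φ(x + s G) at α, hence their limit.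
  have hslope : cw ≤ |a| := by
    have h1 : HasDerivAt (fun s : ℝ => (x + s • G x t, t)) (G x t, (0 : ℝ)) α := by
      have := ((hasDerivAt_id α).smul_const (G x t)).const_add x
      simpa using this.prodMk (hasDerivAt_const α t)
    have h2 : HasDerivAt (fun s : ℝ => φ (x + s • G x t) t) a α := by
      rw [← hasDerivWithinAt_univ] at h1 ⊢
      exact hφ'.comp_hasDerivWithinAt (f := fun s : ℝ => (x + s • G x t, t)) α h1
        (fun s _ => ⟨trivial, ht⟩)
    have h3 := hasDerivAt_iff_tendsto_slope.1 h2
    refine ge_of_tendsto h3.abs ?_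
    have h4 : ∀ᶠ s in 𝓝 α, |s| < ε₀ := continuous_abs.continuousAt.eventually (gt_mem_nhds hδ)
    filter_upwards [self_mem_nhdsWithin, h4.filter_mono nhdsWithin_le_nhds] with s hs hs'
    have h5 := hlow x hx t ht s hs'.le
    rw [slope_def_field, abs_div, le_div_iff₀ (abs_pos.2 (sub_ne_zero.2 hs)), abs_sub_comm s α,
      abs_sub_comm (φ _ t)]
    exact h5
  refine ⟨hslope, ?_⟩
  have hane : a ≠ 0 := fun h => by
    rw [h, abs_zero] at hslope
    exact absurd hslope (not_le.2 hcw)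
  have hfst : HasFDerivWithinAt (Prod.fst : X × ℝ → X) (ContinuousLinearMap.fst ℝ X ℝ)
    (N ×ˢ I) (x, t) := hasFDerivWithinAt_fst
  have hsnd : HasFDerivWithinAt (Prod.snd : X × ℝ → ℝ) (ContinuousLinearMap.snd ℝ X ℝ)
    (N ×ˢ I) (x, t) := hasFDerivWithinAt_snd
  -- Lipschitz estimate at the base point
  have hk : HasFDerivWithinAt
      (fun q : X × ℝ => R q.1 q.2 - φ (q.1 + α • G q.1 q.2) q.2) (R' - A.comp B) (N ×ˢ I) (x, t) := by
    have h1 : HasFDerivWithinAt (fun q : X × ℝ => (q.1 + α • G q.1 q.2, q.2)) B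
        (N ×ˢ I) (x, t) := by
      refine ((hfst.add (hG.hasFDerivWithinAt.const_smul α)).prodMk hsnd).congr_fderiv ?_
      ext v <;> simp [hB, hG']
    exact hR.hasFDerivWithinAt.sub
      (hφ'.comp (f := fun q : X × ℝ => (q.1 + α • G q.1 q.2, q.2)) (x, t) h1
        (fun q hq => ⟨trivial, hq.2⟩))
  -- Testing `hlow` at q with the frozen value α bounds |δ(q) − α| by the residual of α at q, which
  -- vanishes at the base point and is differentiable there.
  have hO : (fun q : X × ℝ => δ q.1 q.2 - α) =O[𝓝[N ×ˢ I] (x, t)] fun q => q - (x, t) := by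
    refine IsBigO.trans ?_ hk.isBigO_sub
    refine IsBigO.of_bound cw⁻¹ ?_
    filter_upwards [self_mem_nhdsWithin] with q hq
    have h0 : R x t - φ (x + α • G x t) t = 0 := by rw [hroot x hx t ht, sub_self]
    have := hlow q.1 hq.1 q.2 hq.2 α hδ.le
    rw [hroot q.1 hq.1 q.2 hq.2] at this
    simp only [h0, sub_zero, Real.norm_eq_abs]
    rw [inv_mul_eq_div, le_div_iff₀ hcw, mul_comm]
    exact this
  have hcont : Tendsto (fun q : X × ℝ => (q, δ q.1 q.2)) (𝓝[N ×ˢ I] (x, t))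
      (𝓝[(N ×ˢ I) ×ˢ Set.univ] ((x, t), α)) := by
    refine tendsto_nhdsWithin_iff.2 ⟨?_, ?_⟩
    · refine Filter.Tendsto.prodMk_nhds (tendsto_id.mono_left nhdsWithin_le_nhds) ?_
      have h1 : Tendsto (fun q : X × ℝ => q - (x, t)) (𝓝[N ×ˢ I] (x, t)) (𝓝 0) := by
        have : Tendsto (fun q : X × ℝ => q - (x, t)) (𝓝 (x, t)) (𝓝 ((x, t) - (x, t))) :=
          (continuous_id.sub continuous_const).tendsto _
        rw [sub_self] at this
        exact this.mono_left nhdsWithin_le_nhds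
      have h2 := hO.trans_tendsto h1
      have := h2.add_const α
      simpa using this
    · filter_upwards [self_mem_nhdsWithin] with q hq using ⟨hq, trivial⟩
  -- Linearisation with the ray parameter as an independent variable. Substituting δ(q) for it is
  -- allowed by `hcont`, and by `hO` the error stays o(q − (x, t)).
  have hΦ : HasFDerivWithinAt
      (fun p : (X × ℝ) × ℝ => φ (p.1.1 + p.2 • G p.1.1 p.1.2) p.1.2)
      ((A.comp B).coprod (ContinuousLinearMap.toSpanSingleton ℝ a)) ((N ×ˢ I) ×ˢ Set.univ)
      ((x, t), α) := by
    have f1 : HasFDerivWithinAt (Prod.fst : (X × ℝ) × ℝ → X × ℝ)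
      (ContinuousLinearMap.fst ℝ (X × ℝ) ℝ) ((N ×ˢ I) ×ˢ Set.univ) ((x, t), α) :=
      hasFDerivWithinAt_fst
    have f2 : HasFDerivWithinAt (Prod.snd : (X × ℝ) × ℝ → ℝ)
      (ContinuousLinearMap.snd ℝ (X × ℝ) ℝ) ((N ×ˢ I) ×ˢ Set.univ) ((x, t), α) :=
      hasFDerivWithinAt_snd
    have m1 : Set.MapsTo (Prod.fst : (X × ℝ) × ℝ → X × ℝ) ((N ×ˢ I) ×ˢ Set.univ) (N ×ˢ I) :=
      fun q hq => hq.1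
    have hG1 := hG.hasFDerivWithinAt.comp (f := (Prod.fst : (X × ℝ) × ℝ → X × ℝ)) _ f1 m1
    have g1 := hfst.comp (f := (Prod.fst : (X × ℝ) × ℝ → X × ℝ)) ((x, t), α) f1 m1
    have g2 := hsnd.comp (f := (Prod.fst : (X × ℝ) × ℝ → X × ℝ)) ((x, t), α) f1 m1
    have h1 : HasFDerivWithinAt
        (fun p : (X × ℝ) × ℝ => (p.1.1 + p.2 • G p.1.1 p.1.2, p.1.2))
        (B.coprod (ContinuousLinearMap.toSpanSingleton ℝ (G x t, (0 : ℝ))))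
        ((N ×ˢ I) ×ˢ Set.univ) ((x, t), α) := by
      refine ((g1.add (f2.smul hG1)).prodMk g2).congr_fderiv ?_
      ext v <;> simp [hB, hG', Function.uncurry]
    refine (hφ'.comp (f := fun p : (X × ℝ) × ℝ => (p.1.1 + p.2 • G p.1.1 p.1.2, p.1.2))
      ((x, t), α) h1 (fun q hq => ⟨trivial, hq.1.2⟩)).congr_fderiv ?_
    ext v <;> simp [ha]
  have hlo := hΦ.isLittleO.comp_tendsto hcont
  have hlo2 : (fun q : X × ℝ => R q.1 q.2 - R x t - (A.comp B (q - (x, t)) +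
      (δ q.1 q.2 - α) * a)) =o[𝓝[N ×ˢ I] (x, t)] fun q => q - (x, t) := by
    refine (hlo.congr' ?_ ?_).trans_isBigO ((isBigO_refl (fun q : X × ℝ => q - (x, t)) _).prod_left hO)
    · filter_upwards [self_mem_nhdsWithin] with q hq
      simp only [Function.comp]
      rw [hroot q.1 hq.1 q.2 hq.2, hroot x hx t ht]
      simp
    · exact Filter.Eventually.of_forall fun q => by simp [Function.comp]
  -- By the root equation, (δ(q) − α) a = (R' − A ∘ B)(q − (x, t)) + o(q − (x, t)); it remains to
  -- divide by a.
  have hlo3 := (hR.hasFDerivWithinAt.isLittleO.sub hlo2).const_mul_left a⁻¹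
  refine HasFDerivWithinAt.of_isLittleO ?_
  refine hlo3.congr_left fun q => ?_
  simp only [Function.uncurry, smul_apply, sub_apply,
    smul_eq_mul, ← hR']
  field_simp
  ring

end Implicit

/-! ### Higher derivatives of implicitly defined functions. -/

section ImplicitFamily

variable {ι : Type*} {X : Type} [NormedAddCommGroup X] [NormedSpace ℝ X]

/-- A bootstrap: the formula for Dδ involves δ itself, but no derivative of δ, so k bounded
derivatives of δ give k bounded derivatives of Dδ. The slope that is inverted is bounded below by
cw. -/
theorem implicit_u1 {m : ℕ} (hm : 1 ≤ m) {N W : ι → Set X} {I : ι → Set ℝ}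
    {φ R δ : ι → X → ℝ → ℝ} {G : ι → X → ℝ → X}
    (hN : ∀ i, IsOpen (N i)) (hW : ∀ i, IsOpen (W i)) (hI : ∀ i, UniqueDiffOn ℝ (I i))
    {ε₀ cw : ℝ} (hcw : 0 < cw)
    (hφ : U1 m (fun i => W i ×ˢ I i) (fun i => Function.uncurry (φ i)))
    (hG : U1 m (fun i => N i ×ˢ I i) (fun i => Function.uncurry (G i)))
    (hR : U1 m (fun i => N i ×ˢ I i) (fun i => Function.uncurry (R i)))
    (hmem : ∀ i, ∀ x ∈ N i, ∀ t ∈ I i, x + δ i x t • G i x t ∈ W i)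
    (hroot : ∀ i, ∀ y ∈ N i, ∀ u ∈ I i, φ i (y + δ i y u • G i y u) u = R i y u)
    (hδ : ∀ i, ∀ x ∈ N i, ∀ t ∈ I i, |δ i x t| < ε₀)
    (hlow : ∀ i, ∀ y ∈ N i, ∀ u ∈ I i, ∀ a, |a| ≤ ε₀ →
      cw * |δ i y u - a| ≤ |φ i (y + δ i y u • G i y u) u - φ i (y + a • G i y u) u|) :
    U1 m (fun i => N i ×ˢ I i) (fun i => Function.uncurry (δ i)) := by
  have hS : ∀ i, UniqueDiffOn ℝ (N i ×ˢ I i) := fun i => (hN i).uniqueDiffOn.prod (hI i)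
  have hT : ∀ i, UniqueDiffOn ℝ (W i ×ˢ I i) := fun i => (hW i).uniqueDiffOn.prod (hI i)
  have key := fun i x (hx : x ∈ N i) t (ht : t ∈ I i) =>
    implicit_hasFDerivWithinAt (hW i) hcw hx ht
      (((hφ.1 i).differentiableOn (by norm_cast; omega)) _ ⟨hmem i x hx t ht, ht⟩)
      (((hG.1 i).differentiableOn (by norm_cast; omega)) _ ⟨hx, ht⟩)
      (((hR.1 i).differentiableOn (by norm_cast; omega)) _ ⟨hx, ht⟩)
      (hmem i x hx t ht) (hroot i) (hδ i x hx t ht) (hlow i)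
  have hdiff : ∀ i, DifferentiableOn ℝ (Function.uncurry (δ i)) (N i ×ˢ I i) := by
    rintro i ⟨x, t⟩ ⟨hx, ht⟩
    exact (key i x hx t ht).2.differentiableWithinAt
  have hb : ∀ i, ∀ p ∈ N i ×ˢ I i, ‖Function.uncurry (δ i) p‖ ≤ ε₀ := by
    rintro i ⟨x, t⟩ ⟨hx, ht⟩
    exact (hδ i x hx t ht).le
  suffices h : ∀ k ≤ m, U1 k (fun i => N i ×ˢ I i) (fun i => Function.uncurry (δ i)) from h m le_rfl
  intro k
  induction k with
  | zero =>
    intro _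
    refine ub_zero_iff.2 ⟨fun i => (hdiff i).continuousOn, max ε₀ 0, le_max_right _ _, ?_⟩
    intro i p hp
    simpa using Or.inl (hb i p hp)
  | succ k ih =>
    intro hk
    have hδk := ih (by omega)
    have hGk := hG.of_le (m := k) (by omega)
    have hY : D1 k (fun i => N i ×ˢ I i)
        (fun i p => p + ((δ i p.1 p.2 • G i p.1 p.2, 0) : X × ℝ)) := by
      have h1 := D1.affine (n := k) (C := 1) hS (fun _ => ContinuousLinearMap.id ℝ (X × ℝ))
        (fun _ => 0) (fun _ => ContinuousLinearMap.norm_id_le)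
      have h2 := ((U1.smul hS hδk hGk).clm hS (ContinuousLinearMap.inl ℝ X ℝ)).toUD
      simpa [Function.uncurry] using h1.add hS h2
    have hmaps : ∀ i, Set.MapsTo (fun p : X × ℝ => p + ((δ i p.1 p.2 • G i p.1 p.2, 0) : X × ℝ))
        (N i ×ˢ I i) (W i ×ˢ I i) := by
      rintro i ⟨x, t⟩ ⟨hx, ht⟩
      simpa using ⟨hmem i x hx t ht, ht⟩
    have hA := D1.comp hS hT (U1.fderivWithin (hφ.of_le hk) hT) hY hmaps
    have hGa : U1 k (fun i => N i ×ˢ I i) (fun i p => ((G i p.1 p.2, 0) : X × ℝ)) :=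
      hGk.clm hS (ContinuousLinearMap.inl ℝ X ℝ)
    have ha := U1.bilinear hS (ContinuousLinearMap.id ℝ (X × ℝ →L[ℝ] ℝ)) hA hGa
    have hainv := U1.inv hS ha hcw (by
      rintro i ⟨x, t⟩ ⟨hx, ht⟩
      simpa using (key i x hx t ht).1)
    have hB := ((UB.clm hS (ContinuousLinearMap.compL ℝ (X × ℝ) X (X × ℝ)
      (ContinuousLinearMap.inl ℝ X ℝ)) (U1.fderivWithin (hG.of_le hk) hS)))
    have hB' := (U1.const (n := k) (S := fun i => N i ×ˢ I i) (C := 1)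
      (fun _ : ι => ContinuousLinearMap.id ℝ (X × ℝ))
      (fun _ => ContinuousLinearMap.norm_id_le)).add hS (U1.smul hS hδk hB)
    have hAB := U1.bilinear hS (ContinuousLinearMap.compL ℝ (X × ℝ) (X × ℝ) ℝ) hA hB'
    have hfin := U1.smul hS hainv ((U1.fderivWithin (hR.of_le hk) hS).sub hS hAB)
    refine U1.of_fderivWithin hS hdiff hb (hfin.congr ?_)
    rintro i ⟨x, t⟩ ⟨hx, ht⟩
    rw [(key i x hx t ht).2.fderivWithin (hS i _ ⟨hx, ht⟩)]
    simp [Function.uncurry]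

end ImplicitFamily

/-! ### Barycentric coordinates on simplices. -/

section Simplices

variable {d : ℕ}

/-- `s` is the vertex set of a nondegenerate `d`-simplex. -/
def IsSimplex (s : Finset (Space d)) : Prop :=
  AffineIndependent ℝ ((↑) : s → Space d) ∧ s.card = d + 1

theorem IsBary.unique {s : Finset (Space d)} (hs : AffineIndependent ℝ ((↑) : s → Space d))
    {x : Space d} {w w' : Space d → ℝ} (h : IsBary s x w) (h' : IsBary s x w') : w = w' := by
  have key := affineIndependent_iff.1 hs Finset.univ (fun v => w v - w' v) (by
    rw [Finset.sum_sub_distrib, Finset.sum_coe_sort s w, Finset.sum_coe_sort s w', h.2.1, h'.2.1,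
      sub_self]) (by
    simp only [sub_smul]
    rw [Finset.sum_sub_distrib, Finset.sum_coe_sort s fun v => w v • v,
      Finset.sum_coe_sort s fun v => w' v • v, h.2.2, h'.2.2, sub_self])
  funext v
  by_cases hv : v ∈ s
  · exact sub_eq_zero.1 (key ⟨v, hv⟩ (Finset.mem_univ _))
  · rw [h.1 v hv, h'.1 v hv]

theorem bary_eq {s : Finset (Space d)} (hs : AffineIndependent ℝ ((↑) : s → Space d))
    {x : Space d} {w : Space d → ℝ} (h : IsBary s x w) : bary s x = w := by
  have h' : ∃ w, IsBary s x w := ⟨w, h⟩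
  rw [bary, dif_pos h']
  exact IsBary.unique hs h'.choose_spec h

theorem AffineIndependent.finset_mono {f s : Finset (Space d)}
    (hs : AffineIndependent ℝ ((↑) : s → Space d)) (hf : f ⊆ s) :
    AffineIndependent ℝ ((↑) : f → Space d) :=
  hs.mono (s := (f : Set (Space d))) (t := (s : Set (Space d))) (by exact_mod_cast hf)

theorem IsBary.mono {f s : Finset (Space d)} (hf : f ⊆ s) {x : Space d} {w : Space d → ℝ}
    (h : IsBary f x w) : IsBary s x w := by
  refine ⟨fun v hv => h.1 v fun h' => hv (hf h'), ?_, ?_⟩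
  · rw [← h.2.1]
    exact (Finset.sum_subset hf fun v _ hv => h.1 v hv).symm
  · rw [← h.2.2]
    exact (Finset.sum_subset hf fun v _ hv => by rw [h.1 v hv, zero_smul]).symm

theorem mem_cell_iff_exists {s : Finset (Space d)} {x : Space d} :
    x ∈ cell s ↔ ∃ w, IsBary s x w ∧ ∀ v, 0 ≤ w v := by
  classical
  rw [cell, Finset.mem_convexHull']
  constructor
  · rintro ⟨w, h1, h2, h3⟩
    refine ⟨fun v => if v ∈ s then w v else 0, ⟨fun v hv => by simp [hv], ?_, ?_⟩, fun v => ?_⟩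
    · rw [← h2]; exact Finset.sum_congr rfl fun v hv => by simp [hv]
    · rw [← h3]; exact Finset.sum_congr rfl fun v hv => by simp [hv]
    · dsimp only
      split_ifs with hv
      exacts [h1 v hv, le_rfl]
  · rintro ⟨w, h1, h2⟩
    exact ⟨w, fun v _ => h2 v, h1.2.1, h1.2.2⟩

theorem isBary_bary_of_mem {s : Finset (Space d)} {x : Space d} (hx : x ∈ cell s) :
    IsBary s x (bary s x) := by
  obtain ⟨w, hw, -⟩ := mem_cell_iff_exists.1 hx
  have h' : ∃ w, IsBary s x w := ⟨w, hw⟩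
  rw [bary, dif_pos h']
  exact h'.choose_spec

theorem bary_nonneg {s : Finset (Space d)} (hs : AffineIndependent ℝ ((↑) : s → Space d))
    {x : Space d} (hx : x ∈ cell s) (v : Space d) : 0 ≤ bary s x v := by
  obtain ⟨w, hw, hw0⟩ := mem_cell_iff_exists.1 hx
  rw [bary_eq hs hw]
  exact hw0 v

theorem cell_mono {f s : Finset (Space d)} (hf : f ⊆ s) : cell f ⊆ cell s :=
  convexHull_mono (by exact_mod_cast hf)

theorem bary_face {f s : Finset (Space d)} (hs : AffineIndependent ℝ ((↑) : s → Space d))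
    (hf : f ⊆ s) {x : Space d} (hx : x ∈ cell f) : bary f x = bary s x :=
  (bary_eq hs (IsBary.mono hf (isBary_bary_of_mem hx))).symm

theorem mem_cell_of_vertex {s : Finset (Space d)} {v : Space d} (hv : v ∈ s) : v ∈ cell s :=
  subset_convexHull ℝ _ hv

theorem convex_cell (s : Finset (Space d)) : Convex ℝ (cell s) := convex_convexHull ℝ _

theorem isCompact_cell (s : Finset (Space d)) : IsCompact (cell s) :=
  (s.finite_toSet).isCompact_convexHull ℝ

theorem isClosed_cell (s : Finset (Space d)) : IsClosed (cell s) := (isCompact_cell s).isClosed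

theorem dist_le_diam_cell {s : Finset (Space d)} {x y : Space d} (hx : x ∈ cell s)
    (hy : y ∈ cell s) : dist x y ≤ Metric.diam (cell s) :=
  Metric.dist_le_diam_of_mem (isCompact_cell s).isBounded hx hy

/-- The gradient of the barycentric coordinate of the vertex `v`. -/
noncomputable def baryLin (s : Finset (Space d)) (v : Space d) : Space d →L[ℝ] ℝ :=
  fderiv ℝ (fun x => bary s x v) 0

namespace IsSimplex

variable {s : Finset (Space d)} (hs : IsSimplex s)
include hs

theorem exists_basis : ∃ b : AffineBasis s ℝ (Space d), ∀ v, b v = v := by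
  have hspan : affineSpan ℝ (Set.range ((↑) : s → Space d)) = ⊤ := by
    rw [hs.1.affineSpan_eq_top_iff_card_eq_finrank_add_one]
    simp [hs.2]
  exact ⟨⟨_, hs.1, hspan⟩, fun v => rfl⟩

theorem isBary (x : Space d) : IsBary s x (bary s x) := by
  classical
  obtain ⟨b, hb⟩ := hs.exists_basis
  have h' : ∃ w, IsBary s x w := by
    refine ⟨fun v => if h : v ∈ s then b.coord ⟨v, h⟩ x else 0, fun v hv => by simp [hv], ?_, ?_⟩
    · rw [← Finset.sum_coe_sort, ← b.sum_coord_apply_eq_one x]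
      exact Finset.sum_congr rfl fun v _ => by simp
    · rw [← Finset.sum_coe_sort s fun v => (if h : v ∈ s then b.coord ⟨v, h⟩ x else 0) • v]
      conv_rhs => rw [← b.linear_combination_coord_eq_self x]
      exact Finset.sum_congr rfl fun v _ => by simp [hb]
  rw [bary, dif_pos h']
  exact h'.choose_spec

theorem bary_eq_of {x : Space d} {w : Space d → ℝ} (h : IsBary s x w) : bary s x = w :=
  bary_eq hs.1 h

theorem sum_bary (x : Space d) : ∑ v ∈ s, bary s x v = 1 := (hs.isBary x).2.1

theorem sum_bary_smul (x : Space d) : ∑ v ∈ s, bary s x v • v = x := (hs.isBary x).2.2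

theorem bary_of_notMem (x : Space d) {v : Space d} (hv : v ∉ s) : bary s x v = 0 :=
  (hs.isBary x).1 v hv

theorem mem_cell_iff {x : Space d} : x ∈ cell s ↔ ∀ v ∈ s, 0 ≤ bary s x v := by
  constructor
  · intro hx v _
    exact bary_nonneg hs.1 hx v
  · intro h
    refine mem_cell_iff_exists.2 ⟨bary s x, hs.isBary x, fun v => ?_⟩
    by_cases hv : v ∈ s
    · exact h v hv
    · rw [hs.bary_of_notMem x hv]

theorem bary_le_one {x : Space d} (hx : x ∈ cell s) (v : Space d) : bary s x v ≤ 1 := by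
  by_cases hv : v ∈ s
  · rw [← hs.sum_bary x]
    exact Finset.single_le_sum (f := bary s x) (fun v _ => bary_nonneg hs.1 hx v) hv
  · rw [hs.bary_of_notMem x hv]; exact zero_le_one

theorem mem_cell_face_iff {f : Finset (Space d)} (hf : f ⊆ s) {x : Space d} :
    x ∈ cell f ↔ x ∈ cell s ∧ ∀ v ∈ s, v ∉ f → bary s x v = 0 := by
  constructor
  · intro hx
    refine ⟨cell_mono hf hx, fun v _ hv => ?_⟩
    rw [← bary_face hs.1 hf hx]
    exact (isBary_bary_of_mem hx).1 v hv
  · rintro ⟨hx, h0⟩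
    have h0' : ∀ v ∉ f, bary s x v = 0 := fun v hv => by
      by_cases hvs : v ∈ s
      exacts [h0 v hvs hv, hs.bary_of_notMem x hvs]
    refine mem_cell_iff_exists.2 ⟨bary s x, ⟨h0', ?_, ?_⟩, bary_nonneg hs.1 hx⟩
    · rw [← hs.sum_bary x]
      exact Finset.sum_subset hf fun v _ hv => h0' v hv
    · conv_rhs => rw [← hs.sum_bary_smul x]
      exact Finset.sum_subset hf fun v _ hv => by rw [h0' v hv, zero_smul]

theorem bary_affine (v : Space d) : ∃ L : Space d →L[ℝ] ℝ, ∃ c, ∀ x, bary s x v = L x + c := by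
  obtain ⟨b, hb⟩ := hs.exists_basis
  by_cases hv : v ∈ s
  · refine ⟨LinearMap.toContinuousLinearMap (b.coord ⟨v, hv⟩).linear, b.coord ⟨v, hv⟩ 0,
      fun x => ?_⟩
    have h1 : bary s x v = b.coord ⟨v, hv⟩ x := by
      classical
      have : bary s x = fun v => if h : v ∈ s then b.coord ⟨v, h⟩ x else 0 := by
        refine hs.bary_eq_of ⟨fun v hv => by simp [hv], ?_, ?_⟩
        · rw [← Finset.sum_coe_sort, ← b.sum_coord_apply_eq_one x]
          exact Finset.sum_congr rfl fun v _ => by simp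
        · rw [← Finset.sum_coe_sort s fun v => (if h : v ∈ s then b.coord ⟨v, h⟩ x else 0) • v]
          conv_rhs => rw [← b.linear_combination_coord_eq_self x]
          exact Finset.sum_congr rfl fun v _ => by simp [hb]
      simp [this, hv]
    rw [h1]
    have := (b.coord ⟨v, hv⟩).decomp'
    have := congrFun (b.coord ⟨v, hv⟩).decomp x
    simpa using this
  · exact ⟨0, 0, fun x => by simp [hs.bary_of_notMem x hv]⟩

theorem bary_eq_baryLin (x y v : Space d) : bary s x v = bary s y v + baryLin s v (x - y) := by
  obtain ⟨L, c, hL⟩ := hs.bary_affine v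
  have : baryLin s v = L := by
    rw [baryLin, funext hL]
    exact (L.hasFDerivAt.add_const c).fderiv
  rw [this, hL, hL, map_sub]
  ring

theorem hasFDerivAt_bary (x v : Space d) : HasFDerivAt (fun x => bary s x v) (baryLin s v) x := by
  have : (fun x => bary s x v) = fun x => baryLin s v x + bary s 0 v := by
    funext x
    rw [hs.bary_eq_baryLin x 0 v, sub_zero, add_comm]
  rw [this]
  exact (baryLin s v).hasFDerivAt.add_const _

theorem continuous_bary (v : Space d) : Continuous fun x => bary s x v :=
  continuous_iff_continuousAt.2 fun x => (hs.hasFDerivAt_bary x v).continuousAt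

theorem sum_baryLin : ∑ v ∈ s, baryLin s v = 0 := by
  ext y
  have h1 := hs.sum_bary y
  have h0 := hs.sum_bary 0
  simp only [fun v => hs.bary_eq_baryLin y 0 v, sub_zero, Finset.sum_add_distrib] at h1
  have : ∑ v ∈ s, baryLin s v y = 0 := by linarith
  simpa using this

theorem sum_baryLin_smul (y : Space d) : ∑ v ∈ s, baryLin s v y • v = y := by
  have h1 := hs.sum_bary_smul y
  have h0 := hs.sum_bary_smul 0
  simp only [fun v => hs.bary_eq_baryLin y 0 v, sub_zero, add_smul, Finset.sum_add_distrib] at h1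
  rwa [h0, zero_add] at h1

theorem mem_interior_iff {x : Space d} : x ∈ interior (cell s) ↔ ∀ v ∈ s, 0 < bary s x v := by
  constructor
  · intro hx v hv
    have hx' := interior_subset hx
    refine lt_of_le_of_ne (bary_nonneg hs.1 hx' v) fun h0 => ?_
    -- move from `x` away from `v`
    have hc : ContinuousAt (fun t : ℝ => x + t • (x - v)) 0 := by fun_prop
    have hm : ∀ᶠ t in nhds (0 : ℝ), x + t • (x - v) ∈ cell s := by
      refine hc.eventually ?_
      simp only [zero_smul, add_zero]
      exact mem_interior_iff_mem_nhds.1 hx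
    obtain ⟨ε, hε, hb⟩ := Metric.eventually_nhds_iff.1 hm
    have := hb (y := ε / 2) (by simp [abs_of_pos hε]; linarith)
    have h1 := bary_nonneg hs.1 this v
    rw [hs.bary_eq_baryLin _ x v, ← h0, add_sub_cancel_left, map_smul, zero_add] at h1
    have h2 := hs.bary_eq_baryLin x v v
    have h3 : bary s v v = 1 := by
      classical
      have : bary s v = Pi.single v 1 := hs.bary_eq_of ⟨fun u hu => by
        rw [Pi.single_eq_of_ne]; rintro rfl; exact hu hv, by simp [hv], by
          rw [Finset.sum_eq_single v] <;> simp +contextual [hv]⟩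
      rw [this, Pi.single_eq_same]
    rw [← h0, h3] at h2
    have : baryLin s v (x - v) = -1 := by linarith
    rw [this, smul_eq_mul] at h1
    linarith
  · intro h
    have ho : IsOpen {y : Space d | ∀ v ∈ s, 0 < bary s y v} := by
      simp only [Set.ofPred_forall]
      exact isOpen_biInter_finset fun v _ => isOpen_lt continuous_const (hs.continuous_bary v)
    exact interior_mono (fun y hy => hs.mem_cell_iff.2 fun v hv => (hy v hv).le)
      (ho.interior_eq.symm ▸ h : x ∈ interior {y : Space d | ∀ v ∈ s, 0 < bary s y v})

theorem nonempty : s.Nonempty := by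
  rw [← Finset.card_pos, hs.2]; omega

theorem interior_nonempty : (interior (cell s)).Nonempty := by
  have hc : (0 : ℝ) < s.card := by exact_mod_cast hs.nonempty.card_pos
  refine ⟨∑ v ∈ s, (s.card : ℝ)⁻¹ • v, ?_⟩
  rw [hs.mem_interior_iff]
  intro v hv
  classical
  have : bary s (∑ v ∈ s, (s.card : ℝ)⁻¹ • v) = fun v => if v ∈ s then (s.card : ℝ)⁻¹ else 0 := by
    refine hs.bary_eq_of ⟨fun v hv => by simp [hv], ?_, ?_⟩
    · rw [Finset.sum_congr rfl fun v hv => if_pos hv, Finset.sum_const, nsmul_eq_mul]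
      field_simp
    · exact Finset.sum_congr rfl fun v hv => by simp only [if_pos hv]
  rw [this]
  simpa [hv] using hs.nonempty

/-- Lets estimates assumed in the interior of elements pass to closed elements, in particular to
vertices. -/
theorem closure_interior : closure (interior (cell s)) = cell s := by
  rw [(convex_cell s).closure_interior_eq_closure_of_nonempty_interior hs.interior_nonempty,
    (isClosed_cell s).closure_eq]

theorem diam_pos (hd : d ≠ 0) : 0 < Metric.diam (cell s) := by
  obtain ⟨u, hu, v, hv, huv⟩ := Finset.one_lt_card.1 (show 1 < s.card by rw [hs.2]; omega)
  exact (dist_pos.2 huv).trans_le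
    (dist_le_diam_cell (mem_cell_of_vertex hu) (mem_cell_of_vertex hv))

/-- The coordinate stays in [0, 1] on the ball, so a step of length ρ/2 from the centre changes it
by at most one. -/
theorem norm_baryLin_le {c : Space d} {ρ : ℝ} (hρ : 0 < ρ) (hb : Metric.ball c ρ ⊆ cell s)
    (v : Space d) : ‖baryLin s v‖ ≤ 2 * ρ⁻¹ := by
  refine ContinuousLinearMap.opNorm_le_bound _ (by positivity) fun y => ?_
  rcases eq_or_ne y 0 with rfl | hy
  · simp
  have hy' : 0 < ‖y‖ := norm_pos_iff.2 hy
  set x := c + (ρ / 2 / ‖y‖) • y with hx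
  have hxb : x ∈ cell s := hb (by
    rw [Metric.mem_ball, dist_eq_norm, hx, add_sub_cancel_left, norm_smul, Real.norm_of_nonneg
      (by positivity), div_mul_cancel₀ _ hy'.ne']
    linarith)
  have hcb : c ∈ cell s := hb (Metric.mem_ball_self hρ)
  have h1 := hs.bary_eq_baryLin x c v
  rw [hx, add_sub_cancel_left, ← hx, map_smul, smul_eq_mul] at h1
  have a1 := bary_nonneg hs.1 hxb v
  have a2 := hs.bary_le_one hxb v
  have a3 := bary_nonneg hs.1 hcb v
  have a4 := hs.bary_le_one hcb v
  have h2 : |ρ / 2 / ‖y‖ * baryLin s v y| ≤ 1 := abs_le.2 ⟨by linarith, by linarith⟩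
  rw [abs_mul, abs_of_pos (by positivity)] at h2
  rw [Real.norm_eq_abs]
  field_simp at h2 ⊢
  linarith

theorem bary_vertex {v : Space d} (hv : v ∈ s) (u : Space d) :
    bary s v u = if u = v then 1 else 0 := by
  classical
  have : bary s v = Pi.single v 1 := hs.bary_eq_of ⟨fun u hu => by
    rw [Pi.single_eq_of_ne]; rintro rfl; exact hu hv, by simp [hv], by
      rw [Finset.sum_eq_single v] <;> simp +contextual [hv]⟩
  rw [this, Pi.single_apply]

end IsSimplex

end Simplices

/-! ### Conforming meshes and the piecewise linear interpolant. -/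

section Meshes

variable {d : ℕ} {Ω : Set (Space d)} {K : Geometry.SimplicialComplex ℝ (Space d)}

theorem mem_region {A : Set (Finset (Space d))} {x : Space d} :
    x ∈ region A ↔ ∃ s ∈ A, x ∈ cell s := by
  simp [region]

theorem cell_subset_region {A : Set (Finset (Space d))} {s : Finset (Space d)} (hs : s ∈ A) :
    cell s ⊆ region A := Set.subset_biUnion_of_mem (u := cell) hs

namespace UnfittedSpaceTime.IsMesh

variable (hK : IsMesh Ω K)
include hK

theorem isSimplex {s : Finset (Space d)} (hs : s ∈ K.facets) : IsSimplex s :=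
  ⟨K.indep hs.1, hK.pure s hs⟩

theorem finite_facets : K.facets.Finite := hK.finite.subset fun _ h => h.1

theorem exists_facet {x : Space d} (hx : x ∈ closure Ω) : ∃ s ∈ K.facets, x ∈ cell s := by
  rw [← hK.cover, Geometry.SimplicialComplex.mem_space_iff] at hx
  obtain ⟨f, hf, hxf⟩ := hx
  obtain ⟨s, hfs, hs⟩ := hK.finite.exists_le_maximal hf
  refine ⟨s, ⟨hs.1, fun t ht hst => ?_⟩, cell_mono hfs hxf⟩
  exact le_antisymm hst (hs.2 ht hst)

theorem cell_subset {s : Finset (Space d)} (hs : s ∈ K.facets) : cell s ⊆ closure Ω := by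
  rw [← hK.cover]
  exact Geometry.SimplicialComplex.convexHull_subset_space hs.1

-- Conformity of the mesh: two elements meet in the face spanned by their common vertices.
omit hK in
theorem mem_cell_inter {s t : Finset (Space d)} [DecidableEq (Space d)] (hs : s ∈ K.facets)
    (ht : t ∈ K.facets) {x : Space d} (hxs : x ∈ cell s) (hxt : x ∈ cell t) : x ∈ cell (s ∩ t) := by
  have := K.inter_subset_convexHull hs.1 ht.1 ⟨hxs, hxt⟩
  rwa [← Finset.coe_inter] at this

theorem eq_of_interior {s t : Finset (Space d)} (hs : s ∈ K.facets)
    (ht : t ∈ K.facets) {x : Space d} (hxs : x ∈ interior (cell s)) (hxt : x ∈ cell t) : s = t := by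
  classical
  have h1 := mem_cell_inter hs ht (interior_subset hxs) hxt
  have h2 := ((hK.isSimplex hs).mem_cell_face_iff Finset.inter_subset_left).1 h1
  have h3 := (hK.isSimplex hs).mem_interior_iff.1 hxs
  refine hs.2 ht.1 fun v hv => ?_
  by_contra hvt
  exact (h3 v hv).ne' (h2.2 v hv fun h => hvt (Finset.mem_inter.1 h).2)

/-- The element picked by `cellAt` is irrelevant: x lies in the common face s ∩ t, and both sets of
coordinates restrict to those of this face. -/
theorem nodalInterp_eq {s : Finset (Space d)} (hs : s ∈ K.facets) {x : Space d} (hx : x ∈ cell s)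
    (f : Space d → ℝ) : nodalInterp K f x = ∑ v ∈ s, bary s x v * f v := by
  classical
  have h' : ∃ s ∈ K.facets, x ∈ cell s := ⟨s, hs, hx⟩
  have hc : cellAt K x = h'.choose := by rw [cellAt, dif_pos h']
  obtain ⟨ht, hxt⟩ := h'.choose_spec
  rw [nodalInterp, hc]
  set t := h'.choose
  have h1 := mem_cell_inter hs ht hx hxt
  have e1 := bary_face (hK.isSimplex hs).1 Finset.inter_subset_left h1
  have e2 := bary_face (hK.isSimplex ht).1 Finset.inter_subset_right h1
  have h0 := (isBary_bary_of_mem h1).1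
  have a1 : ∑ v ∈ s ∩ t, bary (s ∩ t) x v * f v = ∑ v ∈ t, bary (s ∩ t) x v * f v :=
    Finset.sum_subset Finset.inter_subset_right fun v _ hv => by rw [h0 v hv, zero_mul]
  have a2 : ∑ v ∈ s ∩ t, bary (s ∩ t) x v * f v = ∑ v ∈ s, bary (s ∩ t) x v * f v :=
    Finset.sum_subset Finset.inter_subset_left fun v _ hv => by rw [h0 v hv, zero_mul]
  rw [← e2, ← a1, a2, e1]

/-- A function is continuous if it is continuous on every element. -/
theorem continuousOn_of_cells {Y : Type*} [TopologicalSpace Y] {f : Space d → Y}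
    (h : ∀ s ∈ K.facets, ContinuousOn f (cell s)) : ContinuousOn f (closure Ω) := by
  have hfin := hK.finite_facets
  have : closure Ω = ⋃ s : K.facets, cell s.1 := by
    ext x
    simp only [Set.mem_iUnion]
    constructor
    · intro hx
      obtain ⟨s, hs, hxs⟩ := hK.exists_facet hx
      exact ⟨⟨s, hs⟩, hxs⟩
    · rintro ⟨s, hs⟩
      exact hK.cell_subset s.2 hs
  rw [this]
  have : Finite K.facets := hfin
  exact (locallyFinite_of_finite _).continuousOn_iUnion (fun s => isClosed_cell _)
    (fun s => h s.1 s.2)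

/-- A function is continuous on `Ω` if it is continuous on the part of every element in `Ω`. -/
theorem continuousOn_of_cells_inter {Y : Type*} [TopologicalSpace Y]
    {f : Space d → Y} (h : ∀ s ∈ K.facets, ContinuousOn f (cell s ∩ Ω)) : ContinuousOn f Ω := by
  have hfin := hK.finite_facets
  have : Finite K.facets := hfin
  intro x hx
  have h1 : ∀ s : K.facets, ContinuousWithinAt f (cell s.1 ∩ Ω) x := fun s => by
    by_cases hxs : x ∈ cell s.1
    · exact h s.1 s.2 x ⟨hxs, hx⟩
    · refine continuousWithinAt_of_notMem_closure fun h' => hxs ?_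
      exact (isClosed_cell s.1).closure_subset_iff.2 Set.inter_subset_left h'
  have h2 : ContinuousWithinAt f (⋃ s : K.facets, cell s.1 ∩ Ω) x :=
    by simpa only [ContinuousWithinAt, nhdsWithin_iUnion, Filter.tendsto_iSup] using h1
  refine h2.mono fun y hy => ?_
  obtain ⟨s, hs, hys⟩ := hK.exists_facet (subset_closure hy)
  exact Set.mem_iUnion.2 ⟨⟨s, hs⟩, hys, hy⟩

theorem continuousOn_nodalInterp (f : Space d → ℝ) : ContinuousOn (nodalInterp K f) (closure Ω) := by
  refine hK.continuousOn_of_cells fun s hs => ?_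
  refine ContinuousOn.congr ?_ fun x hx => hK.nodalInterp_eq hs hx f
  exact (continuous_finsetSum _ fun v _ =>
    ((hK.isSimplex hs).continuous_bary v).mul continuous_const).continuousOn

theorem diam_le_meshSize {s : Finset (Space d)} (hs : s ∈ K.facets) :
    Metric.diam (cell s) ≤ meshSize K :=
  le_csSup (hK.finite_facets.image _).bddAbove (Set.mem_image_of_mem _ hs)

omit hK in
theorem meshSize_nonneg : 0 ≤ meshSize K := by
  refine Real.sSup_nonneg ?_
  rintro _ ⟨s, -, rfl⟩
  exact Metric.diam_nonneg

theorem dim_ne_zero (h : 0 < meshSize K) : d ≠ 0 := by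
  rintro rfl
  have : meshSize K ≤ 0 := by
    refine Real.sSup_le ?_ le_rfl
    rintro _ ⟨s, -, rfl⟩
    exact (Metric.diam_subsingleton (Set.subsingleton_of_subsingleton)).le
  linarith

end UnfittedSpaceTime.IsMesh

end Meshes

/-! ### Consequences of the assumptions on a slab; the error φ − φh on closed elements. -/

section SlabBasics

variable {d : ℕ} {Ω : Set (Space d)} {qs qt ℓ m : ℕ} {c : Consts} {D : Slab d}

theorem contDiffOn_iterTimeDeriv {X F : Type} [NormedAddCommGroup X] [NormedSpace ℝ X]
    [NormedAddCommGroup F] [NormedSpace ℝ F] {N : Set X} {I : Set ℝ} (hN : UniqueDiffOn ℝ N)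
    (hI : UniqueDiffOn ℝ I) {f : X → ℝ → F} (k : ℕ) {n : ℕ}
    (hf : ContDiffOn ℝ (n + k : ℕ) (Function.uncurry f) (N ×ˢ I)) :
    ContDiffOn ℝ n (Function.uncurry fun x t => iteratedDerivWithin k (f x) I t) (N ×ˢ I) := by
  induction k generalizing n with
  | zero => simpa using hf
  | succ k ih =>
    have h1 := ih (n := n + 1) (by rwa [add_right_comm, add_assoc])
    have h2 := (h1.fderivWithin (hN.prod hI) (m := n) (by norm_cast)).clm_apply
      (contDiffOn_const (c := ((0 : X), (1 : ℝ))))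
    refine h2.congr ?_
    rintro ⟨x, t⟩ ⟨hx, ht⟩
    simp only [Function.uncurry, iteratedDerivWithin_succ]
    exact (hasDerivWithinAt_of_uncurry (f := fun x t => iteratedDerivWithin k (f x) I t) hx
      (h1.differentiableOn (by simp) _ ⟨hx, ht⟩)).derivWithin (hI t ht)

theorem contDiff_eval_mvPolynomial (p : MvPolynomial (Fin d) ℝ) :
    ContDiff ℝ ⊤ fun x : Space d => MvPolynomial.eval (fun i => x i) p := by
  induction p using MvPolynomial.induction_on with
  | C a => simpa using contDiff_const
  | add p q hp hq => simpa using hp.add hq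
  | mul_X p i hp =>
    have : ContDiff ℝ ⊤ fun x : Space d => x i := (EuclideanSpace.proj (𝕜 := ℝ) i).contDiff
    simpa using hp.mul this

theorem UnfittedSpaceTime.Slab.uniqueDiffOn_I (D : Slab d) : UniqueDiffOn ℝ D.I := uniqueDiffOn_Ioc _ _

theorem UnfittedSpaceTime.Slab.convex_I (D : Slab d) : Convex ℝ D.I := convex_Ioc _ _

/-- Time derivatives of space-time polynomials. -/
theorem iteratedDerivWithin_memV {K : Geometry.SimplicialComplex ℝ (Space d)} {I : Set ℝ}
    (hI : UniqueDiffOn ℝ I) {v : Space d → ℝ → ℝ} {w : Fin (qt + 1) → Space d → ℝ}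
    (hv : ∀ x ∈ K.space, ∀ t ∈ I, v x t = ∑ i, w i x * t ^ (i : ℕ)) (k : ℕ) {x : Space d}
    (hx : x ∈ K.space) {t : ℝ} (ht : t ∈ I) :
    ContDiffOn ℝ k (v x) I ∧ iteratedDerivWithin k (v x) I t =
      ∑ i, w i x * iteratedDerivWithin k (fun u => u ^ (i : ℕ)) I t := by
  have h1 : Set.EqOn (v x) (fun u => ∑ i, w i x * u ^ (i : ℕ)) I := fun u hu => hv x hx u hu
  refine ⟨ContDiffOn.congr (by fun_prop) h1, ?_⟩
  rw [iteratedDerivWithin_congr h1 ht, iteratedDerivWithin_fun_sum ht hI (by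
    intro i _; exact ContDiff.contDiffWithinAt (by fun_prop))]
  refine Finset.sum_congr rfl fun i _ => ?_
  exact iteratedDerivWithin_const_mul ht hI _ (ContDiff.contDiffWithinAt (by fun_prop))

namespace UnfittedSpaceTime.Admissible

variable (hA : Admissible Ω qs qt ℓ m c D)
include hA

/-- If the mesh size were zero, the time step condition would force τ ≤ 0. In particular the
dimension is not zero. -/
theorem h_pos : 0 < D.h := by
  rcases (IsMesh.meshSize_nonneg (K := D.K)).eq_or_lt with h | h
  · exfalso
    have h1 := hA.time_step
    have h2 : D.h = 0 := h.symm
    rw [h2, Real.zero_rpow (by have := c.ε_pos; linarith), mul_zero] at h1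
    exact absurd (pow_pos hA.τ_pos _) (not_lt.2 h1)
  · exact h

theorem dim_ne_zero : d ≠ 0 := hA.mesh.dim_ne_zero hA.h_pos

theorem end_mem : D.t₀ + D.τ ∈ D.I := by
  have := hA.τ_pos
  exact ⟨by linarith, le_rfl⟩

theorem norm_baryLin_le {s : Finset (Space d)} (hs : s ∈ D.K.facets) (v : Space d) :
    ‖baryLin s v‖ ≤ 2 * c.σ / Metric.diam (cell s) := by
  obtain ⟨z, hz⟩ := hA.shape s hs
  have hd := (hA.mesh.isSimplex hs).diam_pos hA.dim_ne_zero
  refine ((hA.mesh.isSimplex hs).norm_baryLin_le (div_pos hd c.σ_pos) hz v).trans (le_of_eq ?_)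
  field_simp

theorem cell_subset_Ω {s : Finset (Space d)} (hs : s ∈ D.cellsU Ω c.δU) : cell s ⊆ Ω :=
  fun _ hx => (hs.2 _ hA.end_mem hx).1

theorem region_subset_Ω : region (D.cellsU Ω c.δU) ⊆ Ω := by
  intro x hx
  obtain ⟨s, hs, hxs⟩ := mem_region.1 hx
  exact hA.cell_subset_Ω hs hxs

theorem uniqueDiffOn_cell {s : Finset (Space d)} (hs : s ∈ D.K.facets) :
    UniqueDiffOn ℝ (cell s) :=
  uniqueDiffOn_convex (convex_cell s) (hA.mesh.isSimplex hs).interior_nonempty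

theorem subset_space {x : Space d} (hx : x ∈ closure Ω) : x ∈ D.K.space := by
  rw [hA.mesh.cover]; exact hx

theorem φ_cell {s : Finset (Space d)} (hs : s ∈ D.cellsU Ω c.δU) :
    ContDiffOn ℝ ℓ (Function.uncurry D.φ) (cell s ×ˢ D.I) :=
  hA.φ_smooth.mono (Set.prod_mono (cell_subset_region hs) subset_rfl)

theorem iteratedDerivWithin_error {s : Finset (Space d)} (hs : s ∈ D.cellsU Ω c.δU)
    {k : ℕ} (hk : k ≤ ℓ) {x : Space d} (hx : x ∈ cell s) {t : ℝ} (ht : t ∈ D.I) :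
    iteratedDerivWithin k (fun u => D.φ x u - D.φh x u) D.I t =
      iteratedDerivWithin k (D.φ x) D.I t - iteratedDerivWithin k (D.φh x) D.I t := by
  obtain ⟨w, -, hw⟩ := hA.φh_mem
  have h1 := contDiffOn_time (hA.φ_cell hs) hx
  have h2 := (iteratedDerivWithin_memV D.uniqueDiffOn_I hw k (hA.subset_space (hA.mesh.cell_subset hs.1 hx))
    ht).1
  exact iteratedDerivWithin_sub ht D.uniqueDiffOn_I ((h1.of_le (by exact_mod_cast hk)) t ht) (h2 t ht)

theorem continuousOn_error {s : Finset (Space d)} (hs : s ∈ D.cellsU Ω c.δU)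
    {k : ℕ} (hk : k ≤ ℓ) {t : ℝ} (ht : t ∈ D.I) :
    ContinuousOn (fun y => iteratedDerivWithin k (fun u => D.φ y u - D.φh y u) D.I t) (cell s) := by
  obtain ⟨w, hw1, hw⟩ := hA.φh_mem
  have h1 := (contDiffOn_iterTimeDeriv (hA.uniqueDiffOn_cell hs.1) D.uniqueDiffOn_I k (n := 0)
    ((hA.φ_cell hs).of_le (by norm_cast; omega))).continuousOn.comp (f := fun y => (y, t))
    (s := cell s) (by fun_prop) (fun y hy => ⟨hy, ht⟩)
  have h2 : ContinuousOn (fun y => ∑ i, w i y *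
      iteratedDerivWithin k (fun u => u ^ (i : ℕ)) D.I t) (cell s) :=
    continuousOn_finsetSum _ fun i _ => ((hw1 i).1.mono fun y hy =>
      hA.subset_space (hA.mesh.cell_subset hs.1 hy)).mul continuousOn_const
  refine (h1.sub h2).congr fun y hy => ?_
  rw [hA.iteratedDerivWithin_error hs hk hy ht, (iteratedDerivWithin_memV D.uniqueDiffOn_I hw k
    (hA.subset_space (hA.mesh.cell_subset hs.1 hy)) ht).2]
  rfl

theorem differentiableOn_error {s : Finset (Space d)} (hs : s ∈ D.cellsU Ω c.δU)
    {k : ℕ} (hk : k + 1 ≤ ℓ) {t : ℝ} (ht : t ∈ D.I) :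
    DifferentiableOn ℝ (fun y => iteratedDerivWithin k (fun u => D.φ y u - D.φh y u) D.I t)
      (cell s) := by
  obtain ⟨w, hw1, hw⟩ := hA.φh_mem
  have h1 := ((contDiffOn_iterTimeDeriv (hA.uniqueDiffOn_cell hs.1) D.uniqueDiffOn_I k (n := 1)
    ((hA.φ_cell hs).of_le (by norm_cast; omega))).differentiableOn (by simp)).comp
    (f := fun y => (y, t)) (s := cell s) (by fun_prop) (fun y hy => ⟨hy, ht⟩)
  have h2 : DifferentiableOn ℝ (fun y => ∑ i, w i y *
      iteratedDerivWithin k (fun u => u ^ (i : ℕ)) D.I t) (cell s) := by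
    refine DifferentiableOn.fun_sum fun i _ => ?_
    obtain ⟨p, -, hp⟩ := (hw1 i).2 s hs.1
    have : DifferentiableOn ℝ (w i) (cell s) :=
      (((contDiff_eval_mvPolynomial p).differentiable (by simp)).differentiableOn).congr hp
    exact this.mul_const _
  refine (h1.sub h2).congr fun y hy => ?_
  rw [hA.iteratedDerivWithin_error hs (by omega) hy ht, (iteratedDerivWithin_memV D.uniqueDiffOn_I hw k
    (hA.subset_space (hA.mesh.cell_subset hs.1 hy)) ht).2]
  rfl

/-- The approximation bound is assumed in the interior only. Continuity of the error carries it to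
the vertices, the only points the linear interpolant sees. -/
theorem error_le {s : Finset (Space d)} (hs : s ∈ D.cellsU Ω c.δU) (hℓ : qt + 2 ≤ ℓ) {k : ℕ}
    (hk : k ≤ qt + 1) {x : Space d} (hx : x ∈ cell s) {t : ℝ} (ht : t ∈ D.I) :
    |iteratedDerivWithin k (D.φ x) D.I t - iteratedDerivWithin k (D.φh x) D.I t| ≤
      c.Cap * (D.h ^ (qs + 1) + D.τ ^ (qt + 1 - k)) := by
  rw [← hA.iteratedDerivWithin_error hs (by omega) hx ht]
  have h1 : Set.MapsTo (fun y => iteratedDerivWithin k (fun u => D.φ y u - D.φh y u) D.I t)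
      (interior (cell s)) (Metric.closedBall 0 (c.Cap * (D.h ^ (qs + 1) + D.τ ^ (qt + 1 - k)))) := by
    intro y hy
    have := hA.φh_approx 0 k (Or.inr ⟨rfl, hk⟩) s hs y hy t ht
    rw [mixedDeriv, norm_iteratedFDeriv_zero, Nat.sub_zero] at this
    simpa using this
  have hcl := (hA.mesh.isSimplex hs.1).closure_interior
  have h2 := h1.closure_of_continuousOn (by
    rw [hcl]; exact hA.continuousOn_error hs (by omega) ht)
  rw [hcl, Metric.isClosed_closedBall.closure_eq] at h2
  simpa using h2 hx

/-- The mean value inequality in the convex interior, extended to the closed element by continuity.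
-/
theorem error_lipschitz {s : Finset (Space d)} (hs : s ∈ D.cellsU Ω c.δU) {k : ℕ}
    (hk : k + 1 ≤ ℓ) {t : ℝ} (ht : t ∈ D.I) {B : ℝ} (hB : ∀ x ∈ interior (cell s),
      ‖mixedDeriv D.I 1 k (fun y u => D.φ y u - D.φh y u) x t‖ ≤ B)
    {x y : Space d} (hx : x ∈ cell s) (hy : y ∈ cell s) :
    |(iteratedDerivWithin k (D.φ x) D.I t - iteratedDerivWithin k (D.φh x) D.I t) -
      (iteratedDerivWithin k (D.φ y) D.I t - iteratedDerivWithin k (D.φh y) D.I t)| ≤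
      B * dist x y := by
  rw [← hA.iteratedDerivWithin_error hs (by omega) hx ht,
    ← hA.iteratedDerivWithin_error hs (by omega) hy ht]
  have hcl := (hA.mesh.isSimplex hs.1).closure_interior
  have hB0 : 0 ≤ B := by
    obtain ⟨z, hz⟩ := (hA.mesh.isSimplex hs.1).interior_nonempty
    exact (norm_nonneg _).trans (hB z hz)
  set f := fun y => iteratedDerivWithin k (fun u => D.φ y u - D.φh y u) D.I t with hf
  have h1 : LipschitzOnWith ⟨B, hB0⟩ f (interior (cell s)) := by
    refine LipschitzOnWith.of_dist_le_mul fun x hx y hy => ?_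
    rw [dist_eq_norm, dist_eq_norm]
    refine Convex.norm_image_sub_le_of_norm_fderiv_le (𝕜 := ℝ) (s := interior (cell s)) ?_ ?_
      (convex_cell s).interior hy hx
    · intro z hz
      exact (hA.differentiableOn_error hs hk ht).differentiableAt (mem_interior_iff_mem_nhds.1 hz)
    · intro z hz
      have := hB z hz
      rwa [mixedDeriv, norm_iteratedFDeriv_one] at this
  have h2 := LipschitzOnWith.closure (by
    rw [hcl]; exact hA.continuousOn_error hs (by omega) ht) h1
  rw [hcl] at h2
  have := h2.dist_le_mul x hx y hy
  rwa [Real.dist_eq] at this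

end UnfittedSpaceTime.Admissible

end SlabBasics

/-! ### Scalar equations along rays. -/

section Roots

/-- A continuous function that is bounded from below in the Lipschitz sense takes all values close
to its value at zero. -/
theorem exists_root_of_lower {f : ℝ → ℝ} {cw ε₀ e y : ℝ}
    (hf : ContinuousOn f (Set.Icc (-ε₀) ε₀))
    (hlow : ∀ a b : ℝ, |a| ≤ ε₀ → |b| ≤ ε₀ → cw * |a - b| ≤ |f a - f b|)
    (he : 0 ≤ e) (heε : e ≤ ε₀) (hy : |y - f 0| ≤ cw * e) : ∃ a, |a| ≤ e ∧ f a = y := by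
  have hsub : Set.Icc (-e) e ⊆ Set.Icc (-ε₀) ε₀ := Set.Icc_subset_Icc (by linarith) heε
  rcases (abs_nonneg (y - f 0)).eq_or_lt with h0 | hpos
  · exact ⟨0, by simpa using he, by have := abs_eq_zero.1 h0.symm; linarith⟩
  have hce : 0 < cw * e := hpos.trans_le hy
  have hepos : 0 < e := lt_of_le_of_ne he fun h => by rw [← h, mul_zero] at hce; exact hce.false
  have hcw : 0 < cw := by
    by_contra h
    exact absurd hce (not_lt.2 (mul_nonpos_of_nonpos_of_nonneg (not_lt.1 h) he))
  have hinj : Set.InjOn f (Set.Icc (-e) e) := by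
    intro a ha b hb hab
    have := hlow a b (abs_le.2 (hsub ha)) (abs_le.2 (hsub hb))
    rw [hab, sub_self, abs_zero] at this
    have h3 : |a - b| ≤ 0 := by
      by_contra h
      exact absurd this (not_le.2 (mul_pos hcw (not_le.1 h)))
    exact sub_eq_zero.1 (abs_eq_zero.1 (le_antisymm h3 (abs_nonneg _)))
  have l1 := hlow e 0 (by rwa [abs_of_pos hepos]) (by simpa using he.trans heε)
  have l2 := hlow (-e) 0 (by rwa [abs_neg, abs_of_pos hepos]) (by simpa using he.trans heε)
  rw [sub_zero, abs_of_pos hepos] at l1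
  rw [sub_zero, abs_neg, abs_of_pos hepos] at l2
  obtain ⟨y1, y2⟩ := abs_le.1 hy
  have m1 : (-e) ∈ Set.Icc (-e) e := ⟨le_rfl, by linarith⟩
  have m2 : e ∈ Set.Icc (-e) e := ⟨by linarith, le_rfl⟩
  have m0 : (0 : ℝ) ∈ Set.Icc (-e) e := ⟨by linarith, he⟩
  have hle : -e ≤ e := by linarith
  -- A continuous injective function is strictly monotone. By `l1` and `l2` the end values differ
  -- from f 0 by at least cw e, so they enclose y.
  rcases (hf.mono hsub).strictMonoOn_of_injOn_Icc' hle hinj with hm | hm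
  · have a1 := hm m1 m0 (by linarith)
    have a2 := hm m0 m2 hepos
    rw [abs_of_pos (by linarith)] at l1
    rw [abs_of_neg (by linarith)] at l2
    obtain ⟨a, ha, hya⟩ := intermediate_value_Icc hle (hf.mono hsub)
      (show y ∈ Set.Icc (f (-e)) (f e) from ⟨by linarith, by linarith⟩)
    exact ⟨a, abs_le.2 ha, hya⟩
  · have a1 := hm m1 m0 (by linarith)
    have a2 := hm m0 m2 hepos
    rw [abs_of_neg (by linarith)] at l1
    rw [abs_of_pos (by linarith)] at l2
    obtain ⟨a, ha, hya⟩ := intermediate_value_Icc' hle (hf.mono hsub)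
      (show y ∈ Set.Icc (f e) (f (-e)) from ⟨by linarith, by linarith⟩)
    exact ⟨a, abs_le.2 ha, hya⟩

/-- A function that is injective near a root takes negative values close to the root. -/
theorem mem_closure_neg_of_root {f : ℝ → ℝ} {ε₀ a : ℝ}
    (hf : ContinuousOn f (Set.Icc (-ε₀) ε₀)) (hinj : Set.InjOn f (Set.Icc (-ε₀) ε₀))
    (ha : |a| < ε₀) (h0 : f a = 0) :
    a ∈ closure {b | |b| ≤ ε₀ ∧ f b < 0} := by
  obtain ⟨a1, a2⟩ := abs_lt.1 ha
  have hle : -ε₀ ≤ ε₀ := by linarith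
  have ma : a ∈ Set.Icc (-ε₀) ε₀ := ⟨a1.le, a2.le⟩
  rw [Metric.mem_closure_iff]
  intro ε hε
  -- A step within ε of a that stays inside the interval. The direction of monotonicity decides on
  -- which side f is negative.
  set b := min (ε / 2) (min (ε₀ - a) (a + ε₀)) with hb
  have hbpos : 0 < b := by
    simp only [hb, lt_min_iff]; exact ⟨by linarith, by linarith, by linarith⟩
  have b1 : b ≤ ε / 2 := min_le_left _ _
  have b2 : b ≤ ε₀ - a := (min_le_right _ _).trans (min_le_left _ _)
  have b3 : b ≤ a + ε₀ := (min_le_right _ _).trans (min_le_right _ _)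
  rcases hf.strictMonoOn_of_injOn_Icc' hle hinj with hm | hm
  · refine ⟨a - b, ⟨abs_le.2 ⟨by linarith, by linarith⟩, ?_⟩, ?_⟩
    · rw [← h0]; exact hm ⟨by linarith, by linarith⟩ ma (by linarith)
    · rw [Real.dist_eq, sub_sub_cancel, abs_of_pos hbpos]; linarith
  · refine ⟨a + b, ⟨abs_le.2 ⟨by linarith, by linarith⟩, ?_⟩, ?_⟩
    · rw [← h0]; exact hm ma ⟨by linarith, by linarith⟩ (by linarith)
    · rw [Real.dist_eq, sub_add_cancel_left, abs_neg, abs_of_pos hbpos]; linarith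

end Roots

/-! ### Geometry near the interface. -/

section Neighbourhoods

variable {d : ℕ} {Ω : Set (Space d)} {qs qt ℓ m : ℕ} {c : Consts} {D : Slab d}

/-- The ball is connected and avoids the frontier, so it lies in Ω or in the exterior of Ω; its
centre decides. -/
theorem IsOpen.ball_subset_of_dist_frontier {E : Type*} [NormedAddCommGroup E] [NormedSpace ℝ E]
    {Ω : Set E} (hΩ : IsOpen Ω) {z : E} (hz : z ∈ Ω) {δ : ℝ}
    (hδ : ∀ x ∈ frontier Ω, δ < dist x z) : Metric.ball z δ ⊆ Ω := by
  rcases le_or_gt δ 0 with h | h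
  · rw [Metric.ball_eq_empty.2 h]; exact Set.empty_subset _
  have hpre : IsPreconnected (Metric.ball z δ) := (convex_ball z δ).isPreconnected
  have hsub : Metric.ball z δ ⊆ Ω ∪ (closure Ω)ᶜ := by
    intro x hx
    by_cases hx' : x ∈ closure Ω
    · left
      by_contra hxΩ
      have : x ∈ frontier Ω := by rw [hΩ.frontier_eq]; exact ⟨hx', hxΩ⟩
      exact absurd hx (not_lt.2 (hδ x this).le)
    · exact Or.inr hx'
  rcases isPreconnected_iff_subset_of_disjoint.1 hpre Ω (closure Ω)ᶜ hΩ
    isClosed_closure.isOpen_compl hsub (by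
      ext x
      simp only [Set.mem_inter_iff, Set.mem_compl_iff, Set.mem_empty_iff_false, iff_false]
      rintro ⟨-, h1, h2⟩
      exact h2 (subset_closure h1)) with h' | h'
  · exact h'
  · exact absurd (subset_closure hz) (h' (Metric.mem_ball_self h))

namespace UnfittedSpaceTime.Admissible

/-- The frontier of Ω(t) is taken in the whole space and could a priori touch the frontier of Ω, but
such a point would have distance zero to itself, against the separation assumption. -/
theorem frontier_dom (hA : Admissible Ω qs qt ℓ m c D) (hΩ : IsOpen Ω) {t : ℝ} (ht : t ∈ D.I)
    {z : Space d} (hz : z ∈ frontier (D.dom Ω t)) : Metric.ball z c.δΩ ⊆ Ω := by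
  have h1 : z ∈ closure Ω := closure_mono (fun x hx => hx.1) (frontier_subset_closure hz)
  have h2 : z ∈ Ω := by
    by_contra h
    have : z ∈ frontier Ω := by rw [hΩ.frontier_eq]; exact ⟨h1, h⟩
    have := hA.separated t ht z this z hz
    rw [dist_self] at this
    exact absurd this (not_lt.2 c.δΩ_pos.le)
  exact hΩ.ball_subset_of_dist_frontier h2 fun x hx => hA.separated t ht x hx z hz

theorem mem_nbhd_of_dist (hA : Admissible Ω qs qt ℓ m c D) (hΩ : IsOpen Ω) {t : ℝ} (ht : t ∈ D.I)
    {x z : Space d} (hz : z ∈ frontier (D.dom Ω t)) (hx : dist x z < min c.δΩ c.δU) :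
    x ∈ D.nbhd Ω c.δU t :=
  ⟨hA.frontier_dom hΩ ht hz (hx.trans_le (min_le_left _ _)), z, hz,
    hx.trans_le (min_le_right _ _)⟩

variable (hA : Admissible Ω qs qt ℓ m c D)
include hA

theorem continuousOn_ray {t : ℝ} (ht : t ∈ D.I) {x : Space d} (hx : x ∈ D.nbhd Ω c.δU t) :
    ContinuousOn (fun a : ℝ => D.φ (x + a • D.G x t) t) (Set.Icc (-c.ε₀) c.ε₀) :=
  hA.φ_cont.comp (f := fun a : ℝ => (x + a • D.G x t, t)) (by fun_prop)
    fun a ha => ⟨(hA.signed_dist t ht x hx).1 a (abs_le.2 ha), ht⟩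

theorem ray_lower {t : ℝ} (ht : t ∈ D.I) {x : Space d} (hx : x ∈ D.nbhd Ω c.δU t) (a b : ℝ)
    (ha : |a| ≤ c.ε₀) (hb : |b| ≤ c.ε₀) :
    c.cw * |a - b| ≤ |D.φ (x + a • D.G x t) t - D.φ (x + b • D.G x t) t| :=
  ((hA.signed_dist t ht x hx).2 a b ha hb).1

theorem ray_injOn {t : ℝ} (ht : t ∈ D.I) {x : Space d} (hx : x ∈ D.nbhd Ω c.δU t) :
    Set.InjOn (fun a : ℝ => D.φ (x + a • D.G x t) t) (Set.Icc (-c.ε₀) c.ε₀) := by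
  intro a ha b hb hab
  have := hA.ray_lower ht hx a b (abs_le.2 ha) (abs_le.2 hb)
  simp only at hab
  rw [hab, sub_self, abs_zero] at this
  by_contra h
  have := mul_pos c.cw_pos (abs_pos.2 (sub_ne_zero.2 h))
  linarith

/-- Smallness of φ means closeness to the interface: the ray through x carries a zero of φ at
parameter at most e, and strict monotonicity along the ray makes φ negative arbitrarily close to it,
so the zero is a frontier point. -/
theorem exists_frontier_near {t : ℝ} (ht : t ∈ D.I) {x : Space d} (hx : x ∈ D.nbhd Ω c.δU t)
    {e : ℝ} (he : 0 ≤ e) (heε : e < c.ε₀) (hφ : |D.φ x t| ≤ c.cw * e) :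
    ∃ z ∈ frontier (D.dom Ω t), dist x z ≤ e * c.Cφ := by
  obtain ⟨a, hae, ha⟩ := exists_root_of_lower (y := 0) (hA.continuousOn_ray ht hx)
    (hA.ray_lower ht hx) he heε.le (by simpa using hφ)
  have hcl := mem_closure_neg_of_root (hA.continuousOn_ray ht hx) (hA.ray_injOn ht hx)
    (hae.trans_lt heε) ha
  refine ⟨x + a • D.G x t, ⟨?_, ?_⟩, ?_⟩
  · have hm : Set.MapsTo (fun b : ℝ => x + b • D.G x t)
        {b | |b| ≤ c.ε₀ ∧ D.φ (x + b • D.G x t) t < 0} (D.dom Ω t) := fun b hb =>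
      ⟨(hA.signed_dist t ht x hx).1 b hb.1, hb.2⟩
    exact hm.closure (by fun_prop) hcl
  · intro h
    exact (ne_of_lt (interior_subset h).2) ha
  · rw [dist_eq_norm, sub_add_cancel_left, norm_neg, norm_smul, Real.norm_eq_abs]
    exact mul_le_mul hae (hA.φ_bounds t ht x hx).2.1 (norm_nonneg _) he

theorem isOpen_nbhd (hΩ : IsOpen Ω) {t : ℝ} : IsOpen (D.nbhd Ω c.δU t) := by
  have : D.nbhd Ω c.δU t = Ω ∩ ⋃ z ∈ frontier (D.dom Ω t), Metric.ball z c.δU := by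
    ext x; simp [Slab.nbhd]
  rw [this]
  exact hΩ.inter (isOpen_biUnion fun z _ => Metric.isOpen_ball)

theorem differentiableAt_φ (hΩ : IsOpen Ω) {t : ℝ} (ht : t ∈ D.I) {x : Space d}
    (hx : x ∈ D.nbhd Ω c.δU t) : DifferentiableAt ℝ (fun y => D.φ y t) x := by
  have h1 := ((hA.φ_C2.differentiableOn (by simp)) (x, t) ⟨ht, hx⟩).comp
    (f := fun y : Space d => (y, t)) (s := D.nbhd Ω c.δU t) x (by fun_prop) (fun y hy => ⟨ht, hy⟩)
  exact h1.differentiableAt ((hA.isOpen_nbhd hΩ).mem_nhds hx)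

theorem norm_fderiv_φ_le {t : ℝ} (ht : t ∈ D.I) {x : Space d}
    (hx : x ∈ D.nbhd Ω c.δU t) : ‖fderiv ℝ (fun y => D.φ y t) x‖ ≤ c.Cφ := by
  have := (hA.φ_bounds t ht x hx).2.1
  rwa [Slab.G, gradient, LinearIsometryEquiv.norm_map] at this

theorem abs_φ_sub_le (hΩ : IsOpen Ω) {s : Finset (Space d)} (hs : s ∈ D.cellsU Ω c.δU) {t : ℝ}
    (ht : t ∈ D.I) {x y : Space d} (hx : x ∈ cell s) (hy : y ∈ cell s) :
    |D.φ x t - D.φ y t| ≤ c.Cφ * D.h := by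
  have h1 := Convex.norm_image_sub_le_of_norm_fderiv_le (𝕜 := ℝ) (f := fun y => D.φ y t)
    (fun z hz => hA.differentiableAt_φ hΩ ht (hs.2 t ht hz))
    (fun z hz => hA.norm_fderiv_φ_le ht (hs.2 t ht hz)) (convex_cell s) hy hx
  have h0 : 0 ≤ c.Cφ := (norm_nonneg _).trans (hA.norm_fderiv_φ_le ht (hs.2 t ht hx))
  refine h1.trans (mul_le_mul_of_nonneg_left ?_ h0)
  rw [← dist_eq_norm]
  exact (dist_le_diam_cell hx hy).trans (hA.mesh.diam_le_meshSize hs.1)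

theorem φlin_eq {s : Finset (Space d)} (hs : s ∈ D.K.facets) {x : Space d} (hx : x ∈ cell s)
    (t : ℝ) : D.φlin x t = ∑ v ∈ s, bary s x v * D.φh v t :=
  hA.mesh.nodalInterp_eq hs hx _

/-- A crude O(h) estimate from the gradient bound on the element alone. It serves to locate the cut
elements, before any smoothness around them is available. -/
theorem abs_φlin_sub_le (hΩ : IsOpen Ω) (hℓ : qt + 2 ≤ ℓ) {s : Finset (Space d)}
    (hs : s ∈ D.cellsU Ω c.δU) {t : ℝ} (ht : t ∈ D.I) {x : Space d} (hx : x ∈ cell s) :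
    |D.φlin x t - D.φ x t| ≤ c.Cφ * D.h + c.Cap * (D.h ^ (qs + 1) + D.τ ^ (qt + 1)) := by
  have hS := hA.mesh.isSimplex hs.1
  rw [hA.φlin_eq hs.1 hx]
  have : ∑ v ∈ s, bary s x v * D.φh v t - D.φ x t =
      ∑ v ∈ s, bary s x v * (D.φh v t - D.φ x t) := by
    simp only [mul_sub, Finset.sum_sub_distrib]
    rw [← Finset.sum_mul, hS.sum_bary, one_mul]
  rw [this]
  set B := c.Cφ * D.h + c.Cap * (D.h ^ (qs + 1) + D.τ ^ (qt + 1)) with hB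
  have hv : ∀ v ∈ s, |bary s x v * (D.φh v t - D.φ x t)| ≤ bary s x v * B := by
    intro v hv
    have hvc := mem_cell_of_vertex hv
    rw [abs_mul, abs_of_nonneg (bary_nonneg hS.1 hx v)]
    refine mul_le_mul_of_nonneg_left ?_ (bary_nonneg hS.1 hx v)
    have e1 := hA.error_le hs hℓ (k := 0) (by omega) hvc ht
    simp only [iteratedDerivWithin_zero, Nat.sub_zero] at e1
    have e2 := hA.abs_φ_sub_le hΩ hs ht hvc hx
    calc |D.φh v t - D.φ x t| = |(D.φ v t - D.φ x t) - (D.φ v t - D.φh v t)| := by ring_nf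
      _ ≤ _ := (abs_sub _ _).trans (add_le_add e2 e1)
  refine (Finset.abs_sum_le_sum_abs _ _).trans ((Finset.sum_le_sum hv).trans ?_)
  rw [← Finset.sum_mul, hS.sum_bary, one_mul]

theorem abs_φ_time_le (hℓ : 1 ≤ ℓ) {s : Finset (Space d)} (hs : s ∈ D.cellsU Ω c.δU)
    {t t' : ℝ} (ht : t ∈ D.I) (ht' : t' ∈ D.I) {x : Space d} (hx : x ∈ cell s) :
    |D.φ x t' - D.φ x t| ≤ c.C₂ * D.τ := by
  have h1 := Convex.norm_image_sub_le_of_norm_derivWithin_le (f := D.φ x) (s := D.I) (C := c.C₂)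
    ((contDiffOn_time (hA.φ_cell hs) hx).differentiableOn (by norm_cast; omega))
    (fun u hu => (hA.φ_bounds u hu x (hs.2 u hu hx)).2.2.1) D.convex_I ht ht'
  have h0 : 0 ≤ c.C₂ := (abs_nonneg _).trans (hA.φ_bounds t ht x (hs.2 t ht hx)).2.2.1
  refine h1.trans (mul_le_mul_of_nonneg_left ?_ h0)
  rw [Real.norm_eq_abs, abs_le]
  exact ⟨by linarith [ht.1, ht.2, ht'.1, ht'.2], by linarith [ht.1, ht.2, ht'.1, ht'.2]⟩

theorem φlin_eq_zero (hΩ : IsOpen Ω) {t : ℝ} {z : Space d} (hzΩ : z ∈ Ω)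
    (hz : z ∈ frontier (D.domLin Ω t)) : D.φlin z t = 0 := by
  have hc : ContinuousOn (fun y => D.φlin y t) Ω :=
    (hA.mesh.continuousOn_nodalInterp fun y => D.φh y t).mono subset_closure
  have o1 : IsOpen (D.domLin Ω t) := hc.isOpen_inter_preimage hΩ isOpen_Iio
  have o2 : IsOpen (Ω ∩ (fun y => D.φlin y t) ⁻¹' Set.Ioi 0) :=
    hc.isOpen_inter_preimage hΩ isOpen_Ioi
  rw [o1.frontier_eq] at hz
  refine le_antisymm ?_ ?_
  · by_contra h
    obtain ⟨y, hy1, hy2⟩ := mem_closure_iff.1 hz.1 _ o2 ⟨hzΩ, not_le.1 h⟩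
    exact lt_asymm hy1.2 hy2.2
  · by_contra h
    exact hz.2 ⟨hzΩ, not_le.1 h⟩

end UnfittedSpaceTime.Admissible

end Neighbourhoods

/-! ### Location of the active elements. -/

section ActiveCells

variable {d : ℕ} {Ω : Set (Space d)} {qs qt ℓ m : ℕ}

/-- Points close to the discrete interface are close to the interface. -/
theorem exists_frontier_near_cut (hΩ : IsOpen Ω) (hqs : 1 ≤ qs) (hqt : 1 ≤ qt) (hℓ : qt + 2 ≤ ℓ)
    (c : Consts) : ∃ M ρ : ℝ, 0 ≤ M ∧ 0 < ρ ∧ ∀ D : Slab d, Admissible Ω qs qt ℓ m c D →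
      D.cutCells Ω ⊆ D.cellsU Ω c.δU → D.h + D.τ ≤ ρ →
      ∀ t ∈ D.I, ∀ z ∈ frontier (D.domLin Ω t), ∀ t' ∈ D.I,
        ∃ z' ∈ frontier (D.dom Ω t'), dist z z' ≤ M * (D.h + D.τ) := by
  -- At a point z of the discrete interface φlin vanishes, so |φ(z, t')| is at most the
  -- interpolation error plus the change of φ over the slab. The three constants collect these
  -- contributions, and dividing by cw turns them into a ray parameter.
  set M₁ := (|c.Cφ| + |c.Cap| + |c.C₂|) / c.cw with hM₁
  have hcw := c.cw_pos
  have hε := c.ε₀_pos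
  have hM₁0 : 0 ≤ M₁ := by positivity
  refine ⟨M₁ * |c.Cφ|, min 1 (c.ε₀ / (2 * (M₁ + 1))), by positivity,
    lt_min one_pos (by positivity), ?_⟩
  intro D hA hcut hρ t ht z hz t' ht'
  have hh := hA.h_pos
  have hτ := hA.τ_pos
  have h1 : D.h + D.τ ≤ 1 := hρ.trans (min_le_left _ _)
  have h2 : D.h + D.τ ≤ c.ε₀ / (2 * (M₁ + 1)) := hρ.trans (min_le_right _ _)
  have hzcl : z ∈ closure Ω := closure_mono (fun x hx => hx.1) (frontier_subset_closure hz)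
  obtain ⟨s, hs, hzs⟩ := hA.mesh.exists_facet hzcl
  have hsU : s ∈ D.cellsU Ω c.δU := hcut ⟨hs, t, ht, z, hz, hzs⟩
  have e0 := hA.φlin_eq_zero hΩ (hA.cell_subset_Ω hsU hzs) hz
  have e1 := hA.abs_φlin_sub_le hΩ hℓ hsU ht hzs
  rw [e0, zero_sub, abs_neg] at e1
  have e2 := hA.abs_φ_time_le (by omega) hsU ht ht' hzs
  have p1 : D.h ^ (qs + 1) ≤ D.h := pow_le_of_le_one hh.le (by linarith) (by omega)
  have p2 : D.τ ^ (qt + 1) ≤ D.τ := pow_le_of_le_one hτ.le (by linarith) (by omega)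
  have e3 : |D.φ z t'| ≤ c.cw * (M₁ * (D.h + D.τ)) := by
    have : c.cw * (M₁ * (D.h + D.τ)) = (|c.Cφ| + |c.Cap| + |c.C₂|) * (D.h + D.τ) := by
      rw [hM₁]; field_simp
    rw [this]
    have q1 : c.Cφ * D.h ≤ |c.Cφ| * (D.h + D.τ) :=
      mul_le_mul (le_abs_self _) (by linarith) hh.le (abs_nonneg _)
    have q2 : c.Cap * (D.h ^ (qs + 1) + D.τ ^ (qt + 1)) ≤ |c.Cap| * (D.h + D.τ) :=
      mul_le_mul (le_abs_self _) (by linarith) (by positivity) (abs_nonneg _)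
    have q3 : c.C₂ * D.τ ≤ |c.C₂| * (D.h + D.τ) :=
      mul_le_mul (le_abs_self _) (by linarith) hτ.le (abs_nonneg _)
    have : |D.φ z t'| ≤ |D.φ z t| + |D.φ z t' - D.φ z t| := by
      have := abs_add_le (D.φ z t) (D.φ z t' - D.φ z t)
      rwa [add_sub_cancel] at this
    linarith
  have hlt : M₁ * (D.h + D.τ) < c.ε₀ := by
    have : (D.h + D.τ) * (2 * (M₁ + 1)) ≤ c.ε₀ := (le_div_iff₀ (by positivity)).1 h2
    nlinarith
  obtain ⟨z', hz', hd⟩ := hA.exists_frontier_near ht' (hsU.2 t' ht' hzs) (by positivity) hlt e3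
  refine ⟨z', hz', hd.trans ?_⟩
  have : M₁ * (D.h + D.τ) * c.Cφ ≤ M₁ * (D.h + D.τ) * |c.Cφ| :=
    mul_le_mul_of_nonneg_left (le_abs_self _) (by positivity)
  linarith

/-- A neighbourhood of every element near the discrete interface is covered by elements in `U`. -/
theorem ball_subset_region_cellsU (hΩ : IsOpen Ω) (hqs : 1 ≤ qs) (hqt : 1 ≤ qt)
    (hℓ : qt + 2 ≤ ℓ) (c : Consts) {wb : ℝ} (hwb : wb < min c.δΩ c.δU) :
    ∃ ρ : ℝ, 0 < ρ ∧ ∀ D : Slab d, Admissible Ω qs qt ℓ m c D →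
      D.cutCells Ω ⊆ D.cellsU Ω c.δU → D.h + D.τ ≤ ρ →
      ∀ s ∈ D.K.facets, (∃ t ∈ D.I, ∃ x ∈ cell s, ∃ z ∈ frontier (D.domLin Ω t),
        dist x z < wb + D.h) → ∀ x ∈ cell s,
        Metric.ball x (2 * D.h) ⊆ interior (region (D.cellsU Ω c.δU)) := by
  obtain ⟨M, ρ, hM, hρ, H⟩ := exists_frontier_near_cut (m := m) hΩ hqs hqt hℓ c
  set g := min c.δΩ c.δU - wb with hg
  have hg0 : 0 < g := sub_pos.2 hwb
  -- The slack g has to absorb 4h from y to x, h from x to x₀, h from x₀ to z beyond wb, and M (h +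
  -- τ) from z to the interface at another time: in total less than (M + 6)(h + τ), with a factor 2
  -- in reserve.
  refine ⟨min ρ (g / (2 * (M + 6))), lt_min hρ (by positivity), ?_⟩
  intro D hA hcut hρ' s hs ⟨t, ht, x₀, hx₀, z, hz, hxz⟩ x hx
  have hh := hA.h_pos
  have hτ := hA.τ_pos
  have h2 : (D.h + D.τ) * (2 * (M + 6)) ≤ g :=
    (le_div_iff₀ (by positivity)).1 (hρ'.trans (min_le_right _ _))
  -- The radius 4h contains every element through a point at distance less than 3h from x.
  have key : ∀ y, dist y x < 4 * D.h → ∀ t' ∈ D.I, y ∈ D.nbhd Ω c.δU t' := by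
    intro y hy t' ht'
    obtain ⟨z', hz', hd⟩ := H D hA hcut (hρ'.trans (min_le_left _ _)) t ht z hz t' ht'
    refine hA.mem_nbhd_of_dist hΩ ht' hz' ?_
    have d1 : dist x x₀ ≤ D.h := (dist_le_diam_cell hx hx₀).trans (hA.mesh.diam_le_meshSize hs)
    have d2 := dist_triangle4 y x x₀ z'
    have d3 := dist_triangle x₀ z z'
    nlinarith
  have key2 : ∀ y, dist y x < 3 * D.h → y ∈ region (D.cellsU Ω c.δU) := by
    intro y hy
    have hyΩ : y ∈ Ω := (key y (by linarith) t ht).1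
    obtain ⟨s', hs', hys'⟩ := hA.mesh.exists_facet (subset_closure hyΩ)
    refine mem_region.2 ⟨s', ⟨hs', fun t' ht' y' hy' => key y' ?_ t' ht'⟩, hys'⟩
    have d1 : dist y' y ≤ D.h := (dist_le_diam_cell hy' hys').trans (hA.mesh.diam_le_meshSize hs')
    have := dist_triangle y' y x
    linarith
  refine interior_maximal (fun y hy => key2 y ?_) Metric.isOpen_ball
  have := Metric.mem_ball.1 hy
  linarith

end ActiveCells

/-! ### Mean value and Taylor estimates at fixed time. -/

section SliceEstimates

variable {ι : Type*} {X F : Type} [NormedAddCommGroup X] [NormedSpace ℝ X]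
  [NormedAddCommGroup F] [NormedSpace ℝ F] {N : ι → Set X} {I : ι → Set ℝ}

/-- The Lipschitz bound is stated on convex subsets because the sets to which it is applied, such as
the interior of a union of elements, need not be convex. -/
theorem U1.lipschitz_slice (hN : ∀ i, IsOpen (N i)) (hI : ∀ i, UniqueDiffOn ℝ (I i))
    {f : ι → X → ℝ → F} (hf : U1 1 (fun i => N i ×ˢ I i) (fun i => Function.uncurry (f i))) :
    ∃ C, 0 ≤ C ∧ ∀ i, ∀ t ∈ I i, (∀ x ∈ N i, DifferentiableAt ℝ (fun y => f i y t) x) ∧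
      (∀ x ∈ N i, ‖fderiv ℝ (fun y => f i y t) x‖ ≤ C) ∧
      ∀ S ⊆ N i, Convex ℝ S → ∀ x ∈ S, ∀ y ∈ S, ‖f i y t - f i x t‖ ≤ C * ‖y - x‖ := by
  have h1 := U1.slice (fun i => (hN i).uniqueDiffOn) hI hf
  obtain ⟨h1, C, hC, h2⟩ := u1_iff.1 h1
  have hd : ∀ i, ∀ t ∈ I i, ∀ x ∈ N i, DifferentiableAt ℝ (fun y => f i y t) x := fun i t ht x hx =>
    ((h1 ⟨i, t, ht⟩).differentiableOn (by simp)).differentiableAt ((hN i).mem_nhds hx)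
  have hb : ∀ i, ∀ t ∈ I i, ∀ x ∈ N i, ‖fderiv ℝ (fun y => f i y t) x‖ ≤ C := fun i t ht x hx => by
    have := h2 ⟨i, t, ht⟩ 1 le_rfl x hx
    rwa [iteratedFDerivWithin_of_isOpen 1 (hN i) hx, norm_iteratedFDeriv_one] at this
  refine ⟨C, hC, fun i t ht => ⟨hd i t ht, hb i t ht, fun S hS hcx x hx y hy => ?_⟩⟩
  exact hcx.norm_image_sub_le_of_norm_fderiv_le (𝕜 := ℝ) (fun z hz => hd i t ht z (hS hz))
    (fun z hz => hb i t ht z (hS hz)) hx hy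

theorem U1.taylor_slice (hN : ∀ i, IsOpen (N i)) (hI : ∀ i, UniqueDiffOn ℝ (I i))
    {f : ι → X → ℝ → F} (hf : U1 2 (fun i => N i ×ˢ I i) (fun i => Function.uncurry (f i))) :
    ∃ C, 0 ≤ C ∧ ∀ i, ∀ t ∈ I i, ∀ S ⊆ N i, Convex ℝ S → ∀ x ∈ S, ∀ y ∈ S,
      ‖fderiv ℝ (fun z => f i z t) y - fderiv ℝ (fun z => f i z t) x‖ ≤ C * ‖y - x‖ ∧
      ‖f i y t - f i x t - fderiv ℝ (fun z => f i z t) x (y - x)‖ ≤ C * ‖y - x‖ ^ 2 := by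
  have h1 := U1.slice (fun i => (hN i).uniqueDiffOn) hI hf
  have h2 := (U1.fderivWithin (n := 1) h1 fun p => (hN p.1).uniqueDiffOn)
  obtain ⟨h2, C, hC, h3⟩ := u1_iff.1 h2
  have hd : ∀ i, ∀ t ∈ I i, ∀ x ∈ N i, DifferentiableAt ℝ (fun y => f i y t) x := fun i t ht x hx =>
    ((h1.1 ⟨i, t, ht⟩).differentiableOn (by simp)).differentiableAt ((hN i).mem_nhds hx)
  have key : ∀ i, ∀ t ∈ I i, ∀ S ⊆ N i, Convex ℝ S → ∀ x ∈ S, ∀ y ∈ S,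
      ‖fderiv ℝ (fun z => f i z t) y - fderiv ℝ (fun z => f i z t) x‖ ≤ C * ‖y - x‖ := by
    intro i t ht S hS hcx x hx y hy
    have hd2 : ∀ z ∈ N i, DifferentiableAt ℝ (_root_.fderivWithin ℝ (fun z => f i z t) (N i)) z :=
      fun z hz => ((h2 ⟨i, t, ht⟩).differentiableOn (by simp)).differentiableAt ((hN i).mem_nhds hz)
    have hb : ∀ z ∈ N i, ‖fderiv ℝ (_root_.fderivWithin ℝ (fun z => f i z t) (N i)) z‖ ≤ C :=
      fun z hz => by
        have := h3 ⟨i, t, ht⟩ 1 le_rfl z hz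
        rwa [iteratedFDerivWithin_of_isOpen 1 (hN i) hz, norm_iteratedFDeriv_one] at this
    have := hcx.norm_image_sub_le_of_norm_fderiv_le (𝕜 := ℝ) (fun z hz => hd2 z (hS hz))
      (fun z hz => hb z (hS hz)) hx hy
    rwa [_root_.fderivWithin_of_isOpen (hN i) (hS hy), _root_.fderivWithin_of_isOpen (hN i) (hS hx)] at this
  refine ⟨C, hC, fun i t ht S hS hcx x hx y hy => ⟨key i t ht S hS hcx x hx y hy, ?_⟩⟩
  have hseg : segment ℝ x y ⊆ S := hcx.segment_subset hx hy
  have := (convex_segment x y).norm_image_sub_le_of_norm_fderiv_le' (𝕜 := ℝ)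
    (f := fun z => f i z t) (C := C * ‖y - x‖) (φ := fderiv ℝ (fun z => f i z t) x)
    (fun z hz => hd i t ht z (hS (hseg hz))) (fun z hz => ?_) (left_mem_segment ℝ x y)
    (right_mem_segment ℝ x y)
  · rw [sq, ← mul_assoc]; exact this
  · refine (key i t ht S hS hcx x hx z (hseg hz)).trans (mul_le_mul_of_nonneg_left ?_ hC)
    obtain ⟨a, b, ha, hb, hab, rfl⟩ := hz
    have : a • x + b • y - x = b • (y - x) := by
      rw [show a = 1 - b by linarith]; module
    rw [this, norm_smul, Real.norm_of_nonneg hb]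
    exact mul_le_of_le_one_left (norm_nonneg _) (by linarith)

end SliceEstimates

/-! ### The local problem on one active element. -/

section LocalProblem

variable {d : ℕ}

/-- The data of the ideal mapping on one active element `s`, with a blending function `b`. -/
structure LocalProblem (Ω : Set (Space d)) (qs qt ℓ m : ℕ) (c : Consts) (Cb Cv : ℝ) where
  D : Slab d
  b : Space d → ℝ → ℝ
  s : Finset (Space d)
  adm : Admissible Ω qs qt ℓ m c D
  h_le : D.h ≤ 1
  τ_le : D.τ ≤ 1
  mem : s ∈ D.cellsU Ω c.δU
  ball : ∀ x ∈ cell s, Metric.ball x (2 * D.h) ⊆ interior (region (D.cellsU Ω c.δU))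
  b_range : ∀ x ∈ Ω, ∀ t ∈ D.I, b x t ∈ Set.Icc (0 : ℝ) 1
  b_smooth : ContDiffOn ℝ ℓ (Function.uncurry b) (Ω ×ˢ D.I)
  b_bound : ∀ k ≤ ℓ, ∀ p ∈ Ω ×ˢ D.I,
    ‖iteratedFDerivWithin ℝ k (Function.uncurry b) (Ω ×ˢ D.I) p‖ ≤ Cb
  vertex : ∀ k ≤ qt, ∀ t ∈ D.I, ∀ u ∈ s, ∀ v ∈ s,
    |(iteratedDerivWithin k (D.φ u) D.I t - iteratedDerivWithin k (D.φh u) D.I t) -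
      (iteratedDerivWithin k (D.φ v) D.I t - iteratedDerivWithin k (D.φh v) D.I t)| ≤
      Cv * Metric.diam (cell s)

namespace LocalProblem

variable {Ω : Set (Space d)} {qs qt ℓ m : ℕ} {c : Consts} {Cb Cv : ℝ}

variable (P : LocalProblem Ω qs qt ℓ m c Cb Cv)

/-- The diameter of the element. -/
noncomputable def μ : ℝ := Metric.diam (cell P.s)

/-- A neighbourhood of the element. -/
def N : Set (Space d) := Metric.thickening P.μ (cell P.s)

/-- The interior of the region where the level set function is smooth. -/
def W : Set (Space d) := interior (region (P.D.cellsU Ω c.δU))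

/-- The affine extension of the linear interpolant from the element. -/
noncomputable def lin (x : Space d) (t : ℝ) : ℝ := ∑ v ∈ P.s, bary P.s x v * P.D.φh v t

/-- The interpolation error. -/
noncomputable def err (x : Space d) (t : ℝ) : ℝ := P.lin x t - P.D.φ x t

theorem facet : P.s ∈ P.D.K.facets := P.mem.1

theorem simplex : IsSimplex P.s := P.adm.mesh.isSimplex P.facet

theorem μ_pos : 0 < P.μ := P.simplex.diam_pos P.adm.dim_ne_zero

theorem μ_le : P.μ ≤ P.D.h := P.adm.mesh.diam_le_meshSize P.facet

theorem isOpen_N : IsOpen P.N := Metric.isOpen_thickening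

theorem convex_N : Convex ℝ P.N := (convex_cell _).thickening _

theorem isOpen_W : IsOpen P.W := isOpen_interior

theorem cell_subset_N : cell P.s ⊆ P.N := Metric.self_subset_thickening P.μ_pos _

theorem hI : UniqueDiffOn ℝ P.D.I := P.D.uniqueDiffOn_I

/-- A point of N is within diam ≤ h of the element. The balls of radius 2h in the structure leave
the room h for the displacement. -/
theorem ball_subset_W {x : Space d} (hx : x ∈ P.N) : Metric.ball x P.D.h ⊆ P.W := by
  obtain ⟨z, hz, hd⟩ := Metric.mem_thickening_iff.1 hx
  refine (Metric.ball_subset_ball' ?_).trans (P.ball z hz)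
  have := P.μ_le
  linarith

theorem N_subset_W : P.N ⊆ P.W := fun _ hx =>
  P.ball_subset_W hx (Metric.mem_ball_self P.adm.h_pos)

theorem W_subset_region : P.W ⊆ region (P.D.cellsU Ω c.δU) := interior_subset

theorem W_subset_Ω : P.W ⊆ Ω := P.W_subset_region.trans P.adm.region_subset_Ω

theorem W_subset_nbhd {t : ℝ} (ht : t ∈ P.D.I) : P.W ⊆ P.D.nbhd Ω c.δU t := by
  intro x hx
  obtain ⟨s, hs, hxs⟩ := mem_region.1 (P.W_subset_region hx)
  exact hs.2 t ht hxs

theorem dist_vertex_le {x : Space d} (hx : x ∈ P.N) {v : Space d} (hv : v ∈ P.s) :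
    ‖v - x‖ ≤ 2 * P.μ := by
  obtain ⟨z, hz, hd⟩ := Metric.mem_thickening_iff.1 hx
  rw [← dist_eq_norm]
  have h1 := dist_le_diam_cell (mem_cell_of_vertex hv) hz
  have h2 := dist_triangle v z x
  rw [dist_comm z x] at h2
  have : Metric.diam (cell P.s) = P.μ := rfl
  linarith

theorem norm_baryLin_le (v : Space d) : ‖baryLin P.s v‖ ≤ 2 * c.σ / P.μ :=
  P.adm.norm_baryLin_le P.facet v

theorem abs_bary_le {x : Space d} (hx : x ∈ P.N) (v : Space d) :
    |bary P.s x v| ≤ 1 + 2 * c.σ := by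
  obtain ⟨z, hz, hd⟩ := Metric.mem_thickening_iff.1 hx
  rw [P.simplex.bary_eq_baryLin x z v]
  refine (abs_add_le _ _).trans (add_le_add ?_ ?_)
  · rw [abs_of_nonneg (bary_nonneg P.simplex.1 hz v)]
    exact P.simplex.bary_le_one hz v
  · refine ((baryLin P.s v).le_opNorm _).trans ?_
    refine (mul_le_mul (P.norm_baryLin_le v) (by rw [← dist_eq_norm]; exact hd.le : ‖x - z‖ ≤ P.μ)
      (norm_nonneg _) (div_nonneg (by have := c.σ_pos; positivity) P.μ_pos.le)).trans (le_of_eq ?_)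
    have := P.μ_pos.ne'
    field_simp

theorem lin_eq {x : Space d} (hx : x ∈ cell P.s) (t : ℝ) : P.D.φlin x t = P.lin x t :=
  P.adm.φlin_eq P.facet hx t

end LocalProblem

section Families

variable {Ω : Set (Space d)} {qs qt ℓ m : ℕ} {c : Consts} {Cb Cv : ℝ}

local notation "LP" => LocalProblem Ω qs qt ℓ m c Cb Cv

theorem uniqueDiffOn_N_prod (P : LP) : UniqueDiffOn ℝ (P.N ×ˢ P.D.I) :=
  P.isOpen_N.uniqueDiffOn.prod P.hI

theorem uniqueDiffOn_W_prod (P : LP) : UniqueDiffOn ℝ (P.W ×ˢ P.D.I) :=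
  P.isOpen_W.uniqueDiffOn.prod P.hI

/-- Smoothness is assumed within a union of closed elements. At points of the open set W this union
and W coincide locally, so the derivatives within the two sets agree. -/
theorem u1_restrict_W {F : Type} [NormedAddCommGroup F] [NormedSpace ℝ F] {n : ℕ} {C : ℝ}
    {f : LP → Space d × ℝ → F}
    (h1 : ∀ P : LP, ContDiffOn ℝ n (f P) (region (P.D.cellsU Ω c.δU) ×ˢ P.D.I))
    (h2 : ∀ P : LP, ∀ k ≤ n, ∀ p ∈ region (P.D.cellsU Ω c.δU) ×ˢ P.D.I,
      ‖iteratedFDerivWithin ℝ k (f P) (region (P.D.cellsU Ω c.δU) ×ˢ P.D.I) p‖ ≤ C) :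
    U1 n (fun P : LP => P.W ×ˢ P.D.I) f := by
  refine u1_iff.2 ⟨fun P => (h1 P).mono (Set.prod_mono P.W_subset_region subset_rfl), |C|,
    abs_nonneg _, ?_⟩
  rintro P k hk ⟨x, t⟩ ⟨hx, ht⟩
  have : P.W ×ˢ P.D.I =ᶠ[nhds (x, t)] region (P.D.cellsU Ω c.δU) ×ˢ P.D.I := by
    filter_upwards [(P.isOpen_W.prod isOpen_univ).mem_nhds
      (show (x, t) ∈ P.W ×ˢ Set.univ from ⟨hx, trivial⟩)] with p hp
    exact propext ⟨fun h => ⟨P.W_subset_region h.1, h.2⟩, fun h => ⟨hp.1, h.2⟩⟩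
  rw [iteratedFDerivWithin_congr_set this]
  exact (h2 P k hk _ ⟨P.W_subset_region hx, ht⟩).trans (le_abs_self _)

theorem u1_φ : U1 ℓ (fun P : LP => P.W ×ˢ P.D.I) (fun P => Function.uncurry P.D.φ) :=
  u1_restrict_W (fun P => P.adm.φ_smooth) (fun P => P.adm.φ_smooth_bound)

theorem u1_G : U1 m (fun P : LP => P.W ×ˢ P.D.I) (fun P => Function.uncurry P.D.G) :=
  u1_restrict_W (fun P => P.adm.G_smooth) (fun P => P.adm.G_smooth_bound)

theorem UB.restrict_N {F : Type} [NormedAddCommGroup F] [NormedSpace ℝ F] {n : ℕ}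
    {f : LP → Space d × ℝ → F} (h : U1 n (fun P : LP => P.W ×ˢ P.D.I) f) :
    U1 n (fun P : LP => P.N ×ˢ P.D.I) f :=
  UB.mono_set h uniqueDiffOn_W_prod uniqueDiffOn_N_prod
    fun P => Set.prod_mono P.N_subset_W subset_rfl

theorem u1_b (hΩ : IsOpen Ω) :
    U1 ℓ (fun P : LP => P.N ×ˢ P.D.I) (fun P => Function.uncurry P.b) := by
  have h1 : U1 ℓ (fun P : LP => Ω ×ˢ P.D.I) (fun P => Function.uncurry P.b) :=
    u1_iff.2 ⟨fun P => P.b_smooth, |Cb|, abs_nonneg _, fun P k hk p hp =>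
      (P.b_bound k hk p hp).trans (le_abs_self _)⟩
  exact UB.mono_set h1 (fun P => hΩ.uniqueDiffOn.prod P.hI) uniqueDiffOn_N_prod
    fun P => Set.prod_mono (P.N_subset_W.trans P.W_subset_Ω) subset_rfl

theorem u1_timeDeriv_φ {n k : ℕ} (hk : n + k ≤ ℓ) : U1 n (fun P : LP => P.N ×ˢ P.D.I)
    (fun P => Function.uncurry fun x t => iteratedDerivWithin k (P.D.φ x) P.D.I t) :=
  UB.iterTimeDeriv k (fun P => P.isOpen_N.uniqueDiffOn) (fun P => P.hI)
    ((UB.restrict_N u1_φ).of_le hk)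

/-- Second order remainder of the time derivatives of `φ` at the vertices. -/
theorem exists_remainder_bound {k : ℕ} (hk : 2 + k ≤ ℓ) : ∃ C, 0 ≤ C ∧ ∀ P : LP, ∀ t ∈ P.D.I,
    ∀ x ∈ P.N, ∀ v ∈ P.s,
      |iteratedDerivWithin k (P.D.φ v) P.D.I t - iteratedDerivWithin k (P.D.φ x) P.D.I t -
        fderiv ℝ (fun y => iteratedDerivWithin k (P.D.φ y) P.D.I t) x (v - x)| ≤ C * P.μ ^ 2 := by
  obtain ⟨C, hC, h⟩ := U1.taylor_slice (fun P : LP => P.isOpen_N) (fun P => P.hI) (u1_timeDeriv_φ hk)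
  refine ⟨C * 4, by positivity, fun P t ht x hx v hv => ?_⟩
  have h1 := (h P t ht P.N subset_rfl P.convex_N x hx v
    (P.cell_subset_N (mem_cell_of_vertex hv))).2
  refine h1.trans ?_
  rw [mul_assoc]
  refine mul_le_mul_of_nonneg_left ?_ hC
  have := P.dist_vertex_le hx hv
  nlinarith [norm_nonneg (v - x)]

theorem exists_lipschitz_bound {k : ℕ} (hk : 1 + k ≤ ℓ) : ∃ C, 0 ≤ C ∧ ∀ P : LP, ∀ t ∈ P.D.I,
    ∀ x ∈ P.N, ∀ v ∈ P.s,
      |iteratedDerivWithin k (P.D.φ v) P.D.I t - iteratedDerivWithin k (P.D.φ x) P.D.I t| ≤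
        C * P.μ := by
  obtain ⟨C, hC, h⟩ := U1.lipschitz_slice (fun P : LP => P.isOpen_N) (fun P => P.hI)
    (u1_timeDeriv_φ hk)
  refine ⟨C * 2, by positivity, fun P t ht x hx v hv => ?_⟩
  refine ((h P t ht).2.2 P.N subset_rfl P.convex_N x hx v
    (P.cell_subset_N (mem_cell_of_vertex hv))).trans ?_
  rw [mul_assoc]
  exact mul_le_mul_of_nonneg_left (P.dist_vertex_le hx hv) hC

theorem contDiffOn_φh (P : LP) {v : Space d} (hv : v ∈ P.s) (k : ℕ) :
    ContDiffOn ℝ k (P.D.φh v) P.D.I := by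
  obtain ⟨w, -, hw⟩ := P.adm.φh_mem
  exact (iteratedDerivWithin_memV P.hI hw k (P.adm.subset_space (P.adm.mesh.cell_subset P.facet
    (mem_cell_of_vertex hv))) P.adm.end_mem).1

theorem iteratedDerivWithin_φh_eq_zero (P : LP) {v : Space d} (hv : v ∈ P.s) {k : ℕ}
    (hk : qt < k) {t : ℝ} (ht : t ∈ P.D.I) : iteratedDerivWithin k (P.D.φh v) P.D.I t = 0 := by
  obtain ⟨w, -, hw⟩ := P.adm.φh_mem
  rw [(iteratedDerivWithin_memV P.hI hw k (P.adm.subset_space (P.adm.mesh.cell_subset P.facet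
    (mem_cell_of_vertex hv))) ht).2]
  refine Finset.sum_eq_zero fun i _ => ?_
  rw [iteratedDerivWithin_pow ht P.hI, Nat.descFactorial_eq_zero_iff_lt.2 (by omega)]
  simp

theorem u1_of_iteratedDerivWithin {ι : Type*} {F : Type} [NormedAddCommGroup F] [NormedSpace ℝ F]
    {n : ℕ} {I : ι → Set ℝ} {f : ι → ℝ → F} (h1 : ∀ i, ContDiffOn ℝ n (f i) (I i)) {C : ℝ}
    (h2 : ∀ i, ∀ k ≤ n, ∀ t ∈ I i, ‖iteratedDerivWithin k (f i) (I i) t‖ ≤ C) : U1 n I f := by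
  refine u1_iff.2 ⟨h1, |C|, abs_nonneg _, fun i k hk t ht => ?_⟩
  rw [norm_iteratedFDerivWithin_eq_norm_iteratedDerivWithin]
  exact (h2 i k hk t ht).trans (le_abs_self _)

theorem u1_comp_snd {ι : Type*} {X F : Type} [NormedAddCommGroup X] [NormedSpace ℝ X]
    [NormedAddCommGroup F] [NormedSpace ℝ F] {n : ℕ} {N : ι → Set X} {I : ι → Set ℝ}
    (hN : ∀ i, UniqueDiffOn ℝ (N i)) (hI : ∀ i, UniqueDiffOn ℝ (I i)) {f : ι → ℝ → F}
    (h : U1 n I f) : U1 n (fun i => N i ×ˢ I i) (fun i p => f i p.2) := by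
  have h1 := D1.affine (n := n) (C := 1) (S := fun i => N i ×ˢ I i)
    (fun i => (hN i).prod (hI i)) (fun _ => ContinuousLinearMap.snd ℝ X ℝ) (fun _ => 0)
    (fun _ => ContinuousLinearMap.norm_snd_le ℝ X ℝ)
  exact (D1.comp (fun i => (hN i).prod (hI i)) hI h h1 (fun i p hp => by simpa using hp.2)).congr
    (by simp)

/-- Merges finitely many constants into one; the sum of their absolute values dominates each of
them. -/
theorem exists_bound_of_finite {p : ℕ → ℝ → Prop} (hmono : ∀ k C C', C ≤ C' → p k C → p k C')
    (n : ℕ) (h : ∀ k ≤ n, ∃ C, p k C) : ∃ C, 0 ≤ C ∧ ∀ k ≤ n, p k C := by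
  choose! f hf using h
  refine ⟨∑ k ∈ Finset.range (n + 1), |f k|, Finset.sum_nonneg fun _ _ => abs_nonneg _,
    fun k hk => hmono k _ _ ?_ (hf k hk)⟩
  exact (le_abs_self _).trans (Finset.single_le_sum (f := fun k => |f k|)
    (fun _ _ => abs_nonneg _) (Finset.mem_range.2 (by omega)))

/-- For k ≤ qt the field `vertex` transfers the Lipschitz bound for ∂_t^k φ to φh; for k > qt both
terms vanish, because φh is a polynomial of degree qt in time. Hence no restriction on k is needed.
-/
theorem exists_φh_diff_bound (hℓ : qt + 2 ≤ ℓ) : ∃ C, 0 ≤ C ∧ ∀ P : LP, ∀ k, ∀ t ∈ P.D.I,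
    ∀ u ∈ P.s, ∀ v ∈ P.s, |iteratedDerivWithin k (P.D.φh u) P.D.I t -
      iteratedDerivWithin k (P.D.φh v) P.D.I t| ≤ C * P.μ := by
  obtain ⟨C, hC, h⟩ := exists_bound_of_finite (p := fun k C => ∀ P : LP, ∀ t ∈ P.D.I,
    ∀ x ∈ P.N, ∀ v ∈ P.s,
      |iteratedDerivWithin k (P.D.φ v) P.D.I t - iteratedDerivWithin k (P.D.φ x) P.D.I t| ≤
        C * P.μ) (fun k C C' hCC h P t ht x hx v hv => (h P t ht x hx v hv).trans
          (mul_le_mul_of_nonneg_right hCC P.μ_pos.le)) qt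
    (fun k hk => (exists_lipschitz_bound (by omega)).imp fun C h => h.2)
  refine ⟨C + |Cv|, by positivity, fun P k t ht u hu v hv => ?_⟩
  rcases le_or_gt k qt with hk | hk
  · have h1 := h k hk P t ht v (P.cell_subset_N (mem_cell_of_vertex hv)) u hu
    have h2 := (P.vertex k hk t ht u hu v hv).trans
      (mul_le_mul_of_nonneg_right (le_abs_self Cv) P.μ_pos.le)
    rw [add_mul]
    calc _ = |(iteratedDerivWithin k (P.D.φ u) P.D.I t - iteratedDerivWithin k (P.D.φ v) P.D.I t) -
          ((iteratedDerivWithin k (P.D.φ u) P.D.I t - iteratedDerivWithin k (P.D.φh u) P.D.I t) -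
          (iteratedDerivWithin k (P.D.φ v) P.D.I t - iteratedDerivWithin k (P.D.φh v) P.D.I t))| := by
            congr 1; ring
      _ ≤ _ := (abs_sub _ _).trans (add_le_add h1 h2)
  · rw [iteratedDerivWithin_φh_eq_zero P hu hk ht, iteratedDerivWithin_φh_eq_zero P hv hk ht]
    have := P.μ_pos
    simp only [sub_self, abs_zero]
    positivity

theorem exists_φh_bound (hℓ : qt + 2 ≤ ℓ) : ∃ C, 0 ≤ C ∧ ∀ P : LP, ∀ k, ∀ t ∈ P.D.I,
    ∀ u ∈ P.s, |iteratedDerivWithin k (P.D.φh u) P.D.I t| ≤ C := by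
  obtain ⟨C, hC, h⟩ := exists_bound_of_finite (p := fun k C => ∀ P : LP, ∀ t ∈ P.D.I,
    ∀ x ∈ P.N, |iteratedDerivWithin k (P.D.φ x) P.D.I t| ≤ C)
    (fun k C C' hCC h P t ht x hx => (h P t ht x hx).trans hCC) qt
    (fun k hk => by
      obtain ⟨C, -, h⟩ := UB.bound (u1_timeDeriv_φ (Ω := Ω) (qs := qs) (qt := qt) (m := m) (c := c)
        (Cb := Cb) (Cv := Cv) (n := 0) (k := k) (ℓ := ℓ) (by omega))
      exact ⟨C, fun P t ht x hx => by simpa using h P (x, t) ⟨hx, ht⟩⟩)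
  refine ⟨C + 2 * |c.Cap|, by positivity, fun P k t ht u hu => ?_⟩
  rcases le_or_gt k qt with hk | hk
  · have h1 := h k hk P t ht u (P.cell_subset_N (mem_cell_of_vertex hu))
    have h2 := P.adm.error_le P.mem hℓ (k := k) (by omega) (mem_cell_of_vertex hu) ht
    have h3 : c.Cap * (P.D.h ^ (qs + 1) + P.D.τ ^ (qt + 1 - k)) ≤ 2 * |c.Cap| := by
      have p1 : P.D.h ^ (qs + 1) ≤ 1 := pow_le_one₀ P.adm.h_pos.le P.h_le
      have p2 : P.D.τ ^ (qt + 1 - k) ≤ 1 := pow_le_one₀ P.adm.τ_pos.le P.τ_le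
      have p3 := pow_pos P.adm.h_pos (qs + 1)
      have p4 := pow_pos P.adm.τ_pos (qt + 1 - k)
      rw [mul_comm 2]
      exact mul_le_mul (le_abs_self _) (by linarith) (by positivity) (abs_nonneg _)
    have := abs_sub_abs_le_abs_sub (iteratedDerivWithin k (P.D.φh u) P.D.I t)
      (iteratedDerivWithin k (P.D.φ u) P.D.I t)
    rw [abs_sub_comm] at this
    linarith
  · rw [iteratedDerivWithin_φh_eq_zero P hu hk ht, abs_zero]
    positivity

/-- The gradients of λ_v are only O(1/μ). Since Σ λ_v = 1, the interpolant equals φh(v₀) + Σ (μ λ_v)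
(μ⁻¹ (φh(v) − φh(v₀))), where the first factors have bounded gradients and the second ones bounded
time derivatives. -/
theorem u1_lin (hℓ : qt + 2 ≤ ℓ) (n : ℕ) :
    U1 n (fun P : LP => P.N ×ˢ P.D.I) (fun P => Function.uncurry P.lin) := by
  have v₀ : ∀ P : LP, ∃ v, v ∈ P.s := fun P => P.simplex.nonempty
  choose v₀ hv₀ using v₀
  obtain ⟨C₁, hC₁, h₁⟩ := exists_φh_diff_bound (Ω := Ω) (qs := qs) (m := m) (c := c) (Cb := Cb)
    (Cv := Cv) hℓ
  obtain ⟨C₂, hC₂, h₂⟩ := exists_φh_bound (Ω := Ω) (qs := qs) (m := m) (c := c) (Cb := Cb)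
    (Cv := Cv) hℓ
  have b1 : U1 n (fun P : LP => P.N ×ˢ P.D.I) (fun P p => P.D.φh (v₀ P) p.2) :=
    u1_comp_snd (fun P => P.isOpen_N.uniqueDiffOn) (fun P => P.hI)
      (u1_of_iteratedDerivWithin (fun P => contDiffOn_φh P (hv₀ P) n)
        (fun P k _ t ht => h₂ P k t ht _ (hv₀ P)))
  have b2 : U1 n (fun q : Σ P : LP, {v // v ∈ P.s} => q.1.N ×ˢ q.1.D.I)
      (fun q p => (q.1.μ)⁻¹ * (q.1.D.φh q.2 p.2 - q.1.D.φh (v₀ q.1) p.2)) := by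
    refine u1_comp_snd (fun q : Σ P : LP, {v // v ∈ P.s} => q.1.isOpen_N.uniqueDiffOn)
      (fun q => q.1.hI) (f := fun q t => (q.1.μ)⁻¹ * (q.1.D.φh q.2 t - q.1.D.φh (v₀ q.1) t)) ?_
    refine u1_of_iteratedDerivWithin (C := C₁) (fun q => ?_) (fun q k _ t ht => ?_)
    · exact contDiffOn_const.mul ((contDiffOn_φh q.1 q.2.2 n).sub (contDiffOn_φh q.1 (hv₀ q.1) n))
    · have e1 := contDiffOn_φh q.1 q.2.2 k
      have e2 := contDiffOn_φh q.1 (hv₀ q.1) k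
      have e3 := iteratedDerivWithin_sub ht q.1.hI (e1 t ht) (e2 t ht)
      rw [iteratedDerivWithin_const_mul ht q.1.hI _ ((e1.sub e2) t ht)]
      change ‖(q.1.μ)⁻¹ * iteratedDerivWithin k (q.1.D.φh q.2 - q.1.D.φh (v₀ q.1)) q.1.D.I t‖ ≤ _
      have hμ := q.1.μ_pos
      rw [e3, norm_mul, Real.norm_of_nonneg (by positivity), inv_mul_eq_div, div_le_iff₀ hμ]
      exact h₁ q.1 k t ht _ q.2.2 _ (hv₀ q.1)
  have b3 : U1 n (fun q : Σ P : LP, {v // v ∈ P.s} => q.1.N ×ˢ q.1.D.I)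
      (fun q p => q.1.μ * bary q.1.s p.1 q.2) := by
    have := D1.affine (n := n) (C := 2 * c.σ)
      (S := fun q : Σ P : LP, {v // v ∈ P.s} => q.1.N ×ˢ q.1.D.I)
      (fun q => uniqueDiffOn_N_prod q.1)
      (fun q => q.1.μ • (baryLin q.1.s q.2).comp (ContinuousLinearMap.fst ℝ (Space d) ℝ))
      (fun q => q.1.μ * bary q.1.s 0 q.2) (fun q => by
        have hμ := q.1.μ_pos
        have e1 : ‖(baryLin q.1.s q.2).comp (ContinuousLinearMap.fst ℝ (Space d) ℝ)‖ ≤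
            2 * c.σ / q.1.μ * 1 :=
          (ContinuousLinearMap.opNorm_comp_le _ _).trans (mul_le_mul (q.1.norm_baryLin_le _)
            (ContinuousLinearMap.norm_fst_le ℝ (Space d) ℝ) (norm_nonneg _)
            (div_nonneg (by have := c.σ_pos; positivity) hμ.le))
        rw [norm_smul, Real.norm_of_nonneg hμ.le]
        rw [mul_one, le_div_iff₀ hμ] at e1
        linarith)
    refine UB.congr (UD.toUB (by simp) (by simp) this (C' := 1 + 2 * c.σ) ?_) ?_
    · rintro q ⟨x, t⟩ ⟨hx, ht⟩
      have e : (q.1.μ • (baryLin q.1.s q.2).comp (ContinuousLinearMap.fst ℝ (Space d) ℝ)) (x, t) +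
          q.1.μ * bary q.1.s 0 q.2 = q.1.μ * bary q.1.s x q.2 := by
        rw [q.1.simplex.bary_eq_baryLin x 0]; simp; ring
      rw [e, norm_mul, Real.norm_of_nonneg q.1.μ_pos.le, mul_one]
      refine (mul_le_mul (q.1.μ_le.trans q.1.h_le) (q.1.abs_bary_le hx _) (abs_nonneg _)
        zero_le_one).trans (by rw [one_mul])
    · rintro q ⟨x, t⟩ -
      rw [q.1.simplex.bary_eq_baryLin x 0]; simp; ring
  have b4 := U1.mul (fun q : Σ P : LP, {v // v ∈ P.s} => uniqueDiffOn_N_prod q.1) b3 b2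
  have b5 := UB.sum (κ := fun _ _ => 1) (η := fun _ _ => 1) (S := fun P : LP => P.N ×ˢ P.D.I) uniqueDiffOn_N_prod (by simp) (by simp)
    (fun P : LP => P.s) (d + 1) (fun P => P.simplex.2.le)
    (fun P v p => P.μ * bary P.s p.1 v * ((P.μ)⁻¹ * (P.D.φh v p.2 - P.D.φh (v₀ P) p.2))) b4
  refine (b5.add uniqueDiffOn_N_prod b1).congr ?_
  rintro P ⟨x, t⟩ -
  have hμ := P.μ_pos.ne'
  have : ∀ v, P.μ * bary P.s x v * ((P.μ)⁻¹ * (P.D.φh v t - P.D.φh (v₀ P) t)) =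
      bary P.s x v * P.D.φh v t - bary P.s x v * P.D.φh (v₀ P) t := fun v => by
    field_simp
  simp only [this, Finset.sum_sub_distrib, Function.uncurry, LocalProblem.lin]
  rw [← Finset.sum_mul, P.simplex.sum_bary]
  ring

end Families

end LocalProblem

/-! ### The error of piecewise linear interpolation. -/

section ErrorBounds

variable {d : ℕ} {Ω : Set (Space d)} {qs qt ℓ m : ℕ} {c : Consts} {Cb Cv : ℝ}

local notation "LP" => LocalProblem Ω qs qt ℓ m c Cb Cv

theorem iteratedDerivWithin_lin (P : LP) (k : ℕ) (x : Space d) {t : ℝ} (ht : t ∈ P.D.I) :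
    iteratedDerivWithin k (P.lin x) P.D.I t =
      ∑ v ∈ P.s, bary P.s x v * iteratedDerivWithin k (P.D.φh v) P.D.I t := by
  have h1 : ∀ v ∈ P.s, ContDiffWithinAt ℝ k (fun u => bary P.s x v * P.D.φh v u) P.D.I t :=
    fun v hv => contDiffWithinAt_const.mul (contDiffOn_φh P hv k t ht)
  have h2 := iteratedDerivWithin_fun_sum ht P.hI h1
  refine h2.trans (Finset.sum_congr rfl fun v hv => ?_)
  exact iteratedDerivWithin_const_mul ht P.hI _ (contDiffOn_φh P hv k t ht)

theorem contDiffOn_lin (P : LP) (k : ℕ) (x : Space d) : ContDiffOn ℝ k (P.lin x) P.D.I :=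
  ContDiffOn.sum fun _ hv => contDiffOn_const.mul (contDiffOn_φh P hv k)

theorem contDiffOn_φ_time (P : LP) {x : Space d} (hx : x ∈ P.N) :
    ContDiffOn ℝ ℓ (P.D.φ x) P.D.I :=
  contDiffOn_time P.adm.φ_smooth (P.W_subset_region (P.N_subset_W hx))

theorem iteratedDerivWithin_err (P : LP) {k : ℕ} (hk : k ≤ ℓ) {x : Space d} (hx : x ∈ P.N) {t : ℝ}
    (ht : t ∈ P.D.I) : iteratedDerivWithin k (P.err x) P.D.I t =
      ∑ v ∈ P.s, bary P.s x v * iteratedDerivWithin k (P.D.φh v) P.D.I t -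
        iteratedDerivWithin k (P.D.φ x) P.D.I t := by
  rw [← iteratedDerivWithin_lin P k x ht]
  exact iteratedDerivWithin_sub ht P.hI (contDiffOn_lin P k x t ht)
    ((contDiffOn_φ_time P hx t ht).of_le (by exact_mod_cast hk))

/-- Interpolation reproduces affine functions, so the first order Taylor term drops out of the
error. -/
theorem sum_bary_mul_fderiv (P : LP) (L : Space d →L[ℝ] ℝ) (x : Space d) :
    ∑ v ∈ P.s, bary P.s x v * L (v - x) = 0 := by
  have : ∑ v ∈ P.s, bary P.s x v * L (v - x) = L (∑ v ∈ P.s, bary P.s x v • (v - x)) := by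
    simp [map_sum]
  rw [this]
  simp only [smul_sub, Finset.sum_sub_distrib, ← Finset.sum_smul, P.simplex.sum_bary,
    P.simplex.sum_bary_smul]
  simp

/-- The error at x is the λ-weighted sum, over the vertices, of the second order Taylor remainder,
O(μ²), minus the approximation error of φh, O(h^(qs+1) + τ^(qt+1−k)). On N the weights are bounded
by shape regularity. -/
theorem exists_timeDeriv_err_bound (hℓ : qt + 2 ≤ ℓ) (hqs : 1 ≤ qs) {k : ℕ} (hk : k ≤ qt) :
    ∃ C, 0 ≤ C ∧ ∀ P : LP, ∀ t ∈ P.D.I, ∀ x ∈ P.N,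
      |iteratedDerivWithin k (P.err x) P.D.I t| ≤ C * (P.D.h ^ 2 + P.D.τ ^ (qt + 1 - k)) := by
  obtain ⟨C, hC, h⟩ := exists_remainder_bound (Ω := Ω) (qs := qs) (qt := qt) (m := m) (c := c)
    (Cb := Cb) (Cv := Cv) (ℓ := ℓ) (k := k) (by omega)
  have hσ := c.σ_pos
  refine ⟨(d + 1) * ((1 + 2 * c.σ) * (C + |c.Cap|)), by positivity, fun P t ht x hx => ?_⟩
  set E := P.D.h ^ 2 + P.D.τ ^ (qt + 1 - k) with hE
  have hE0 : 0 ≤ E := by have := P.adm.τ_pos; positivity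
  have hμE : P.μ ^ 2 ≤ E := by
    have := P.adm.τ_pos
    have h1 : P.μ ^ 2 ≤ P.D.h ^ 2 := pow_le_pow_left₀ P.μ_pos.le P.μ_le 2
    have h2 : 0 ≤ P.D.τ ^ (qt + 1 - k) := by positivity
    linarith
  set L := fderiv ℝ (fun y => iteratedDerivWithin k (P.D.φ y) P.D.I t) x with hL
  rw [iteratedDerivWithin_err P (by omega) hx ht]
  have e : ∑ v ∈ P.s, bary P.s x v * iteratedDerivWithin k (P.D.φh v) P.D.I t -
        iteratedDerivWithin k (P.D.φ x) P.D.I t =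
      ∑ v ∈ P.s, bary P.s x v * ((iteratedDerivWithin k (P.D.φ v) P.D.I t -
        iteratedDerivWithin k (P.D.φ x) P.D.I t - L (v - x)) -
        (iteratedDerivWithin k (P.D.φ v) P.D.I t - iteratedDerivWithin k (P.D.φh v) P.D.I t)) := by
    have h1 : ∀ v, bary P.s x v * ((iteratedDerivWithin k (P.D.φ v) P.D.I t -
        iteratedDerivWithin k (P.D.φ x) P.D.I t - L (v - x)) -
        (iteratedDerivWithin k (P.D.φ v) P.D.I t - iteratedDerivWithin k (P.D.φh v) P.D.I t)) =
        bary P.s x v * iteratedDerivWithin k (P.D.φh v) P.D.I t -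
        bary P.s x v * iteratedDerivWithin k (P.D.φ x) P.D.I t - bary P.s x v * L (v - x) :=
      fun v => by ring
    simp only [h1, Finset.sum_sub_distrib, sum_bary_mul_fderiv P L x]
    rw [← Finset.sum_mul, P.simplex.sum_bary]
    ring
  rw [e]
  refine (Finset.abs_sum_le_sum_abs _ _).trans ?_
  refine (Finset.sum_le_card_nsmul _ _ ((1 + 2 * c.σ) * ((C + |c.Cap|) * E)) fun v hv => ?_).trans
    (le_of_eq ?_)
  · rw [abs_mul]
    refine mul_le_mul (P.abs_bary_le hx v) ?_ (abs_nonneg _) (by positivity)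
    refine (abs_sub _ _).trans ?_
    rw [add_mul]
    refine add_le_add ((h P t ht x hx v hv).trans (mul_le_mul_of_nonneg_left hμE hC)) ?_
    refine (P.adm.error_le P.mem hℓ (by omega) (mem_cell_of_vertex hv) ht).trans ?_
    have h1 : P.D.h ^ (qs + 1) ≤ P.D.h ^ 2 :=
      pow_le_pow_of_le_one P.adm.h_pos.le P.h_le (by omega)
    exact mul_le_mul (le_abs_self _) (by rw [hE]; linarith)
      (by have := P.adm.τ_pos; have := P.adm.h_pos; positivity) (abs_nonneg _)
  · rw [nsmul_eq_mul, show P.s.card = d + 1 from P.simplex.2]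
    push_cast
    ring

theorem hasFDerivAt_err (P : LP) (hℓ : 1 ≤ ℓ) {t : ℝ} (ht : t ∈ P.D.I) {x : Space d}
    (hx : x ∈ P.N) : HasFDerivAt (fun y => P.err y t)
      (∑ v ∈ P.s, P.D.φh v t • baryLin P.s v - fderiv ℝ (fun y => P.D.φ y t) x) x := by
  have h1 : DifferentiableAt ℝ (fun y => P.D.φ y t) x := by
    have h2 := ((u1_φ (qt := qt) (Cb := Cb) (Cv := Cv)).slice
      (fun P : LP => P.isOpen_W.uniqueDiffOn) (fun P => P.hI)).1 ⟨P, t, ht⟩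
    exact (h2.differentiableOn (by exact_mod_cast (by omega : ℓ ≠ 0))).differentiableAt
      (P.isOpen_W.mem_nhds (P.N_subset_W hx))
  refine HasFDerivAt.sub ?_ h1.hasFDerivAt
  refine (HasFDerivAt.fun_sum (fun v _ => (P.simplex.hasFDerivAt_bary x v).mul_const
    (P.D.φh v t))).congr_fderiv ?_
  rfl

/-- The gradients of λ_v are O(1/μ), so their coefficients must be O(μ). Taylor remainders are
O(μ²). The approximation error at v is not divisible by μ, but Σ ∇λ_v = 0 allows subtracting its
value at v₀, and the increment is at most |∇(φ − φh)| μ. -/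
theorem exists_fderiv_err_bound (hℓ : qt + 2 ≤ ℓ) (hqs : 1 ≤ qs) :
    ∃ C, 0 ≤ C ∧ ∀ P : LP, ∀ t ∈ P.D.I, ∀ x ∈ P.N,
      ‖fderiv ℝ (fun y => P.err y t) x‖ ≤ C * (P.D.h + P.D.τ ^ (qt + 1)) := by
  obtain ⟨C, hC, h⟩ := exists_remainder_bound (Ω := Ω) (qs := qs) (qt := qt) (m := m) (c := c)
    (Cb := Cb) (Cv := Cv) (ℓ := ℓ) (k := 0) (by omega)
  have hσ := c.σ_pos
  refine ⟨(d + 1) * ((2 * c.σ) * (C + |c.Cap|)), by positivity, fun P t ht x hx => ?_⟩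
  obtain ⟨v₀, hv₀⟩ := P.simplex.nonempty
  have hμ := P.μ_pos
  have hh := P.adm.h_pos
  have hτ := P.adm.τ_pos
  set E := P.D.h + P.D.τ ^ (qt + 1) with hE
  have hE0 : 0 ≤ E := by positivity
  have hμE : P.μ ≤ E := by
    have h1 : 0 ≤ P.D.τ ^ (qt + 1) := by positivity
    have := P.μ_le
    linarith
  rw [(hasFDerivAt_err P (by omega) ht hx).fderiv]
  set L := fderiv ℝ (fun y => P.D.φ y t) x with hL
  have h' := h P t ht x hx
  simp only [iteratedDerivWithin_zero] at h'
  rw [← hL] at h'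
  have hlip : ∀ v ∈ P.s, |(P.D.φ v t - P.D.φh v t) - (P.D.φ v₀ t - P.D.φh v₀ t)| ≤
      |c.Cap| * E * P.μ := by
    intro v hv
    have h1 := P.adm.error_lipschitz P.mem (k := 0) (by omega) ht (B := |c.Cap| * E)
      (fun y hy => (P.adm.φh_approx 1 0 (Or.inl ⟨by omega, by omega⟩) P.s P.mem y hy t ht).trans
        (mul_le_mul (le_abs_self _) (by
          rw [hE]
          have : P.D.h ^ (qs + 1 - 1) ≤ P.D.h ^ 1 :=
            pow_le_pow_of_le_one hh.le P.h_le (by omega)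
          simpa using this) (by positivity) (abs_nonneg _)))
      (mem_cell_of_vertex hv) (mem_cell_of_vertex hv₀)
    simp only [iteratedDerivWithin_zero] at h1
    exact h1.trans (mul_le_mul_of_nonneg_left (dist_le_diam_cell (mem_cell_of_vertex hv)
      (mem_cell_of_vertex hv₀)) (by positivity))
  have e : ∑ v ∈ P.s, P.D.φh v t • baryLin P.s v - L =
      ∑ v ∈ P.s, ((P.D.φ v t - P.D.φ x t - L (v - x)) - ((P.D.φ v t - P.D.φh v t) -
        (P.D.φ v₀ t - P.D.φh v₀ t))) • baryLin P.s v := by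
    ext y
    have h1 : ∀ v, ((P.D.φ v t - P.D.φ x t - L (v - x)) - ((P.D.φ v t - P.D.φh v t) -
        (P.D.φ v₀ t - P.D.φh v₀ t))) * baryLin P.s v y = P.D.φh v t * baryLin P.s v y -
        L (baryLin P.s v y • v) + (L x - P.D.φ x t + (P.D.φ v₀ t - P.D.φh v₀ t)) *
          baryLin P.s v y := fun v => by
      rw [map_smul, map_sub, smul_eq_mul]; ring
    have h2 : ∑ v ∈ P.s, baryLin P.s v y = 0 := by
      have := DFunLike.congr_fun P.simplex.sum_baryLin y
      simpa using this
    simp only [_root_.sub_apply, _root_.sum_apply,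
      _root_.smul_apply, smul_eq_mul, h1, Finset.sum_add_distrib,
      Finset.sum_sub_distrib, ← Finset.mul_sum, h2, ← map_sum, P.simplex.sum_baryLin_smul]
    ring
  rw [e]
  refine (norm_sum_le _ _).trans ((Finset.sum_le_card_nsmul _ _
    ((2 * c.σ) * ((C + |c.Cap|) * E)) fun v hv => ?_).trans (le_of_eq ?_))
  · rw [norm_smul, Real.norm_eq_abs]
    have h3 : |(P.D.φ v t - P.D.φ x t - L (v - x)) - ((P.D.φ v t - P.D.φh v t) -
        (P.D.φ v₀ t - P.D.φh v₀ t))| ≤ (C + |c.Cap|) * E * P.μ := by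
      refine (abs_sub _ _).trans ((add_le_add (h' v hv) (hlip v hv)).trans ?_)
      have : C * P.μ ^ 2 ≤ C * E * P.μ := by
        rw [sq, ← mul_assoc]
        exact mul_le_mul_of_nonneg_right (mul_le_mul_of_nonneg_left hμE hC) hμ.le
      linarith
    refine (mul_le_mul h3 (P.norm_baryLin_le v) (norm_nonneg _) (by positivity)).trans
      (le_of_eq ?_)
    field_simp
  · rw [nsmul_eq_mul, show P.s.card = d + 1 from P.simplex.2]
    push_cast
    ring

theorem u1_err (hℓ : qt + 2 ≤ ℓ) {n : ℕ} (hn : n ≤ ℓ) :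
    U1 n (fun P : LP => P.N ×ˢ P.D.I) (fun P => Function.uncurry P.err) :=
  ((u1_lin hℓ n).sub uniqueDiffOn_N_prod ((UB.restrict_N u1_φ).of_le hn)).congr fun _ _ _ => rfl

end ErrorBounds

/-! ### The distance function on a neighbourhood of an active element. -/

section LocalMapping

variable {d : ℕ} {Ω : Set (Space d)} {qs qt ℓ m : ℕ} {c : Consts} {Cb Cv : ℝ}

namespace LocalProblem

variable (P : LocalProblem Ω qs qt ℓ m c Cb Cv)

/-- The right-hand side of the equation for the distance function. -/
noncomputable def rhs (x : Space d) (t : ℝ) : ℝ := P.D.φ x t + (1 - P.b x t) * P.err x t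

open Classical in
/-- The distance function on the neighbourhood of the element. -/
noncomputable def dist (x : Space d) (t : ℝ) : ℝ :=
  if h : ∃ a, |a| ≤ c.ε₀ ∧ P.D.φ (x + a • P.D.G x t) t = P.rhs x t then h.choose else 0

/-- The displacement on the neighbourhood of the element. -/
noncomputable def disp (x : Space d) (t : ℝ) : Space d := P.dist x t • P.D.G x t

/-- The interpolation error is small enough for the distance function to exist. -/
structure Small (E : ℝ) : Prop where
  err_le : ∀ t ∈ P.D.I, ∀ x ∈ P.N, |P.err x t| ≤ E * (P.D.h ^ 2 + P.D.τ ^ (qt + 1))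
  lt : E / c.cw * (P.D.h ^ 2 + P.D.τ ^ (qt + 1)) < c.ε₀
  grad : E / c.cw * (P.D.h ^ 2 + P.D.τ ^ (qt + 1)) * |c.Cφ| < P.D.h

variable {P} {E : ℝ}

theorem mem_nbhd {x : Space d} {t : ℝ} (hx : x ∈ P.N) (ht : t ∈ P.D.I) :
    x ∈ P.D.nbhd Ω c.δU t := P.W_subset_nbhd ht (P.N_subset_W hx)

theorem abs_one_sub_b_le {x : Space d} {t : ℝ} (hx : x ∈ P.N) (ht : t ∈ P.D.I) :
    |1 - P.b x t| ≤ 1 := by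
  have := P.b_range x (P.W_subset_Ω (P.N_subset_W hx)) t ht
  rw [abs_le]
  constructor <;> linarith [this.1, this.2]

theorem abs_rhs_sub_le {x : Space d} {t : ℝ} (hx : x ∈ P.N) (ht : t ∈ P.D.I) :
    |P.rhs x t - P.D.φ x t| ≤ |P.err x t| := by
  have h1 : P.rhs x t - P.D.φ x t = (1 - P.b x t) * P.err x t := by rw [rhs]; ring
  rw [h1, abs_mul]
  exact mul_le_of_le_one_left (abs_nonneg _) (abs_one_sub_b_le hx ht)

theorem norm_G_le {x : Space d} {t : ℝ} (hx : x ∈ P.N) (ht : t ∈ P.D.I) :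
    ‖P.D.G x t‖ ≤ |c.Cφ| :=
  (P.adm.φ_bounds t ht x (mem_nbhd hx ht)).2.1.trans (le_abs_self _)

/-- The intermediate value theorem gives a root with |a| ≤ ε₀. Whichever root the choice picks, the
lower bound along the ray improves its size to |err| / cw, which is below ε₀; the strict inequality
is needed for differentiability. -/
theorem Small.dist_spec (hP : P.Small E) {x : Space d} {t : ℝ} (hx : x ∈ P.N) (ht : t ∈ P.D.I) :
    |P.dist x t| < c.ε₀ ∧ P.D.φ (x + P.dist x t • P.D.G x t) t = P.rhs x t := by
  have hcw := c.cw_pos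
  have h0 := hP.err_le t ht x hx
  have h1 : |P.err x t| / c.cw < c.ε₀ := by
    refine lt_of_le_of_lt ?_ hP.lt
    rw [div_mul_eq_mul_div]
    exact div_le_div_of_nonneg_right h0 hcw.le
  have hex : ∃ a, |a| ≤ c.ε₀ ∧ P.D.φ (x + a • P.D.G x t) t = P.rhs x t := by
    obtain ⟨a, ha, h⟩ := exists_root_of_lower (P.adm.continuousOn_ray ht (mem_nbhd hx ht))
      (P.adm.ray_lower ht (mem_nbhd hx ht)) (e := |P.err x t| / c.cw) (by positivity) h1.le
      (y := P.rhs x t) (by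
        rw [mul_div_cancel₀ _ hcw.ne']
        simpa using abs_rhs_sub_le hx ht)
    exact ⟨a, ha.trans h1.le, h⟩
  have hd : P.dist x t = hex.choose := dif_pos hex
  obtain ⟨s1, s2⟩ := hex.choose_spec
  rw [← hd] at s1 s2
  refine ⟨?_, s2⟩
  have h2 := P.adm.ray_lower ht (mem_nbhd hx ht) (P.dist x t) 0 s1 (by simpa using c.ε₀_pos.le)
  rw [s2, sub_zero, zero_smul, add_zero] at h2
  have h3 := h2.trans (abs_rhs_sub_le hx ht)
  refine lt_of_le_of_lt ?_ h1
  rw [le_div_iff₀ hcw]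
  linarith

theorem Small.abs_dist_le (hP : P.Small E) {x : Space d} {t : ℝ} (hx : x ∈ P.N)
    (ht : t ∈ P.D.I) : |P.dist x t| ≤ c.cw⁻¹ * |P.err x t| := by
  obtain ⟨h1, h2⟩ := hP.dist_spec hx ht
  have h3 := P.adm.ray_lower ht (mem_nbhd hx ht) (P.dist x t) 0 h1.le (by simpa using c.ε₀_pos.le)
  rw [h2, sub_zero, zero_smul, add_zero] at h3
  rw [inv_mul_eq_div, le_div_iff₀ c.cw_pos, mul_comm]
  exact h3.trans (abs_rhs_sub_le hx ht)

theorem Small.abs_dist_le' (hP : P.Small E) {x : Space d} {t : ℝ} (hx : x ∈ P.N)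
    (ht : t ∈ P.D.I) : |P.dist x t| ≤ E / c.cw * (P.D.h ^ 2 + P.D.τ ^ (qt + 1)) := by
  refine (hP.abs_dist_le hx ht).trans ?_
  rw [div_mul_eq_mul_div, div_eq_inv_mul]
  exact mul_le_mul_of_nonneg_left (hP.err_le t ht x hx) (inv_nonneg.2 c.cw_pos.le)

theorem Small.norm_disp_lt (hP : P.Small E) {x : Space d} {t : ℝ} (hx : x ∈ P.N)
    (ht : t ∈ P.D.I) : ‖P.disp x t‖ < P.D.h := by
  rw [disp, norm_smul]
  refine lt_of_le_of_lt ?_ hP.grad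
  exact mul_le_mul (hP.abs_dist_le' hx ht) (norm_G_le hx ht) (norm_nonneg _)
    ((abs_nonneg _).trans (hP.abs_dist_le' hx ht))

theorem Small.mem_ball (hP : P.Small E) {x : Space d} {t : ℝ} (hx : x ∈ P.N)
    (ht : t ∈ P.D.I) : x + P.disp x t ∈ Metric.ball x P.D.h := by
  rw [mem_ball_iff_norm, add_sub_cancel_left]
  exact hP.norm_disp_lt hx ht

theorem Small.mem_W (hP : P.Small E) {x : Space d} {t : ℝ} (hx : x ∈ P.N)
    (ht : t ∈ P.D.I) : x + P.disp x t ∈ P.W := P.ball_subset_W hx (hP.mem_ball hx ht)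

theorem rhs_eq {x : Space d} (hx : x ∈ cell P.s) (t : ℝ) :
    P.rhs x t = (1 - P.b x t) * P.D.φlin x t + P.b x t * P.D.φ x t := by
  rw [rhs, P.lin_eq hx, err]; ring

/-- The competition runs over all real α. Roots with modulus at most ε₀ coincide with `dist` by
injectivity along the ray, and all others have larger modulus. -/
theorem Small.isSmallestRoot_iff (hP : P.Small E) {x : Space d} {t : ℝ} (hx : x ∈ cell P.s)
    (ht : t ∈ P.D.I) (α : ℝ) : P.D.IsSmallestRoot Ω P.b x t α ↔ α = P.dist x t := by
  have hxN := P.cell_subset_N hx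
  have hU := mem_nbhd hxN ht
  obtain ⟨h1, h2⟩ := hP.dist_spec hxN ht
  rw [rhs_eq hx] at h2
  have hroot : P.D.IsRoot Ω P.b x t (P.dist x t) :=
    ⟨(P.adm.signed_dist t ht x hU).1 _ h1.le, h2⟩
  have key : ∀ β, P.D.IsRoot Ω P.b x t β → |β| ≤ c.ε₀ → β = P.dist x t := fun β hβ hb =>
    P.adm.ray_injOn ht hU (abs_le.1 hb) (abs_le.1 h1.le) (hβ.2.trans h2.symm)
  constructor
  · rintro ⟨hα, hmin⟩
    exact key α hα ((hmin _ hroot).trans h1.le)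
  · rintro rfl
    refine ⟨hroot, fun β hβ => ?_⟩
    by_contra! hlt
    rw [key β hβ (hlt.le.trans h1.le)] at hlt
    exact lt_irrefl _ hlt

theorem Small.existsUnique (hP : P.Small E) {x : Space d} {t : ℝ} (hx : x ∈ cell P.s)
    (ht : t ∈ P.D.I) : ∃! α, P.D.IsSmallestRoot Ω P.b x t α :=
  ⟨P.dist x t, (hP.isSmallestRoot_iff hx ht _).2 rfl, fun β hβ => (hP.isSmallestRoot_iff hx ht β).1 hβ⟩

theorem Small.ΨΓ_eq (hP : P.Small E) {x : Space d} {t : ℝ} (hx : x ∈ cell P.s)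
    (ht : t ∈ P.D.I) : P.D.ΨΓ Ω P.b x t = x + P.disp x t := by
  have hex : ∃ α, P.D.IsSmallestRoot Ω P.b x t α := (hP.existsUnique hx ht).exists
  have : P.D.distFn Ω P.b x t = hex.choose := dif_pos hex
  rw [Slab.ΨΓ, this, (hP.isSmallestRoot_iff hx ht _).1 hex.choose_spec, disp]

/-- For b = 1 the equation is φ(x + α G) = φ(x), solved by zero. This glues the mapping continuously
to the identity. -/
theorem Small.dist_eq_zero (hP : P.Small E) {x : Space d} {t : ℝ} (hx : x ∈ P.N)
    (ht : t ∈ P.D.I) (hb : P.b x t = 1) : P.dist x t = 0 := by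
  obtain ⟨h1, h2⟩ := hP.dist_spec hx ht
  refine P.adm.ray_injOn ht (mem_nbhd hx ht) (abs_le.1 h1.le)
    (abs_le.1 (by simpa using c.ε₀_pos.le)) ?_
  simp only [h2, rhs, hb]
  simp

end LocalProblem

section Families

/-- Local problems with a small interpolation error. -/
abbrev SmallProblem (Ω : Set (Space d)) (qs qt ℓ m : ℕ) (c : Consts) (Cb Cv E : ℝ) : Type :=
  {P : LocalProblem Ω qs qt ℓ m c Cb Cv // P.Small E}

variable {E : ℝ}

local notation "LP" => LocalProblem Ω qs qt ℓ m c Cb Cv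
local notation "SP" => SmallProblem Ω qs qt ℓ m c Cb Cv E

theorem ndo_N (P : SP) : UniqueDiffOn ℝ (P.1.N ×ˢ P.1.D.I) := uniqueDiffOn_N_prod P.1

theorem u1_rhs (hΩ : IsOpen Ω) (hℓ : qt + 2 ≤ ℓ) :
    U1 ℓ (fun P : LP => P.N ×ˢ P.D.I) (fun P => Function.uncurry P.rhs) := by
  have h1 := UB.restrict_N (u1_φ (Ω := Ω) (qs := qs) (qt := qt) (m := m) (c := c) (Cb := Cb)
    (Cv := Cv) (ℓ := ℓ))
  have h2 := (U1.const (n := ℓ) (S := fun P : LP => P.N ×ˢ P.D.I) (fun _ => (1 : ℝ)) (C := 1)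
    (by simp)).sub uniqueDiffOn_N_prod (u1_b hΩ)
  exact h1.add uniqueDiffOn_N_prod (U1.mul uniqueDiffOn_N_prod h2 (u1_err hℓ le_rfl))

theorem u1_dist (hΩ : IsOpen Ω) (hℓ : qt + 2 ≤ ℓ) (hm1 : 1 ≤ m) (hm : m ≤ ℓ) :
    U1 m (fun P : SP => P.1.N ×ˢ P.1.D.I) (fun P => Function.uncurry P.1.dist) :=
  implicit_u1 hm1 (fun P : SP => P.1.isOpen_N) (fun P => P.1.isOpen_W) (fun P => P.1.hI) c.cw_pos
    ((UB.of_le u1_φ hm).reindex Subtype.val) ((UB.restrict_N u1_G).reindex Subtype.val)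
    (((u1_rhs hΩ hℓ).of_le hm).reindex Subtype.val)
    (fun P _ hx _ ht => P.2.mem_W hx ht) (fun P _ hx _ ht => (P.2.dist_spec hx ht).2)
    (fun P _ hx _ ht => (P.2.dist_spec hx ht).1)
    (fun P _ hy _ hu a ha => P.1.adm.ray_lower hu (LocalProblem.mem_nbhd hy hu) _ a
      (P.2.dist_spec hy hu).1.le ha)

theorem u1_disp (hΩ : IsOpen Ω) (hℓ : qt + 2 ≤ ℓ) (hm1 : 1 ≤ m) (hm : m ≤ ℓ) :
    U1 m (fun P : SP => P.1.N ×ˢ P.1.D.I) (fun P => Function.uncurry P.1.disp) :=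
  U1.smul ndo_N (u1_dist hΩ hℓ hm1 hm) ((UB.restrict_N u1_G).reindex Subtype.val)

theorem exists_norm_fderivWithin_le {ι : Type*} {X F : Type} [NormedAddCommGroup X]
    [NormedSpace ℝ X] [NormedAddCommGroup F] [NormedSpace ℝ F] {S : ι → Set X} {f : ι → X → F}
    (h : U1 1 S f) (hS : ∀ i, UniqueDiffOn ℝ (S i)) :
    (∀ i, ∀ x ∈ S i, DifferentiableWithinAt ℝ (f i) (S i) x) ∧
      ∃ C, 0 ≤ C ∧ ∀ i, ∀ x ∈ S i, ‖fderivWithin ℝ (f i) (S i) x‖ ≤ C := by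
  obtain ⟨C, hC, h2⟩ := UB.bound (U1.fderivWithin (n := 0) h hS)
  exact ⟨fun i => (h.1 i).differentiableOn (by simp), C, hC, by simpa using h2⟩

/-- Inserting R = φ + (1 − b) err into the implicit formula groups the terms by smallness: Dφ at two
points that differ by the displacement, the derivative of err, and multiples of err and of the root.
-/
theorem fderivWithin_dist_apply (hℓ : qt + 2 ≤ ℓ) (hΩ : IsOpen Ω) (hm1 : 1 ≤ m) (P : SP)
    {x : Space d} (hx : x ∈ P.1.N) {t : ℝ} (ht : t ∈ P.1.D.I) (v : Space d × ℝ) :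
    c.cw ≤ |fderivWithin ℝ (Function.uncurry P.1.D.φ) (P.1.W ×ˢ P.1.D.I)
      (x + P.1.disp x t, t) (P.1.D.G x t, 0)| ∧
    fderivWithin ℝ (Function.uncurry P.1.dist) (P.1.N ×ˢ P.1.D.I) (x, t) v =
      (fderivWithin ℝ (Function.uncurry P.1.D.φ) (P.1.W ×ˢ P.1.D.I)
        (x + P.1.disp x t, t) (P.1.D.G x t, 0))⁻¹ *
      ((fderivWithin ℝ (Function.uncurry P.1.D.φ) (P.1.W ×ˢ P.1.D.I) (x, t) v -
        fderivWithin ℝ (Function.uncurry P.1.D.φ) (P.1.W ×ˢ P.1.D.I) (x + P.1.disp x t, t) v) +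
        (1 - P.1.b x t) * fderivWithin ℝ (Function.uncurry P.1.err) (P.1.N ×ˢ P.1.D.I) (x, t) v -
        fderivWithin ℝ (Function.uncurry P.1.b) (P.1.N ×ˢ P.1.D.I) (x, t) v * P.1.err x t -
        P.1.dist x t * fderivWithin ℝ (Function.uncurry P.1.D.φ) (P.1.W ×ˢ P.1.D.I)
          (x + P.1.disp x t, t)
          (fderivWithin ℝ (Function.uncurry P.1.D.G) (P.1.N ×ˢ P.1.D.I) (x, t) v, 0)) := by
  have hφW := (u1_φ (Ω := Ω) (qs := qs) (qt := qt) (m := m) (c := c) (Cb := Cb)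
    (Cv := Cv) (ℓ := ℓ)).1 P.1 |>.differentiableOn (by exact_mod_cast (by omega : ℓ ≠ 0))
  have hG := (UB.restrict_N (u1_G (Ω := Ω) (qs := qs) (qt := qt) (m := m) (c := c) (Cb := Cb)
    (Cv := Cv) (ℓ := ℓ))).1 P.1 |>.differentiableOn (by exact_mod_cast (by omega : m ≠ 0))
  have hb := (u1_b (qs := qs) (qt := qt) (m := m) (c := c) (Cb := Cb)
    (Cv := Cv) (ℓ := ℓ) hΩ).1 P.1 |>.differentiableOn (by exact_mod_cast (by omega : ℓ ≠ 0))
  have he := (u1_err (Ω := Ω) (qs := qs) (qt := qt) (m := m) (c := c) (Cb := Cb)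
    (Cv := Cv) (ℓ := ℓ) hℓ le_rfl).1 P.1 |>.differentiableOn
      (by exact_mod_cast (by omega : ℓ ≠ 0))
  have hxt : (x, t) ∈ P.1.N ×ˢ P.1.D.I := ⟨hx, ht⟩
  have hxW : (x, t) ∈ P.1.W ×ˢ P.1.D.I := ⟨P.1.N_subset_W hx, ht⟩
  have hR : HasFDerivWithinAt (Function.uncurry P.1.rhs)
      (fderivWithin ℝ (Function.uncurry P.1.D.φ) (P.1.W ×ˢ P.1.D.I) (x, t) +
        ((1 - P.1.b x t) • fderivWithin ℝ (Function.uncurry P.1.err) (P.1.N ×ˢ P.1.D.I) (x, t) +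
        P.1.err x t • (-fderivWithin ℝ (Function.uncurry P.1.b) (P.1.N ×ˢ P.1.D.I) (x, t))))
      (P.1.N ×ˢ P.1.D.I) (x, t) :=
    (((hφW _ hxW).hasFDerivWithinAt).mono (Set.prod_mono P.1.N_subset_W subset_rfl)).add
      (((hb _ hxt).hasFDerivWithinAt.const_sub 1).mul (he _ hxt).hasFDerivWithinAt)
  obtain ⟨h1, h2⟩ := implicit_hasFDerivWithinAt P.1.isOpen_W c.cw_pos hx ht
    (φ := P.1.D.φ) (G := P.1.D.G) (R := P.1.rhs) (δ := P.1.dist) (ε₀ := c.ε₀)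
    (hφW _ ⟨P.2.mem_W hx ht, ht⟩) (hG _ hxt) hR.differentiableWithinAt (P.2.mem_W hx ht)
    (fun y hy u hu => (P.2.dist_spec hy hu).2) (P.2.dist_spec hx ht).1
    (fun y hy u hu a ha => P.1.adm.ray_lower hu (LocalProblem.mem_nbhd hy hu) _ a
      (P.2.dist_spec hy hu).1.le ha)
  refine ⟨h1, ?_⟩
  rw [h2.fderivWithin (ndo_N P _ hxt), hR.fderivWithin (ndo_N P _ hxt)]
  simp only [_root_.smul_apply, _root_.sub_apply, _root_.add_apply, _root_.neg_apply,
    ContinuousLinearMap.comp_apply, ContinuousLinearMap.id_apply, smul_eq_mul, map_add,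
    ContinuousLinearMap.inl_apply, map_smul, LocalProblem.disp]
  ring

/-- Stated for single directions v, because the derivatives of err in time and in space are small of
different orders. Directions (0, 1) and (u, 0) give the two low order bounds. -/
theorem exists_fderiv_disp_bound (hℓ : qt + 2 ≤ ℓ) (hΩ : IsOpen Ω) (hm1 : 1 ≤ m) (hm : m ≤ ℓ) :
    ∃ C, 0 ≤ C ∧ ∀ P : SP, ∀ t ∈ P.1.D.I, ∀ x ∈ P.1.N, ∀ v,
      ‖fderivWithin ℝ (Function.uncurry P.1.disp) (P.1.N ×ˢ P.1.D.I) (x, t) v‖ ≤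
        C * (|fderivWithin ℝ (Function.uncurry P.1.err) (P.1.N ×ˢ P.1.D.I) (x, t) v| +
          (P.1.D.h ^ 2 + P.1.D.τ ^ (qt + 1)) * ‖v‖) := by
  obtain ⟨-, C₁, hC₁, h₁⟩ := exists_norm_fderivWithin_le
    (UB.of_le (u1_φ (Ω := Ω) (qs := qs) (qt := qt) (m := m) (c := c) (Cb := Cb)
    (Cv := Cv) (ℓ := ℓ)) (by omega)) uniqueDiffOn_W_prod
  obtain ⟨dG, C₂, hC₂, h₂⟩ := exists_norm_fderivWithin_le
    (UB.of_le (UB.restrict_N (u1_G (Ω := Ω) (qs := qs) (qt := qt) (m := m) (c := c) (Cb := Cb)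
    (Cv := Cv) (ℓ := ℓ))) hm1) uniqueDiffOn_N_prod
  obtain ⟨-, C₃, hC₃, h₃⟩ := exists_norm_fderivWithin_le
    (UB.of_le (u1_b (Ω := Ω) (qs := qs) (qt := qt) (m := m) (c := c) (Cb := Cb)
    (Cv := Cv) (ℓ := ℓ) hΩ) (by omega)) uniqueDiffOn_N_prod
  obtain ⟨C₄, hC₄, h₄⟩ := U1.lipschitz_slice (fun P : LP => P.isOpen_W) (fun P => P.hI)
    (f := fun P x t => fderivWithin ℝ (Function.uncurry P.D.φ) (P.W ×ˢ P.D.I) (x, t))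
    (U1.fderivWithin (n := 1) (UB.of_le (u1_φ (Ω := Ω) (qs := qs) (qt := qt) (m := m) (c := c)
      (Cb := Cb) (Cv := Cv) (ℓ := ℓ)) (by omega)) uniqueDiffOn_W_prod)
  obtain ⟨dd, -⟩ := exists_norm_fderivWithin_le
    (UB.of_le (u1_dist (Ω := Ω) (qs := qs) (qt := qt) (m := m) (c := c) (Cb := Cb)
    (Cv := Cv) (ℓ := ℓ) (E := E) hΩ hℓ hm1 hm) hm1) ndo_N
  set K := |c.Cφ| with hK
  have hK0 : 0 ≤ K := abs_nonneg _
  set M := |E / c.cw| with hM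
  have hM0 : 0 ≤ M := abs_nonneg _
  have hcw := c.cw_pos
  have hcwi : 0 ≤ c.cw⁻¹ := inv_nonneg.2 hcw.le
  set A := C₄ * K * M + C₃ * |E| + M * (C₁ * C₂) with hA
  have hA0 : 0 ≤ A := by positivity
  refine ⟨c.cw⁻¹ * (1 + A) * K + M * C₂, by positivity, fun P t ht x hx v => ?_⟩
  have hxt : (x, t) ∈ P.1.N ×ˢ P.1.D.I := ⟨hx, ht⟩
  have hxW := P.1.N_subset_W hx
  obtain ⟨ha, hd⟩ := fderivWithin_dist_apply hℓ hΩ hm1 P hx ht v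
  set η := P.1.D.h ^ 2 + P.1.D.τ ^ (qt + 1) with hη
  have hη0 : 0 ≤ η := by have := P.1.adm.τ_pos; positivity
  have hδ : |P.1.dist x t| ≤ M * η :=
    (P.2.abs_dist_le' hx ht).trans (mul_le_mul_of_nonneg_right (le_abs_self _) hη0)
  have herr : |P.1.err x t| ≤ |E| * η :=
    (P.2.err_le t ht x hx).trans (mul_le_mul_of_nonneg_right (le_abs_self _) hη0)
  have hGx := LocalProblem.norm_G_le hx ht
  set e' := fderivWithin ℝ (Function.uncurry P.1.err) (P.1.N ×ˢ P.1.D.I) (x, t) v with he'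
  -- Dφ is Lipschitz on the ball of radius h around x, which lies in W and contains the displaced
  -- point.
  have i1 : |fderivWithin ℝ (Function.uncurry P.1.D.φ) (P.1.W ×ˢ P.1.D.I) (x, t) v -
        fderivWithin ℝ (Function.uncurry P.1.D.φ) (P.1.W ×ˢ P.1.D.I) (x + P.1.disp x t, t) v| ≤
      C₄ * K * M * (η * ‖v‖) := by
    have := (h₄ P.1 t ht).2.2 (Metric.ball x P.1.D.h) (P.1.ball_subset_W hx) (convex_ball _ _)
      (x + P.1.disp x t) (P.2.mem_ball hx ht) x (Metric.mem_ball_self P.1.adm.h_pos)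
    rw [← _root_.sub_apply]
    refine (ContinuousLinearMap.le_of_opNorm_le _ this v).trans ?_
    rw [sub_add_cancel_left, norm_neg, LocalProblem.disp, norm_smul, Real.norm_eq_abs]
    calc C₄ * (|P.1.dist x t| * ‖P.1.D.G x t‖) * ‖v‖ ≤ C₄ * ((M * η) * K) * ‖v‖ := by gcongr
      _ = _ := by ring
  have i2 : |(1 - P.1.b x t) * e'| ≤ |e'| := by
    rw [abs_mul]
    exact mul_le_of_le_one_left (abs_nonneg _) (LocalProblem.abs_one_sub_b_le hx ht)
  have i3 : |fderivWithin ℝ (Function.uncurry P.1.b) (P.1.N ×ˢ P.1.D.I) (x, t) v * P.1.err x t| ≤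
      C₃ * |E| * (η * ‖v‖) := by
    rw [abs_mul]
    have := ContinuousLinearMap.le_of_opNorm_le _ (h₃ P.1 (x, t) hxt) v
    rw [Real.norm_eq_abs] at this
    calc _ ≤ (C₃ * ‖v‖) * (|E| * η) := by gcongr
      _ = _ := by ring
  have hG' := ContinuousLinearMap.le_of_opNorm_le _ (h₂ P.1 (x, t) hxt) v
  have i4 : |P.1.dist x t * fderivWithin ℝ (Function.uncurry P.1.D.φ) (P.1.W ×ˢ P.1.D.I)
          (x + P.1.disp x t, t)
          (fderivWithin ℝ (Function.uncurry P.1.D.G) (P.1.N ×ˢ P.1.D.I) (x, t) v, 0)| ≤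
      M * (C₁ * C₂) * (η * ‖v‖) := by
    rw [abs_mul]
    have := ContinuousLinearMap.le_of_opNorm_le _ (h₁ P.1 (x + P.1.disp x t, t)
      ⟨P.2.mem_W hx ht, ht⟩)
      (fderivWithin ℝ (Function.uncurry P.1.D.G) (P.1.N ×ˢ P.1.D.I) (x, t) v, 0)
    rw [Real.norm_eq_abs, Prod.norm_mk, norm_zero, max_eq_left (norm_nonneg _)] at this
    calc _ ≤ (M * η) * (C₁ * (C₂ * ‖v‖)) := by
          refine mul_le_mul hδ (this.trans ?_) (abs_nonneg _) (by positivity)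
          exact mul_le_mul_of_nonneg_left hG' hC₁
      _ = _ := by ring
  have hDd : |fderivWithin ℝ (Function.uncurry P.1.dist) (P.1.N ×ˢ P.1.D.I) (x, t) v| ≤
      c.cw⁻¹ * (|e'| + A * (η * ‖v‖)) := by
    rw [hd, abs_mul, abs_inv]
    refine mul_le_mul (inv_anti₀ hcw ha) ?_ (abs_nonneg _) hcwi
    refine (abs_sub _ _).trans ((add_le_add ((abs_sub _ _).trans (add_le_add
      ((abs_add_le _ _).trans (add_le_add i1 i2)) i3)) i4).trans (le_of_eq ?_))
    rw [hA]; ring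
  have hw : fderivWithin ℝ (Function.uncurry P.1.disp) (P.1.N ×ˢ P.1.D.I) (x, t) v =
      P.1.dist x t • fderivWithin ℝ (Function.uncurry P.1.D.G) (P.1.N ×ˢ P.1.D.I) (x, t) v +
      fderivWithin ℝ (Function.uncurry P.1.dist) (P.1.N ×ˢ P.1.D.I) (x, t) v • P.1.D.G x t := by
    have h5 := ((dd P (x, t) hxt).hasFDerivWithinAt.smul (dG P.1 (x, t) hxt).hasFDerivWithinAt)
    have h6 := h5.fderivWithin (ndo_N P _ hxt)
    exact (DFunLike.congr_fun h6 v).trans rfl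
  rw [hw]
  refine (norm_add_le _ _).trans ?_
  rw [norm_smul, norm_smul, Real.norm_eq_abs, Real.norm_eq_abs]
  have hv : 0 ≤ η * ‖v‖ := by positivity
  calc _ ≤ (M * η) * (C₂ * ‖v‖) + c.cw⁻¹ * (|e'| + A * (η * ‖v‖)) * K := by
        refine add_le_add ?_ ?_
        · exact mul_le_mul hδ hG' (norm_nonneg _) (by positivity)
        · exact mul_le_mul hDd hGx (norm_nonneg _) (by positivity)
    _ = M * C₂ * (η * ‖v‖) + c.cw⁻¹ * K * |e'| + c.cw⁻¹ * A * K * (η * ‖v‖) := by ring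
    _ ≤ M * C₂ * (|e'| + η * ‖v‖) + c.cw⁻¹ * K * (|e'| + η * ‖v‖) +
        c.cw⁻¹ * A * K * (|e'| + η * ‖v‖) := by
        gcongr
        · linarith [abs_nonneg e']
        · linarith
        · linarith [abs_nonneg e']
    _ = _ := by ring

end Families

end LocalMapping

/-! ### Low order bounds for the displacement. -/

section LocalBounds

variable {d : ℕ} {Ω : Set (Space d)} {qs qt ℓ m : ℕ} {c : Consts} {Cb Cv E : ℝ}

local notation "LP" => LocalProblem Ω qs qt ℓ m c Cb Cv
local notation "SP" => SmallProblem Ω qs qt ℓ m c Cb Cv E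

theorem hasFDerivAt_of_uncurry {X F : Type} [NormedAddCommGroup X] [NormedSpace ℝ X]
    [NormedAddCommGroup F] [NormedSpace ℝ F] {N : Set X} (hN : IsOpen N) {I : Set ℝ}
    {f : X → ℝ → F} {x : X} {t : ℝ} (hx : x ∈ N) (ht : t ∈ I)
    (h : DifferentiableWithinAt ℝ (Function.uncurry f) (N ×ˢ I) (x, t)) :
    HasFDerivAt (fun y => f y t) ((fderivWithin ℝ (Function.uncurry f) (N ×ˢ I) (x, t)).comp
      (ContinuousLinearMap.inl ℝ X ℝ)) x := by
  have h1 : HasFDerivWithinAt (fun y : X => (y, t)) (ContinuousLinearMap.inl ℝ X ℝ) N x :=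
    (hasFDerivAt_prodMk_left x t).hasFDerivWithinAt
  exact (h.hasFDerivWithinAt.comp (t := N ×ˢ I) (f := fun y => (y, t)) x h1 (fun y hy => ⟨hy, ht⟩)).hasFDerivAt (hN.mem_nhds hx)

theorem exists_disp_bounds (hℓ : qt + 2 ≤ ℓ) (hqs : 1 ≤ qs) (hqt : 1 ≤ qt) (hΩ : IsOpen Ω)
    (hm1 : 1 ≤ m) (hm : m ≤ ℓ) :
    ∃ C, 0 ≤ C ∧ ∀ P : SP, ∀ t ∈ P.1.D.I, ∀ x ∈ P.1.N,
      ‖P.1.disp x t‖ ≤ C * (P.1.D.h ^ 2 + P.1.D.τ ^ (qt + 1)) ∧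
      (DifferentiableWithinAt ℝ (P.1.disp x) P.1.D.I t ∧
        ‖derivWithin (P.1.disp x) P.1.D.I t‖ ≤ C * (P.1.D.h ^ 2 + P.1.D.τ ^ qt)) ∧
      DifferentiableAt ℝ (fun y => P.1.disp y t) x ∧
        ‖fderiv ℝ (fun y => P.1.disp y t) x‖ ≤ C * (P.1.D.h + P.1.D.τ ^ (qt + 1)) := by
  obtain ⟨A, hA, hd⟩ := exists_fderiv_disp_bound (Ω := Ω) (qs := qs) (qt := qt) (m := m) (c := c)
    (Cb := Cb) (Cv := Cv) (ℓ := ℓ) (E := E) hℓ hΩ hm1 hm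
  obtain ⟨B₀, hB₀, h₀⟩ := exists_fderiv_err_bound (Ω := Ω) (qs := qs) (qt := qt) (m := m) (c := c)
    (Cb := Cb) (Cv := Cv) (ℓ := ℓ) hℓ hqs
  obtain ⟨B₁, hB₁, h₁⟩ := exists_timeDeriv_err_bound (Ω := Ω) (qs := qs) (qt := qt) (m := m)
    (c := c) (Cb := Cb) (Cv := Cv) (ℓ := ℓ) hℓ hqs hqt
  have hdisp := u1_disp (Ω := Ω) (qs := qs) (qt := qt) (m := m)
    (c := c) (Cb := Cb) (Cv := Cv) (ℓ := ℓ) (E := E) hΩ hℓ hm1 hm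
  have herr := u1_err (Ω := Ω) (qs := qs) (qt := qt) (m := m)
    (c := c) (Cb := Cb) (Cv := Cv) (ℓ := ℓ) hℓ le_rfl
  set M := |E / c.cw| * |c.Cφ| with hM
  have hM0 : 0 ≤ M := by positivity
  refine ⟨M + A * (B₁ + 1) + A * (B₀ + 1), by positivity, fun P t ht x hx => ?_⟩
  have hxt : (x, t) ∈ P.1.N ×ˢ P.1.D.I := ⟨hx, ht⟩
  have dw := ((hdisp.1 P).differentiableOn (by exact_mod_cast (by omega : m ≠ 0))) (x, t) hxt
  have de := ((herr.1 P.1).differentiableOn (by exact_mod_cast (by omega : ℓ ≠ 0))) (x, t) hxt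
  have hh := P.1.adm.h_pos
  have hτ := P.1.adm.τ_pos
  have hh1 := P.1.h_le
  have hτ1 := P.1.τ_le
  have e1 : P.1.D.h ^ 2 ≤ P.1.D.h := by nlinarith
  have e2 : P.1.D.τ ^ (qt + 1) ≤ P.1.D.τ ^ qt := pow_le_pow_of_le_one hτ.le hτ1 (by omega)
  have p1 : 0 ≤ P.1.D.τ ^ (qt + 1) := by positivity
  refine ⟨?_, ?_, ?_⟩
  · rw [LocalProblem.disp, norm_smul, Real.norm_eq_abs]
    have h5 := (P.2.abs_dist_le' hx ht).trans (mul_le_mul_of_nonneg_right (le_abs_self (E / c.cw))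
      (by positivity))
    calc |P.1.dist x t| * ‖P.1.D.G x t‖ ≤ (|E / c.cw| * (P.1.D.h ^ 2 + P.1.D.τ ^ (qt + 1))) *
          |c.Cφ| := mul_le_mul h5 (LocalProblem.norm_G_le hx ht) (norm_nonneg _) (by positivity)
      _ = M * (P.1.D.h ^ 2 + P.1.D.τ ^ (qt + 1)) := by rw [hM]; ring
      _ ≤ _ := by
        refine mul_le_mul_of_nonneg_right ?_ (by positivity)
        have : 0 ≤ A * (B₁ + 1) + A * (B₀ + 1) := by positivity
        linarith
  · have h2 := hasDerivWithinAt_of_uncurry hx dw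
    have h3 := hasDerivWithinAt_of_uncurry hx de
    refine ⟨h2.differentiableWithinAt, ?_⟩
    rw [h2.derivWithin (P.1.hI t ht)]
    refine (hd P t ht x hx (0, 1)).trans ?_
    rw [← h3.derivWithin (P.1.hI t ht)]
    have h4 := h₁ P.1 t ht x hx
    rw [iteratedDerivWithin_one, Nat.add_sub_cancel] at h4
    have : ‖((0, 1) : Space d × ℝ)‖ = 1 := by simp [Prod.norm_def]
    rw [this, mul_one]
    calc _ ≤ A * (B₁ * (P.1.D.h ^ 2 + P.1.D.τ ^ qt) + (P.1.D.h ^ 2 + P.1.D.τ ^ qt)) := by gcongr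
      _ = A * (B₁ + 1) * (P.1.D.h ^ 2 + P.1.D.τ ^ qt) := by ring
      _ ≤ _ := by
        refine mul_le_mul_of_nonneg_right ?_ (by positivity)
        have : 0 ≤ A * (B₀ + 1) := by positivity
        linarith
  · have h2 := hasFDerivAt_of_uncurry P.1.isOpen_N hx ht dw
    have h3 := hasFDerivAt_of_uncurry P.1.isOpen_N hx ht de
    refine ⟨h2.differentiableAt, ?_⟩
    rw [h2.fderiv]
    refine ContinuousLinearMap.opNorm_le_bound _ (by positivity) fun u => ?_
    refine (hd P t ht x hx (u, 0)).trans ?_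
    have h4 := ContinuousLinearMap.le_of_opNorm_le _ (h₀ P.1 t ht x hx) u
    rw [h3.fderiv, Real.norm_eq_abs] at h4
    have : ‖((u, 0) : Space d × ℝ)‖ = ‖u‖ := by simp [Prod.norm_def]
    rw [this]
    calc _ ≤ A * (B₀ * (P.1.D.h + P.1.D.τ ^ (qt + 1)) * ‖u‖ +
          (P.1.D.h + P.1.D.τ ^ (qt + 1)) * ‖u‖) := by
          refine mul_le_mul_of_nonneg_left (add_le_add h4 ?_) hA
          gcongr
      _ = A * (B₀ + 1) * (P.1.D.h + P.1.D.τ ^ (qt + 1)) * ‖u‖ := by ring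
      _ ≤ _ := by
        refine mul_le_mul_of_nonneg_right (mul_le_mul_of_nonneg_right ?_ (by positivity))
          (norm_nonneg _)
        have : 0 ≤ A * (B₁ + 1) := by positivity
        linarith

/-- The smallness conditions hold for small mesh size and time step. -/
theorem exists_small (hℓ : qt + 2 ≤ ℓ) (hqs : 1 ≤ qs) :
    ∃ E ρ : ℝ, 0 < ρ ∧ ∀ P : LP, P.D.h ≤ ρ → P.Small E := by
  obtain ⟨E, hE, h⟩ := exists_timeDeriv_err_bound (Ω := Ω) (qs := qs) (qt := qt) (m := m)
    (c := c) (Cb := Cb) (Cv := Cv) (ℓ := ℓ) (k := 0) hℓ hqs (Nat.zero_le _)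
  -- By the time step condition h² + τ^(qt+1) ≤ h (h + |Cτh| h^ε), and the second factor tends to
  -- zero because ε > 0. Smallness of h alone therefore suffices.
  have hlim : Filter.Tendsto (fun y : ℝ => E / c.cw * (y + |c.Cτh| * y ^ c.ε) * (1 + |c.Cφ|))
      (nhds 0) (nhds 0) := by
    have : ContinuousAt (fun y : ℝ => E / c.cw * (y + |c.Cτh| * y ^ c.ε) * (1 + |c.Cφ|)) 0 := by
      have h1 : ContinuousAt (fun y : ℝ => y ^ c.ε) 0 :=
        Real.continuousAt_rpow_const _ _ (Or.inr c.ε_pos.le)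
      fun_prop
    have h2 := this.tendsto
    simpa [Real.zero_rpow c.ε_pos.ne'] using h2
  -- One threshold serves both smallness conditions: 1 for `grad` and ε₀ for `lt`, as the factor 1 +
  -- |Cφ| dominates 1 and |Cφ|.
  have hev := hlim.eventually (gt_mem_nhds (lt_min zero_lt_one c.ε₀_pos))
  obtain ⟨ρ, hρ, hball⟩ := Metric.eventually_nhds_iff.1 hev
  refine ⟨E, min (ρ / 2) 1, by positivity, fun P hP => ?_⟩
  have hh := P.adm.h_pos
  have hτ := P.adm.τ_pos
  have hcw := c.cw_pos
  have h1 : P.D.h < ρ := by linarith [hP.trans (min_le_left _ _)]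
  have h2 := hball (y := P.D.h) (by rw [Real.dist_eq, sub_zero, abs_of_pos hh]; exact h1)
  set y := P.D.h with hy
  have hη : y ^ 2 + P.D.τ ^ (qt + 1) ≤ y * (y + |c.Cτh| * y ^ c.ε) := by
    have h3 := P.adm.time_step
    rw [Real.rpow_add hh, Real.rpow_one] at h3
    have h4 : c.Cτh * (y * y ^ c.ε) ≤ |c.Cτh| * (y * y ^ c.ε) :=
      mul_le_mul_of_nonneg_right (le_abs_self _) (by positivity)
    have h5 : P.D.τ ^ (qt + 1) ≤ |c.Cτh| * (y * y ^ c.ε) := h3.trans h4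
    nlinarith
  have hK : 0 ≤ E / c.cw := by positivity
  have hz : 0 ≤ y + |c.Cτh| * y ^ c.ε := by positivity
  have h6 : E / c.cw * (y ^ 2 + P.D.τ ^ (qt + 1)) * (1 + |c.Cφ|) < y * min 1 c.ε₀ := by
    refine lt_of_le_of_lt ?_ (mul_lt_mul_of_pos_left h2 hh)
    calc _ ≤ E / c.cw * (y * (y + |c.Cτh| * y ^ c.ε)) * (1 + |c.Cφ|) := by gcongr
      _ = _ := by ring
  have h7 : 0 ≤ E / c.cw * (y ^ 2 + P.D.τ ^ (qt + 1)) := by positivity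
  have h8 : 0 ≤ E / c.cw * (y ^ 2 + P.D.τ ^ (qt + 1)) * |c.Cφ| := by positivity
  have hy1 : y ≤ 1 := P.h_le
  have h9 : y * min 1 c.ε₀ ≤ c.ε₀ :=
    (mul_le_of_le_one_left (by positivity [c.ε₀_pos]) hy1).trans (min_le_right _ _)
  have h10 : y * min 1 c.ε₀ ≤ y := mul_le_of_le_one_right hh.le (min_le_left _ _)
  refine ⟨fun t ht x hx => by simpa using h P t ht x hx, ?_, ?_⟩ <;> nlinarith

end LocalBounds

/-! ### Smallness that survives time differentiation. -/

section TimeSmallness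

theorem UB.of_derivWithin {ι : Type*} {F : Type} [NormedAddCommGroup F] [NormedSpace ℝ F]
    {I : ι → Set ℝ} (hI : ∀ i, UniqueDiffOn ℝ (I i)) {κ : ι → ℝ} (hκ : ∀ i, 0 ≤ κ i)
    {n : ℕ} {f f' : ι → ℝ → F} (hf : ∀ i, ∀ t ∈ I i, HasDerivWithinAt (f i) (f' i t) (I i) t)
    {C : ℝ} (hb : ∀ i, ∀ t ∈ I i, ‖f i t‖ ≤ C * κ i)
    (h : UB n I (fun i _ => κ i) (fun _ _ => 1) f') :
    UB (n + 1) I (fun i _ => κ i) (fun _ _ => 1) f := by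
  refine UB.of_fderivWithin (fun i _ _ => hκ i) (by simp) hI
    (fun i t ht => (hf i t ht).differentiableWithinAt) hb ?_
  simp only [inv_one, mul_one]
  refine (h.clm hI (ContinuousLinearMap.smulRightL ℝ ℝ F (1 : ℝ →L[ℝ] ℝ))).congr fun i t ht => ?_
  rw [(hf i t ht).hasFDerivWithinAt.fderivWithin (hI i t ht)]
  ext
  simp

theorem UB.derivWithin {ι : Type*} {F : Type} [NormedAddCommGroup F] [NormedSpace ℝ F]
    {I : ι → Set ℝ} (hI : ∀ i, UniqueDiffOn ℝ (I i)) {κ : ι → ℝ}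
    {n : ℕ} {f : ι → ℝ → F} (h : UB (n + 1) I (fun i _ => κ i) (fun _ _ => 1) f) :
    UB n I (fun i _ => κ i) (fun _ _ => 1) (fun i => derivWithin (f i) (I i)) := by
  have := (UB.fderivWithin h hI).clm hI (ContinuousLinearMap.apply ℝ F (1 : ℝ))
  simp only [inv_one, mul_one] at this
  exact this.congr fun i t _ => (fderivWithin_derivWithin).symm

variable {ι : Type*} {X : Type} [NormedAddCommGroup X] [NormedSpace ℝ X]
  {W : ι → Set X} {I : ι → Set ℝ}

theorem D1.graph (hI : ∀ i, UniqueDiffOn ℝ (I i)) {κ : ι → ℝ} {K : ℝ} (hK : 0 ≤ K)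
    (hκK : ∀ i, κ i ≤ K) {n : ℕ} {w : ι → ℝ → X} (y : ι → X)
    (hw : UB n I (fun i _ => κ i) (fun _ _ => 1) w) :
    D1 n I (fun i t => (y i + w i t, t)) := by
  have h1 := (hw.to_one hK (fun i _ _ => hκK i)).clm hI (ContinuousLinearMap.inl ℝ X ℝ)
  have h2 := D1.affine (n := n) hI (fun _ => ContinuousLinearMap.inr ℝ X ℝ) (fun i => (y i, 0))
    (fun _ => ContinuousLinearMap.norm_inr_le_one ℝ X ℝ)
  obtain ⟨e1, C, hC, e2⟩ := UD.add hI h1.toUD h2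
  have e : ∀ i t, (ContinuousLinearMap.inl ℝ X ℝ) (w i t) +
      ((ContinuousLinearMap.inr ℝ X ℝ) t + (y i, 0)) = (y i + w i t, t) := fun i t => by
    simp [add_comm]
  simp only [e] at e1 e2
  exact ⟨e1, C, hC, e2⟩

/-- Increments of a smooth function are as small as the displacement, with all time
derivatives. -/
theorem UB.increment (hW : ∀ i, IsOpen (W i)) (hI : ∀ i, UniqueDiffOn ℝ (I i)) {κ : ι → ℝ}
    (hκ : ∀ i, 0 ≤ κ i) {K : ℝ} (hK : 0 ≤ K) (hκK : ∀ i, κ i ≤ K) {n : ℕ} {w : ι → ℝ → X}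
    {y : ι → X} (hw : UB n I (fun i _ => κ i) (fun _ _ => 1) w) (hy : ∀ i, y i ∈ W i)
    (hmem : ∀ i, ∀ t ∈ I i, ∃ S ⊆ W i, Convex ℝ S ∧ y i ∈ S ∧ y i + w i t ∈ S)
    {F : Type} [NormedAddCommGroup F] [NormedSpace ℝ F] {ψ : ι → X → ℝ → F}
    (hψ : U1 (n + 1) (fun i => W i ×ˢ I i) (fun i => Function.uncurry (ψ i))) :
    UB n I (fun i _ => κ i) (fun _ _ => 1) (fun i t => ψ i (y i + w i t) t - ψ i (y i) t) := by
  have hWI : ∀ i, UniqueDiffOn ℝ (W i ×ˢ I i) := fun i => (hW i).uniqueDiffOn.prod (hI i)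
  have hm : ∀ i, ∀ t ∈ I i, (y i + w i t, t) ∈ W i ×ˢ I i := fun i t ht => by
    obtain ⟨S, hS, -, -, h⟩ := hmem i t ht
    exact ⟨hS h, ht⟩
  have hb : ∀ {ψ : ι → X → ℝ → F}, U1 1 (fun i => W i ×ˢ I i) (fun i => Function.uncurry (ψ i)) →
      ∃ C, 0 ≤ C ∧ ∀ i, ∀ t ∈ I i, ‖ψ i (y i + w i t) t - ψ i (y i) t‖ ≤ C * κ i := by
    intro ψ hψ
    obtain ⟨C, hC, h⟩ := U1.lipschitz_slice hW hI hψ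
    obtain ⟨C', hC', h'⟩ := hw.bound
    refine ⟨C * C', by positivity, fun i t ht => ?_⟩
    obtain ⟨S, hS, hc, h1, h2⟩ := hmem i t ht
    refine ((h i t ht).2.2 S hS hc _ h1 _ h2).trans ?_
    rw [add_sub_cancel_left, mul_assoc]
    exact mul_le_mul_of_nonneg_left (h' i t ht) hC
  induction n generalizing F ψ with
  | zero =>
    obtain ⟨C, hC, h⟩ := hb hψ
    have hgr := D1.graph hI hK hκK y hw
    refine ub_zero_iff.2 ⟨fun i => ?_, C, hC, h⟩
    have h1 : ContinuousOn (Function.uncurry (ψ i)) (W i ×ˢ I i) := (hψ.1 i).continuousOn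
    refine (h1.comp (hgr.1 i).continuousOn (hm i)).sub ?_
    exact h1.comp (f := fun t => (y i, t)) (by fun_prop) fun t ht => ⟨hy i, ht⟩
  | succ n ih =>
    obtain ⟨C, hC, h⟩ := hb (hψ.of_le (by omega))
    have hψ' := U1.fderivWithin hψ hWI
    have hgr := D1.graph hI hK hκK y (hw.of_le (Nat.le_succ n))
    -- The time derivative of the increment is D_xψ(y + w, t) w' plus the increment of ∂_tψ. The
    -- first term is small because w' is; the second is covered by the induction hypothesis, which
    -- consumes one order of smoothness of ψ.
    have hw' := UB.derivWithin hI hw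
    have hA : U1 n I (fun i t => _root_.fderivWithin ℝ (Function.uncurry (ψ i)) (W i ×ˢ I i)
        (y i + w i t, t)) := D1.comp hI hWI (hψ'.of_le (Nat.le_succ n)) hgr hm
    have hA' := hA.clm hI ((ContinuousLinearMap.compL ℝ X (X × ℝ) F).flip
      (ContinuousLinearMap.inl ℝ X ℝ))
    have h1 := UB.bilinear hI (ContinuousLinearMap.id ℝ (X →L[ℝ] F)) hA' hw'
    have h2 := ih (hw.of_le (Nat.le_succ n))
      (ψ := fun i x t => _root_.derivWithin (ψ i x) (I i) t)
      (UB.timeDeriv (fun i => (hW i).uniqueDiffOn) hI hψ) (fun {ψ} hψ => by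
        obtain ⟨C, hC, h⟩ := U1.lipschitz_slice hW hI hψ
        obtain ⟨C', hC', h'⟩ := hw.bound
        refine ⟨C * C', by positivity, fun i t ht => ?_⟩
        obtain ⟨S, hS, hc, h1, h2⟩ := hmem i t ht
        refine ((h i t ht).2.2 S hS hc _ h1 _ h2).trans ?_
        rw [add_sub_cancel_left, mul_assoc]
        exact mul_le_mul_of_nonneg_left (h' i t ht) hC)
    refine UB.of_derivWithin hI hκ (fun i t ht => ?_) h
      ((h1.weight (κ' := fun i _ => κ i) (η' := fun _ _ => 1) 1 zero_le_one
        (fun i t _ j _ => by simp)).add hI h2)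
    have hd := (hψ.1 i).differentiableOn (by norm_cast)
    have e1 : HasDerivWithinAt (w i) (_root_.derivWithin (w i) (I i) t) (I i) t :=
      (((hw.1 i).differentiableOn (by norm_cast)) t ht).hasDerivWithinAt
    have e2 : HasDerivWithinAt (fun t => (y i + w i t, t)) (_root_.derivWithin (w i) (I i) t, 1) (I i) t :=
      (e1.const_add (y i)).prodMk (hasDerivWithinAt_id t (I i))
    have e3 := (hd _ (hm i t ht)).hasFDerivWithinAt.comp_hasDerivWithinAt (f := fun t => (y i + w i t, t))
      (t := W i ×ˢ I i) t e2 (hm i)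
    have e4 := hasDerivWithinAt_of_uncurry (hm i t ht).1 (hd _ (hm i t ht))
    have e5 := hasDerivWithinAt_of_uncurry (hy i) (hd _ (show (y i, t) ∈ W i ×ˢ I i from ⟨hy i, ht⟩))
    refine (e3.sub e5).congr_deriv ?_
    rw [e4.derivWithin (hI i t ht), e5.derivWithin (hI i t ht)]
    have e6 : (_root_.derivWithin (w i) (I i) t, (1 : ℝ)) =
        (_root_.derivWithin (w i) (I i) t, 0) + ((0 : X), (1 : ℝ)) := by simp
    rw [e6, map_add]
    simp
    abel

end TimeSmallness

/-! ### Time derivatives of the displacement of size h when τ ≤ C h. -/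

section CflBounds

variable {d : ℕ} {Ω : Set (Space d)} {qs qt ℓ m : ℕ} {c : Consts} {Cb Cv E Ccfl : ℝ}

/-- Local problems without blending for which the time step is bounded by the mesh size. -/
abbrev CflProblem (Ω : Set (Space d)) (qs qt ℓ m : ℕ) (c : Consts) (Cb Cv E Ccfl : ℝ) : Type :=
  {P : SmallProblem Ω qs qt ℓ m c Cb Cv E // P.1.b = 0 ∧ P.1.D.τ ≤ Ccfl * P.1.D.h}

local notation "LP" => LocalProblem Ω qs qt ℓ m c Cb Cv
local notation "FP" => CflProblem Ω qs qt ℓ m c Cb Cv E Ccfl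

theorem UB.of_iteratedDerivWithin {ι : Type*} {F : Type} [NormedAddCommGroup F] [NormedSpace ℝ F]
    {n : ℕ} {I : ι → Set ℝ} {κ : ι → ℝ} {f : ι → ℝ → F} (h1 : ∀ i, ContDiffOn ℝ n (f i) (I i))
    {C : ℝ} (hC : 0 ≤ C)
    (h2 : ∀ i, ∀ k ≤ n, ∀ t ∈ I i, ‖iteratedDerivWithin k (f i) (I i) t‖ ≤ C * κ i) :
    UB n I (fun i _ => κ i) (fun _ _ => 1) f := by
  refine ⟨h1, C, hC, fun i k hk t ht => ?_⟩
  rw [norm_iteratedFDerivWithin_eq_norm_iteratedDerivWithin]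
  simpa using h2 i k hk t ht

/-- For k ≤ qt the exponent qt + 1 − k is at least one, so τ^(qt+1−k) ≤ τ ≤ Ccfl h. For k = qt + 1
this power is 1; hence the restriction to qt time derivatives with finite element blending. -/
theorem ub_err_time (hℓ : qt + 2 ≤ ℓ) (hqs : 1 ≤ qs) :
    UB qt (fun p : Σ P : FP, P.1.1.N => p.1.1.1.D.I) (fun p _ => p.1.1.1.D.h) (fun _ _ => 1)
      (fun p t => p.1.1.1.err p.2 t) := by
  obtain ⟨C, hC, h⟩ := exists_bound_of_finite (p := fun k C => ∀ P : LP, ∀ t ∈ P.D.I,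
    ∀ x ∈ P.N, |iteratedDerivWithin k (P.err x) P.D.I t| ≤
      C * (P.D.h ^ 2 + P.D.τ ^ (qt + 1 - k))) (fun k C C' hCC h P t ht x hx =>
        (h P t ht x hx).trans (mul_le_mul_of_nonneg_right hCC
          (by have := P.adm.τ_pos; positivity))) qt
    (fun k hk => (exists_timeDeriv_err_bound hℓ hqs hk).imp fun C h => h.2)
  refine UB.of_iteratedDerivWithin (C := C * (1 + |Ccfl|)) (fun p => ?_) (by positivity)
    fun p k hk t ht => ?_
  · exact (contDiffOn_lin p.1.1.1 qt p.2).sub ((contDiffOn_φ_time p.1.1.1 p.2.2).of_le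
      (by exact_mod_cast (by omega : qt ≤ ℓ)))
  · obtain ⟨⟨⟨P, hs⟩, hb, hcfl⟩, x, hx⟩ := p
    have hh := P.adm.h_pos
    have hτ := P.adm.τ_pos
    refine (h k hk P t ht x hx).trans ?_
    rw [mul_assoc]
    refine mul_le_mul_of_nonneg_left ?_ hC
    have h1 : P.D.τ ^ (qt + 1 - k) ≤ P.D.τ := pow_le_of_le_one hτ.le P.τ_le (by omega)
    have h2 : Ccfl * P.D.h ≤ |Ccfl| * P.D.h := mul_le_mul_of_nonneg_right (le_abs_self _) hh.le
    have h3 : P.D.h ^ 2 ≤ P.D.h := pow_le_of_le_one hh.le P.h_le (by omega)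
    change P.D.h ^ 2 + P.D.τ ^ (qt + 1 - k) ≤ (1 + |Ccfl|) * P.D.h
    change P.D.τ ≤ Ccfl * P.D.h at hcfl
    linarith

/-- Boundedness from `u1_dist` is not enough here; size h is wanted. Without blending, ∂_t d is a
bounded factor times ∂_t err, the increment of ∂_tφ from x to the displaced point, and d times a
bounded term. If d is O(h) with n time derivatives, so are all three, and n increases by one. -/
theorem ub_dist_time (hℓ : qt + 2 ≤ ℓ) (hqs : 1 ≤ qs) (hΩ : IsOpen Ω) (hm1 : qt + 1 ≤ m)
    (hm : m ≤ ℓ) {n : ℕ} (hn : n ≤ qt) :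
    UB n (fun p : Σ P : FP, P.1.1.N => p.1.1.1.D.I) (fun p _ => p.1.1.1.D.h) (fun _ _ => 1)
      (fun p t => p.1.1.1.dist p.2 t) ∧
    UB n (fun p : Σ P : FP, P.1.1.N => p.1.1.1.D.I) (fun p _ => p.1.1.1.D.h) (fun _ _ => 1)
      (fun p t => p.1.1.1.disp p.2 t) := by
  have hI : ∀ p : Σ P : FP, P.1.1.N, UniqueDiffOn ℝ p.1.1.1.D.I := fun p => p.1.1.1.hI
  have hNo : ∀ P : FP, UniqueDiffOn ℝ P.1.1.N := fun P => P.1.1.isOpen_N.uniqueDiffOn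
  have hIo : ∀ P : FP, UniqueDiffOn ℝ P.1.1.D.I := fun P => P.1.1.hI
  have hh : ∀ p : Σ P : FP, P.1.1.N, 0 ≤ p.1.1.1.D.h := fun p => p.1.1.1.adm.h_pos.le
  have hG : U1 m (fun P : FP => P.1.1.N ×ˢ P.1.1.D.I)
      (fun P => Function.uncurry P.1.1.D.G) :=
    (UB.restrict_N (u1_G (Ω := Ω) (qs := qs) (qt := qt) (m := m) (c := c) (Cb := Cb)
      (Cv := Cv) (ℓ := ℓ))).reindex (fun P : FP => P.1.1)
  have hGt : U1 m (fun p : Σ P : FP, P.1.1.N => p.1.1.1.D.I) (fun p t => p.1.1.1.D.G p.2 t) :=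
    UB.timeSlice hNo (κ := fun _ => 1) (by simp) hIo hG
  have hφ : U1 ℓ (fun P : FP => P.1.1.W ×ˢ P.1.1.D.I) (fun P => Function.uncurry P.1.1.D.φ) :=
    (u1_φ (Ω := Ω) (qs := qs) (qt := qt) (m := m) (c := c) (Cb := Cb)
      (Cv := Cv) (ℓ := ℓ)).reindex (fun P : FP => P.1.1)
  have hφ' : U1 ℓ (fun p : Σ P : FP, P.1.1.N => p.1.1.1.W ×ˢ p.1.1.1.D.I)
      (fun p => Function.uncurry p.1.1.1.D.φ) := hφ.reindex Sigma.fst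
  have hWo : ∀ p : Σ P : FP, P.1.1.N, IsOpen p.1.1.1.W := fun p => p.1.1.1.isOpen_W
  have hWI : ∀ p : Σ P : FP, P.1.1.N, UniqueDiffOn ℝ (p.1.1.1.W ×ˢ p.1.1.1.D.I) :=
    fun p => uniqueDiffOn_W_prod p.1.1.1
  have hdisp : ∀ {n}, n ≤ qt →
      UB n (fun p : Σ P : FP, P.1.1.N => p.1.1.1.D.I) (fun p _ => p.1.1.1.D.h) (fun _ _ => 1)
      (fun p t => p.1.1.1.dist p.2 t) →
      UB n (fun p : Σ P : FP, P.1.1.N => p.1.1.1.D.I) (fun p _ => p.1.1.1.D.h) (fun _ _ => 1)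
      (fun p t => p.1.1.1.disp p.2 t) := fun hn h =>
    (UB.smul hI h (hGt.of_le (by omega : _ ≤ m))).weight 1 zero_le_one (fun i x _ j _ => by simp)
  have hdd := ((u1_dist (Ω := Ω) (qs := qs) (qt := qt) (m := m) (c := c) (Cb := Cb)
      (Cv := Cv) (ℓ := ℓ) (E := E) hΩ hℓ (by omega) hm).1)
  have herr := ub_err_time (Ω := Ω) (m := m) (c := c) (Cb := Cb) (Cv := Cv) (E := E)
    (Ccfl := Ccfl) hℓ hqs
  obtain ⟨B, hB, hb⟩ := herr.bound
  have hdb : ∀ p : Σ P : FP, P.1.1.N, ∀ t ∈ p.1.1.1.D.I,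
      ‖p.1.1.1.dist p.2 t‖ ≤ c.cw⁻¹ * B * p.1.1.1.D.h := fun p t ht => by
    refine (p.1.1.2.abs_dist_le p.2.2 ht).trans ?_
    rw [mul_assoc]
    exact mul_le_mul_of_nonneg_left (hb p t ht) (inv_nonneg.2 c.cw_pos.le)
  have hddiff : ∀ p : Σ P : FP, P.1.1.N, ∀ t ∈ p.1.1.1.D.I,
      DifferentiableWithinAt ℝ (Function.uncurry p.1.1.1.dist) (p.1.1.1.N ×ˢ p.1.1.1.D.I)
        (p.2.1, t) := fun p t ht =>
    ((hdd p.1.1).differentiableOn (by exact_mod_cast (by omega : m ≠ 0))) _ ⟨p.2.2, ht⟩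
  induction n with
  | zero =>
    have h0 : UB 0 (fun p : Σ P : FP, P.1.1.N => p.1.1.1.D.I) (fun p _ => p.1.1.1.D.h)
        (fun _ _ => 1) (fun p t => p.1.1.1.dist p.2 t) :=
      ub_zero_iff.2 ⟨fun p t ht =>
        (hasDerivWithinAt_of_uncurry p.2.2 (hddiff p t ht)).continuousWithinAt,
        _, mul_nonneg (inv_nonneg.2 c.cw_pos.le) hB, hdb⟩
    exact ⟨h0, hdisp (Nat.zero_le _) h0⟩
  | succ n ih =>
    obtain ⟨ih1, ih2⟩ := ih (by omega)
    have hmemW : ∀ p : Σ P : FP, P.1.1.N, ∀ t ∈ p.1.1.1.D.I,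
        (p.2.1 + p.1.1.1.disp p.2 t, t) ∈ p.1.1.1.W ×ˢ p.1.1.1.D.I := fun p t ht =>
      ⟨p.1.1.2.mem_W p.2.2 ht, ht⟩
    have hgr := D1.graph hI (κ := fun p => p.1.1.1.D.h) zero_le_one (fun p => p.1.1.1.h_le)
      (fun p : Σ P : FP, P.1.1.N => p.2.1) ih2
    have hA := D1.comp hI hWI ((U1.fderivWithin (n := n) (hφ'.of_le (by omega)) hWI)) hgr hmemW
    have hGn := (hGt.of_le (by omega : n ≤ m)).clm hI (ContinuousLinearMap.inl ℝ (Space d) ℝ)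
    have ha := U1.bilinear hI (ContinuousLinearMap.id ℝ (Space d × ℝ →L[ℝ] ℝ)) hA hGn
    have hinv := U1.inv hI ha c.cw_pos (fun p t ht =>
      (fderivWithin_dist_apply hℓ hΩ (by omega) p.1.1 p.2.2 ht (0, 1)).1)
    have hGt' : U1 n (fun p : Σ P : FP, P.1.1.N => p.1.1.1.D.I)
        (fun p t => derivWithin (p.1.1.1.D.G p.2) p.1.1.1.D.I t) :=
      UB.timeSlice hNo (κ := fun _ => 1) (by simp) hIo
        (UB.timeDeriv hNo hIo (hG.of_le (by omega : n + 1 ≤ m)))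
    have hAG := U1.bilinear hI (ContinuousLinearMap.id ℝ (Space d × ℝ →L[ℝ] ℝ)) hA
      (hGt'.clm hI (ContinuousLinearMap.inl ℝ (Space d) ℝ))
    have hinc := UB.increment hWo hI hh zero_le_one (fun p => p.1.1.1.h_le)
      (y := fun p : Σ P : FP, P.1.1.N => p.2.1) ih2
      (fun p => p.1.1.1.N_subset_W p.2.2) (fun p t ht => ⟨Metric.ball p.2.1 p.1.1.1.D.h,
        p.1.1.1.ball_subset_W p.2.2, convex_ball _ _, Metric.mem_ball_self p.1.1.1.adm.h_pos,
        p.1.1.2.mem_ball p.2.2 ht⟩)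
      (ψ := fun p x t => derivWithin (p.1.1.1.D.φ x) p.1.1.1.D.I t)
      (UB.timeDeriv (fun p : Σ P : FP, P.1.1.N => (hWo p).uniqueDiffOn) hI
        (hφ'.of_le (by omega : n + 1 + 1 ≤ ℓ)))
    have het := UB.derivWithin hI (herr.of_le hn)
    have hδA := (UB.mul hI ih1 hAG).weight (κ' := fun p _ => p.1.1.1.D.h) (η' := fun _ _ => 1)
      1 zero_le_one (fun p t _ j _ => by simp)
    have hR := ((het.sub hI hinc).sub hI hδA)
    have hall := (UB.mul hI hinv hR).weight (κ' := fun p _ => p.1.1.1.D.h) (η' := fun _ _ => 1)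
      1 zero_le_one (fun p t _ j _ => by simp)
    have hres : UB (n + 1) (fun p : Σ P : FP, P.1.1.N => p.1.1.1.D.I) (fun p _ => p.1.1.1.D.h)
        (fun _ _ => 1) (fun p t => p.1.1.1.dist p.2 t) := by
      refine UB.of_derivWithin hI hh (fun p t ht => ?_) hdb hall
      have h1 := hasDerivWithinAt_of_uncurry p.2.2 (hddiff p t ht)
      refine h1.congr_deriv ?_
      rw [(fderivWithin_dist_apply hℓ hΩ (by omega) p.1.1 p.2.2 ht (0, 1)).2]
      have hxt : (p.2.1, t) ∈ p.1.1.1.N ×ˢ p.1.1.1.D.I := ⟨p.2.2, ht⟩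
      have hφd := (hφ'.1 p).differentiableOn (by exact_mod_cast (by omega : ℓ ≠ 0))
      have hGd := (hG.1 p.1).differentiableOn (by exact_mod_cast (by omega : m ≠ 0))
      have hed := ((u1_err (Ω := Ω) (qs := qs) (qt := qt) (m := m)
        (c := c) (Cb := Cb) (Cv := Cv) (ℓ := ℓ) hℓ le_rfl).1 p.1.1.1).differentiableOn
          (by exact_mod_cast (by omega : ℓ ≠ 0))
      rw [← (hasDerivWithinAt_of_uncurry p.2.2 (hGd _ hxt)).derivWithin (hI p t ht),
        ← (hasDerivWithinAt_of_uncurry p.2.2 (hed _ hxt)).derivWithin (hI p t ht),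
        ← (hasDerivWithinAt_of_uncurry (hmemW p t ht).1 (hφd _ (hmemW p t ht))).derivWithin
          (hI p t ht),
        ← (hasDerivWithinAt_of_uncurry (p.1.1.1.N_subset_W p.2.2)
          (hφd (p.2.1, t) ⟨p.1.1.1.N_subset_W p.2.2, ht⟩)).derivWithin (hI p t ht)]
      have hb0 : ∀ y : Space d, fderivWithin ℝ (Function.uncurry p.1.1.1.b)
          (p.1.1.1.N ×ˢ p.1.1.1.D.I) (y, t) = 0 := fun y => by
        rw [p.1.2.1]
        exact fderivWithin_const_apply _
      rw [hb0, p.1.2.1]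
      simp only [Pi.zero_apply, sub_zero, one_mul, _root_.zero_apply, zero_mul]
      congr 1
      simp only [ContinuousLinearMap.id_apply, ContinuousLinearMap.inl_apply]
      ring
    exact ⟨hres, hdisp hn hres⟩

theorem ub_disp_time (hℓ : qt + 2 ≤ ℓ) (hqs : 1 ≤ qs) (hΩ : IsOpen Ω) (hm1 : qt + 1 ≤ m)
    (hm : m ≤ ℓ) : ∃ C, 0 ≤ C ∧ ∀ P : FP, ∀ k ≤ qt, ∀ x ∈ P.1.1.N, ∀ t ∈ P.1.1.D.I,
      ‖iteratedDerivWithin k (P.1.1.disp x) P.1.1.D.I t‖ ≤ C * P.1.1.D.h := by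
  obtain ⟨-, C, hC, h⟩ := (ub_dist_time (Ω := Ω) (c := c) (Cb := Cb) (Cv := Cv)
    (E := E) (Ccfl := Ccfl) hℓ hqs hΩ hm1 hm le_rfl).2
  refine ⟨C, hC, fun P k hk x hx t ht => ?_⟩
  have := h ⟨P, x, hx⟩ k hk t ht
  rw [norm_iteratedFDerivWithin_eq_norm_iteratedDerivWithin] at this
  simpa using this

end CflBounds

/-! ### From the displacement to the mapping. -/

section Assembly

variable {d : ℕ}

theorem UnfittedSpaceTime.HasMixedDerivOn.add {F : Type} [NormedAddCommGroup F] [NormedSpace ℝ F]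
    {S : Set (Space d)} {I : Set ℝ} (hI : UniqueDiffOn ℝ I) {ls lt : ℕ}
    {f g : Space d → ℝ → F} (hf : HasMixedDerivOn S I ls lt f) (hg : HasMixedDerivOn S I ls lt g) :
    HasMixedDerivOn S I ls lt (fun x t => f x t + g x t) := by
  refine ⟨fun x hx => (hf.1 x hx).add (hg.1 x hx), fun t ht => ?_⟩
  refine ((hf.2 t ht).add (hg.2 t ht)).congr fun x hx => ?_
  exact iteratedDerivWithin_add ht hI (hf.1 x hx t ht) (hg.1 x hx t ht)

theorem mixedDeriv_add {F : Type} [NormedAddCommGroup F] [NormedSpace ℝ F]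
    {S : Set (Space d)} (hS : IsOpen S) {I : Set ℝ} (hI : UniqueDiffOn ℝ I) {ls lt : ℕ}
    {f g : Space d → ℝ → F} (hf : HasMixedDerivOn S I ls lt f) (hg : HasMixedDerivOn S I ls lt g)
    {x : Space d} (hx : x ∈ S) {t : ℝ} (ht : t ∈ I) :
    mixedDeriv I ls lt (fun x t => f x t + g x t) x t =
      mixedDeriv I ls lt f x t + mixedDeriv I ls lt g x t := by
  have h1 : (fun y => iteratedDerivWithin lt (fun u => f y u + g y u) I t) =ᶠ[nhds x]
      (fun y => iteratedDerivWithin lt (f y) I t) + fun y => iteratedDerivWithin lt (g y) I t := by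
    filter_upwards [hS.mem_nhds hx] with y hy
    exact iteratedDerivWithin_add ht hI (hf.1 y hy t ht) (hg.1 y hy t ht)
  rw [mixedDeriv, (Filter.EventuallyEq.iteratedFDeriv ℝ h1 ls).eq_of_nhds]
  exact iteratedFDeriv_add_apply ((hf.2 t ht).contDiffAt (hS.mem_nhds hx))
    ((hg.2 t ht).contDiffAt (hS.mem_nhds hx))

/-- All pairs (S, I) form one family, which yields a single constant. Boundedness of Ω is needed for
order zero. -/
theorem exists_mixedDeriv_id_bound {Ω : Set (Space d)} (hΩb : Bornology.IsBounded Ω) (ls lt : ℕ) :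
    ∃ C, 0 ≤ C ∧ ∀ S ⊆ closure Ω, IsOpen S → ∀ I : Set ℝ, UniqueDiffOn ℝ I →
      HasMixedDerivOn S I ls lt (fun x _ => x) ∧
      ∀ t ∈ I, ∀ x ∈ S, ‖mixedDeriv I ls lt (fun (x : Space d) _ => x) x t‖ ≤ C := by
  obtain ⟨R, hR⟩ := hΩb.closure.exists_norm_le
  let ι := {p : Set (Space d) × Set ℝ // p.1 ⊆ closure Ω ∧ IsOpen p.1 ∧ UniqueDiffOn ℝ p.2}
  have hu : ∀ p : ι, UniqueDiffOn ℝ (p.1.1 ×ˢ p.1.2) := fun p => p.2.2.1.uniqueDiffOn.prod p.2.2.2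
  have h1 : U1 (ls + lt) (fun p : ι => p.1.1 ×ˢ p.1.2)
      (fun _ => Function.uncurry fun (x : Space d) (_ : ℝ) => x) := by
    have := UD.toUB (by simp) (by simp) (D1.affine (n := ls + lt) hu
      (fun _ => ContinuousLinearMap.fst ℝ (Space d) ℝ) (fun _ => 0)
      (fun _ => ContinuousLinearMap.norm_fst_le ℝ (Space d) ℝ)) (C' := R) (fun p x hx => by
        simpa using hR _ (p.2.1 hx.1))
    exact this.congr fun p x _ => by simp [Function.uncurry]
  obtain ⟨C, hC, h⟩ := mixedDeriv_bound (fun p : ι => p.2.2.1) (fun p => p.2.2.2)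
    (f := fun _ x _ => x) h1
  exact ⟨C, hC, fun S hS hSo I hI => h ⟨(S, I), hS, hSo, hI⟩⟩

theorem exists_bound_of_finite₂ {p : ℕ → ℕ → ℝ → Prop}
    (hmono : ∀ k l C C', C ≤ C' → p k l C → p k l C') (n n' : ℕ)
    (h : ∀ k ≤ n, ∀ l ≤ n', ∃ C, p k l C) : ∃ C, 0 ≤ C ∧ ∀ k ≤ n, ∀ l ≤ n', p k l C :=
  exists_bound_of_finite (p := fun k C => ∀ l ≤ n', p k l C)
    (fun k C C' hC h l hl => hmono k l C C' hC (h l hl)) n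
    (fun k hk => (exists_bound_of_finite (hmono k) n' (h k hk)).imp fun _ h => h.2)

variable {Ω : Set (Space d)} {qs qt ℓ m : ℕ} {c : Consts} {Cb Cv E : ℝ}

local notation "SP" => SmallProblem Ω qs qt ℓ m c Cb Cv E

theorem exists_mixedDeriv_disp_bound (hΩ : IsOpen Ω) (hℓ : qt + 2 ≤ ℓ) (hm1 : 1 ≤ m) (hm : m ≤ ℓ)
    (n n' : ℕ) : ∃ C, 0 ≤ C ∧ ∀ ls ≤ n, ∀ lt ≤ n', ls + lt ≤ m → ∀ P : SP,
      HasMixedDerivOn P.1.N P.1.D.I ls lt P.1.disp ∧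
      ∀ t ∈ P.1.D.I, ∀ x ∈ P.1.N, ‖mixedDeriv P.1.D.I ls lt P.1.disp x t‖ ≤ C := by
  refine exists_bound_of_finite₂ (p := fun ls lt C => ls + lt ≤ m → ∀ P : SP,
      HasMixedDerivOn P.1.N P.1.D.I ls lt P.1.disp ∧
      ∀ t ∈ P.1.D.I, ∀ x ∈ P.1.N, ‖mixedDeriv P.1.D.I ls lt P.1.disp x t‖ ≤ C)
    (fun ls lt C C' hCC h hlm P => ⟨(h hlm P).1, fun t ht x hx => ((h hlm P).2 t ht x hx).trans hCC⟩)
    n n' fun ls _ lt _ => ?_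
  by_cases hlm : ls + lt ≤ m
  · obtain ⟨C, -, h⟩ := mixedDeriv_bound (fun P : SP => P.1.isOpen_N) (fun P => P.1.hI)
      (f := fun P : SP => P.1.disp) ((u1_disp hΩ hℓ hm1 hm).of_le hlm)
    exact ⟨C, fun _ => h⟩
  · exact ⟨0, fun h => absurd h hlm⟩

/-- On an element where the mapping is `id + w`, with `w` bounded, the mixed derivatives of the
mapping are bounded. -/
theorem highOrder_of_add {S S' : Set (Space d)} (hS : IsOpen S) {I : Set ℝ}
    (hI : UniqueDiffOn ℝ I) (hSS : S ⊆ S') {ls lt : ℕ} {Ψ w : Space d → ℝ → Space d} {C C' : ℝ}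
    (hid : HasMixedDerivOn S I ls lt (fun x _ => x) ∧
      ∀ t ∈ I, ∀ x ∈ S, ‖mixedDeriv I ls lt (fun (x : Space d) _ => x) x t‖ ≤ C)
    (hw : HasMixedDerivOn S' I ls lt w ∧ ∀ t ∈ I, ∀ x ∈ S, ‖mixedDeriv I ls lt w x t‖ ≤ C')
    (hΨ : ∀ x ∈ S, ∀ t ∈ I, Ψ x t = x + w x t) :
    HasMixedDerivOn S I ls lt Ψ ∧ ∀ t ∈ I, ∀ x ∈ S, ‖mixedDeriv I ls lt Ψ x t‖ ≤ C + C' := by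
  have hw1 : HasMixedDerivOn S I ls lt w := HasMixedDerivOn.congr hw.1 hSS fun _ _ _ _ => rfl
  refine ⟨HasMixedDerivOn.congr (HasMixedDerivOn.add hI hid.1 hw1) subset_rfl hΨ, fun t ht x hx => ?_⟩
  rw [mixedDeriv_congr hS hΨ hx ht, mixedDeriv_add hS hI hid.1 hw1 hx ht]
  exact (norm_add_le _ _).trans (add_le_add (hid.2 t ht x hx) (hw.2 t ht x hx))

theorem fderiv_of_add {S : Set (Space d)} (hS : IsOpen S) {Ψ w : Space d → Space d}
    (hΨ : ∀ x ∈ S, Ψ x = x + w x) {x : Space d} (hx : x ∈ S) (hw : DifferentiableAt ℝ w x) :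
    DifferentiableAt ℝ Ψ x ∧
      fderiv ℝ Ψ x - ContinuousLinearMap.id ℝ (Space d) = fderiv ℝ w x := by
  have h1 : HasFDerivAt Ψ (ContinuousLinearMap.id ℝ (Space d) + fderiv ℝ w x) x :=
    ((hasFDerivAt_id x).add hw.hasFDerivAt).congr_of_eventuallyEq (by
      filter_upwards [hS.mem_nhds hx] with y hy
      exact hΨ y hy)
  exact ⟨h1.differentiableAt, by rw [h1.fderiv, add_sub_cancel_left]⟩

theorem derivWithin_of_add {I : Set ℝ} (hI : UniqueDiffOn ℝ I) {x : Space d}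
    {Ψ w : ℝ → Space d} (hΨ : ∀ t ∈ I, Ψ t = x + w t) {t : ℝ} (ht : t ∈ I)
    (hw : DifferentiableWithinAt ℝ w I t) :
    DifferentiableWithinAt ℝ Ψ I t ∧ derivWithin Ψ I t = derivWithin w I t := by
  have h1 : HasDerivWithinAt Ψ (derivWithin w I t) I t :=
    (hw.hasDerivWithinAt.const_add x).congr_of_mem hΨ ht
  exact ⟨h1.differentiableWithinAt, h1.derivWithin (hI t ht)⟩

end Assembly

/-! ### Smooth blending. -/

section Smooth

variable {d : ℕ} {Ω : Set (Space d)} {qs qt ℓ m : ℕ} {c : Consts} {wb Cb : ℝ} {D : Slab d}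
  {b : Space d → ℝ → ℝ}

/-- A cut element has interior points in Ω, and b = 0 < 1 there. -/
theorem UnfittedSpaceTime.SmoothBlending.cut_subset (hA : Admissible Ω qs qt ℓ m c D)
    (hB : SmoothBlending Ω qs qt ℓ c wb Cb D b) : D.cutCells Ω ⊆ D.blendCells Ω b := by
  rintro s hs
  obtain ⟨y, hy⟩ := (hA.mesh.isSimplex hs.1).interior_nonempty
  obtain ⟨x, hx1, hx2⟩ := mem_closure_iff.1 (hA.mesh.cell_subset hs.1 (interior_subset hy))
    _ isOpen_interior hy
  obtain ⟨t, ht, -⟩ := hs.2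
  refine ⟨hs.1, t, ht, x, ⟨interior_subset hx1, hx2⟩, ?_⟩
  rw [hB.zero_on_cut x ⟨cell_subset_region hs (interior_subset hx1), hx2⟩ t ht]
  exact zero_lt_one

/-- Where b < 1 the distance to the discrete interface is at most wb; in particular the interface is
not empty. Adding h makes the bound strict, so that a point z can be selected. -/
theorem UnfittedSpaceTime.SmoothBlending.exists_frontier (hA : Admissible Ω qs qt ℓ m c D)
    (hB : SmoothBlending Ω qs qt ℓ c wb Cb D b) (hwb : 0 < wb) {s : Finset (Space d)}
    (hs : s ∈ D.blendCells Ω b) : ∃ t ∈ D.I, ∃ x ∈ cell s, ∃ z ∈ frontier (D.domLin Ω t),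
      dist x z < wb + D.h := by
  obtain ⟨-, t, ht, x, ⟨hx, hxΩ⟩, hb⟩ := hs
  refine ⟨t, ht, x, hx, ?_⟩
  have h1 : Metric.infEDist x (frontier (D.domLin Ω t)) ≤ ENNReal.ofReal wb := by
    by_contra! h
    rw [hB.one_far t ht x hxΩ h] at hb
    exact lt_irrefl _ hb
  have hh := hA.h_pos
  have h2 : Metric.infEDist x (frontier (D.domLin Ω t)) < ENNReal.ofReal (wb + D.h) :=
    h1.trans_lt ((ENNReal.ofReal_lt_ofReal_iff (by linarith)).2 (by linarith))
  obtain ⟨z, hz, hd⟩ := Metric.infEDist_lt_iff.1 h2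
  refine ⟨z, hz, ?_⟩
  rwa [edist_dist, ENNReal.ofReal_lt_ofReal_iff (by linarith)] at hd

/-- The field `vertex` comes from the gradient bound on ∂_t^k (φ − φh) that is assumed for smooth
blending; both powers in it are at most one, whence the factor 2. -/
theorem UnfittedSpaceTime.SmoothBlending.localProblem (hA : Admissible Ω qs qt ℓ m c D)
    (hℓ : qt + 2 ≤ ℓ)
    (hB : SmoothBlending Ω qs qt ℓ c wb Cb D b) (hh : D.h ≤ 1) (hτ : D.τ ≤ 1)
    {s : Finset (Space d)} (hs : s ∈ D.blendCells Ω b)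
    (hball : ∀ x ∈ cell s, Metric.ball x (2 * D.h) ⊆ interior (region (D.cellsU Ω c.δU))) :
    ∃ P : LocalProblem Ω qs qt ℓ m c Cb (|c.Cap| * 2), P.D = D ∧ P.b = b ∧ P.s = s := by
  refine ⟨⟨D, b, s, hA, hh, hτ, hB.active hs, hball, hB.range, hB.smooth, hB.bound, ?_⟩,
    rfl, rfl, rfl⟩
  intro k hk t ht u hu v hv
  have h0 := hA.h_pos
  have h1 := hA.τ_pos
  refine (hA.error_lipschitz (hB.active hs) (by omega) ht (B := |c.Cap| * 2) (fun x hx => ?_)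
    (mem_cell_of_vertex hu) (mem_cell_of_vertex hv)).trans ?_
  · refine (hB.φh_approx_grad k (by omega) s (hB.active hs) x hx t ht).trans ?_
    refine mul_le_mul (le_abs_self _) ?_ (by positivity) (abs_nonneg _)
    have := pow_le_one₀ h0.le hh (n := qs)
    have := pow_le_one₀ h1.le hτ (n := qt + 1 - k)
    linarith
  · exact mul_le_mul_of_nonneg_left (dist_le_diam_cell (mem_cell_of_vertex hu)
      (mem_cell_of_vertex hv)) (by positivity)

theorem smoothBlending_bounds (hΩ : IsOpen Ω) (hΩb : Bornology.IsBounded Ω)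
    (hqs : 1 ≤ qs) (hqt : 1 ≤ qt) (hℓ : qt + 2 ≤ ℓ) (hm1 : 1 ≤ m) (hm : m ≤ ℓ) (c : Consts)
    (wb Cb : ℝ) (hwb0 : 0 < wb) (hwb : wb < min c.δΩ c.δU) :
    ∃ C h₀ τ₀ : ℝ, 0 < C ∧ 0 < h₀ ∧ 0 < τ₀ ∧
      ∀ (D : Slab d) (b : Space d → ℝ → ℝ), Admissible Ω qs qt ℓ m c D →
        SmoothBlending Ω qs qt ℓ c wb Cb D b → D.h ≤ h₀ → D.τ ≤ τ₀ →
        D.WellPosed Ω b (D.blendCells Ω b) ∧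
        LowOrderBounds Ω qt D (D.ΨSmooth Ω b) C ∧
        GradBound D (D.ΨSmooth Ω b) 1 (C * (D.h + D.τ ^ (qt + 1))) ∧
        ∀ ls lt : ℕ, ls ≤ qs + 1 → lt ≤ qt + 1 → ls + lt ≤ m →
          HighOrderBound D (D.ΨSmooth Ω b) ls lt C := by
  obtain ⟨ρ₁, hρ₁, hball⟩ := ball_subset_region_cellsU (m := m) hΩ hqs hqt hℓ c hwb
  obtain ⟨E, ρ₂, hρ₂, hsmall⟩ := exists_small (Ω := Ω) (qs := qs) (qt := qt) (m := m) (c := c)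
    (Cb := Cb) (Cv := |c.Cap| * 2) (ℓ := ℓ) hℓ hqs
  obtain ⟨C₁, hC₁, hlow⟩ := exists_disp_bounds (Ω := Ω) (qs := qs) (qt := qt) (m := m) (c := c)
    (Cb := Cb) (Cv := |c.Cap| * 2) (ℓ := ℓ) (E := E) hℓ hqs hqt hΩ hm1 hm
  obtain ⟨C₂, hC₂, hhigh⟩ := exists_mixedDeriv_disp_bound (Ω := Ω) (qs := qs) (qt := qt) (m := m)
    (c := c) (Cb := Cb) (Cv := |c.Cap| * 2) (ℓ := ℓ) (E := E) hΩ hℓ hm1 hm (qs + 1) (qt + 1)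
  obtain ⟨C₃, hC₃, hid⟩ := exists_bound_of_finite₂ (p := fun ls lt C => ∀ S ⊆ closure Ω,
      IsOpen S → ∀ I : Set ℝ, UniqueDiffOn ℝ I →
      HasMixedDerivOn S I ls lt (fun x _ => x) ∧
      ∀ t ∈ I, ∀ x ∈ S, ‖mixedDeriv I ls lt (fun (x : Space d) _ => x) x t‖ ≤ C)
    (fun ls lt C C' hCC h S hS hSo I hI => ⟨(h S hS hSo I hI).1,
      fun t ht x hx => ((h S hS hSo I hI).2 t ht x hx).trans hCC⟩) (qs + 1) (qt + 1)
    (fun ls _ lt _ => (exists_mixedDeriv_id_bound hΩb ls lt).imp fun _ h => h.2)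
  refine ⟨C₁ + C₂ + C₃ + 1, min (min (ρ₁ / 2) ρ₂) 1, min (ρ₁ / 2) 1, by positivity, by positivity,
    by positivity, fun D b hA hB hh hτ => ?_⟩
  have hh1 : D.h ≤ 1 := hh.trans (min_le_right _ _)
  have hτ1 : D.τ ≤ 1 := hτ.trans (min_le_right _ _)
  have hh0 := hA.h_pos
  have hτ0 := hA.τ_pos
  have hρ : D.h + D.τ ≤ ρ₁ := by
    linarith [hh.trans ((min_le_left _ _).trans (min_le_left _ _)), hτ.trans (min_le_left _ _)]
  -- the local problem on every active element
  have hP : ∀ s ∈ D.blendCells Ω b, ∃ P : SmallProblem Ω qs qt ℓ m c Cb (|c.Cap| * 2) E,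
      P.1.D = D ∧ P.1.b = b ∧ P.1.s = s := fun s hs => by
    obtain ⟨P, e1, e2, e3⟩ := hB.localProblem hA hℓ hh1 hτ1 hs (hball D hA
      ((hB.cut_subset hA).trans hB.active) hρ s hs.1 (hB.exists_frontier hA hwb0 hs))
    exact ⟨⟨P, hsmall P (by rw [e1]; exact hh.trans ((min_le_left _ _).trans (min_le_right _ _)))⟩,
      e1, e2, e3⟩
  have hact : ∀ s ∈ D.blendCells Ω b, ∃ P : SmallProblem Ω qs qt ℓ m c Cb (|c.Cap| * 2) E,
      P.1.D = D ∧ cell s ⊆ P.1.N ∧ ∀ x ∈ cell s, ∀ t ∈ D.I,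
        D.ΨSmooth Ω b x t = x + P.1.disp x t := fun s hs => by
    obtain ⟨P, e1, e2, e3⟩ := hP s hs
    subst e1 e2 e3
    refine ⟨P, rfl, P.1.cell_subset_N, fun x hx t ht => ?_⟩
    rw [Slab.ΨSmooth, if_pos (cell_subset_region hs hx), P.2.ΨΓ_eq hx ht]
  -- On an inactive element b = 1 throughout. Points it shares with an active element therefore have
  -- zero displacement, and the two definitions of the mapping agree.
  have hinact : ∀ s ∈ D.K.facets, s ∉ D.blendCells Ω b → ∀ x ∈ cell s ∩ Ω, ∀ t ∈ D.I,
      D.ΨSmooth Ω b x t = x := by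
    intro s hs hsb x hx t ht
    by_cases hxr : x ∈ region (D.blendCells Ω b)
    · obtain ⟨s', hs', hxs'⟩ := mem_region.1 hxr
      obtain ⟨P, e1, e2, e3⟩ := hP s' hs'
      subst e1 e2 e3
      have hb1 : P.1.b x t = 1 := by
        refine le_antisymm (hB.range x hx.2 t ht).2 ?_
        by_contra! h
        exact hsb ⟨hs, t, ht, x, hx, h⟩
      rw [Slab.ΨSmooth, if_pos hxr, P.2.ΨΓ_eq hxs' ht, LocalProblem.disp,
        P.2.dist_eq_zero (P.1.cell_subset_N hxs') ht hb1, zero_smul, add_zero]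
    · rw [Slab.ΨSmooth, if_neg hxr]
  have hinact' : ∀ x, x ∉ region (D.blendCells Ω b) → ∀ t, D.ΨSmooth Ω b x t = x :=
    fun x hx t => by rw [Slab.ΨSmooth, if_neg hx]
  have hout : ∀ s ∈ D.K.facets, s ∉ D.blendCells Ω b → ∀ x ∈ interior (cell s),
      x ∉ region (D.blendCells Ω b) := fun s hs hsb x hx hxr => by
    obtain ⟨s', hs', hxs'⟩ := mem_region.1 hxr
    exact hsb (hA.mesh.eq_of_interior hs hs'.1 hx hxs' ▸ hs')
  have hI := D.uniqueDiffOn_I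
  refine ⟨?_, ⟨?_, ?_, ?_⟩, ?_, ?_⟩
  · intro x hx t ht
    obtain ⟨s, hs, hxs⟩ := mem_region.1 hx
    obtain ⟨P, e1, e2, e3⟩ := hP s hs
    subst e1 e2 e3
    exact P.2.existsUnique hxs ht
  · intro t ht
    refine hA.mesh.continuousOn_of_cells_inter fun s hs => ?_
    by_cases hsb : s ∈ D.blendCells Ω b
    · obtain ⟨P, rfl, hN, hΨ⟩ := hact s hsb
      have : ContinuousOn (fun x => x + P.1.disp x t) (cell s ∩ Ω) := fun x hx =>
        (continuousAt_id.add ((hlow P t ht x (hN hx.1)).2.2.1.continuousAt)).continuousWithinAt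
      exact this.congr fun x hx => hΨ x hx.1 t ht
    · exact continuousOn_id.congr fun x hx => hinact s hs hsb x hx t ht
  · intro t ht x hx
    have hC : C₁ ≤ C₁ + C₂ + C₃ + 1 := by linarith
    by_cases hxr : x ∈ region (D.blendCells Ω b)
    · obtain ⟨s, hs, hxs⟩ := mem_region.1 hxr
      obtain ⟨P, rfl, hN, hΨ⟩ := hact s hs
      rw [hΨ x hxs t ht, add_sub_cancel_left]
      exact (hlow P t ht x (hN hxs)).1.trans (mul_le_mul_of_nonneg_right hC (by positivity))
    · rw [hinact' x hxr, sub_self, norm_zero]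
      positivity
  · intro x hx t ht
    have hC : C₁ ≤ C₁ + C₂ + C₃ + 1 := by linarith
    by_cases hxr : x ∈ region (D.blendCells Ω b)
    · obtain ⟨s, hs, hxs⟩ := mem_region.1 hxr
      obtain ⟨P, rfl, hN, hΨ⟩ := hact s hs
      obtain ⟨h1, h2⟩ := (hlow P t ht x (hN hxs)).2.1
      obtain ⟨h3, h4⟩ := derivWithin_of_add hI (hΨ x hxs) ht h1
      refine ⟨h3, ?_⟩
      rw [h4]
      exact h2.trans (mul_le_mul_of_nonneg_right hC (by positivity))
    · have h0 : D.ΨSmooth Ω b x = fun _ => x := funext fun t => hinact' x hxr t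
      rw [h0]
      refine ⟨differentiableWithinAt_const _, ?_⟩
      rw [derivWithin_fun_const, Pi.zero_apply, norm_zero]
      positivity
  · intro t ht s hs x hx
    have hC : C₁ ≤ C₁ + C₂ + C₃ + 1 := by linarith
    rw [one_mul]
    by_cases hsb : s ∈ D.blendCells Ω b
    · obtain ⟨P, rfl, hN, hΨ⟩ := hact s hsb
      obtain ⟨h1, h2⟩ := (hlow P t ht x (hN (interior_subset hx))).2.2
      obtain ⟨h3, h4⟩ := fderiv_of_add isOpen_interior (Ψ := fun y => P.1.D.ΨSmooth Ω b y t)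
        (fun y hy => hΨ y (interior_subset hy) t ht) hx h1
      refine ⟨h3, ?_⟩
      rw [h4]
      exact h2.trans (mul_le_mul_of_nonneg_right hC (by positivity))
    · obtain ⟨h3, h4⟩ := fderiv_of_add isOpen_interior (Ψ := fun y => D.ΨSmooth Ω b y t)
        (w := fun _ => 0) (fun y hy => by rw [hinact' y (hout s hs hsb y hy), add_zero]) hx
        (differentiableAt_const _)
      refine ⟨h3, ?_⟩
      rw [h4, fderiv_fun_const, Pi.zero_apply, norm_zero]
      positivity
  · intro ls lt hls hlt hlm s hs
    have hi := hid ls hls lt hlt (interior (cell s))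
      (interior_subset.trans (hA.mesh.cell_subset hs)) isOpen_interior D.I hI
    by_cases hsb : s ∈ D.blendCells Ω b
    · obtain ⟨P, rfl, hN, hΨ⟩ := hact s hsb
      obtain ⟨h1, h2⟩ := hhigh ls hls lt hlt hlm P
      obtain ⟨h3, h4⟩ := highOrder_of_add isOpen_interior hI (interior_subset.trans hN) hi
        ⟨h1, fun t ht x hx => h2 t ht x (hN (interior_subset hx))⟩
        (fun x hx t ht => hΨ x (interior_subset hx) t ht)
      exact ⟨h3, fun t ht x hx => (h4 t ht x hx).trans (by linarith)⟩
    · have he : ∀ x ∈ interior (cell s), ∀ t ∈ D.I, D.ΨSmooth Ω b x t = x := fun x hx t _ =>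
        hinact' x (hout s hs hsb x hx) t
      refine ⟨HasMixedDerivOn.congr hi.1 subset_rfl he, fun t ht x hx => ?_⟩
      rw [mixedDeriv_congr isOpen_interior he hx ht]
      exact (hi.2 t ht x hx).trans (by linarith)

end Smooth

/-! ### Homogeneous polynomials in barycentric coordinates -/

section HomPoly

variable {d : ℕ} {F : Type} [NormedAddCommGroup F] [NormedSpace ℝ F]

/-- `P` is a homogeneous polynomial of degree `l` in the barycentric coordinates of `s`, with
coefficients bounded by `c`. -/
def HomPoly (s : Finset (Space d)) : ℕ → ℝ → (Space d → F) → Prop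
  | 0, c, P => ∃ a, ‖a‖ ≤ c ∧ ∀ x, P x = a
  | l + 1, c, P => ∃ Q : Space d → Space d → F, (∀ v ∈ s, HomPoly s l c (Q v)) ∧
      ∀ x, P x = ∑ v ∈ s, bary s x v • Q v x

variable {s : Finset (Space d)} {l : ℕ} {c c' : ℝ} {P P' : Space d → F}

theorem HomPoly.mono (h : HomPoly s l c P) (hc : c ≤ c') : HomPoly s l c' P := by
  induction l generalizing P with
  | zero => obtain ⟨a, ha, h⟩ := h; exact ⟨a, ha.trans hc, h⟩
  | succ l ih => obtain ⟨Q, hQ, h⟩ := h; exact ⟨Q, fun v hv => ih (hQ v hv), h⟩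

theorem HomPoly.congr (h : HomPoly s l c P) (he : ∀ x, P' x = P x) : HomPoly s l c P' := by
  rwa [show P' = P from funext he]

theorem HomPoly.zero (l : ℕ) (hc : 0 ≤ c) : HomPoly s l c (fun _ => (0 : F)) := by
  induction l with
  | zero => exact ⟨0, by simpa using hc, fun _ => rfl⟩
  | succ l ih => exact ⟨fun _ _ => 0, fun _ _ => ih, by simp⟩

theorem HomPoly.add (h : HomPoly s l c P) (h' : HomPoly s l c' P') :
    HomPoly s l (c + c') (fun x => P x + P' x) := by
  induction l generalizing P P' with
  | zero =>
    obtain ⟨a, ha, h⟩ := h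
    obtain ⟨b, hb, h'⟩ := h'
    exact ⟨a + b, norm_add_le_of_le ha hb, fun x => by simp only [h, h']⟩
  | succ l ih =>
    obtain ⟨Q, hQ, h⟩ := h
    obtain ⟨Q', hQ', h'⟩ := h'
    exact ⟨fun v x => Q v x + Q' v x, fun v hv => ih (hQ v hv) (hQ' v hv), fun x => by
      simp only [h, h', smul_add, Finset.sum_add_distrib]⟩

theorem HomPoly.smul (a : ℝ) (h : HomPoly s l c P) : HomPoly s l (|a| * c) (fun x => a • P x) := by
  induction l generalizing P with
  | zero =>
    obtain ⟨b, hb, h⟩ := h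
    exact ⟨a • b, by
      rw [norm_smul, Real.norm_eq_abs]; exact mul_le_mul_of_nonneg_left hb (abs_nonneg a),
      fun x => by simp only [h]⟩
  | succ l ih =>
    obtain ⟨Q, hQ, h⟩ := h
    exact ⟨fun v x => a • Q v x, fun v hv => ih (hQ v hv), fun x => by
      simp only [h, Finset.smul_sum, smul_comm a]⟩

theorem HomPoly.sum {α : Type*} (t : Finset α) {P : α → Space d → F}
    (h : ∀ a ∈ t, HomPoly s l c (P a)) : HomPoly s l (t.card * c) (fun x => ∑ a ∈ t, P a x) := by
  classical
  induction t using Finset.induction_on with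
  | empty => simpa using HomPoly.zero l le_rfl
  | insert a t ha ih =>
    have h1 := (h a (Finset.mem_insert_self a t)).add
      (ih fun b hb => h b (Finset.mem_insert_of_mem hb))
    refine (h1.congr fun x => Finset.sum_insert ha).mono (le_of_eq ?_)
    rw [Finset.card_insert_of_notMem ha]
    push_cast
    ring

theorem HomPoly.linear_smul (b : Space d → ℝ) {B : ℝ} (hc : 0 ≤ c) (hb : ∀ v ∈ s, |b v| ≤ B)
    (h : HomPoly s l c P) :
    HomPoly s (l + 1) (B * c) (fun x => (∑ v ∈ s, b v * bary s x v) • P x) :=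
  ⟨fun v x => b v • P x, fun v hv => (h.smul (b v)).mono (mul_le_mul_of_nonneg_right (hb v hv) hc),
    fun x => by simp only [Finset.sum_smul, smul_smul, mul_comm]⟩

/-- Multiplication by Σ λ_v = 1. Homogeneous polynomials of degree l thus include all of lower
degree, with the same coefficient bound. -/
theorem HomPoly.raise (hs : IsSimplex s) (hc : 0 ≤ c) (h : HomPoly s l c P) :
    HomPoly s (l + 1) c P := by
  have := h.linear_smul (fun _ => 1) hc (B := 1) (by simp)
  rw [one_mul] at this
  exact this.congr fun x => by simp [hs.sum_bary]

theorem HomPoly.raise_le (hs : IsSimplex s) (hc : 0 ≤ c) (h : HomPoly s l c P) {l' : ℕ}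
    (hl : l ≤ l') : HomPoly s l' c P := by
  induction hl with
  | refl => exact h
  | step _ ih => exact ih.raise hs hc

theorem HomPoly.prod_range (n : ℕ) (b : ℕ → Space d → ℝ) {B : ℝ} (hB : 0 ≤ B) (hc : 0 ≤ c)
    (hb : ∀ i < n, ∀ v ∈ s, |b i v| ≤ B) (h : HomPoly s l c P) :
    HomPoly s (l + n) (B ^ n * c)
      (fun x => (∏ i ∈ Finset.range n, ∑ v ∈ s, b i v * bary s x v) • P x) := by
  induction n with
  | zero => simpa using h
  | succ n ih =>
    have h1 := (ih fun i hi => hb i (by omega)).linear_smul (b n)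
      (mul_nonneg (pow_nonneg hB n) hc) (hb n (by omega))
    refine (h1.congr fun x => ?_).mono (le_of_eq (by ring))
    rw [Finset.prod_range_succ, smul_smul, mul_comm]

theorem HomPoly.prod {α : Type*} (t : Finset α) (n : α → ℕ) (b : α → ℕ → Space d → ℝ) {B : ℝ}
    (hB : 0 ≤ B) (hc : 0 ≤ c) (hb : ∀ a ∈ t, ∀ i < n a, ∀ v ∈ s, |b a i v| ≤ B)
    (h : HomPoly s l c P) :
    HomPoly s (l + ∑ a ∈ t, n a) (B ^ (∑ a ∈ t, n a) * c)
      (fun x => (∏ a ∈ t, ∏ i ∈ Finset.range (n a), ∑ v ∈ s, b a i v * bary s x v) • P x) := by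
  classical
  induction t using Finset.induction_on with
  | empty => simpa using h
  | insert a t ha ih =>
    have h1 := HomPoly.prod_range (n a) (b a) hB (mul_nonneg (pow_nonneg hB _) hc)
      (hb a (Finset.mem_insert_self a t)) (ih fun a' ha' => hb a' (Finset.mem_insert_of_mem ha'))
    rw [Finset.sum_insert ha, add_comm (n a), ← add_assoc]
    refine (h1.congr fun x => ?_).mono (le_of_eq (by rw [pow_add]; ring))
    rw [Finset.prod_insert ha, smul_smul]

end HomPoly

/-! ### Exactness of Lagrange interpolation. -/

section Lagrange

variable {d : ℕ}

/-- The basis functions of nodal interpolation in terms of scaled barycentric coordinates. -/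
noncomputable def lagWeight (f : Finset (Space d)) (y : Space d → ℝ) (α : Space d → ℕ) : ℝ :=
  ∏ v ∈ f, ∏ i ∈ Finset.range (α v), (y v - i) / ((α v : ℝ) - i)

variable {f : Finset (Space d)} {y : Space d → ℝ}

/-- `lagWeight` is a product of generalised binomial coefficients C(y_v, α_v), and this is the
absorption identity (β + 1) C(y, β + 1) = y C(y − 1, β) in one factor. -/
theorem lagWeight_add_single {u : Space d} (hu : u ∈ f) (β : Space d → ℕ) :
    lagWeight f y (β + Pi.single u 1) * ((β u : ℝ) + 1) =
      y u * lagWeight f (y - Pi.single u 1) β := by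
  rw [lagWeight, lagWeight, ← Finset.mul_prod_erase _ _ hu, ← Finset.mul_prod_erase _ _ hu]
  have h1 : ∏ v ∈ f.erase u, ∏ i ∈ Finset.range ((β + Pi.single u 1 : Space d → ℕ) v),
        (y v - i) / (((β + Pi.single u 1 : Space d → ℕ) v : ℝ) - i) =
      ∏ v ∈ f.erase u, ∏ i ∈ Finset.range (β v),
        ((y - Pi.single u 1 : Space d → ℝ) v - i) / ((β v : ℝ) - i) := by
    refine Finset.prod_congr rfl fun v hv => ?_
    have hne := Finset.ne_of_mem_erase hv
    simp [Pi.single_eq_of_ne hne]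
  rw [h1]
  simp only [Pi.add_apply, Pi.sub_apply, Pi.single_eq_same]
  rw [Finset.prod_range_succ']
  have h2 : ∀ i ∈ Finset.range (β u), (y u - ((i + 1 : ℕ) : ℝ)) / (((β u + 1 : ℕ) : ℝ) - ((i + 1 : ℕ) : ℝ)) =
      (y u - 1 - i) / ((β u : ℝ) - i) := fun i _ => by
    push_cast
    congr 1 <;> ring
  rw [Finset.prod_congr rfl h2]
  have h3 : ((β u : ℝ) + 1) ≠ 0 := by positivity
  push_cast
  simp only [sub_zero]
  field_simp

/-- Terms with α_u = 0 drop out and the others are α = β + e_u: a factor α_u lowers degree and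
argument by one. All exactness results follow from this recursion. -/
theorem sum_lagWeight_mul {u : Space d} (hu : u ∈ f) (j : ℕ) (g : (Space d → ℕ) → ℝ) :
    ∑ α ∈ f.piAntidiag (j + 1), lagWeight f y α * ((α u : ℝ) * g α) =
      y u * ∑ β ∈ f.piAntidiag j, lagWeight f (y - Pi.single u 1) β * g (β + Pi.single u 1) := by
  have hinj : Function.Injective fun β : Space d → ℕ => β + Pi.single u 1 := add_left_injective _
  have hsum : ∀ β : Space d → ℕ, ∑ v ∈ f, (β + Pi.single u 1 : Space d → ℕ) v =
      ∑ v ∈ f, β v + 1 := fun β => by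
    simp [Finset.sum_add_distrib, Finset.sum_pi_single', hu]
  have h1 : ∑ α ∈ f.piAntidiag (j + 1), lagWeight f y α * ((α u : ℝ) * g α) =
      ∑ α ∈ (f.piAntidiag j).map ⟨_, hinj⟩, lagWeight f y α * ((α u : ℝ) * g α) := by
    symm
    refine Finset.sum_subset (fun α hα => ?_) fun α hα hα' => ?_
    · obtain ⟨β, hβ, rfl⟩ := Finset.mem_map.1 hα
      rw [Finset.mem_piAntidiag] at hβ ⊢
      refine ⟨by change ∑ v ∈ f, (β + Pi.single u 1 : Space d → ℕ) v = _; rw [hsum, hβ.1],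
        fun v hv => ?_⟩
      by_cases hvu : v = u
      · exact hvu ▸ hu
      · exact hβ.2 v (by simpa [Pi.single_eq_of_ne hvu] using hv)
    · rcases Nat.eq_zero_or_pos (α u) with h0 | h0
      · simp [h0]
      · exfalso
        refine hα' (Finset.mem_map.2 ⟨α - Pi.single u 1, ?_, ?_⟩)
        · have he : (α - Pi.single u 1) + Pi.single u 1 = α := by
            funext v
            by_cases hvu : v = u
            · subst hvu; simp; omega
            · simp [Pi.single_eq_of_ne hvu]
          rw [Finset.mem_piAntidiag] at hα ⊢
          refine ⟨?_, fun v hv => hα.2 v fun h => hv (by simp [h])⟩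
          have := hsum (α - Pi.single u 1)
          rw [he, hα.1] at this
          exact (Nat.succ_injective this).symm
        · funext v
          by_cases hvu : v = u
          · subst hvu; simp; omega
          · simp [Pi.single_eq_of_ne hvu]
  rw [h1, Finset.sum_map, Finset.mul_sum]
  refine Finset.sum_congr rfl fun β _ => ?_
  have := lagWeight_add_single (y := y) hu β
  simp only [Function.Embedding.coeFn_mk, Pi.add_apply, Pi.single_eq_same]
  push_cast
  rw [← mul_assoc, ← mul_assoc, this]

theorem sum_sub_single {u : Space d} (hu : u ∈ f) {j : ℕ} (hy : ∑ v ∈ f, y v = (j + 1 : ℕ)) :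
    ∑ v ∈ f, (y - Pi.single u 1 : Space d → ℝ) v = j := by
  simp only [Pi.sub_apply, Finset.sum_sub_distrib, hy, Finset.sum_pi_single', hu, if_true]
  push_cast
  ring

/-- Vandermonde's identity, by induction on j: multiply by j + 1 = Σ α_u and apply the recursion for
every u. -/
theorem sum_lagWeight {j : ℕ} (hy : ∑ v ∈ f, y v = j) :
    ∑ α ∈ f.piAntidiag j, lagWeight f y α = 1 := by
  induction j generalizing y with
  | zero => simp [lagWeight]
  | succ j ih =>
    have h1 : ((j : ℝ) + 1) * ∑ α ∈ f.piAntidiag (j + 1), lagWeight f y α = (j : ℝ) + 1 := by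
      calc ((j : ℝ) + 1) * ∑ α ∈ f.piAntidiag (j + 1), lagWeight f y α
          = ∑ α ∈ f.piAntidiag (j + 1), ∑ u ∈ f, lagWeight f y α * ((α u : ℝ) * 1) := by
            rw [Finset.mul_sum]
            refine Finset.sum_congr rfl fun α hα => ?_
            rw [Finset.mem_piAntidiag] at hα
            rw [← Finset.mul_sum, mul_comm]
            congr 1
            have : ((∑ v ∈ f, α v : ℕ) : ℝ) = (j + 1 : ℕ) := by exact_mod_cast hα.1
            push_cast at this
            simp [this]
        _ = ∑ u ∈ f, y u := by
            rw [Finset.sum_comm]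
            refine Finset.sum_congr rfl fun u hu => ?_
            rw [sum_lagWeight_mul hu j fun _ => 1]
            simp only [mul_one, ih (sum_sub_single hu hy)]
        _ = _ := by rw [hy]; push_cast; ring
    have h2 : ((j : ℝ) + 1) ≠ 0 := by positivity
    exact mul_left_cancel₀ h2 (h1.trans (mul_one _).symm)

/-- Nodal interpolation is exact for products of affine functions. -/
theorem sum_lagWeight_prod (n : ℕ) {j : ℕ} (hy : ∑ v ∈ f, y v = j) (L : List (Space d × ℝ))
    (hn : L.length = n) (hL : ∀ p ∈ L, p.1 ∈ f) (hj : n ≤ j) :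
    ∑ α ∈ f.piAntidiag j, lagWeight f y α * (L.map fun p => (α p.1 : ℝ) + p.2).prod =
      (L.map fun p => y p.1 + p.2).prod := by
  induction n generalizing j y L with
  | zero =>
    obtain rfl := List.length_eq_zero_iff.1 hn
    simpa using sum_lagWeight hy
  | succ n ih =>
    obtain ⟨⟨u, c⟩, L, rfl⟩ : ∃ p L', L = p :: L' := List.exists_cons_of_length_eq_add_one hn
    obtain ⟨j, rfl⟩ : ∃ j', j = j' + 1 := ⟨j - 1, by omega⟩
    have hu : u ∈ f := hL (u, c) (by simp)
    have hL' : ∀ p ∈ L, p.1 ∈ f := fun p hp => hL p (by simp [hp])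
    have hn' : L.length = n := by simpa using hn
    have h1 := sum_lagWeight_mul (y := y) hu j fun α => (L.map fun p => (α p.1 : ℝ) + p.2).prod
    have h2 := ih hy L hn' hL' (by omega)
    -- After the shift α = β + e_u a factor α_u + c' of the remaining list reads β_u + (c' + 1); the
    -- list M carries the changed constants.
    set M := L.map fun p => (p.1, p.2 + (Pi.single u 1 : Space d → ℝ) p.1) with hM
    have h3 := ih (sum_sub_single hu hy) M (by simpa [hM] using hn') (fun p hp => by
      obtain ⟨q, hq, rfl⟩ := List.mem_map.1 hp
      exact hL' q hq) (by omega)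
    have e1 : ∀ β : Space d → ℕ, (L.map fun p => (((β + Pi.single u 1 : Space d → ℕ) p.1 : ℕ) : ℝ)
        + p.2).prod = (M.map fun p => (β p.1 : ℝ) + p.2).prod := fun β => by
      rw [hM, List.map_map]
      congr 1
      refine List.map_congr_left fun p _ => ?_
      by_cases hp : p.1 = u
      · simp [hp]; ring
      · simp [Pi.single_eq_of_ne hp]
    have e2 : (M.map fun p => (y - Pi.single u 1 : Space d → ℝ) p.1 + p.2).prod =
        (L.map fun p => y p.1 + p.2).prod := by
      rw [hM, List.map_map]
      congr 1
      refine List.map_congr_left fun p _ => ?_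
      simp only [Function.comp_apply, Pi.sub_apply]
      ring
    simp only [e1] at h1
    rw [h3, e2] at h1
    simp only [List.map_cons, List.prod_cons]
    rw [add_mul, ← h1, ← h2, Finset.mul_sum, ← Finset.sum_add_distrib]
    exact Finset.sum_congr rfl fun α _ => by ring

end Lagrange

/-! ### The extension from one face. -/

section FaceExtension

variable {d : ℕ}

/-- The multinomial coefficients sum to |f|^n and each of them is at least one. -/
theorem card_piAntidiag_le {α : Type*} [DecidableEq α] (f : Finset α) (n : ℕ) :
    (f.piAntidiag n).card ≤ f.card ^ n := by
  have h := Finset.sum_pow_eq_sum_piAntidiag f (fun _ => (1 : ℕ)) n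
  simp only [Finset.sum_const, smul_eq_mul, mul_one, one_pow, Finset.prod_const_one] at h
  rw [h, Finset.card_eq_sum_ones]
  refine Finset.sum_le_sum fun α _ => ?_
  exact Nat.succ_le_of_lt (Nat.multinomial_pos f α)

/-- The interpolation nodes. -/
noncomputable def node (f : Finset (Space d)) (j : ℕ) (α : Space d → ℕ) : Space d :=
  ∑ v ∈ f, ((α v : ℝ) / j) • v

theorem isBary_node {f : Finset (Space d)} {j : ℕ} (hj : 1 ≤ j) {α : Space d → ℕ}
    (hα : α ∈ f.piAntidiag j) : IsBary f (node f j α) (fun v => (α v : ℝ) / j) := by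
  rw [Finset.mem_piAntidiag] at hα
  refine ⟨fun v hv => ?_, ?_, rfl⟩
  · have : α v = 0 := by
      by_contra h
      exact hv (hα.2 v h)
    simp [this]
  · rw [← Finset.sum_div]
    have : ((∑ v ∈ f, α v : ℕ) : ℝ) = j := by exact_mod_cast hα.1
    push_cast at this
    rw [this]
    exact div_self (by positivity)

theorem node_mem_cell {f : Finset (Space d)} {j : ℕ} (hj : 1 ≤ j) {α : Space d → ℕ}
    (hα : α ∈ f.piAntidiag j) : node f j α ∈ cell f :=
  mem_cell_iff_exists.2 ⟨_, isBary_node hj hα, fun v => by positivity⟩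

/-- The sum of the barycentric coordinates that belong to a face. -/
noncomputable def faceSum (s f : Finset (Space d)) (x : Space d) : ℝ := ∑ v ∈ f, bary s x v

/-- The projection onto a face. -/
noncomputable def faceProj (s f : Finset (Space d)) (x : Space d) : Space d :=
  (faceSum s f x)⁻¹ • ∑ v ∈ f, bary s x v • v

/-- The homogeneous extension of the nodal interpolant of degree `j` on a face. -/
noncomputable def homExt (s f : Finset (Space d)) (j : ℕ) (u : Space d → Space d) (x : Space d) :
    Space d :=
  ∑ α ∈ f.piAntidiag j, (∏ v ∈ f, ∏ i ∈ Finset.range (α v),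
    ((j : ℝ) * bary s x v - i * faceSum s f x) / ((α v : ℝ) - i)) • u (node f j α)

theorem lagrange_eq (j : ℕ) (f : Finset (Space d)) (u : Space d → Space d) (z : Space d) :
    lagrange j f u z = ∑ α ∈ f.piAntidiag j,
      lagWeight f (fun v => j * bary f z v) α • u (node f j α) := rfl

variable {s f g : Finset (Space d)} {x : Space d} {u u' : Space d → Space d} {k r j l : ℕ}

/-- Each basis function is a product of j linear forms (j λ_v − i ω) / (α_v − i). Their coefficients
are at most 2j, since i < α_v ≤ j makes the denominators at least one; the number of nodes is at
most (d + 1)^j. -/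
theorem homPoly_homExt (hs : IsSimplex s) (hf : f ⊆ s) {c : ℝ} (hc : 0 ≤ c)
    (hu : ∀ α ∈ f.piAntidiag j, ‖u (node f j α)‖ ≤ c) :
    HomPoly s j ((d + 1) ^ j * ((2 * j) ^ j * c)) (homExt s f j u) := by
  classical
  have h1 : ∀ α ∈ f.piAntidiag j, HomPoly s j ((2 * j : ℝ) ^ j * c) (fun x =>
      (∏ v ∈ f, ∏ i ∈ Finset.range (α v),
        ((j : ℝ) * bary s x v - i * faceSum s f x) / ((α v : ℝ) - i)) • u (node f j α)) := by
    intro α hα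
    have h0 : HomPoly s 0 c (fun _ => u (node f j α)) := ⟨_, hu α hα, fun _ => rfl⟩
    have hα1 : ∑ v ∈ f, α v = j := (Finset.mem_piAntidiag.1 hα).1
    have h2 := h0.prod f α (fun v i u => ((j : ℝ) * (if u = v then 1 else 0) -
      i * (if u ∈ f then 1 else 0)) / ((α v : ℝ) - i)) (B := 2 * j) (by positivity) hc (by
        intro v hv i hi u _
        have hle : α v ≤ j := hα1 ▸ Finset.single_le_sum (fun _ _ => Nat.zero_le _) hv
        have hi1 : (i : ℝ) + 1 ≤ α v := by exact_mod_cast hi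
        have hi2 : (i : ℝ) ≤ j := by exact_mod_cast (hi.le.trans hle)
        rw [abs_div, abs_of_pos (by linarith : (0 : ℝ) < α v - i), div_le_iff₀ (by linarith)]
        have h3 : |(j : ℝ) * (if u = v then 1 else 0) - i * (if u ∈ f then 1 else 0)| ≤ j + i := by
          refine (abs_sub _ _).trans (add_le_add ?_ ?_)
          · split_ifs <;> simp
          · split_ifs <;> simp
        have h4 : (0 : ℝ) ≤ j := by positivity
        nlinarith)
    rw [hα1, zero_add] at h2
    refine h2.congr fun x => ?_
    congr 1
    refine Finset.prod_congr rfl fun v hv => Finset.prod_congr rfl fun i _ => ?_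
    have e1 : ∑ u ∈ s, ((j : ℝ) * (if u = v then 1 else 0) - i * (if u ∈ f then 1 else 0)) /
        ((α v : ℝ) - i) * bary s x u = (j * ∑ u ∈ s, (if u = v then bary s x u else 0) -
          i * ∑ u ∈ s, (if u ∈ f then bary s x u else 0)) / ((α v : ℝ) - i) := by
      rw [Finset.mul_sum, Finset.mul_sum, ← Finset.sum_sub_distrib, Finset.sum_div]
      refine Finset.sum_congr rfl fun u _ => ?_
      split_ifs <;> ring
    rw [e1, Finset.sum_ite_eq' s v, if_pos (hf hv), ← Finset.sum_filter, faceSum,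
      Finset.filter_mem_eq_inter, Finset.inter_eq_right.2 hf]
  have h2 := (HomPoly.sum _ h1).mono (c' := (d + 1) ^ j * ((2 * j) ^ j * c)) (by
    refine mul_le_mul_of_nonneg_right ?_ (by positivity)
    have h3 := card_piAntidiag_le f j
    have h4 : f.card ≤ d + 1 := (Finset.card_le_card hf).trans hs.2.le
    exact_mod_cast h3.trans (Nat.pow_le_pow_left h4 j))
  exact h2

theorem faceSum_nonneg (hs : IsSimplex s) (hx : x ∈ cell s) : 0 ≤ faceSum s f x :=
  Finset.sum_nonneg fun v _ => bary_nonneg hs.1 hx v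

theorem faceSum_mono (hs : IsSimplex s) (hfg : f ⊆ g) (hx : x ∈ cell s) :
    faceSum s f x ≤ faceSum s g x :=
  Finset.sum_le_sum_of_subset_of_nonneg hfg fun v _ _ => bary_nonneg hs.1 hx v

theorem faceSum_self (hs : IsSimplex s) (x : Space d) : faceSum s s x = 1 := hs.sum_bary x

theorem faceSum_le_one (hs : IsSimplex s) (hf : f ⊆ s) (hx : x ∈ cell s) : faceSum s f x ≤ 1 :=
  (faceSum_mono hs hf hx).trans (faceSum_self hs x).le

theorem faceSum_pos (hs : IsSimplex s) (hf : f ⊆ s) (hne : f.Nonempty)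
    (hx : x ∈ interior (cell s)) : 0 < faceSum s f x :=
  Finset.sum_pos (fun v hv => hs.mem_interior_iff.1 hx v (hf hv)) hne

theorem bary_eq_zero_of_faceSum (hs : IsSimplex s) (hx : x ∈ cell s) (h0 : faceSum s f x = 0)
    {v : Space d} (hv : v ∈ f) : bary s x v = 0 :=
  (Finset.sum_eq_zero_iff_of_nonneg fun v _ => bary_nonneg hs.1 hx v).1 h0 v hv

open Classical in
theorem isBary_faceProj (h0 : faceSum s f x ≠ 0) :
    IsBary f (faceProj s f x) (fun v => if v ∈ f then (faceSum s f x)⁻¹ * bary s x v else 0) := by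
  refine ⟨fun v hv => if_neg hv, ?_, ?_⟩
  · rw [Finset.sum_congr rfl fun v hv => if_pos hv, ← Finset.mul_sum, ← faceSum]
    exact inv_mul_cancel₀ h0
  · rw [faceProj, Finset.smul_sum]
    refine Finset.sum_congr rfl fun v hv => ?_
    simp only [if_pos hv, mul_smul]

theorem bary_faceProj (hs : IsSimplex s) (hf : f ⊆ s) (h0 : faceSum s f x ≠ 0) {v : Space d}
    (hv : v ∈ f) : bary f (faceProj s f x) v = (faceSum s f x)⁻¹ * bary s x v := by
  rw [bary_eq (AffineIndependent.finset_mono hs.1 hf) (isBary_faceProj h0)]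
  exact if_pos hv

theorem bary_simplex_faceProj (hs : IsSimplex s) (hf : f ⊆ s) (h0 : faceSum s f x ≠ 0)
    {v : Space d} (hv : v ∈ f) : bary s (faceProj s f x) v = (faceSum s f x)⁻¹ * bary s x v := by
  classical
  rw [bary_eq hs.1 (IsBary.mono hf (isBary_faceProj h0))]
  exact if_pos hv

theorem bary_simplex_faceProj_of_notMem (hs : IsSimplex s) (hf : f ⊆ s) (h0 : faceSum s f x ≠ 0)
    {v : Space d} (hv : v ∉ f) : bary s (faceProj s f x) v = 0 := by
  classical
  rw [bary_eq hs.1 (IsBary.mono hf (isBary_faceProj h0))]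
  exact if_neg hv

theorem faceProj_mem_cell (hs : IsSimplex s) (hx : x ∈ cell s)
    (h0 : faceSum s f x ≠ 0) : faceProj s f x ∈ cell f := by
  classical
  refine mem_cell_iff_exists.2 ⟨_, isBary_faceProj h0, fun v => ?_⟩
  beta_reduce
  split_ifs
  · exact mul_nonneg (inv_nonneg.2 (faceSum_nonneg hs hx)) (bary_nonneg hs.1 hx v)
  · exact le_rfl

theorem faceSum_of_mem (hs : IsSimplex s) (hf : f ⊆ s) (hx : x ∈ cell f) : faceSum s f x = 1 := by
  rw [faceSum, ← bary_face hs.1 hf hx]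
  exact (isBary_bary_of_mem hx).2.1

theorem faceProj_of_mem (hs : IsSimplex s) (hf : f ⊆ s) (hx : x ∈ cell f) :
    faceProj s f x = x := by
  rw [faceProj, faceSum_of_mem hs hf hx, inv_one, one_smul, ← bary_face hs.1 hf hx]
  exact (isBary_bary_of_mem hx).2.2

/-- On the face λ_v(Z) = λ_v / ω. The factor ω^j distributes over the j linear factors of each basis
function and clears the denominators, so the left side is polynomial on all of s. -/
theorem lagrange_faceProj (hs : IsSimplex s) (hf : f ⊆ s) (h0 : faceSum s f x ≠ 0) :
    faceSum s f x ^ j • lagrange j f u (faceProj s f x) = homExt s f j u x := by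
  rw [lagrange_eq, homExt, Finset.smul_sum]
  refine Finset.sum_congr rfl fun α hα => ?_
  rw [smul_smul]
  congr 1
  have hα1 : ∑ v ∈ f, α v = j := (Finset.mem_piAntidiag.1 hα).1
  rw [← hα1, ← Finset.prod_pow_eq_pow_sum, lagWeight, ← Finset.prod_mul_distrib, hα1]
  refine Finset.prod_congr rfl fun v hv => ?_
  have e1 : faceSum s f x ^ α v = ∏ _i ∈ Finset.range (α v), faceSum s f x := by
    rw [Finset.prod_const, Finset.card_range]
  rw [bary_faceProj hs hf h0 hv, e1, ← Finset.prod_mul_distrib]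
  refine Finset.prod_congr rfl fun i _ => ?_
  rw [mul_div_assoc', mul_sub]
  congr 2
  · field_simp
  · ring

theorem homExt_eq_zero (hs : IsSimplex s) (hj : 1 ≤ j) (hx : x ∈ cell s)
    (h0 : faceSum s f x = 0) : homExt s f j u x = 0 := by
  refine Finset.sum_eq_zero fun α hα => ?_
  have hα1 : ∑ v ∈ f, α v = j := (Finset.mem_piAntidiag.1 hα).1
  obtain ⟨v, hv, hαv⟩ : ∃ v ∈ f, α v ≠ 0 := by
    by_contra! h
    rw [Finset.sum_eq_zero h] at hα1
    omega
  rw [Finset.prod_eq_zero hv, zero_smul]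
  refine Finset.prod_eq_zero (Finset.mem_range.2 (Nat.pos_of_ne_zero hαv)) ?_
  rw [bary_eq_zero_of_faceSum hs hx h0 hv, h0]
  simp

/-- Isolates the only term that is not a polynomial, because ω^l Λ_{l−1} = ω · ω^(l−1) Λ_{l−1}.
Where ω = 0 all terms vanish. -/
theorem faceExt_eq (hs : IsSimplex s) (hf : f ⊆ s) (hx : x ∈ cell s) :
    faceExt k r s f u x = faceSum s f x ^ r •
        (u (faceProj s f x) - lagrange k f u (faceProj s f x)) +
      ∑ l ∈ Finset.Icc 2 k, (homExt s f l u x - faceSum s f x • homExt s f (l - 1) u x) := by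
  change faceSum s f x ^ r • (u (faceProj s f x) - lagrange k f u (faceProj s f x)) +
    ∑ l ∈ Finset.Icc 2 k, faceSum s f x ^ l • (lagrange l f u (faceProj s f x) -
      lagrange (l - 1) f u (faceProj s f x)) = _
  congr 1
  refine Finset.sum_congr rfl fun l hl => ?_
  have hl2 : 2 ≤ l := (Finset.mem_Icc.1 hl).1
  by_cases h0 : faceSum s f x = 0
  · rw [h0, zero_pow (by omega), homExt_eq_zero hs (by omega) hx h0]
    simp
  · rw [smul_sub, lagrange_faceProj hs hf h0, ← lagrange_faceProj (j := l - 1) hs hf h0, smul_smul,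
      ← pow_succ', show l - 1 + 1 = l by omega]

theorem faceExt_of_faceSum_eq_zero (hr : 1 ≤ r) (h0 : faceSum s f x = 0) :
    faceExt k r s f u x = 0 := by
  change faceSum s f x ^ r • (u (faceProj s f x) - lagrange k f u (faceProj s f x)) +
    ∑ l ∈ Finset.Icc 2 k, faceSum s f x ^ l • (lagrange l f u (faceProj s f x) -
      lagrange (l - 1) f u (faceProj s f x)) = _
  rw [h0, zero_pow (by omega), zero_smul, zero_add]
  refine Finset.sum_eq_zero fun l hl => ?_
  have hl2 : 2 ≤ l := (Finset.mem_Icc.1 hl).1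
  rw [zero_pow (by omega), zero_smul]

/-- Nodal interpolation is exact for polynomials, multiplied by products of affine functions. -/
theorem sum_lagWeight_homPoly {F : Type} [NormedAddCommGroup F] [NormedSpace ℝ F]
    (hs : IsSimplex s) (hf : f ⊆ s) {c : ℝ} {P : Space d → F}
    (hP : HomPoly s l c P) (hj : 1 ≤ j) {z : Space d} (hz : z ∈ cell f)
    (L : List (Space d × ℝ)) (hL : ∀ p ∈ L, p.1 ∈ f) (hjl : L.length + l ≤ j) :
    ∑ α ∈ f.piAntidiag j, lagWeight f (fun v => j * bary s z v) α •
        ((L.map fun p => (α p.1 : ℝ) + p.2).prod • P (node f j α)) =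
      (L.map fun p => j * bary s z p.1 + p.2).prod • P z := by
  have hsum : ∑ v ∈ f, (j : ℝ) * bary s z v = j := by
    rw [← Finset.mul_sum]
    have := faceSum_of_mem hs hf hz
    rw [faceSum] at this
    rw [this, mul_one]
  induction l generalizing P L with
  | zero =>
    obtain ⟨a, -, h⟩ := hP
    simp only [h, smul_smul]
    rw [← Finset.sum_smul, sum_lagWeight_prod L.length hsum L rfl hL (by omega)]
  | succ l ih =>
    obtain ⟨Q, hQ, h⟩ := hP
    have hj0 : (j : ℝ) ≠ 0 := by positivity
    have hb : ∀ α ∈ f.piAntidiag j, bary s (node f j α) = fun v => (α v : ℝ) / j := fun α hα =>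
      bary_eq hs.1 (IsBary.mono hf (isBary_node hj hα))
    have key : ∀ v ∈ s, ∑ α ∈ f.piAntidiag j, lagWeight f (fun v => j * bary s z v) α •
        ((L.map fun p => (α p.1 : ℝ) + p.2).prod • (((α v : ℝ) / j) • Q v (node f j α))) =
        (L.map fun p => j * bary s z p.1 + p.2).prod • (bary s z v • Q v z) := by
      intro v hv
      by_cases hvf : v ∈ f
      -- At the nodes λ_v = α_v / j, so this factor of P is moved into the list of affine factors.
      -- For v outside f both sides vanish.
      · have h1 := ih (hQ v hv) ((v, 0) :: L) (by simpa [hvf] using hL)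
          (by simp only [List.length_cons]; omega)
        simp only [List.map_cons, List.prod_cons, add_zero] at h1
        have h2 := congrArg (fun y => (j : ℝ)⁻¹ • y) h1
        simp only [Finset.smul_sum, smul_smul] at h2 ⊢
        refine (Finset.sum_congr rfl fun α _ => ?_).trans (h2.trans ?_)
        · congr 1
          field_simp
        · congr 1
          field_simp
      · have h1 : bary s z v = 0 := by
          rw [← bary_face hs.1 hf hz]
          exact (isBary_bary_of_mem hz).1 v hvf
        rw [h1, zero_smul, smul_zero]
        refine Finset.sum_eq_zero fun α hα => ?_
        have : α v = 0 := by
          by_contra h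
          exact hvf ((Finset.mem_piAntidiag.1 hα).2 v h)
        simp [this]
    rw [h z, Finset.smul_sum, ← Finset.sum_congr rfl key, Finset.sum_comm]
    refine Finset.sum_congr rfl fun α hα => ?_
    rw [h, hb α hα, Finset.smul_sum, Finset.smul_sum]

theorem lagrange_homPoly (hs : IsSimplex s) (hf : f ⊆ s) {c : ℝ}
    (hu : HomPoly s l c u) (hj : 1 ≤ j) (hlj : l ≤ j) {z : Space d} (hz : z ∈ cell f) :
    lagrange j f u z = u z := by
  have h := sum_lagWeight_homPoly hs hf hu hj hz [] (by simp) (by simpa using hlj)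
  simp only [List.map_nil, List.prod_nil, one_smul] at h
  rw [lagrange_eq, bary_face hs.1 hf hz]
  exact h

theorem lagrange_congr (hj : 1 ≤ j) (h : ∀ z ∈ cell f, u z = u' z) (z : Space d) :
    lagrange j f u z = lagrange j f u' z := by
  rw [lagrange_eq, lagrange_eq]
  exact Finset.sum_congr rfl fun α hα => by rw [h _ (node_mem_cell hj hα)]

theorem faceExt_congr (hs : IsSimplex s) (hk : 1 ≤ k) (hr : 1 ≤ r) (hx : x ∈ cell s)
    (h : ∀ z ∈ cell f, u z = u' z) : faceExt k r s f u x = faceExt k r s f u' x := by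
  by_cases h0 : faceSum s f x = 0
  · rw [faceExt_of_faceSum_eq_zero hr h0, faceExt_of_faceSum_eq_zero hr h0]
  · change faceSum s f x ^ r • (u (faceProj s f x) - lagrange k f u (faceProj s f x)) +
      ∑ l ∈ Finset.Icc 2 k, faceSum s f x ^ l • (lagrange l f u (faceProj s f x) -
        lagrange (l - 1) f u (faceProj s f x)) = faceSum s f x ^ r •
        (u' (faceProj s f x) - lagrange k f u' (faceProj s f x)) +
      ∑ l ∈ Finset.Icc 2 k, faceSum s f x ^ l • (lagrange l f u' (faceProj s f x) -
        lagrange (l - 1) f u' (faceProj s f x))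
    rw [h _ (faceProj_mem_cell hs hx h0), lagrange_congr hk h]
    congr 1
    refine Finset.sum_congr rfl fun l hl => ?_
    have hl2 : 2 ≤ l := (Finset.mem_Icc.1 hl).1
    rw [lagrange_congr (by omega) h, lagrange_congr (j := l - 1) (by omega) h]

theorem faceExt_face (hs : IsSimplex s) (hg : g ⊆ s) (hx : x ∈ cell g) :
    faceExt k r s f u x = faceExt k r g f u x := by
  rw [faceExt, faceExt, bary_face hs.1 hg hx]

theorem faceExt_add (u u' : Space d → Space d) (x : Space d) :
    faceExt k r s f (fun z => u z + u' z) x = faceExt k r s f u x + faceExt k r s f u' x := by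
  have h : ∀ l z, lagrange l f (fun z => u z + u' z) z = lagrange l f u z + lagrange l f u' z :=
    fun l z => by simp only [lagrange_eq, smul_add, Finset.sum_add_distrib]
  simp only [faceExt, h, add_sub_add_comm, smul_add, Finset.sum_add_distrib]
  abel

theorem faceExt_sum {α : Type*} (t : Finset α) (u : α → Space d → Space d) (x : Space d) :
    faceExt k r s f (fun z => ∑ a ∈ t, u a z) x = ∑ a ∈ t, faceExt k r s f (u a) x := by
  classical
  induction t using Finset.induction_on with
  | empty => simp [faceExt, lagrange]
  | insert a t ha ih =>
    rw [Finset.sum_insert ha, ← ih, ← faceExt_add]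
    simp only [Finset.sum_insert ha]

/-- The extension vanishes on faces that do not contain `f`. -/
theorem faceExt_eq_zero (hs : IsSimplex s) (hf : f ⊆ s) (hg : g ⊆ s) (hfg : ¬ f ⊆ g) (hk : 1 ≤ k)
    (hr : 1 ≤ r) (hx : x ∈ cell g)
    (hu : ∀ f' ⊆ f, f' ≠ f → ∀ z ∈ cell f', u z = 0) : faceExt k r s f u x = 0 := by
  classical
  by_cases h0 : faceSum s f x = 0
  · exact faceExt_of_faceSum_eq_zero hr h0
  have hxs := cell_mono hg hx
  -- Since x has no coordinates outside g, the point Z(x) and all nodes with nonzero weight lie in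
  -- the proper face f ∩ g of f, where u vanishes.
  have hsub : f ∩ g ⊆ f := Finset.inter_subset_left
  have hne : f ∩ g ≠ f := fun h => hfg (Finset.inter_eq_left.1 h)
  have hb : ∀ v ∈ f, v ∉ g → bary f (faceProj s f x) v = 0 := fun v hv hvg => by
    rw [bary_faceProj hs hf h0 hv, ← bary_face hs.1 hg hx, (isBary_bary_of_mem hx).1 v hvg,
      mul_zero]
  have hZf := faceProj_mem_cell hs hxs h0
  have hmem : ∀ (z : Space d) (w : Space d → ℝ), IsBary f z w → (∀ v, 0 ≤ w v) →
      (∀ v ∈ f, v ∉ g → w v = 0) → z ∈ cell (f ∩ g) := by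
    rintro z w ⟨h1, h2, h3⟩ h4 h5
    have hz : ∀ v ∈ f, v ∉ f ∩ g → w v = 0 := fun v hv hvg =>
      h5 v hv fun h => hvg (Finset.mem_inter.2 ⟨hv, h⟩)
    refine mem_cell_iff_exists.2 ⟨w, ⟨fun v hv => ?_, ?_, ?_⟩, h4⟩
    · by_cases hvf : v ∈ f
      · exact hz v hvf hv
      · exact h1 v hvf
    · rw [← h2]
      exact Finset.sum_subset hsub hz
    · rw [← h3]
      exact Finset.sum_subset hsub fun v hv hvg => by rw [hz v hv hvg, zero_smul]
  have hZ : u (faceProj s f x) = 0 := hu _ hsub hne _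
    (hmem _ _ (isBary_bary_of_mem hZf)
      (bary_nonneg (AffineIndependent.finset_mono hs.1 hf) hZf) hb)
  have hlag : ∀ l, 1 ≤ l → lagrange l f u (faceProj s f x) = 0 := by
    intro l hl
    rw [lagrange_eq]
    refine Finset.sum_eq_zero fun α hα => ?_
    by_cases hαg : ∀ v ∈ f, v ∉ g → α v = 0
    · rw [hu _ hsub hne _ (hmem _ _ (isBary_node hl hα) (fun v => by positivity)
        fun v hv hvg => by simp [hαg v hv hvg]), smul_zero]
    · push Not at hαg
      obtain ⟨v, hv, hvg, hα0⟩ := hαg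
      rw [lagWeight, Finset.prod_eq_zero hv, zero_smul]
      refine Finset.prod_eq_zero (Finset.mem_range.2 (Nat.pos_of_ne_zero hα0)) ?_
      simp [hb v hv hvg]
  change faceSum s f x ^ r • (u (faceProj s f x) - lagrange k f u (faceProj s f x)) +
    ∑ l ∈ Finset.Icc 2 k, faceSum s f x ^ l • (lagrange l f u (faceProj s f x) -
      lagrange (l - 1) f u (faceProj s f x)) = _
  rw [hZ, hlag k hk, sub_zero, smul_zero, zero_add]
  refine Finset.sum_eq_zero fun l hl => ?_
  have hl2 : 2 ≤ l := (Finset.mem_Icc.1 hl).1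
  rw [hlag l (by omega), hlag (l - 1) (by omega), sub_zero, smul_zero]

/-- On the face itself the extension is the given function. -/
theorem faceExt_self (hs : IsSimplex s) (hf : f ⊆ s) (hk : 1 ≤ k) (hx : x ∈ cell f)
    (hu : ∀ v ∈ f, u v = 0) : faceExt k r s f u x = u x := by
  change faceSum s f x ^ r • (u (faceProj s f x) - lagrange k f u (faceProj s f x)) +
    ∑ l ∈ Finset.Icc 2 k, faceSum s f x ^ l • (lagrange l f u (faceProj s f x) -
      lagrange (l - 1) f u (faceProj s f x)) = _
  simp only [faceSum_of_mem hs hf hx, faceProj_of_mem hs hf hx, one_pow, one_smul]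
  -- The sum of the differences telescopes to Λ_k u − Λ_1 u, and Λ_1 u = 0 because u vanishes at the
  -- vertices; this is why the sum in the extension starts at l = 2.
  have h1 : lagrange 1 f u x = 0 := by
    rw [lagrange_eq]
    refine Finset.sum_eq_zero fun α hα => ?_
    have hα1 : ∑ v ∈ f, α v = 1 := (Finset.mem_piAntidiag.1 hα).1
    obtain ⟨v, hv, hαv⟩ : ∃ v ∈ f, α v ≠ 0 := by
      by_contra! h
      rw [Finset.sum_eq_zero h] at hα1
      omega
    have hv1 : α v = 1 := by
      have := Finset.single_le_sum (f := α) (fun _ _ => Nat.zero_le _) hv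
      omega
    have hw : ∀ w ∈ f, w ≠ v → α w = 0 := fun w hw hwv => by
      have := Finset.add_le_sum (f := α) (fun _ _ => Nat.zero_le _) hv hw hwv.symm
      omega
    have : node f 1 α = v := by
      rw [node, Finset.sum_eq_single_of_mem v hv fun w hw' hwv => by simp [hw w hw' hwv], hv1]
      simp
    rw [this, hu v hv, smul_zero]
  have h2 : ∀ k, 1 ≤ k → ∑ l ∈ Finset.Icc 2 k, (lagrange l f u x - lagrange (l - 1) f u x) =
      lagrange k f u x - lagrange 1 f u x := by
    intro k hk
    induction k, hk using Nat.le_induction with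
    | base => simp
    | succ n hn ih =>
      rw [Finset.sum_Icc_succ_top (by omega), ih, Nat.add_sub_cancel]
      abel
  rw [h2 k hk, h1]
  abel

end FaceExtension

/-! ### The levelwise extension: traces, linearity in the data, continuity. -/

section ExtLevel

variable {d : ℕ} {A : Set (Finset (Space d))} {k r j : ℕ} {s f g : Finset (Space d)}
  {w : Space d → Space d} {x : Space d}

open Classical in
theorem extLevel_zero : extLevel A k r s w 0 x =
    ∑ v ∈ s with ∃ s' ∈ A, v ∈ s', bary s x v • w v := rfl

open Classical in
theorem extLevel_succ : extLevel A k r s w (j + 1) x = extLevel A k r s w j x +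
    ∑ f ∈ s.powerset with f.card = j + 2 ∧ ∃ s' ∈ A, f ⊆ s',
      faceExt k r s f (fun z => w z - extLevel A k r s w j z) x := rfl

/-- The extension interpolates on active faces. -/
theorem extLevel_eq_of_face (hs : IsSimplex s) (hk : 1 ≤ k) (hr : 1 ≤ r) (hf : f ⊆ s)
    (hA : ∃ s' ∈ A, f ⊆ s') (hc : f.card ≤ j + 1) (hx : x ∈ cell f) :
    extLevel A k r s w j x = w x := by
  classical
  induction j generalizing f x with
  | zero =>
    have hne : f.Nonempty := by
      by_contra h
      rw [Finset.not_nonempty_iff_eq_empty] at h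
      subst h
      simp [cell] at hx
    obtain ⟨v, rfl⟩ := Finset.card_eq_one.1 (le_antisymm hc hne.card_pos)
    have hxv : x = v := by simpa [cell] using hx
    subst hxv
    have hv : x ∈ s := hf (Finset.mem_singleton_self x)
    rw [extLevel_zero, Finset.sum_eq_single_of_mem x]
    · rw [hs.bary_vertex hv]; simp
    · obtain ⟨s', hs', hxs'⟩ := hA
      exact Finset.mem_filter.2 ⟨hv, s', hs', hxs' (Finset.mem_singleton_self x)⟩
    · intro u _ hu
      rw [hs.bary_vertex hv]; simp [hu]
  | succ j ih =>
    -- By induction the residual vanishes on all proper faces of an active face with j + 2 vertices,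
    -- so its extension does not disturb any other face of that dimension.
    have hres : ∀ f' ⊆ s, (∃ s' ∈ A, f' ⊆ s') → f'.card = j + 2 → ∀ f'' ⊆ f', f'' ≠ f' →
        ∀ z ∈ cell f'', w z - extLevel A k r s w j z = 0 := by
      intro f' hf' ⟨s', hs', hfs'⟩ hcard f'' hf'' hne z hz
      have := Finset.card_lt_card (Finset.ssubset_iff_subset_ne.2 ⟨hf'', hne⟩)
      rw [ih (hf''.trans hf') ⟨s', hs', hf''.trans hfs'⟩ (by omega) hz, sub_self]
    have hz : ∀ f' ∈ s.powerset.filter (fun f' => f'.card = j + 2 ∧ ∃ s' ∈ A, f' ⊆ s'), f' ≠ f →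
        faceExt k r s f' (fun z => w z - extLevel A k r s w j z) x = 0 := by
      intro f' hf' hne
      obtain ⟨h1, h2, h3⟩ := Finset.mem_filter.1 hf'
      rw [Finset.mem_powerset] at h1
      exact faceExt_eq_zero hs h1 hf
        (fun h => hne (Finset.eq_of_subset_of_card_le h (by omega))) hk hr hx (hres f' h1 h3 h2)
    rw [extLevel_succ]
    by_cases hc' : f.card = j + 2
    · rw [Finset.sum_eq_single_of_mem f
        (Finset.mem_filter.2 ⟨Finset.mem_powerset.2 hf, hc', hA⟩) hz,
        faceExt_self hs hf hk hx fun v hv => hres f hf hA hc' {v} (by simpa using hv)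
          (fun h => by rw [← h] at hc'; simp at hc') v (by simp [cell])]
      abel
    · have h0 := Finset.sum_eq_zero fun f' hf' => hz f' hf' fun h => hc' (by
        rw [← h]; exact (Finset.mem_filter.1 hf').2.1)
      rw [h0, add_zero]
      exact ih hf hA (by omega) hx

/-- On a face the extension is determined by the data of this face. -/
theorem extLevel_face (hs : IsSimplex s) (hk : 1 ≤ k) (hr : 1 ≤ r) (hg : g ⊆ s)
    (hx : x ∈ cell g) : extLevel A k r s w j x = extLevel A k r g w j x := by
  classical
  induction j generalizing x with
  | zero =>
    rw [extLevel_zero, extLevel_zero, bary_face hs.1 hg hx]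
    symm
    refine Finset.sum_subset (Finset.filter_subset_filter _ hg) fun v hv hv' => ?_
    rw [← bary_face hs.1 hg hx, (isBary_bary_of_mem hx).1 v fun h =>
      hv' (Finset.mem_filter.2 ⟨h, (Finset.mem_filter.1 hv).2⟩), zero_smul]
  | succ j ih =>
    rw [extLevel_succ, extLevel_succ, ih hx]
    congr 1
    symm
    refine (Finset.sum_congr rfl fun f hf => ?_).trans
      (Finset.sum_subset (Finset.filter_subset_filter _ (Finset.powerset_mono.2 hg))
        fun f hf hf' => ?_)
    · have hfg := Finset.mem_powerset.1 (Finset.mem_filter.1 hf).1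
      rw [← faceExt_face hs hg hx]
      exact faceExt_congr hs hk hr (cell_mono hg hx) fun z hz => by rw [ih (cell_mono hfg hz)]
    -- Corrections from faces not contained in g vanish on g, as the residual is zero on proper
    -- faces.
    · obtain ⟨h1, h2, s', hs', hfs'⟩ := Finset.mem_filter.1 hf
      rw [Finset.mem_powerset] at h1
      refine faceExt_eq_zero hs h1 hg (fun h => hf' (Finset.mem_filter.2
        ⟨Finset.mem_powerset.2 h, h2, s', hs', hfs'⟩)) hk hr hx fun f'' hf'' hne z hz => ?_
      have := Finset.card_lt_card (Finset.ssubset_iff_subset_ne.2 ⟨hf'', hne⟩)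
      rw [extLevel_eq_of_face hs hk hr (hf''.trans h1) ⟨s', hs', hf''.trans hfs'⟩ (by omega) hz,
        sub_self]

theorem extLevel_eq_zero (h : ∀ v ∈ s, ∀ s' ∈ A, v ∉ s') : extLevel A k r s w j x = 0 := by
  classical
  induction j generalizing x with
  | zero =>
    rw [extLevel_zero, Finset.filter_false_of_mem, Finset.sum_empty]
    rintro v hv ⟨s', hs', hvs'⟩
    exact h v hv s' hs' hvs'
  | succ j ih =>
    rw [extLevel_succ, ih, Finset.filter_false_of_mem, Finset.sum_empty, add_zero]
    rintro f hf ⟨hc, s', hs', hfs'⟩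
    obtain ⟨v, hv⟩ := Finset.card_pos.1 (by omega : 0 < f.card)
    exact h v (Finset.mem_powerset.1 hf hv) s' hs' (hfs' hv)

/-- For fixed x the extension combines finitely many values on f with fixed weights. The parameter
set E lets this be iterated over the levels, with the data w as parameter. -/
theorem faceExt_mem_submodule {E : Type*} {S : Submodule ℝ (E → Space d)} (hs : IsSimplex s)
    (hk : 1 ≤ k) (hr : 1 ≤ r) (hx : x ∈ cell s) (U : E → Space d → Space d)
    (hU : ∀ z ∈ cell f, (fun e => U e z) ∈ S) : (fun e => faceExt k r s f (U e) x) ∈ S := by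
  by_cases h0 : faceSum s f x = 0
  · have : (fun e => faceExt k r s f (U e) x) = 0 :=
      funext fun e => faceExt_of_faceSum_eq_zero hr h0
    rw [this]
    exact S.zero_mem
  · have hlag : ∀ l, 1 ≤ l → (fun e => lagrange l f (U e) (faceProj s f x)) ∈ S := by
      intro l hl
      have : (fun e => lagrange l f (U e) (faceProj s f x)) = ∑ α ∈ f.piAntidiag l,
          lagWeight f (fun v => l * bary f (faceProj s f x) v) α •
            fun e => U e (node f l α) := by
        funext e
        rw [lagrange_eq, Finset.sum_apply]
        rfl
      rw [this]
      exact S.sum_mem fun α hα => S.smul_mem _ (hU _ (node_mem_cell hl hα))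
    refine S.add_mem (S.smul_mem _ (S.sub_mem (hU _ (faceProj_mem_cell hs hx h0)) (hlag k hk))) ?_
    have : (fun e => ∑ l ∈ Finset.Icc 2 k, (∑ v ∈ f, bary s x v) ^ l •
        (lagrange l f (U e) (faceProj s f x) - lagrange (l - 1) f (U e) (faceProj s f x))) =
        ∑ l ∈ Finset.Icc 2 k, (∑ v ∈ f, bary s x v) ^ l •
        ((fun e => lagrange l f (U e) (faceProj s f x)) -
          fun e => lagrange (l - 1) f (U e) (faceProj s f x)) := by
      funext e
      rw [Finset.sum_apply]
      rfl
    refine Set.mem_of_eq_of_mem this (S.sum_mem fun l hl => S.smul_mem _ (S.sub_mem ?_ ?_))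
    · exact hlag l (by have := (Finset.mem_Icc.1 hl).1; omega)
    · exact hlag (l - 1) (by have := (Finset.mem_Icc.1 hl).1; omega)

/-- The extension is a linear combination of values on the active region. -/
theorem extLevel_mem_span (hs : IsSimplex s) (hk : 1 ≤ k) (hr : 1 ≤ r) (hx : x ∈ cell s) :
    (fun w => extLevel A k r s w j x) ∈
      Submodule.span ℝ {L : (Space d → Space d) → Space d | ∃ p ∈ region A, L = fun w => w p} := by
  classical
  set S := Submodule.span ℝ {L : (Space d → Space d) → Space d | ∃ p ∈ region A, L = fun w => w p}
  have hev : ∀ p ∈ region A, (fun w : Space d → Space d => w p) ∈ S := fun p hp =>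
    Submodule.subset_span ⟨p, hp, rfl⟩
  induction j generalizing x with
  | zero =>
    have : (fun w : Space d → Space d => extLevel A k r s w 0 x) =
        ∑ v ∈ s with ∃ s' ∈ A, v ∈ s', bary s x v • fun w : Space d → Space d => w v := by
      funext w
      rw [extLevel_zero, Finset.sum_apply]
      rfl
    rw [this]
    refine S.sum_mem fun v hv => S.smul_mem _ (hev v ?_)
    obtain ⟨s', hs', hv'⟩ := (Finset.mem_filter.1 hv).2
    exact mem_region.2 ⟨s', hs', mem_cell_of_vertex hv'⟩
  | succ j ih =>
    have : (fun w : Space d → Space d => extLevel A k r s w (j + 1) x) =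
        (fun w => extLevel A k r s w j x) +
        ∑ f ∈ s.powerset with f.card = j + 2 ∧ ∃ s' ∈ A, f ⊆ s',
          fun w : Space d → Space d =>
            faceExt k r s f (fun z => w z - extLevel A k r s w j z) x := by
      funext w
      rw [extLevel_succ, Pi.add_apply, Finset.sum_apply]
    rw [this]
    refine S.add_mem (ih hx) (S.sum_mem fun f hf => ?_)
    obtain ⟨h1, -, s', hs', hfs'⟩ := Finset.mem_filter.1 hf
    rw [Finset.mem_powerset] at h1
    exact faceExt_mem_submodule hs hk hr hx (fun w z => w z - extLevel A k r s w j z)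
      fun z hz => S.sub_mem (hev z (mem_region.2 ⟨s', hs', cell_mono hfs' hz⟩))
        (ih (cell_mono h1 hz))

/-- Time derivatives commute with the extension. -/
theorem extLevel_time (hs : IsSimplex s) (hk : 1 ≤ k) (hr : 1 ≤ r) (hx : x ∈ cell s) {I : Set ℝ}
    (hI : UniqueDiffOn ℝ I) {n : ℕ} {W : Space d → ℝ → Space d}
    (hW : ∀ p ∈ region A, ContDiffOn ℝ n (W p) I) :
    ContDiffOn ℝ n (fun t => extLevel A k r s (fun y => W y t) j x) I ∧ ∀ i ≤ n, ∀ t ∈ I,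
      iteratedDerivWithin i (fun t => extLevel A k r s (fun y => W y t) j x) I t =
        extLevel A k r s (fun y => iteratedDerivWithin i (W y) I t) j x := by
  -- The extension at x is a finite combination of point values at active points, so it suffices to
  -- treat evaluations, sums and multiples.
  refine Submodule.span_induction (p := fun L _ =>
    ContDiffOn ℝ n (fun t => L (fun y => W y t)) I ∧ ∀ i ≤ n, ∀ t ∈ I,
      iteratedDerivWithin i (fun t => L (fun y => W y t)) I t =
        L (fun y => iteratedDerivWithin i (W y) I t)) ?_ ?_ ?_ ?_
    (extLevel_mem_span (j := j) (A := A) hs hk hr hx)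
  · rintro L ⟨p, hp, rfl⟩
    exact ⟨hW p hp, fun i _ t _ => rfl⟩
  · refine ⟨contDiffOn_const, fun i _ t _ => ?_⟩
    have : (fun t => (0 : (Space d → Space d) → Space d) (fun y => W y t)) = fun _ => 0 := rfl
    rw [this]
    simp [iteratedDerivWithin_const]
  · rintro L L' - - ⟨h1, h2⟩ ⟨h3, h4⟩
    refine ⟨h1.add h3, fun i hi t ht => ?_⟩
    have hi' : (i : WithTop ℕ∞) ≤ n := by exact_mod_cast hi
    exact (iteratedDerivWithin_fun_add ht hI ((h1.of_le hi') t ht) ((h3.of_le hi') t ht)).trans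
      (congrArg₂ (· + ·) (h2 i hi t ht) (h4 i hi t ht))
  · rintro a L - ⟨h1, h2⟩
    refine ⟨contDiffOn_const.smul h1, fun i hi t ht => ?_⟩
    have hi' : (i : WithTop ℕ∞) ≤ n := by exact_mod_cast hi
    exact (iteratedDerivWithin_const_smul ht hI a ((h1.of_le hi') t ht)).trans
      (congrArg (a • ·) (h2 i hi t ht))

theorem continuous_homExt (hs : IsSimplex s) (f : Finset (Space d)) (l : ℕ)
    (u : Space d → Space d) : Continuous (homExt s f l u) := by
  have := hs.continuous_bary
  unfold homExt faceSum
  fun_prop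

theorem continuous_faceSum (hs : IsSimplex s) (f : Finset (Space d)) :
    Continuous (faceSum s f) := by
  unfold faceSum
  have := hs.continuous_bary
  fun_prop

theorem continuousAt_faceProj (hs : IsSimplex s) (h0 : faceSum s f x ≠ 0) :
    ContinuousAt (faceProj s f) x := by
  unfold faceProj
  have h1 := hs.continuous_bary
  have h2 := continuous_faceSum hs f
  refine (h2.continuousAt.inv₀ h0).smul (Continuous.continuousAt ?_)
  fun_prop

/-- Where ω = 0 the projection Z has no limit in general, but u − Λ_k u is bounded and its factor
ω^r tends to zero. All other terms are polynomials. -/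
theorem continuousOn_faceExt (hs : IsSimplex s) (hf : f ⊆ s) (hr : 1 ≤ r)
    {u : Space d → Space d} (hu : ContinuousOn u (cell f)) :
    ContinuousOn (faceExt k r s f u) (cell s) := by
  have hE : ContinuousOn (fun z => u z - homExt s f k u z) (cell f) :=
    hu.sub (continuous_homExt hs f k u).continuousOn
  obtain ⟨B, hB⟩ := (isCompact_cell f).exists_bound_of_continuousOn hE
  have hlag : ∀ z ∈ cell f, lagrange k f u z = homExt s f k u z := fun z hz => by
    have h1 := faceSum_of_mem hs hf hz
    have := lagrange_faceProj (j := k) (u := u) hs hf (x := z) (by rw [h1]; exact one_ne_zero)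
    rwa [h1, one_pow, one_smul, faceProj_of_mem hs hf hz] at this
  have h1 : ContinuousOn (fun x => faceSum s f x ^ r •
      (u (faceProj s f x) - homExt s f k u (faceProj s f x))) (cell s) := by
    intro x hx
    by_cases h0 : faceSum s f x = 0
    · change Filter.Tendsto _ _ (nhds (faceSum s f x ^ r •
        (u (faceProj s f x) - homExt s f k u (faceProj s f x))))
      rw [h0, zero_pow (by omega), zero_smul]
      have hlim : Filter.Tendsto (fun x => faceSum s f x ^ r * B) (nhdsWithin x (cell s))
          (nhds 0) := by
        have : Continuous fun x => faceSum s f x ^ r * B :=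
          ((continuous_faceSum hs f).pow r).mul continuous_const
        have h2 := this.continuousWithinAt (s := cell s) (x := x)
        have h3 : faceSum s f x ^ r * B = 0 := by rw [h0, zero_pow (by omega), zero_mul]
        rw [ContinuousWithinAt, h3] at h2
        exact h2
      refine squeeze_zero_norm' ?_ hlim
      filter_upwards [self_mem_nhdsWithin] with y hy
      by_cases hy0 : faceSum s f y = 0
      · rw [hy0, zero_pow (by omega), zero_smul, norm_zero, zero_mul]
      · rw [norm_smul, Real.norm_eq_abs, abs_of_nonneg (pow_nonneg (faceSum_nonneg hs hy) r)]
        exact mul_le_mul_of_nonneg_left (hB _ (faceProj_mem_cell hs hy hy0))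
          (pow_nonneg (faceSum_nonneg hs hy) r)
    · refine ((continuous_faceSum hs f).pow r).continuousWithinAt.smul ?_
      have h2 : Filter.Tendsto (faceProj s f) (nhdsWithin x (cell s))
          (nhdsWithin (faceProj s f x) (cell f)) := by
        refine tendsto_nhdsWithin_iff.2
          ⟨(continuousAt_faceProj hs h0).mono_left nhdsWithin_le_nhds, ?_⟩
        filter_upwards [self_mem_nhdsWithin, nhdsWithin_le_nhds
          ((continuous_faceSum hs f).continuousAt.eventually_ne h0)] with y hy hy0
        exact faceProj_mem_cell hs hy hy0
      exact (hE _ (faceProj_mem_cell hs hx h0)).tendsto.comp h2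
  refine (h1.add (continuous_finsetSum (Finset.Icc 2 k) fun l _ => (continuous_homExt hs f l u).sub
    ((continuous_faceSum hs f).smul (continuous_homExt hs f (l - 1) u))).continuousOn).congr
    fun x hx => ?_
  rw [faceExt_eq hs hf hx]
  congr 1
  change _ = faceSum s f x ^ r • (u (faceProj s f x) - homExt s f k u (faceProj s f x))
  by_cases h0 : faceSum s f x = 0
  · rw [h0, zero_pow (by omega), zero_smul, zero_smul]
  · rw [hlag _ (faceProj_mem_cell hs hx h0)]

theorem continuousOn_extLevel (hs : IsSimplex s) (hr : 1 ≤ r)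
    (hw : ∀ s' ∈ A, ContinuousOn w (cell s')) :
    ContinuousOn (extLevel A k r s w j) (cell s) := by
  classical
  induction j with
  | zero =>
    have := hs.continuous_bary
    change ContinuousOn (fun x => ∑ v ∈ s with ∃ s' ∈ A, v ∈ s', bary s x v • w v) _
    fun_prop
  | succ j ih =>
    refine ih.add (continuousOn_finsetSum _ fun f hf => ?_)
    obtain ⟨h1, -, s', hs', hfs'⟩ := Finset.mem_filter.1 hf
    rw [Finset.mem_powerset] at h1
    exact continuousOn_faceExt hs h1 hr
      (((hw s' hs').mono (cell_mono hfs')).sub (ih.mono (cell_mono h1)))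

end ExtLevel

/-! ### Symmetry of iterated derivatives. -/

section Symmetric

variable {E F : Type} [NormedAddCommGroup E] [NormedSpace ℝ E] [NormedAddCommGroup F]
  [NormedSpace ℝ F]

theorem iteratedFDeriv_clm_apply {n : ℕ} {f : E → F} {x : E} {G : Type} [NormedAddCommGroup G]
    [NormedSpace ℝ G] (hf : ContDiffAt ℝ n f x) (L : F →L[ℝ] G) (a : Fin n → E) :
    iteratedFDeriv ℝ n (fun y => L (f y)) x a = L (iteratedFDeriv ℝ n f x a) :=
  congrArg (fun T => T a) (L.iteratedFDeriv_comp_left hf le_rfl)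

/-- In the last two slots the derivative of order n + 2 is D^n of the Hessian, and the Hessian is
symmetric in a whole neighbourhood. -/
theorem iteratedFDeriv_comp_last_swap {n : ℕ} {f : E → F} {x : E}
    (hf : ContDiffAt ℝ (n + 2 : ℕ) f x) (m m' : Fin (n + 2) → E)
    (h : ∀ i : Fin n, m i.castSucc.castSucc = m' i.castSucc.castSucc)
    (h1 : m (Fin.last n).castSucc = m' (Fin.last (n + 1)))
    (h2 : m (Fin.last (n + 1)) = m' (Fin.last n).castSucc) :
    iteratedFDeriv ℝ (n + 2) f x m = iteratedFDeriv ℝ (n + 2) f x m' := by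
  have hD : ∀ m : Fin (n + 2) → E, iteratedFDeriv ℝ (n + 2) f x m =
      iteratedFDeriv ℝ n (fderiv ℝ (fderiv ℝ f)) x (fun i => m i.castSucc.castSucc)
        (m (Fin.last n).castSucc) (m (Fin.last (n + 1))) := fun m => by
    rw [iteratedFDeriv_succ_apply_right, iteratedFDeriv_succ_apply_right]
    rfl
  have hc : ContDiffAt ℝ n (fderiv ℝ (fderiv ℝ f)) x := by
    have h1 : ContDiffAt ℝ (n + 1 : ℕ) (fderiv ℝ f) x := hf.fderiv_right (by norm_cast)
    exact h1.fderiv_right (by norm_cast)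
  have hev : ∀ (a : Fin n → E) (v w : E), iteratedFDeriv ℝ n (fderiv ℝ (fderiv ℝ f)) x a v w =
      iteratedFDeriv ℝ n (fun y => fderiv ℝ (fderiv ℝ f) y v w) x a := fun a v w =>
    (iteratedFDeriv_clm_apply (G := F) hc ((ContinuousLinearMap.apply ℝ F w).comp
      (ContinuousLinearMap.apply ℝ (E →L[ℝ] F) v)) a).symm
  have hsymm : ∀ v w, (fun y => fderiv ℝ (fderiv ℝ f) y v w) =ᶠ[nhds x]
      fun y => fderiv ℝ (fderiv ℝ f) y w v := by
    intro v w
    filter_upwards [hf.eventually (WithTop.coe_lt_coe.2 (ENat.natCast_lt_top (n + 2))).ne] with y hy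
    have : IsSymmSndFDerivAt ℝ f y := hy.isSymmSndFDerivAt (by
      rw [minSmoothness_of_isRCLikeNormedField]
      exact_mod_cast (by omega : 2 ≤ n + 2))
    exact this v w
  have hswap : ∀ (a : Fin n → E) (v w : E), iteratedFDeriv ℝ n (fderiv ℝ (fderiv ℝ f)) x a v w =
      iteratedFDeriv ℝ n (fderiv ℝ (fderiv ℝ f)) x a w v := fun a v w => by
    rw [hev, hev, ((hsymm v w).iteratedFDeriv ℝ n).eq_of_nhds]
  rw [hD, hD, hswap, h1, h2]
  congr 3
  exact funext h

/-- Adjacent transpositions generate all permutations. The transposition of the last two slots is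
the Hessian case; any other one fixes the last argument and acts on the derivatives of Df. -/
theorem iteratedFDeriv_comp_swap {n : ℕ} (i : Fin n) {F : Type} [NormedAddCommGroup F]
    [NormedSpace ℝ F] {f : E → F} {x : E} (hf : ContDiffAt ℝ (n + 1 : ℕ) f x)
    (m : Fin (n + 1) → E) : iteratedFDeriv ℝ (n + 1) f x (m ∘ Equiv.swap i.castSucc i.succ) =
      iteratedFDeriv ℝ (n + 1) f x m := by
  induction n generalizing F with
  | zero => exact i.elim0
  | succ n ih =>
    induction i using Fin.lastCases with
    | last =>
      refine iteratedFDeriv_comp_last_swap hf _ _ (fun i => ?_) ?_ ?_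
      · refine congrArg m (Equiv.swap_apply_of_ne_of_ne ?_ ?_) <;>
          simp [Fin.ext_iff] <;> omega
      · exact congrArg m (Equiv.swap_apply_left _ _)
      · exact congrArg m (Equiv.swap_apply_right _ _)
    | cast i =>
      have hD : ContDiffAt ℝ (n + 1 : ℕ) (fderiv ℝ f) x := hf.fderiv_right (by norm_cast)
      rw [iteratedFDeriv_succ_apply_right (n := n + 1), iteratedFDeriv_succ_apply_right (n := n + 1) m]
      have e1 : (m ∘ Equiv.swap i.castSucc.castSucc i.castSucc.succ) (Fin.last (n + 1)) =
          m (Fin.last (n + 1)) := by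
        refine congrArg m (Equiv.swap_apply_of_ne_of_ne ?_ ?_) <;>
          simp [Fin.ext_iff] <;> omega
      have e2 : Fin.init (m ∘ Equiv.swap i.castSucc.castSucc i.castSucc.succ) =
          Fin.init m ∘ Equiv.swap i.castSucc i.succ := by
        funext a
        refine congrArg m ?_
        rw [Fin.succ_castSucc, Equiv.swap_apply_def, Equiv.swap_apply_def]
        simp only [Fin.castSucc_inj]
        split_ifs <;> rfl
      rw [e1, e2]
      exact congrArg (fun L => L (m (Fin.last (n + 1)))) (ih i hD (Fin.init m))

/-- The iterated derivatives of a smooth function are symmetric. -/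
theorem iteratedFDeriv_comp_perm {n : ℕ} {f : E → F} {x : E} (hf : ContDiffAt ℝ n f x)
    (σ : Equiv.Perm (Fin n)) (m : Fin n → E) :
    iteratedFDeriv ℝ n f x (m ∘ σ) = iteratedFDeriv ℝ n f x m := by
  cases n with
  | zero => exact congrArg _ (Subsingleton.elim _ _)
  | succ n =>
    have hσ : σ ∈ Submonoid.closure (Set.range fun i : Fin n ↦ Equiv.swap i.castSucc i.succ) := by
      rw [Equiv.Perm.mclosure_swap_castSucc_succ]
      trivial
    induction hσ using Submonoid.closure_induction generalizing m with
    | mem σ h =>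
      obtain ⟨i, rfl⟩ := h
      exact iteratedFDeriv_comp_swap i hf m
    | one => rfl
    | mul σ τ _ _ h1 h2 => exact (h2 (m ∘ σ)).trans (h1 m)

end Symmetric

/-! ### Taylor's formula with derivatives. -/

section Taylor

variable {E F : Type} [NormedAddCommGroup E] [NormedSpace ℝ E] [NormedAddCommGroup F]
  [NormedSpace ℝ F]

/-- The Taylor polynomial of degree less than `k` at `a`. -/
noncomputable def taylorPoly (k : ℕ) (w : E → F) (a x : E) : F :=
  ∑ l ∈ Finset.range k, ((l.factorial : ℝ)⁻¹) • iteratedFDeriv ℝ l w a (fun _ => x - a)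

/-- The l + 1 terms of the product rule coincide by symmetry, and their number turns (l + 1)! into
l!. -/
theorem hasFDerivAt_iteratedFDeriv_diag {l : ℕ} {w : E → F} {a : E}
    (hw : ContDiffAt ℝ (l + 1 : ℕ) w a) (x : E) :
    HasFDerivAt (fun x => (((l + 1).factorial : ℝ)⁻¹) •
        iteratedFDeriv ℝ (l + 1) w a (fun _ => x - a))
      (((l.factorial : ℝ)⁻¹) • iteratedFDeriv ℝ l (fderiv ℝ w) a (fun _ => x - a)) x := by
  set f := iteratedFDeriv ℝ (l + 1) w a
  have h1 : HasFDerivAt (fun x : E => fun _ : Fin (l + 1) => x - a)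
      (ContinuousLinearMap.pi fun _ => ContinuousLinearMap.id ℝ E) x :=
    hasFDerivAt_pi.2 fun _ => (hasFDerivAt_id x).sub_const a
  have h2 := ((f.hasFDerivAt (x := fun _ => x - a)).comp x h1).const_smul
    (((l + 1).factorial : ℝ)⁻¹)
  refine h2.congr_fderiv ?_
  ext y
  have hterm : ∀ i : Fin (l + 1), f (Function.update (fun _ => x - a) i y) =
      iteratedFDeriv ℝ l (fderiv ℝ w) a (fun _ => x - a) y := by
    intro i
    have e1 : Function.update (fun _ => x - a) i y =
        Function.update (fun _ : Fin (l + 1) => x - a) (Fin.last l) y ∘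
          Equiv.swap i (Fin.last l) := by
      funext j
      by_cases hj : j = i
      · subst hj
        simp
      · rw [Function.update_of_ne hj, Function.comp_apply, Function.update_of_ne]
        rw [Ne, Equiv.swap_apply_eq_iff, Equiv.swap_apply_right]
        exact hj
    rw [e1, iteratedFDeriv_comp_perm hw, iteratedFDeriv_succ_apply_right, Function.update_self]
    congr 2
    funext j
    exact Function.update_of_ne (Fin.castSucc_lt_last j).ne _ _
  simp only [smul_apply, ContinuousLinearMap.comp_apply,
    ContinuousMultilinearMap.linearDeriv_apply, ContinuousLinearMap.coe_pi',
    ContinuousLinearMap.id_apply, hterm, Finset.sum_const, Finset.card_univ, Fintype.card_fin]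
  rw [← Nat.cast_smul_eq_nsmul ℝ, smul_smul]
  congr 1
  rw [Nat.factorial_succ]
  push_cast
  have : (l.factorial : ℝ) ≠ 0 := by positivity
  field_simp

/-- Differentiation maps the Taylor polynomial of w to that of Dw, so the remainder of Dw is the
derivative of the remainder of w; this drives the induction for Taylor's theorem. -/
theorem hasFDerivAt_taylorPoly {k : ℕ} {w : E → F} {a : E} (hw : ContDiffAt ℝ k w a) (x : E) :
    HasFDerivAt (taylorPoly (k + 1) w a) (taylorPoly k (fderiv ℝ w) a x) x := by
  have h1 : taylorPoly (k + 1) w a = fun x => (∑ l ∈ Finset.range k,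
      (((l + 1).factorial : ℝ)⁻¹) • iteratedFDeriv ℝ (l + 1) w a (fun _ => x - a)) + w a := by
    funext x
    rw [taylorPoly, Finset.sum_range_succ']
    simp
  rw [h1]
  refine (HasFDerivAt.fun_sum fun l hl => hasFDerivAt_iteratedFDeriv_diag (hw.of_le ?_) x).add_const _
  exact_mod_cast Finset.mem_range.1 hl

theorem contDiff_taylorPoly (k : ℕ) (w : E → F) (a : E) {n : WithTop ℕ∞} :
    ContDiff ℝ n (taylorPoly k w a) := by
  unfold taylorPoly
  refine ContDiff.sum fun l _ => contDiff_const.smul ?_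
  exact (iteratedFDeriv ℝ l w a).contDiff.comp (contDiff_pi.2 fun _ => contDiff_id.sub contDiff_const)

/-- Taylor's theorem for the derivatives. -/
theorem norm_iteratedFDeriv_sub_taylorPoly_le {k : ℕ} {w : E → F} {U : Set E} (hU : IsOpen U)
    (hc : Convex ℝ U) {a : E} (ha : a ∈ U) (hw : ContDiffOn ℝ k w U) {M : ℝ} (hM : 0 ≤ M)
    (hb : ∀ x ∈ U, ‖iteratedFDeriv ℝ k w x‖ ≤ M) {i : ℕ} (hi : i ≤ k) {x : E} (hx : x ∈ U) :
    ‖iteratedFDeriv ℝ i (fun x => w x - taylorPoly k w a x) x‖ ≤ M * ‖x - a‖ ^ (k - i) := by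
  induction k generalizing F i x with
  | zero =>
    obtain rfl : i = 0 := by omega
    have : (fun x => w x - taylorPoly 0 w a x) = w := by
      funext x
      simp [taylorPoly]
    rw [this]
    simpa using hb x hx
  | succ k ih =>
    have hwD : ContDiffOn ℝ k (fderiv ℝ w) U := hw.fderiv_of_isOpen hU (by norm_cast)
    have hD : ∀ y ∈ U, HasFDerivAt (fun x => w x - taylorPoly (k + 1) w a x)
        (fderiv ℝ w y - taylorPoly k (fderiv ℝ w) a y) y := fun y hy =>
      ((hw.differentiableOn (by simp) y hy).differentiableAt
        (hU.mem_nhds hy)).hasFDerivAt.sub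
        (hasFDerivAt_taylorPoly ((hw.contDiffAt (hU.mem_nhds ha)).of_le (by norm_cast; omega)) y)
    have hstep : ∀ i ≤ k, ∀ y ∈ U, ‖iteratedFDeriv ℝ (i + 1)
        (fun x => w x - taylorPoly (k + 1) w a x) y‖ ≤ M * ‖y - a‖ ^ (k - i) := by
      intro i hi y hy
      rw [← norm_iteratedFDeriv_fderiv]
      have he : fderiv ℝ (fun x => w x - taylorPoly (k + 1) w a x) =ᶠ[nhds y]
          fun x => fderiv ℝ w x - taylorPoly k (fderiv ℝ w) a x := by
        filter_upwards [hU.mem_nhds hy] with z hz using (hD z hz).fderiv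
      rw [(he.iteratedFDeriv ℝ i).eq_of_nhds]
      exact ih hwD (fun z hz => by rw [norm_iteratedFDeriv_fderiv]; exact hb z hz) hi hy
    cases i with
    | succ i =>
      have := hstep i (by omega) x hx
      rwa [show k + 1 - (i + 1) = k - i by omega]
    | zero =>
      rw [norm_iteratedFDeriv_zero, Nat.sub_zero]
      -- On this convex set the gradient of the remainder is at most M ‖x − a‖^k, so the mean value
      -- inequality from a to x gains the last power.
      set S := U ∩ Metric.closedBall a ‖x - a‖
      have hS : Convex ℝ S := hc.inter (convex_closedBall _ _)
      have h0 : w a - taylorPoly (k + 1) w a a = 0 := by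
        rw [taylorPoly, Finset.sum_range_succ', Finset.sum_eq_zero]
        · simp
        · intro l _
          rw [ContinuousMultilinearMap.map_coord_zero _ 0 (sub_self a), smul_zero]
      have h1 := hS.norm_image_sub_le_of_norm_hasFDerivWithin_le
        (C := M * ‖x - a‖ ^ k) (fun y hy => (hD y hy.1).hasFDerivWithinAt) (fun y hy => by
          have h2 := hstep 0 (Nat.zero_le k) y hy.1
          rw [← norm_iteratedFDeriv_fderiv, norm_iteratedFDeriv_zero, (hD y hy.1).fderiv] at h2
          refine h2.trans (mul_le_mul_of_nonneg_left ?_ hM)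
          have h3 : ‖y - a‖ ≤ ‖x - a‖ := mem_closedBall_iff_norm.1 hy.2
          exact pow_le_pow_left₀ (norm_nonneg _) h3 _)
        (⟨ha, by simp⟩ : a ∈ S) (⟨hx, by simp [dist_eq_norm]⟩ : x ∈ S)
      rw [h0, sub_zero] at h1
      rwa [pow_succ, ← mul_assoc]

variable {d : ℕ} {s : Finset (Space d)}

/-- Multilinear forms in the distance to a vertex are homogeneous polynomials. -/
theorem homPoly_diag (hs : IsSimplex s) {a : Space d} (ha : a ∈ s) {l : ℕ} {F : Type}
    [NormedAddCommGroup F] [NormedSpace ℝ F]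
    (f : ContinuousMultilinearMap ℝ (fun _ : Fin l => Space d) F) :
    HomPoly s l (‖f‖ * Metric.diam (cell s) ^ l) (fun x => f fun _ => x - a) := by
  induction l with
  | zero =>
    refine ⟨f 0, ?_, fun x => congrArg f (Subsingleton.elim _ _)⟩
    simp
  | succ l ih =>
    refine ⟨fun v x => f.curryLeft (v - a) fun _ => x - a, fun v hv => ?_, fun x => ?_⟩
    · refine (ih (f.curryLeft (v - a))).mono ?_
      rw [pow_succ', ← mul_assoc]
      refine mul_le_mul_of_nonneg_right ?_ (by positivity)
      refine (f.curryLeft.le_opNorm _).trans ?_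
      rw [ContinuousMultilinearMap.curryLeft_norm]
      refine mul_le_mul_of_nonneg_left ?_ (norm_nonneg _)
      rw [← dist_eq_norm]
      exact dist_le_diam_cell (mem_cell_of_vertex hv) (mem_cell_of_vertex ha)
    · have e1 : x - a = ∑ v ∈ s, bary s x v • (v - a) := by
        simp only [smul_sub, Finset.sum_sub_distrib, hs.sum_bary_smul, ← Finset.sum_smul,
          hs.sum_bary, one_smul]
      have e2 : f (fun _ => x - a) = f.curryLeft (x - a) (fun _ => x - a) := by
        rw [ContinuousMultilinearMap.curryLeft_apply]
        congr 1
        funext i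
        refine Fin.cases rfl (fun _ => rfl) i
      change f (fun _ => x - a) = ∑ v ∈ s, bary s x v • f.curryLeft (v - a) fun _ => x - a
      rw [e2]
      generalize (fun _ : Fin l => x - a) = y
      rw [e1, map_sum, sum_apply]
      refine Finset.sum_congr rfl fun v _ => ?_
      rw [map_smul, smul_apply]

end Taylor

/-! ### Derivatives of face projections, with the length scale diam · ω. -/

section FaceFamilies

variable {d : ℕ} {ι : Type*} {F : Type} [NormedAddCommGroup F] [NormedSpace ℝ F]

/-- A shape regular family of simplices. -/
structure ShapeFamily (s : ι → Finset (Space d)) (Cσ : ℝ) : Prop where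
  simplex (i : ι) : IsSimplex (s i)
  diam_pos (i : ι) : 0 < Metric.diam (cell (s i))
  norm_baryLin_le (i : ι) (v : Space d) : ‖baryLin (s i) v‖ ≤ Cσ * (Metric.diam (cell (s i)))⁻¹

theorem ShapeFamily.reindex {s : ι → Finset (Space d)} {Cσ : ℝ} (h : ShapeFamily s Cσ)
    {ι' : Type*} (σ : ι' → ι) : ShapeFamily (fun i => s (σ i)) Cσ :=
  ⟨fun i => h.simplex _, fun i => h.diam_pos _, fun i v => h.norm_baryLin_le _ v⟩

theorem HomPoly.norm_le {s : Finset (Space d)} (hs : IsSimplex s) {l : ℕ} {c : ℝ}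
    {P : Space d → F} (h : HomPoly s l c P) {x : Space d} (hx : x ∈ cell s) : ‖P x‖ ≤ c := by
  induction l generalizing P with
  | zero =>
    obtain ⟨a, ha, h⟩ := h
    rwa [h]
  | succ l ih =>
    obtain ⟨Q, hQ, h⟩ := h
    rw [h]
    calc ‖∑ v ∈ s, bary s x v • Q v x‖ ≤ ∑ v ∈ s, bary s x v * c := by
          refine norm_sum_le_of_le _ fun v hv => ?_
          rw [norm_smul, Real.norm_eq_abs, abs_of_nonneg (bary_nonneg hs.1 hx v)]
          exact mul_le_mul_of_nonneg_left (ih (hQ v hv)) (bary_nonneg hs.1 hx v)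
      _ = c := by rw [← Finset.sum_mul, hs.sum_bary, one_mul]

theorem uniqueDiffOn_interior (S : Set (Space d)) : UniqueDiffOn ℝ (interior S) :=
  isOpen_interior.uniqueDiffOn

/-- Polynomials in functions with controlled derivatives. -/
theorem ub_homPoly {n : ℕ} {s : ι → Finset (Space d)} (hs : ∀ i, IsSimplex (s i))
    {S : ι → Set (Space d)} (hS : ∀ i, UniqueDiffOn ℝ (S i)) {κ η : ι → Space d → ℝ}
    (hκ : ∀ i, ∀ x ∈ S i, 0 ≤ κ i x) (hη : ∀ i, ∀ x ∈ S i, 0 < η i x) {Y : ι → Space d → Space d}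
    (hY : UB n (fun p : Σ i, {v // v ∈ s i} => S p.1) (fun p => κ p.1) (fun p => η p.1)
      (fun p x => bary (s p.1) (Y p.1 x) p.2)) (l : ℕ) {c : ι → ℝ} (hc : ∀ i, 0 ≤ c i) {C : ℝ}
    {P : ι → Space d → F} (hP : ∀ i, HomPoly (s i) l (C * c i) (P i)) :
    UB n S (fun i x => c i * κ i x ^ l) η (fun i x => P i (Y i x)) := by
  induction l generalizing ι with
  | zero =>
    choose a ha h using hP
    simp only [pow_zero, mul_one]
    exact (UB.const (fun i x _ => hc i) hη a (C := C) fun i x _ => ha i).congr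
      fun i x _ => h i _
  | succ l ih =>
    choose Q hQ h using hP
    have h1 := ih (ι := Σ i, {v // v ∈ s i}) (s := fun p => s p.1) (fun p => hs p.1)
      (S := fun p => S p.1) (fun p => hS p.1) (κ := fun p => κ p.1) (η := fun p => η p.1)
      (fun p => hκ p.1) (fun p => hη p.1) (Y := fun p => Y p.1)
      (hY.reindex fun q : Σ p : (Σ i, {v // v ∈ s i}), {v // v ∈ s p.1} => ⟨q.1.1, q.2⟩)
      (c := fun p => c p.1) (fun p => hc p.1) (P := fun p => Q p.1 p.2)
      fun p => hQ p.1 p.2 p.2.2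
    have h2 := UB.smul (fun p : Σ i, {v // v ∈ s i} => hS p.1) hY h1
    refine (UB.sum hS (κ := fun i x => c i * κ i x ^ (l + 1)) (η := η)
      (fun i x hx => mul_nonneg (hc i) (pow_nonneg (hκ i x hx) _)) hη s (d + 1)
      (fun i => (hs i).2.le) (fun i v x => bary (s i) (Y i x) v • Q i v (Y i x))
      (h2.weight 1 zero_le_one fun p x _ j _ => ?_)).congr fun i x _ => h i _
    rw [one_mul]
    exact le_of_eq (by ring)

variable {s : ι → Finset (Space d)} {Cσ : ℝ} (hs : ShapeFamily s Cσ)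
include hs

theorem ShapeFamily.ub_bary {S : ι → Set (Space d)} (hS : ∀ i, UniqueDiffOn ℝ (S i))
    {κ η : ι → Space d → ℝ} (hκ : ∀ i, ∀ x ∈ S i, 0 ≤ κ i x) (hη : ∀ i, ∀ x ∈ S i, 0 < η i x)
    {v : ι → Space d} (n : ℕ) {C C' : ℝ} (hb : ∀ i, ∀ x ∈ S i, |bary (s i) x (v i)| ≤ C * κ i x)
    (hL : ∀ i, ∀ x ∈ S i, (Metric.diam (cell (s i)))⁻¹ ≤ C' * (κ i x * (η i x)⁻¹)) :
    UB n S κ η (fun i x => bary (s i) x (v i)) := by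
  have h1 : UD n S κ η (fun i x => baryLin (s i) (v i) x + bary (s i) 0 (v i)) :=
    UD.affine (C := |Cσ| * C') hS hκ hη (fun i => baryLin (s i) (v i))
      (fun i => bary (s i) 0 (v i)) (fun i x hx => by
      refine (hs.norm_baryLin_le i _).trans ?_
      rw [mul_assoc]
      refine (mul_le_mul_of_nonneg_right (le_abs_self Cσ)
        (inv_nonneg.2 (hs.diam_pos i).le)).trans ?_
      exact mul_le_mul_of_nonneg_left (hL i x hx) (abs_nonneg _))
  have h2 : ∀ i x, baryLin (s i) (v i) x + bary (s i) 0 (v i) = bary (s i) x (v i) := fun i x => by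
    rw [(hs.simplex i).bary_eq_baryLin x 0, sub_zero, add_comm]
  simp only [h2] at h1
  exact h1.toUB hκ hη (C' := C) fun i x hx => by rw [Real.norm_eq_abs]; exact hb i x hx

variable {f g : ι → Finset (Space d)} (hg : ∀ i, g i ⊆ s i) (hgn : ∀ i, (g i).Nonempty)
include hg hgn

theorem ShapeFamily.weight_pos (i : ι) (x : Space d) (hx : x ∈ interior (cell (s i))) :
    0 < Metric.diam (cell (s i)) * faceSum (s i) (g i) x :=
  mul_pos (hs.diam_pos i) (faceSum_pos (hs.simplex i) (hg i) (hgn i) hx)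

/-- The gradient of ω is O(1/diam), which is exactly the size ω divided by the scale diam · ω. -/
theorem ShapeFamily.ub_faceSum (n : ℕ) : UB n (fun i => interior (cell (s i)))
    (fun i x => faceSum (s i) (g i) x)
    (fun i x => Metric.diam (cell (s i)) * faceSum (s i) (g i) x)
    (fun i x => faceSum (s i) (g i) x) := by
  have hS := fun i => uniqueDiffOn_interior (cell (s i))
  have hpos : ∀ i, ∀ x ∈ interior (cell (s i)), 0 < faceSum (s i) (g i) x := fun i x hx =>
    faceSum_pos (hs.simplex i) (hg i) (hgn i) hx
  refine UB.sum hS (fun i x hx => (hpos i x hx).le) (hs.weight_pos hg hgn) g (d + 1)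
    (fun i => (Finset.card_le_card (hg i)).trans (hs.simplex i).2.le)
    (fun i v x => bary (s i) x v) ?_
  refine (hs.reindex fun p : Σ i, {v // v ∈ g i} => p.1).ub_bary (C := 1) (C' := 1)
    (fun p => hS p.1) (fun p x hx => (hpos p.1 x hx).le)
    (fun p x hx => hs.weight_pos hg hgn p.1 x hx) (v := fun p => p.2) n
    (fun p x hx => ?_) fun p x hx => ?_
  · have hx' := interior_subset hx
    rw [abs_of_nonneg (bary_nonneg (hs.simplex p.1).1 hx' _), one_mul]
    exact Finset.single_le_sum (f := fun v => bary (s p.1) x v)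
      (fun v _ => bary_nonneg (hs.simplex p.1).1 hx' v) p.2.2
  · have h1 := hpos p.1 x hx
    have h2 := hs.diam_pos p.1
    rw [one_mul]
    refine le_of_eq ?_
    field_simp

/-- These coordinates are the quotients λ_v / ω for v in g, and zero otherwise: bounded, with every
derivative costing 1/(diam ω). -/
theorem ShapeFamily.ub_bary_faceProj (n : ℕ) :
    UB n (fun p : Σ i, {v // v ∈ s i} => interior (cell (s p.1))) (fun _ _ => 1)
      (fun p x => Metric.diam (cell (s p.1)) * faceSum (s p.1) (g p.1) x)
      (fun p x => bary (s p.1) (faceProj (s p.1) (g p.1) x) p.2) := by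
  classical
  have hS := fun p : Σ i, {v // v ∈ s i} => uniqueDiffOn_interior (cell (s p.1))
  have hpos : ∀ i, ∀ x ∈ interior (cell (s i)), 0 < faceSum (s i) (g i) x := fun i x hx =>
    faceSum_pos (hs.simplex i) (hg i) (hgn i) hx
  have hη := fun (p : Σ i, {v // v ∈ s i}) x hx => hs.weight_pos hg hgn p.1 x hx
  have h1 : UB n (fun p : Σ i, {v // v ∈ s i} => interior (cell (s p.1)))
      (fun p x => faceSum (s p.1) (g p.1) x)
      (fun p x => Metric.diam (cell (s p.1)) * faceSum (s p.1) (g p.1) x)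
      (fun p x => if (p.2 : Space d) ∈ g p.1 then bary (s p.1) x p.2 else 0) := by
    have h2 : UD n (fun p : Σ i, {v // v ∈ s i} => interior (cell (s p.1)))
        (fun p x => faceSum (s p.1) (g p.1) x)
        (fun p x => Metric.diam (cell (s p.1)) * faceSum (s p.1) (g p.1) x)
        (fun p x => (if (p.2 : Space d) ∈ g p.1 then baryLin (s p.1) p.2 else 0) x +
          if (p.2 : Space d) ∈ g p.1 then bary (s p.1) 0 p.2 else 0) := by
      refine UD.affine (C := |Cσ|) hS (fun p x hx => (hpos p.1 x hx).le) hη _ _ fun p x hx => ?_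
      have h1 := hpos p.1 x hx
      have h2 := hs.diam_pos p.1
      have h3 : faceSum (s p.1) (g p.1) x *
          (Metric.diam (cell (s p.1)) * faceSum (s p.1) (g p.1) x)⁻¹ =
          (Metric.diam (cell (s p.1)))⁻¹ := by field_simp
      rw [h3]
      split_ifs
      · exact (hs.norm_baryLin_le _ _).trans
          (mul_le_mul_of_nonneg_right (le_abs_self _) (inv_nonneg.2 h2.le))
      · rw [norm_zero]
        positivity
    have h3 : ∀ (p : Σ i, {v // v ∈ s i}) x,
        (if (p.2 : Space d) ∈ g p.1 then baryLin (s p.1) p.2 else 0) x +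
          (if (p.2 : Space d) ∈ g p.1 then bary (s p.1) 0 p.2 else 0) =
        if (p.2 : Space d) ∈ g p.1 then bary (s p.1) x p.2 else 0 := fun p x => by
      split_ifs
      · rw [(hs.simplex p.1).bary_eq_baryLin x 0, sub_zero, add_comm]
      · simp
    simp only [h3] at h2
    refine h2.toUB (C' := 1) (fun p x hx => (hpos p.1 x hx).le) hη fun p x hx => ?_
    have hx' := interior_subset hx
    rw [one_mul, Real.norm_eq_abs]
    split_ifs with h
    · rw [abs_of_nonneg (bary_nonneg (hs.simplex p.1).1 hx' _)]
      exact Finset.single_le_sum (f := fun v => bary (s p.1) x v)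
        (fun v _ => bary_nonneg (hs.simplex p.1).1 hx' v) h
    · rw [abs_zero]
      exact (hpos p.1 x hx).le
  have h4 := ((hs.ub_faceSum hg hgn n).inv (fun i => uniqueDiffOn_interior (cell (s i)))
    (hs.weight_pos hg hgn) hpos (c := 1) one_pos
    (fun i x hx => by rw [one_mul]; exact le_abs_self _)).reindex
    fun p : Σ i, {v // v ∈ s i} => p.1
  refine ((UB.mul hS h4 h1).weight 1 zero_le_one fun p x hx j _ => ?_).congr fun p x hx => ?_
  · rw [inv_mul_cancel₀ (hpos p.1 x hx).ne', one_mul, one_mul]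
  · split_ifs with h
    · exact bary_simplex_faceProj (hs.simplex p.1) (hg p.1) (hpos p.1 x hx).ne' h
    · rw [mul_zero]
      exact bary_simplex_faceProj_of_notMem (hs.simplex p.1) (hg p.1) (hpos p.1 x hx).ne' h

/-- Z differs from a fixed vertex v₀ by Σ λ_v(Z) (v − v₀), which has size diam. The vertex itself is
not small, hence `UD` only. -/
theorem ShapeFamily.ud_faceProj (n : ℕ) :
    UD n (fun i => interior (cell (s i))) (fun i _ => Metric.diam (cell (s i)))
      (fun i x => Metric.diam (cell (s i)) * faceSum (s i) (g i) x)
      (fun i x => faceProj (s i) (g i) x) := by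
  have hS := fun i => uniqueDiffOn_interior (cell (s i))
  have hη := hs.weight_pos hg hgn
  have hsub : ∀ i, ∀ v ∈ s i, dist v (hgn i).choose ≤ Metric.diam (cell (s i)) := fun i v hv =>
    dist_le_diam_cell (mem_cell_of_vertex hv) (mem_cell_of_vertex (hg i (hgn i).choose_spec))
  have h0 : UB n (fun p : Σ i, {v // v ∈ s i} => interior (cell (s p.1)))
      (fun p _ => Metric.diam (cell (s p.1)))
      (fun p x => Metric.diam (cell (s p.1)) * faceSum (s p.1) (g p.1) x)
      (fun p _ => (p.2 : Space d) - (hgn p.1).choose) :=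
    UB.const (C := 1) (fun p x _ => (hs.diam_pos p.1).le) (fun p x hx => hη p.1 x hx) _
      fun p x _ => by
        rw [one_mul, ← dist_eq_norm]
        exact hsub p.1 p.2 p.2.2
  have h0' := UB.smul (fun p : Σ i, {v // v ∈ s i} => hS p.1) (hs.ub_bary_faceProj hg hgn n) h0
  simp only [one_mul] at h0'
  have h1 : UB n (fun i => interior (cell (s i))) (fun i _ => Metric.diam (cell (s i)))
      (fun i x => Metric.diam (cell (s i)) * faceSum (s i) (g i) x)
      (fun i x => ∑ v ∈ s i,
        bary (s i) (faceProj (s i) (g i) x) v • (v - (hgn i).choose)) :=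
    UB.sum hS (fun i _ _ => (hs.diam_pos i).le) hη s (d + 1) (fun i => (hs.simplex i).2.le)
      (fun i v x => bary (s i) (faceProj (s i) (g i) x) v • (v - (hgn i).choose)) h0'
  have h2 : UD n (fun i => interior (cell (s i))) (fun i _ => Metric.diam (cell (s i)))
      (fun i x => Metric.diam (cell (s i)) * faceSum (s i) (g i) x)
      (fun i x => (0 : Space d →L[ℝ] Space d) x + (hgn i).choose) :=
    UD.affine (C := 0) hS (fun i x _ => (hs.diam_pos i).le) hη _ _ fun i x _ => by simp
  have h3 := UD.add hS h1.toUD h2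
  have h4 : ∀ i x, ∑ v ∈ s i, bary (s i) (faceProj (s i) (g i) x) v • (v - (hgn i).choose) +
      ((0 : Space d →L[ℝ] Space d) x + (hgn i).choose) = faceProj (s i) (g i) x := fun i x => by
    simp only [smul_sub, Finset.sum_sub_distrib, ← Finset.sum_smul, (hs.simplex i).sum_bary,
    (hs.simplex i).sum_bary_smul]
    simp
  simpa only [h4] using h3

/-- Composition with the projections onto faces. -/
theorem ShapeFamily.ub_comp_faceProj {n : ℕ} {T : ι → Set (Space d)}
    (hT : ∀ i, UniqueDiffOn ℝ (T i)) {K : ι → ℝ} (hK : ∀ i, 0 ≤ K i) {w : ι → Space d → F}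
    (hw : UB n T (fun i _ => K i) (fun i _ => Metric.diam (cell (s i))) w)
    (hgT : ∀ i, cell (g i) ⊆ T i) :
    UB n (fun i => interior (cell (s i))) (fun i _ => K i)
      (fun i x => Metric.diam (cell (s i)) * faceSum (s i) (g i) x)
      (fun i x => w i (faceProj (s i) (g i) x)) :=
  UB.comp (fun i => uniqueDiffOn_interior (cell (s i))) (hs.weight_pos hg hgn) hT
    (fun i _ _ => hK i) (fun i _ _ => hs.diam_pos i) hw (hs.ud_faceProj hg hgn n)
    fun i x hx => hgT i (faceProj_mem_cell (hs.simplex i) (interior_subset hx)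
      (faceSum_pos (hs.simplex i) (hg i) (hgn i) hx).ne')

end FaceFamilies

/-! ### The extension of polynomials and of bounded functions. -/

section FaceExtPoly

variable {d : ℕ} {s f : Finset (Space d)} {k r l : ℕ} {c : ℝ} {u P : Space d → Space d}

theorem faceSum_eq_sum (hf : f ⊆ s) (x : Space d) [DecidableEq (Space d)] :
    ∑ v ∈ s, (if v ∈ f then (1 : ℝ) else 0) * bary s x v = faceSum s f x := by
  simp only [ite_mul, one_mul, zero_mul]
  rw [← Finset.sum_filter, Finset.filter_mem_eq_inter, Finset.inter_eq_right.2 hf, faceSum]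

theorem HomPoly.faceSum_pow_smul (hf : f ⊆ s) (hc : 0 ≤ c) (n : ℕ) (hP : HomPoly s l c P) :
    HomPoly s (l + n) c (fun x => faceSum s f x ^ n • P x) := by
  classical
  have h := hP.prod_range n (fun _ v => if v ∈ f then (1 : ℝ) else 0) zero_le_one hc
    fun i _ v _ => by split_ifs <;> simp
  rw [one_pow, one_mul] at h
  refine h.congr fun x => ?_
  simp only [faceSum_eq_sum hf, Finset.prod_const, Finset.card_range]

/-- The constant in the bounds for interpolants. -/
noncomputable def lagConst (d k : ℕ) : ℝ := (d + 1) ^ k * (2 * k) ^ k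

theorem lagConst_nonneg (d k : ℕ) : 0 ≤ lagConst d k := by unfold lagConst; positivity

theorem homPoly_homExt_of_le (hs : IsSimplex s) (hf : f ⊆ s) {j : ℕ} (hj : 1 ≤ j) (hjk : j ≤ k)
    (hu : ∀ x ∈ cell f, ‖u x‖ ≤ c) (hc : 0 ≤ c) :
    HomPoly s j (lagConst d k * c) (homExt s f j u) := by
  refine (homPoly_homExt hs hf hc fun α hα => hu _ (node_mem_cell hj hα)).mono ?_
  rw [← mul_assoc]
  refine mul_le_mul_of_nonneg_right (mul_le_mul ?_ ?_ (by positivity) (by positivity)) hc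
  · exact pow_le_pow_right₀ (by simp) hjk
  · have h1 : (j : ℝ) ≤ k := by exact_mod_cast hjk
    have h2 : (1 : ℝ) ≤ j := by exact_mod_cast hj
    exact (pow_le_pow_left₀ (by positivity) (by linarith) j).trans
      (pow_le_pow_right₀ (by linarith) hjk)

theorem homPoly_homExt_sub (hs : IsSimplex s) (hf : f ⊆ s) {j : ℕ} (hj : 2 ≤ j) (hjk : j ≤ k)
    (hu : ∀ x ∈ cell f, ‖u x‖ ≤ c) (hc : 0 ≤ c) :
    HomPoly s j (2 * (lagConst d k * c))
      (fun x => homExt s f j u x - faceSum s f x • homExt s f (j - 1) u x) := by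
  have hb := mul_nonneg (lagConst_nonneg d k) hc
  have h1 := homPoly_homExt_of_le hs hf (by omega) hjk hu hc
  have h2 := ((homPoly_homExt_of_le hs hf (j := j - 1) (by omega) (by omega) hu
    hc).faceSum_pow_smul hf hb 1).smul (-1)
  rw [show j - 1 + 1 = j by omega] at h2
  refine ((h1.add h2).congr fun x => ?_).mono (le_of_eq ?_)
  · rw [pow_one, neg_one_smul, sub_eq_add_neg]
  · rw [abs_neg, abs_one]; ring

/-- The extension of polynomials is polynomial. -/
theorem exists_homPoly_faceExt (hs : IsSimplex s) (hf : f ⊆ s) (hk : 1 ≤ k) (hr : 1 ≤ r)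
    (hlk : l ≤ k) (hc : 0 ≤ c) (hP : HomPoly s l c P) :
    ∃ P', HomPoly s l (k * (2 * (lagConst d k * c))) P' ∧
      ∀ x ∈ cell s, faceExt k r s f P x = P' x := by
  have hb : 0 ≤ 2 * (lagConst d k * c) :=
    mul_nonneg zero_le_two (mul_nonneg (lagConst_nonneg d k) hc)
  have hPc : ∀ x ∈ cell f, ‖P x‖ ≤ c := fun x hx => hP.norm_le hs (cell_mono hf hx)
  -- For j > l both interpolants reproduce P, as does Λ_k, so those terms cancel. The terms with j ≤
  -- l are raised to degree l.
  refine ⟨fun x => ∑ j ∈ Finset.Icc 2 l,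
    (homExt s f j P x - faceSum s f x • homExt s f (j - 1) P x), ?_, fun x hx => ?_⟩
  · refine (HomPoly.sum (c := 2 * (lagConst d k * c)) (Finset.Icc 2 l) fun j hj => ?_).mono ?_
    · obtain ⟨h1, h2⟩ := Finset.mem_Icc.1 hj
      exact (homPoly_homExt_sub hs hf h1 (h2.trans hlk) hPc hc).raise_le hs hb h2
    · refine mul_le_mul_of_nonneg_right ?_ hb
      rw [Nat.card_Icc]
      exact_mod_cast (by omega : l + 1 - 2 ≤ k)
  · rw [faceExt_eq hs hf hx]
    have h1 : faceSum s f x ^ r • (P (faceProj s f x) - lagrange k f P (faceProj s f x)) = 0 := by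
      by_cases h0 : faceSum s f x = 0
      · rw [h0, zero_pow (by omega), zero_smul]
      · rw [lagrange_homPoly hs hf hP hk hlk (faceProj_mem_cell hs hx h0), sub_self, smul_zero]
    rw [h1, zero_add]
    symm
    refine Finset.sum_subset (Finset.Icc_subset_Icc_right hlk) fun j hj hj' => ?_
    simp only [Finset.mem_Icc] at hj hj'
    by_cases h0 : faceSum s f x = 0
    · rw [homExt_eq_zero hs (by omega) hx h0, h0, zero_smul, sub_zero]
    · have hZ := faceProj_mem_cell hs hx h0
      rw [← lagrange_faceProj hs hf h0, ← lagrange_faceProj (j := j - 1) hs hf h0,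
        lagrange_homPoly hs hf hP (by omega) (by omega) hZ,
        lagrange_homPoly hs hf hP (by omega) (by omega) hZ, smul_smul, ← pow_succ',
        show j - 1 + 1 = j by omega, sub_self]

/-- The extension of a bounded function is a polynomial plus a weighted composition. -/
theorem exists_homPoly_faceExt_sub (hs : IsSimplex s) (hf : f ⊆ s) (hk : 1 ≤ k) (hkr : k ≤ r)
    (hc : 0 ≤ c) (hu : ∀ x ∈ cell f, ‖u x‖ ≤ c) :
    ∃ R, HomPoly s r ((2 * k + 1) * (lagConst d k * c)) R ∧
      ∀ x ∈ cell s, faceExt k r s f u x = faceSum s f x ^ r • u (faceProj s f x) + R x := by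
  have hb0 := mul_nonneg (lagConst_nonneg d k) hc
  have hb : 0 ≤ 2 * (lagConst d k * c) := mul_nonneg zero_le_two hb0
  -- The part −ω^r Λ_k u ∘ Z equals −ω^(r−k) times a polynomial of degree k; this uses k ≤ r.
  have h1 := ((homPoly_homExt_of_le hs hf hk le_rfl hu hc).faceSum_pow_smul hf hb0 (r - k)).smul (-1)
  have h2 := HomPoly.sum (Finset.Icc 2 k) (P := fun j x =>
    homExt s f j u x - faceSum s f x • homExt s f (j - 1) u x)
    (s := s) (l := r) (c := 2 * (lagConst d k * c)) fun j hj => by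
      obtain ⟨h1, h2⟩ := Finset.mem_Icc.1 hj
      exact (homPoly_homExt_sub hs hf h1 h2 hu hc).raise_le hs hb (h2.trans hkr)
  rw [show k + (r - k) = r by omega] at h1
  refine ⟨_, (h1.add h2).mono ?_, fun x hx => ?_⟩
  · rw [abs_neg, abs_one, Nat.card_Icc]
    have : ((k + 1 - 2 : ℕ) : ℝ) ≤ k := by exact_mod_cast (by omega : k + 1 - 2 ≤ k)
    nlinarith
  · rw [faceExt_eq hs hf hx, ← add_assoc, neg_one_smul, ← sub_eq_add_neg]
    congr 1
    rw [smul_sub]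
    congr 1
    by_cases h0 : faceSum s f x = 0
    · rw [homExt_eq_zero hs hk hx h0, h0, zero_pow (by omega), zero_smul, smul_zero]
    · rw [← lagrange_faceProj hs hf h0, smul_smul, ← pow_add, show r - k + k = r by omega]

end FaceExtPoly

/-! ### Functions on faces split into polynomials and remainders. -/

section ExtRegular

variable {d : ℕ} {ι : Type*} {k r N : ℕ} {s f g : ι → Finset (Space d)} {c : ι → ℕ → ℝ} {K : ι → ℝ}
  {u u' : ι → Space d → Space d} {Cσ : ℝ}

/-- On the faces `g` of the simplices `s`, the functions `u` are sums of homogeneous polynomials of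
degree at most `k` with coefficients of size `c` and remainders of size `K`. -/
def ExtRegular (k N : ℕ) (s g : ι → Finset (Space d)) (c : ι → ℕ → ℝ) (K : ι → ℝ)
    (u : ι → Space d → Space d) : Prop :=
  ∃ C, 0 ≤ C ∧ ∃ (P : ι → ℕ → Space d → Space d) (q : ι → Space d → Space d),
    (∀ i, ∀ l ≤ k, HomPoly (s i) l (C * c i l) (P i l)) ∧
    (∀ i, ∀ x ∈ cell (g i), u i x = ∑ l ∈ Finset.range (k + 1), P i l x + q i x) ∧
    (∀ i, ∀ x ∈ cell (g i), ‖q i x‖ ≤ C * K i) ∧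
    UB N (fun i => interior (cell (s i))) (fun i _ => K i)
      (fun i x => Metric.diam (cell (s i)) * faceSum (s i) (g i) x)
      (fun i x => q i (faceProj (s i) (g i) x))

theorem ExtRegular.reindex {ι' : Type*} (σ : ι' → ι) (h : ExtRegular k N s g c K u) :
    ExtRegular k N (fun i => s (σ i)) (fun i => g (σ i)) (fun i => c (σ i)) (fun i => K (σ i))
      (fun i => u (σ i)) := by
  obtain ⟨C, hC, P, q, h1, h2, h3, h4⟩ := h
  exact ⟨C, hC, fun i => P (σ i), fun i => q (σ i), fun i => h1 _, fun i => h2 _, fun i => h3 _,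
    h4.reindex σ⟩

theorem ExtRegular.congr (h : ExtRegular k N s g c K u)
    (he : ∀ i, ∀ x ∈ cell (g i), u' i x = u i x) : ExtRegular k N s g c K u' := by
  obtain ⟨C, hC, P, q, h1, h2, h3, h4⟩ := h
  exact ⟨C, hC, P, q, h1, fun i x hx => (he i x hx).trans (h2 i x hx), h3, h4⟩

theorem ExtRegular.add_smul (a : ℝ)
    (h : ExtRegular k N s g c K u) (h' : ExtRegular k N s g c K u') :
    ExtRegular k N s g c K (fun i x => u i x + a • u' i x) := by
  obtain ⟨C, hC, P, q, h1, h2, h3, h4⟩ := h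
  obtain ⟨C', hC', P', q', h1', h2', h3', h4'⟩ := h'
  have hS := fun i => uniqueDiffOn_interior (cell (s i))
  refine ⟨C + |a| * C', by positivity, fun i l x => P i l x + a • P' i l x,
    fun i x => q i x + a • q' i x, fun i l hl => ?_, fun i x hx => ?_, fun i x hx => ?_, ?_⟩
  · exact ((h1 i l hl).add ((h1' i l hl).smul a)).mono (le_of_eq (by ring))
  · beta_reduce
    rw [h2 i x hx, h2' i x hx, Finset.sum_add_distrib, ← Finset.smul_sum, smul_add]
    abel
  · refine (norm_add_le _ _).trans ?_
    rw [norm_smul, Real.norm_eq_abs]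
    have := mul_le_mul_of_nonneg_left (h3' i x hx) (abs_nonneg a)
    linarith [h3 i x hx]
  · exact UB.add hS h4 (UB.clm hS (a • ContinuousLinearMap.id ℝ (Space d)) h4')

theorem ExtRegular.sum (hs : ShapeFamily s Cσ) (hg : ∀ i, g i ⊆ s i) (hgn : ∀ i, (g i).Nonempty)
    (hc : ∀ i l, 0 ≤ c i l) (hK : ∀ i, 0 ≤ K i) {α : Type*} (t : ι → Finset α) (M : ℕ)
    (hM : ∀ i, (t i).card ≤ M) (v : ι → α → Space d → Space d)
    (h : ExtRegular k N (fun p : Σ i, {a // a ∈ t i} => s p.1) (fun p => g p.1) (fun p => c p.1)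
      (fun p => K p.1) (fun p => v p.1 p.2)) :
    ExtRegular k N s g c K (fun i x => ∑ a ∈ t i, v i a x) := by
  classical
  obtain ⟨C, hC, P, q, h1, h2, h3, h4⟩ := h
  have hMi : ∀ i, ((t i).card : ℝ) ≤ M := fun i => by exact_mod_cast hM i
  refine ⟨M * C, by positivity,
    fun i l x => ∑ a ∈ t i, if h : a ∈ t i then P ⟨i, a, h⟩ l x else 0,
    fun i x => ∑ a ∈ t i, if h : a ∈ t i then q ⟨i, a, h⟩ x else 0, fun i l hl => ?_,
    fun i x hx => ?_, fun i x hx => ?_, ?_⟩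
  · refine (HomPoly.sum (t i) (c := C * c i l) fun a ha => ?_).mono ?_
    · simp only [dif_pos ha]
      exact h1 ⟨i, a, ha⟩ l hl
    · rw [mul_assoc]
      exact mul_le_mul_of_nonneg_right (hMi i) (mul_nonneg hC (hc i l))
  · rw [Finset.sum_comm, ← Finset.sum_add_distrib]
    refine Finset.sum_congr rfl fun a ha => ?_
    simp only [dif_pos ha]
    exact h2 ⟨i, a, ha⟩ x hx
  · calc _ ≤ ∑ a ∈ t i, C * K i := norm_sum_le_of_le _ fun a ha => by
          simp only [dif_pos ha]
          exact h3 ⟨i, a, ha⟩ x hx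
      _ ≤ M * C * K i := by
          rw [Finset.sum_const, nsmul_eq_mul, mul_assoc]
          exact mul_le_mul_of_nonneg_right (hMi i) (mul_nonneg hC (hK i))
  · refine UB.sum (fun i => uniqueDiffOn_interior (cell (s i))) (fun i _ _ => hK i)
      (hs.weight_pos hg hgn) t M hM
      (fun i a x => if h : a ∈ t i then q ⟨i, a, h⟩ (faceProj (s i) (g i) x) else 0) ?_
    exact h4.congr fun p x _ => dif_pos p.2.2

theorem faceProj_faceProj {s f g : Finset (Space d)} (hs : IsSimplex s) (hfg : f ⊆ g) (hg : g ⊆ s)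
    {x : Space d} (h0 : faceSum s g x ≠ 0) :
    faceSum s f (faceProj s g x) = (faceSum s g x)⁻¹ * faceSum s f x ∧
      faceProj s f (faceProj s g x) = faceProj s f x := by
  have h1 : ∀ v ∈ f, bary s (faceProj s g x) v = (faceSum s g x)⁻¹ * bary s x v := fun v hv =>
    bary_simplex_faceProj hs hg h0 (hfg hv)
  have h2 : faceSum s f (faceProj s g x) = (faceSum s g x)⁻¹ * faceSum s f x := by
    rw [faceSum.eq_1 s f x, Finset.mul_sum]
    exact Finset.sum_congr rfl h1
  refine ⟨h2, ?_⟩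
  rw [faceProj.eq_1 s f, faceProj.eq_1 s f, h2, Finset.sum_congr rfl fun v hv => by rw [h1 v hv, mul_smul],
    ← Finset.smul_sum, smul_smul, mul_inv, inv_inv, mul_right_comm, mul_inv_cancel₀ h0, one_mul]

/-- Regularity is inherited by the extension to larger faces. -/
theorem ExtRegular.extend (hs : ShapeFamily s Cσ) (hg : ∀ i, g i ⊆ s i) (hfg : ∀ i, f i ⊆ g i)
    (hfn : ∀ i, (f i).Nonempty) (hc : ∀ i l, 0 ≤ c i l) (hK : ∀ i, 0 ≤ K i) (hk : 1 ≤ k)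
    (hkr : k ≤ r) (hNr : N ≤ r) (h : ExtRegular k N s f c K u) :
    ExtRegular k N s g c K (fun i => faceExt k r (s i) (f i) (u i)) := by
  have hf : ∀ i, f i ⊆ s i := fun i => (hfg i).trans (hg i)
  have hgn : ∀ i, (g i).Nonempty := fun i => (hfn i).mono (hfg i)
  obtain ⟨C, hC, P, q, h1, h2, h3, h4⟩ := h
  have hP : ∀ i l, ∃ P', l ≤ k → HomPoly (s i) l (k * (2 * (lagConst d k * (C * c i l)))) P' ∧
      ∀ x ∈ cell (s i), faceExt k r (s i) (f i) (P i l) x = P' x := by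
    intro i l
    by_cases hl : l ≤ k
    · obtain ⟨P', h⟩ := exists_homPoly_faceExt (hs.simplex i) (hf i) hk (hk.trans hkr) hl
        (mul_nonneg hC (hc i l)) (h1 i l hl)
      exact ⟨P', fun _ => h⟩
    · exact ⟨0, fun h => absurd h hl⟩
  choose P' hP' using hP
  choose R hR1 hR2 using fun i => exists_homPoly_faceExt_sub (hs.simplex i) (hf i) hk hkr
    (mul_nonneg hC (hK i)) (h3 i)
  have hB := lagConst_nonneg d k
  have hS := fun i => uniqueDiffOn_interior (cell (s i))
  have hposf : ∀ i, ∀ x ∈ interior (cell (s i)), 0 < faceSum (s i) (f i) x := fun i x hx =>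
    faceSum_pos (hs.simplex i) (hf i) (hfn i) hx
  have hposg : ∀ i, ∀ x ∈ interior (cell (s i)), 0 < faceSum (s i) (g i) x := fun i x hx =>
    faceSum_pos (hs.simplex i) (hg i) (hgn i) hx
  -- The polynomial parts extend to the polynomials P'. The extension of the remainder, ω_f^r q ∘
  -- Z_f + R, becomes the new remainder.
  refine ⟨k * (2 * (lagConst d k * C)) + (C + (2 * k + 1) * (lagConst d k * C)), by positivity, P',
    fun i => faceExt k r (s i) (f i) (q i), fun i l hl => ?_,
    fun i x hx => ?_, fun i x hx => ?_, ?_⟩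
  · refine (hP' i l hl).1.mono ?_
    have e : k * (2 * (lagConst d k * (C * c i l))) = k * (2 * (lagConst d k * C)) * c i l := by ring
    rw [e]
    exact mul_le_mul_of_nonneg_right (le_add_of_nonneg_right (by positivity)) (hc i l)
  · have hx' := cell_mono (hg i) hx
    beta_reduce
    rw [faceExt_congr (hs.simplex i) hk (hk.trans hkr) hx' (h2 i), faceExt_add, faceExt_sum]
    congr 1
    exact Finset.sum_congr rfl fun l hl => (hP' i l (by
      have := Finset.mem_range.1 hl; omega)).2 x hx'
  · have hx' := cell_mono (hg i) hx
    beta_reduce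
    rw [hR2 i x hx']
    have hRb := (hR1 i).norm_le (hs.simplex i) hx'
    have hqb : ‖faceSum (s i) (f i) x ^ r • q i (faceProj (s i) (f i) x)‖ ≤ C * K i := by
      by_cases h0 : faceSum (s i) (f i) x = 0
      · rw [h0, zero_pow (by omega), zero_smul, norm_zero]
        exact mul_nonneg hC (hK i)
      · have h5 := faceSum_nonneg (f := f i) (hs.simplex i) hx'
        rw [norm_smul, Real.norm_eq_abs, abs_of_nonneg (pow_nonneg h5 r)]
        exact (mul_le_of_le_one_left (norm_nonneg _)
          (pow_le_one₀ h5 (faceSum_le_one (hs.simplex i) (hf i) hx'))).trans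
          (h3 i _ (faceProj_mem_cell (hs.simplex i) hx' h0))
    refine (norm_add_le_of_le hqb hRb).trans ?_
    have : 0 ≤ k * (2 * (lagConst d k * C)) * K i :=
      mul_nonneg (by positivity) (hK i)
    linarith
  · have hηf := hs.weight_pos hf hfn
    have hηg := hs.weight_pos hg hgn
    have hle : ∀ i, ∀ x ∈ interior (cell (s i)), faceSum (s i) (f i) x ≤ faceSum (s i) (g i) x :=
      fun i x hx => faceSum_mono (hs.simplex i) (hfg i) (interior_subset hx)
    have hR : UB N (fun i => interior (cell (s i))) (fun i _ => K i)
        (fun i x => Metric.diam (cell (s i)) * faceSum (s i) (g i) x)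
        (fun i x => R i (faceProj (s i) (g i) x)) := by
      have := ub_homPoly (Y := fun i x => faceProj (s i) (g i) x) hs.simplex hS
        (fun _ _ _ => zero_le_one) hηg
        (hs.ub_bary_faceProj hg hgn N) r hK (C := (2 * k + 1) * (lagConst d k * C)) (P := R)
        fun i => (hR1 i).mono (le_of_eq (by ring))
      simpa only [one_pow, mul_one] using this
    have hinv : UB N (fun i => interior (cell (s i))) (fun i x => (faceSum (s i) (g i) x)⁻¹)
        (fun i x => Metric.diam (cell (s i)) * faceSum (s i) (f i) x)
        (fun i x => (faceSum (s i) (g i) x)⁻¹) := by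
      refine ((hs.ub_faceSum hg hgn N).inv hS hηg hposg (c := 1) one_pos
        (fun i x hx => by rw [one_mul]; exact le_abs_self _)).weight 1 zero_le_one
        fun i x hx j _ => ?_
      rw [one_mul]
      refine mul_le_mul_of_nonneg_left (pow_le_pow_left₀ (inv_nonneg.2 (hηg i x hx).le) ?_ j)
        (inv_nonneg.2 (hposg i x hx).le)
      exact inv_anti₀ (hηf i x hx) (mul_le_mul_of_nonneg_left (hle i x hx) (hs.diam_pos i).le)
    -- θ = ω_f / ω_g is the function ω_f composed with the projection onto g.
    have hθ := UB.mul hS hinv (hs.ub_faceSum hf hfn N)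
    have hpow : ∀ m : ℕ, UB N (fun i => interior (cell (s i)))
        (fun i x => ((faceSum (s i) (g i) x)⁻¹ * faceSum (s i) (f i) x) ^ m)
        (fun i x => Metric.diam (cell (s i)) * faceSum (s i) (f i) x)
        (fun i x => ((faceSum (s i) (g i) x)⁻¹ * faceSum (s i) (f i) x) ^ m) := by
      intro m
      induction m with
      | zero =>
        simp only [pow_zero]
        exact UB.const (C := 1) (fun _ _ _ => zero_le_one) hηf (fun _ => (1 : ℝ)) fun _ _ _ => by
          simp
      | succ m ih =>
        simp only [pow_succ]
        exact UB.mul hS ih hθ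
    have hmain : UB N (fun i => interior (cell (s i))) (fun i _ => K i)
        (fun i x => Metric.diam (cell (s i)) * faceSum (s i) (g i) x)
        (fun i x => ((faceSum (s i) (g i) x)⁻¹ * faceSum (s i) (f i) x) ^ r •
          q i (faceProj (s i) (f i) x)) := by
      refine (UB.smul hS (hpow r) h4).weight 1 zero_le_one fun i x hx j hj => ?_
      have h5 := hposf i x hx
      have h6 := hposg i x hx
      have h7 := hs.diam_pos i
      set θ := (faceSum (s i) (g i) x)⁻¹ * faceSum (s i) (f i) x with hθd
      have hθ0 : 0 < θ := mul_pos (inv_pos.2 h6) h5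
      have hθ1 : θ ≤ 1 := by
        rw [hθd, inv_mul_le_iff₀ h6, mul_one]
        exact hle i x hx
      have e : (Metric.diam (cell (s i)) * faceSum (s i) (f i) x)⁻¹ =
          θ⁻¹ * (Metric.diam (cell (s i)) * faceSum (s i) (g i) x)⁻¹ := by
        rw [hθd]
        field_simp
      -- A derivative of order j of q ∘ Z_f costs (diam ω_f)^(−j) = θ^(−j) (diam ω_g)^(−j). The
      -- factor θ^r pays for θ^(−j) because θ ≤ 1 and j ≤ N ≤ r.
      have e2 : θ ^ r * (θ⁻¹) ^ j ≤ 1 := by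
        rw [inv_pow, mul_inv_le_iff₀ (by positivity), one_mul]
        exact pow_le_pow_of_le_one hθ0.le hθ1 (hj.trans hNr)
      have h8 : 0 ≤ K i * (Metric.diam (cell (s i)) * faceSum (s i) (g i) x)⁻¹ ^ j :=
        mul_nonneg (hK i) (by positivity)
      calc θ ^ r * K i * (Metric.diam (cell (s i)) * faceSum (s i) (f i) x)⁻¹ ^ j
          = θ ^ r * (θ⁻¹) ^ j *
            (K i * (Metric.diam (cell (s i)) * faceSum (s i) (g i) x)⁻¹ ^ j) := by
            rw [e, mul_pow]; ring
        _ ≤ _ := mul_le_mul_of_nonneg_right e2 h8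
    refine (UB.add hS hmain hR).congr fun i x hx => ?_
    obtain ⟨e1, e2⟩ := faceProj_faceProj (hs.simplex i) (hfg i) (hg i) (hposg i x hx).ne'
    beta_reduce
    rw [hR2 i _ (cell_mono (hg i) (faceProj_mem_cell (hs.simplex i) (interior_subset hx)
      (hposg i x hx).ne')), e1, e2]

end ExtRegular

/-! ### Regularity of the levelwise extension. -/

section ExtLevelRegular

variable {d : ℕ} {ι : Type*} {k r N : ℕ} {s : ι → Finset (Space d)} {c : ι → ℕ → ℝ} {K : ι → ℝ}
  {Cσ : ℝ}

/-- The extension is regular on all faces if the given function is regular on the active faces. -/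
theorem extRegular_extLevel (hs : ShapeFamily s Cσ) (A : ι → Set (Finset (Space d)))
    (hc : ∀ i l, 0 ≤ c i l) (hK : ∀ i, 0 ≤ K i) (hk : 1 ≤ k) (hkr : k ≤ r) (hNr : N ≤ r)
    (w : ι → Space d → Space d)
    (hw : ExtRegular k N
      (fun p : Σ i, {f : Finset (Space d) // f.Nonempty ∧ f ⊆ s i ∧ ∃ s' ∈ A i, f ⊆ s'} => s p.1)
      (fun p => p.2) (fun p => c p.1) (fun p => K p.1) (fun p => w p.1))
    {C : ℝ} (hC : 0 ≤ C)
    (hv : ∀ i, ∀ v ∈ s i, (∃ s' ∈ A i, v ∈ s') → ‖w i v‖ ≤ C * c i 1) (j : ℕ) :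
    ExtRegular k N (fun p : Σ i, {g : Finset (Space d) // g.Nonempty ∧ g ⊆ s i} => s p.1)
      (fun p => p.2) (fun p => c p.1) (fun p => K p.1)
      (fun p => extLevel (A p.1) k r (s p.1) (w p.1) j) := by
  classical
  have hr := hk.trans hkr
  induction j with
  | zero =>
    -- Level 0 is homogeneous of degree one with the vertex values as coefficients; there is no
    -- remainder.
    refine ⟨C, hC, fun p l => if l = 1 then extLevel (A p.1) k r (s p.1) (w p.1) 0 else 0,
      fun _ _ => 0, fun p l hl => ?_, fun p x _ => ?_, fun p x _ => ?_, ?_⟩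
    · beta_reduce
      split_ifs with h
      · subst h
        refine ⟨fun v _ => if ∃ s' ∈ A p.1, v ∈ s' then w p.1 v else 0, fun v hvs => ⟨_, ?_,
          fun _ => rfl⟩, fun x => ?_⟩
        · split_ifs with h
          · exact hv p.1 v hvs h
          · rw [norm_zero]
            exact mul_nonneg hC (hc _ _)
        · rw [extLevel_zero, Finset.sum_filter]
          simp only [smul_ite, smul_zero]
      · exact HomPoly.zero l (mul_nonneg hC (hc _ _))
    · beta_reduce
      rw [Finset.sum_eq_single_of_mem 1 (Finset.mem_range.2 (by omega)), if_pos rfl, add_zero]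
      intro l _ hl
      rw [if_neg hl, Pi.zero_apply]
    · rw [norm_zero]
      exact mul_nonneg hC (hK _)
    · exact UB.const (C := 0) (fun p _ _ => hK p.1)
        ((hs.reindex Sigma.fst).weight_pos (fun p => p.2.2.2) fun p => p.2.2.1) _
        fun p x _ => by simp
  | succ j ih =>
    have h1 := (hw.add_smul (-1) (ih.reindex fun p : Σ i, {f : Finset (Space d) //
      f.Nonempty ∧ f ⊆ s i ∧ ∃ s' ∈ A i, f ⊆ s'} => ⟨p.1, p.2.1, p.2.2.1, p.2.2.2.1⟩))
    -- On a face g only the active faces contained in g matter, and only for these the extension to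
    -- g is controlled. The discarded corrections vanish on g.
    let t : (Σ i, {g : Finset (Space d) // g.Nonempty ∧ g ⊆ s i}) → Finset (Finset (Space d)) :=
      fun p => (s p.1).powerset.filter fun f => (f.card = j + 2 ∧ ∃ s' ∈ A p.1, f ⊆ s') ∧ f ⊆ p.2.1
    have ht : ∀ p : Σ p, {f // f ∈ t p}, p.2.1.Nonempty ∧ p.2.1 ⊆ s p.1.1 ∧
        (∃ s' ∈ A p.1.1, p.2.1 ⊆ s') ∧ p.2.1 ⊆ p.1.2.1 := fun p => by
      obtain ⟨h1, ⟨h2, h3⟩, h4⟩ := Finset.mem_filter.1 p.2.2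
      exact ⟨Finset.card_pos.1 (by omega), Finset.mem_powerset.1 h1, h3, h4⟩
    have h2 := (h1.reindex fun p : Σ p, {f // f ∈ t p} =>
      ⟨p.1.1, p.2.1, (ht p).1, (ht p).2.1, (ht p).2.2.1⟩).extend (r := r)
      (g := fun p => p.1.2.1) (hs.reindex fun p => p.1.1) (fun p => p.1.2.2.2)
      (fun p => (ht p).2.2.2) (fun p => (ht p).1) (fun p => hc _) (fun p => hK _) hk hkr hNr
    have h3 := ExtRegular.sum (hs.reindex Sigma.fst) (fun p => p.2.2.2) (fun p => p.2.2.1)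
      (fun p => hc p.1) (fun p => hK p.1) t (2 ^ (d + 1)) (fun p => by
        refine (Finset.card_filter_le _ _).trans ?_
        rw [Finset.card_powerset, (hs.simplex p.1).2])
      (fun p f => faceExt k r (s p.1) f
        (fun z => w p.1 z + (-1 : ℝ) • extLevel (A p.1) k r (s p.1) (w p.1) j z)) h2
    refine (ih.add_smul 1 h3).congr fun p x hx => ?_
    rw [extLevel_succ, one_smul]
    congr 1
    simp only [neg_one_smul, ← sub_eq_add_neg]
    symm
    refine Finset.sum_subset (fun f hf => ?_) fun f hf hf' => ?_
    · obtain ⟨h1, h2, -⟩ := Finset.mem_filter.1 hf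
      exact Finset.mem_filter.2 ⟨h1, h2⟩
    · obtain ⟨h1, h2, s', hs', hfs'⟩ := Finset.mem_filter.1 hf
      have h1' := Finset.mem_powerset.1 h1
      refine faceExt_eq_zero (hs.simplex p.1) h1' p.2.2.2 (fun h => hf' (Finset.mem_filter.2
        ⟨h1, ⟨h2, s', hs', hfs'⟩, h⟩)) hk hr hx fun f'' hf'' hne z hz => ?_
      have := Finset.card_lt_card (Finset.ssubset_iff_subset_ne.2 ⟨hf'', hne⟩)
      rw [extLevel_eq_of_face (hs.simplex p.1) hk hr (hf''.trans h1') ⟨s', hs', hf''.trans hfs'⟩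
        (by omega) hz, sub_self]

theorem faceProj_self {s : Finset (Space d)} (hs : IsSimplex s) (x : Space d) :
    faceProj s s x = x := by
  rw [faceProj, faceSum_self hs, inv_one, one_smul, hs.sum_bary_smul]

theorem UB.sum_range {E F : Type} [NormedAddCommGroup E] [NormedSpace ℝ E] [NormedAddCommGroup F]
    [NormedSpace ℝ F] {n : ℕ} {S : ι → Set E} {κ η : ι → E → ℝ} (hS : ∀ i, UniqueDiffOn ℝ (S i))
    (hκ : ∀ i, ∀ x ∈ S i, 0 ≤ κ i x) (hη : ∀ i, ∀ x ∈ S i, 0 < η i x) (m : ℕ)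
    {f : ℕ → ι → E → F} (h : ∀ l < m, UB n S κ η (f l)) :
    UB n S κ η (fun i x => ∑ l ∈ Finset.range m, f l i x) := by
  induction m with
  | zero =>
    simp only [Finset.range_zero, Finset.sum_empty]
    exact UB.const (C := 0) hκ hη _ fun i x _ => by simp
  | succ m ih =>
    simp only [Finset.sum_range_succ]
    exact UB.add hS (ih fun l hl => h l (by omega)) (h m (by omega))

/-- On the whole simplex ω = 1 and Z is the identity, so the singular weight disappears. -/
theorem ExtRegular.ub_remainder (hs : ShapeFamily s Cσ) {q : ι → Space d → Space d}
    (h : UB N (fun i => interior (cell (s i))) (fun i _ => K i)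
      (fun i x => Metric.diam (cell (s i)) * faceSum (s i) (s i) x)
      (fun i x => q i (faceProj (s i) (s i) x))) :
    UB N (fun i => interior (cell (s i))) (fun i _ => K i) (fun i _ => Metric.diam (cell (s i))) q :=
  (h.weight 1 zero_le_one fun i x _ j _ => by
    rw [faceSum_self (hs.simplex i), mul_one, one_mul]).congr fun i x _ => by
      rw [faceProj_self (hs.simplex i)]

/-- The coarse variant: all coefficients have the same size K, and every derivative loses 1/diam. -/
theorem ExtRegular.bounds {u : ι → Space d → Space d} (hs : ShapeFamily s Cσ)
    (hK : ∀ i, 0 ≤ K i) (h : ExtRegular k N s s (fun i _ => K i) K u) :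
    (∃ C, 0 ≤ C ∧ ∀ i, ∀ x ∈ cell (s i), ‖u i x‖ ≤ C * K i) ∧
    UB N (fun i => interior (cell (s i))) (fun i _ => K i)
      (fun i _ => Metric.diam (cell (s i))) u := by
  obtain ⟨C, hC, P, q, h1, h2, h3, h4⟩ := h
  have hS := fun i => uniqueDiffOn_interior (cell (s i))
  refine ⟨⟨(k + 1) * C + C, by positivity, fun i x hx => ?_⟩, ?_⟩
  · rw [h2 i x hx]
    have : ‖∑ l ∈ Finset.range (k + 1), P i l x‖ ≤ ∑ l ∈ Finset.range (k + 1), C * K i :=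
      norm_sum_le_of_le _ fun l hl => (h1 i l (by have := Finset.mem_range.1 hl; omega)).norm_le
        (hs.simplex i) hx
    rw [Finset.sum_const, Finset.card_range, nsmul_eq_mul] at this
    push_cast at this
    have h5 := h3 i x hx
    refine (norm_add_le_of_le this h5).trans (le_of_eq (by ring))
  · have hb : UB N (fun p : Σ i, {v // v ∈ s i} => interior (cell (s p.1))) (fun _ _ => 1)
        (fun p _ => Metric.diam (cell (s p.1))) (fun p x => bary (s p.1) x p.2) :=
      (hs.reindex fun p : Σ i, {v // v ∈ s i} => p.1).ub_bary (C := 1) (C' := 1) (fun p => hS p.1)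
        (fun _ _ _ => zero_le_one) (fun p _ _ => hs.diam_pos p.1) (v := fun p => p.2) N
        (fun p x hx => by
          rw [abs_of_nonneg (bary_nonneg (hs.simplex p.1).1 (interior_subset hx) _), one_mul]
          exact (hs.simplex p.1).bary_le_one (interior_subset hx) _)
        (fun p x _ => by rw [one_mul, one_mul])
    have hP : ∀ l < k + 1, UB N (fun i => interior (cell (s i))) (fun i _ => K i)
        (fun i _ => Metric.diam (cell (s i))) (fun i => P i l) := fun l hl => by
      have := ub_homPoly (Y := fun _ x => x) hs.simplex hS (fun _ _ _ => zero_le_one)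
        (fun i _ _ => hs.diam_pos i) hb l hK (C := C) (P := fun i => P i l)
        fun i => h1 i l (by omega)
      simpa only [one_pow, mul_one] using this
    exact (UB.add hS (UB.sum_range hS (fun i _ _ => hK i) (fun i _ _ => hs.diam_pos i) (k + 1) hP)
      (ExtRegular.ub_remainder hs h4)).congr fun i x hx => h2 i x (interior_subset hx)

/-- The sharp variant: a degree l polynomial in the λ_v loses at most diam^(−l), which its
coefficients diam^l compensate; the remainder keeps diam^(N−j) for derivatives of order j ≤ N. -/
theorem ExtRegular.u1 {u : ι → Space d → Space d} (hs : ShapeFamily s Cσ) {B : ℝ}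
    (hB : ∀ i, Metric.diam (cell (s i)) ≤ B)
    (h : ExtRegular k N s s (fun i l => Metric.diam (cell (s i)) ^ l)
      (fun i => Metric.diam (cell (s i)) ^ N) u) :
    U1 N (fun i => interior (cell (s i))) u := by
  obtain ⟨C, hC, P, q, h1, h2, h3, h4⟩ := h
  have hS := fun i => uniqueDiffOn_interior (cell (s i))
  have hb : UB N (fun p : Σ i, {v // v ∈ s i} => interior (cell (s p.1)))
      (fun p _ => (Metric.diam (cell (s p.1)))⁻¹) (fun _ _ => 1)
      (fun p x => bary (s p.1) x p.2) :=
    (hs.reindex fun p : Σ i, {v // v ∈ s i} => p.1).ub_bary (C := B) (C' := 1) (fun p => hS p.1)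
      (fun p _ _ => inv_nonneg.2 (hs.diam_pos p.1).le) (fun _ _ _ => one_pos) (v := fun p => p.2) N
      (fun p x hx => by
        rw [abs_of_nonneg (bary_nonneg (hs.simplex p.1).1 (interior_subset hx) _)]
        refine ((hs.simplex p.1).bary_le_one (interior_subset hx) _).trans ?_
        rw [← div_eq_mul_inv, one_le_div (hs.diam_pos p.1)]
        exact hB p.1)
      (fun p x _ => by rw [one_mul, inv_one, mul_one])
  have hP : ∀ l < k + 1, U1 N (fun i => interior (cell (s i))) (fun i => P i l) := fun l hl => by
    refine (ub_homPoly (Y := fun _ x => x) hs.simplex hS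
      (fun i _ _ => inv_nonneg.2 (hs.diam_pos i).le)
      (fun _ _ _ => one_pos) hb l (fun i => pow_nonneg (hs.diam_pos i).le l) (C := C)
      (P := fun i => P i l) fun i => h1 i l (by omega)).to_one zero_le_one fun i x _ => ?_
    rw [← mul_pow, mul_inv_cancel₀ (hs.diam_pos i).ne', one_pow]
  have hq : U1 N (fun i => interior (cell (s i))) q := by
    refine (ExtRegular.ub_remainder hs h4).weight ((1 + |B|) ^ N) (by positivity) fun i x _ j hj => ?_
    have h5 := hs.diam_pos i
    rw [inv_one, one_pow, mul_one, mul_one]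
    have e : Metric.diam (cell (s i)) ^ N * (Metric.diam (cell (s i)))⁻¹ ^ j =
        Metric.diam (cell (s i)) ^ (N - j) := by
      rw [inv_pow, ← div_eq_mul_inv, pow_sub₀ _ h5.ne' hj, div_eq_mul_inv]
    rw [e]
    have h6 : Metric.diam (cell (s i)) ≤ 1 + |B| :=
      (hB i).trans ((le_abs_self B).trans (by linarith))
    exact (pow_le_pow_left₀ h5.le h6 _).trans
      (pow_le_pow_right₀ (by linarith [abs_nonneg B]) (Nat.sub_le _ _))
  exact (UB.add hS (UB.sum_range hS (fun _ _ _ => zero_le_one) (fun _ _ _ => one_pos) (k + 1) hP)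
    hq).congr fun i x hx => h2 i x (interior_subset hx)

/-- Regularity on the whole simplex. -/
theorem extRegular_extLevel_self (hs : ShapeFamily s Cσ) (A : ι → Set (Finset (Space d)))
    (hc : ∀ i l, 0 ≤ c i l) (hK : ∀ i, 0 ≤ K i) (hk : 1 ≤ k) (hkr : k ≤ r) (hNr : N ≤ r)
    (w : ι → Space d → Space d)
    (hw : ExtRegular k N
      (fun p : Σ i, {f : Finset (Space d) // f.Nonempty ∧ f ⊆ s i ∧ ∃ s' ∈ A i, f ⊆ s'} => s p.1)
      (fun p => p.2) (fun p => c p.1) (fun p => K p.1) (fun p => w p.1))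
    {C : ℝ} (hC : 0 ≤ C)
    (hv : ∀ i, ∀ v ∈ s i, (∃ s' ∈ A i, v ∈ s') → ‖w i v‖ ≤ C * c i 1) (j : ℕ) :
    ExtRegular k N s s c K (fun i => extLevel (A i) k r (s i) (w i) j) :=
  (extRegular_extLevel hs A hc hK hk hkr hNr w hw hC hv j).reindex
    fun i => ⟨i, s i, (hs.simplex i).nonempty, subset_rfl⟩

end ExtLevelRegular

/-! ### Sources of regular data. -/

section ExtRegularFamilies

variable {d : ℕ} {ι : Type*} {k N : ℕ} {s g : ι → Finset (Space d)} {u : ι → Space d → Space d}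
  {Cσ : ℝ} (hs : ShapeFamily s Cσ) (hg : ∀ i, g i ⊆ s i) (hgn : ∀ i, (g i).Nonempty)
  {T : ι → Set (Space d)} (hgT : ∀ i, cell (g i) ⊆ T i)
include hs hg hgn hgT

/-- With zero polynomial part the whole function is the remainder; enough where each derivative may
lose 1/diam. -/
theorem ShapeFamily.extRegular (hT : ∀ i, UniqueDiffOn ℝ (T i)) {c : ι → ℕ → ℝ}
    (hc : ∀ i l, 0 ≤ c i l) {K : ι → ℝ} (hK : ∀ i, 0 ≤ K i)
    (hu : UB N T (fun i _ => K i) (fun i _ => Metric.diam (cell (s i))) u) :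
    ExtRegular k N s g c K u := by
  obtain ⟨C, hC, hb⟩ := hu.bound
  exact ⟨C, hC, fun _ _ _ => 0, u, fun i l _ => HomPoly.zero l (mul_nonneg hC (hc i l)),
    fun i x _ => by simp, fun i x hx => hb i x (hgT i hx),
    hs.ub_comp_faceProj hg hgn hT hK hu hgT⟩

/-- Functions with bounded derivatives are split by Taylor's formula at a vertex. -/
theorem ShapeFamily.extRegular_taylor (hTo : ∀ i, IsOpen (T i)) (hTc : ∀ i, Convex ℝ (T i)) {B : ℝ}
    (hB : ∀ i, ∀ a ∈ g i, ∀ x ∈ T i, ‖x - a‖ ≤ B * Metric.diam (cell (s i)))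
    (hu : U1 (k + 1) T u) :
    ExtRegular k (k + 1) s g (fun i l => Metric.diam (cell (s i)) ^ l)
      (fun i => Metric.diam (cell (s i)) ^ (k + 1)) u := by
  obtain ⟨h1, M, hM, h2⟩ := u1_iff.1 hu
  have h3 : ∀ i, ∀ j ≤ k + 1, ∀ x ∈ T i, ‖iteratedFDeriv ℝ j (u i) x‖ ≤ M := fun i j hj x hx => by
    rw [← iteratedFDerivWithin_of_isOpen j (hTo i) hx]
    exact h2 i j hj x hx
  choose a ha using hgn
  have haT : ∀ i, a i ∈ T i := fun i => hgT i (mem_cell_of_vertex (ha i))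
  have hB1 : 1 ≤ (|B| + 1) ^ (k + 1) := one_le_pow₀ (by linarith [abs_nonneg B])
  -- Taylor's theorem bounds the j-th derivative of the remainder by diam^(k+1−j) = diam^(k+1)
  -- diam^(−j), because T has size comparable to diam around the vertex a.
  have hq : UB (k + 1) T (fun i _ => Metric.diam (cell (s i)) ^ (k + 1))
      (fun i _ => Metric.diam (cell (s i)))
      (fun i x => u i x - taylorPoly (k + 1) (u i) (a i) x) := by
    refine ⟨fun i => (h1 i).sub (contDiff_taylorPoly _ _ _).contDiffOn, M * (|B| + 1) ^ (k + 1),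
      by positivity, fun i j hj x hx => ?_⟩
    have hd := hs.diam_pos i
    rw [iteratedFDerivWithin_of_isOpen j (hTo i) hx]
    refine (norm_iteratedFDeriv_sub_taylorPoly_le (hTo i) (hTc i) (haT i) (h1 i) hM
      (h3 i _ le_rfl) hj hx).trans ?_
    rw [mul_assoc]
    refine mul_le_mul_of_nonneg_left ?_ hM
    have e : Metric.diam (cell (s i)) ^ (k + 1) * (Metric.diam (cell (s i)))⁻¹ ^ j =
        Metric.diam (cell (s i)) ^ (k + 1 - j) := by
      rw [inv_pow, pow_sub₀ _ hd.ne' hj]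
    rw [e]
    calc ‖x - a i‖ ^ (k + 1 - j) ≤ ((|B| + 1) * Metric.diam (cell (s i))) ^ (k + 1 - j) := by
          refine pow_le_pow_left₀ (norm_nonneg _) ((hB i _ (ha i) x hx).trans ?_) _
          exact mul_le_mul_of_nonneg_right (by linarith [le_abs_self B]) hd.le
      _ ≤ _ := by
          rw [mul_pow]
          refine mul_le_mul_of_nonneg_right ?_ (by positivity)
          exact pow_le_pow_right₀ (by linarith [abs_nonneg B]) (by omega)
  obtain ⟨C, hC, hb⟩ := hq.bound
  refine ⟨M + C, by positivity, fun i l x => ((l.factorial : ℝ)⁻¹) •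
    iteratedFDeriv ℝ l (u i) (a i) (fun _ => x - a i), _, fun i l hl => ?_, fun i x _ => ?_,
    fun i x hx => ?_, hs.ub_comp_faceProj hg (fun i => ⟨a i, ha i⟩)
      (fun i => (hTo i).uniqueDiffOn) (fun i => pow_nonneg (hs.diam_pos i).le _) hq hgT⟩
  · have hd := hs.diam_pos i
    refine ((homPoly_diag (hs.simplex i) (hg i (ha i)) (iteratedFDeriv ℝ l (u i) (a i))).smul
      ((l.factorial : ℝ)⁻¹)).mono ?_
    rw [← mul_assoc]
    refine mul_le_mul_of_nonneg_right ?_ (by positivity)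
    rw [abs_of_nonneg (by positivity)]
    have h4 : ((l.factorial : ℝ)⁻¹) ≤ 1 :=
      inv_le_one_of_one_le₀ (by exact_mod_cast Nat.succ_le_of_lt l.factorial_pos)
    have h5 := h3 i l (by omega) _ (haT i)
    calc _ ≤ 1 * ‖iteratedFDeriv ℝ l (u i) (a i)‖ :=
          mul_le_mul_of_nonneg_right h4 (norm_nonneg _)
      _ ≤ M + C := by linarith
  · simp [taylorPoly]
  · exact (hb i x (hgT i hx)).trans (mul_le_mul_of_nonneg_right (by linarith)
      (pow_nonneg (hs.diam_pos i).le _))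

end ExtRegularFamilies

/-! ### Elements next to the active region. -/

section ExtensionProblems

variable {d : ℕ}

/-- The displacement of the ideal mapping without blending. -/
noncomputable def UnfittedSpaceTime.Slab.feDisp (D : Slab d) (Ω : Set (Space d)) (x : Space d)
    (t : ℝ) : Space d := D.ΨΓ Ω 0 x t - x

/-- An element together with the local problems on all active elements. -/
structure ExtProblem (Ω : Set (Space d)) (qs qt ℓ m : ℕ) (c : Consts) (Cb Cv E Ccfl κ : ℝ) where
  D : Slab d
  s : Finset (Space d)
  adm : Admissible Ω qs qt ℓ m c D
  facet : s ∈ D.K.facets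
  h_le_one : D.h ≤ 1
  h_le : D.h ≤ κ * Metric.diam (cell s)
  loc : ∀ s' ∈ D.cutCells Ω, ∃ P : CflProblem Ω qs qt ℓ m c Cb Cv E Ccfl,
    P.1.1.D = D ∧ P.1.1.s = s'

variable {Ω : Set (Space d)} {qs qt ℓ m r : ℕ} {c : Consts} {Cb Cv E Ccfl κ : ℝ}

local notation "FP" => CflProblem Ω qs qt ℓ m c Cb Cv E Ccfl
local notation "EP" => ExtProblem Ω qs qt ℓ m c Cb Cv E Ccfl κ

theorem feDisp_eq (P : FP) {x : Space d} (hx : x ∈ cell P.1.1.s) {t : ℝ} (ht : t ∈ P.1.1.D.I) :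
    P.1.1.D.feDisp Ω x t = P.1.1.disp x t := by
  have h := P.1.2.ΨΓ_eq hx ht
  rw [P.2.1] at h
  rw [Slab.feDisp, h, add_sub_cancel_left]

/-- The `k`-th time derivative of the displacement. -/
noncomputable def UnfittedSpaceTime.Slab.feDispDeriv (D : Slab d) (Ω : Set (Space d)) (k : ℕ) (t : ℝ)
    (x : Space d) : Space d := iteratedDerivWithin k (D.feDisp Ω x) D.I t

theorem feDispDeriv_eq (P : FP) {x : Space d} (hx : x ∈ cell P.1.1.s) (k : ℕ) {t : ℝ}
    (ht : t ∈ P.1.1.D.I) :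
    P.1.1.D.feDispDeriv Ω k t x = iteratedDerivWithin k (P.1.1.disp x) P.1.1.D.I t :=
  iteratedDerivWithin_congr (fun _ hu => feDisp_eq P hx hu) ht

theorem shapeFamily_extProblem : ShapeFamily (fun i : EP => i.s) (2 * c.σ) :=
  ⟨fun i => i.adm.mesh.isSimplex i.facet,
    fun i => (i.adm.mesh.isSimplex i.facet).diam_pos i.adm.dim_ne_zero,
    fun i v => by rw [← div_eq_mul_inv]; exact i.adm.norm_baryLin_le i.facet v⟩

/-- The index set for the faces on which the data of the extension are given. -/
abbrev ExtFace (Ω : Set (Space d)) (qs qt ℓ m : ℕ) (c : Consts) (Cb Cv E Ccfl κ : ℝ) : Type :=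
  Σ q : (Σ i : ExtProblem Ω qs qt ℓ m c Cb Cv E Ccfl κ, i.D.I),
    {f : Finset (Space d) // f.Nonempty ∧ f ⊆ q.1.s ∧ ∃ s' ∈ q.1.D.cutCells Ω, f ⊆ s'}

/-- A face may belong to several active elements. Any of them serves, since each local displacement
agrees with `feDisp` on its own element. -/
theorem ExtFace.exists_loc (p : ExtFace Ω qs qt ℓ m c Cb Cv E Ccfl κ) :
    ∃ P : FP, ∃ t : P.1.1.D.I, P.1.1.D = p.1.1.D ∧ (t : ℝ) = p.1.2 ∧ p.2.1 ⊆ P.1.1.s := by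
  obtain ⟨⟨⟨D, s, hA, hs, h1, hh, hloc⟩, t, ht⟩, f, hfn, hfs, s', hs', hfs'⟩ := p
  obtain ⟨P, rfl, rfl⟩ := hloc s' hs'
  exact ⟨P, ⟨t, ht⟩, rfl, rfl, hfs'⟩

/-- The data of the extension are smooth only elementwise, whereas a local displacement is smooth on
a neighbourhood of its element. Choosing a local problem for every face reduces the regularity to
that of local displacements. -/
theorem extRegular_feDispDeriv {N lt : ℕ} (hqs : 1 ≤ qs) (hr : qs ≤ r) (hN : N ≤ r)
    {cf : Slab d → Finset (Space d) → ℕ → ℝ} {K : Slab d → Finset (Space d) → ℝ}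
    (hc : ∀ (i : EP) l, 0 ≤ cf i.D i.s l) (hK : ∀ i : EP, 0 ≤ K i.D i.s)
    (hw : ∀ (P : ExtFace Ω qs qt ℓ m c Cb Cv E Ccfl κ → FP)
      (t : ∀ p, (P p).1.1.D.I), (∀ p, (P p).1.1.D = p.1.1.D) → (∀ p, p.2.1 ⊆ (P p).1.1.s) →
      ExtRegular qs N (fun p : ExtFace Ω qs qt ℓ m c Cb Cv E Ccfl κ => p.1.1.s) (fun p => p.2)
        (fun p => cf p.1.1.D p.1.1.s) (fun p => K p.1.1.D p.1.1.s)
        (fun p x => iteratedDerivWithin lt ((P p).1.1.disp x) (P p).1.1.D.I (t p)))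
    {C : ℝ} (hC : 0 ≤ C)
    (hv : ∀ (P : FP) (s : Finset (Space d)), P.1.1.D.h ≤ κ * Metric.diam (cell s) → ∀ t ∈ P.1.1.D.I, ∀ x ∈ cell P.1.1.s,
      ‖iteratedDerivWithin lt (P.1.1.disp x) P.1.1.D.I t‖ ≤ C * cf P.1.1.D s 1) (j : ℕ) :
    ExtRegular qs N (fun q : (Σ i : EP, i.D.I) => q.1.s) (fun q => q.1.s)
      (fun q => cf q.1.D q.1.s) (fun q => K q.1.D q.1.s)
      (fun q => extLevel (q.1.D.cutCells Ω) qs r q.1.s (q.1.D.feDispDeriv Ω lt q.2) j) := by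
  choose P t hD ht hP using ExtFace.exists_loc (Ω := Ω) (qs := qs) (qt := qt) (ℓ := ℓ) (m := m)
    (c := c) (Cb := Cb) (Cv := Cv) (E := E) (Ccfl := Ccfl) (κ := κ)
  refine extRegular_extLevel_self (shapeFamily_extProblem.reindex fun q : (Σ i : EP, i.D.I) => q.1)
    (fun q => q.1.D.cutCells Ω) (fun q => hc q.1) (fun q => hK q.1) hqs hr hN
    (fun q => q.1.D.feDispDeriv Ω lt q.2) ?_ hC ?_ j
  · refine (hw P t hD hP).congr fun p x hx => ?_
    rw [← feDispDeriv_eq (P p) (cell_mono (hP p) hx) lt (t p).2, ht p, hD p]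
  · rintro ⟨⟨D, s, hA, hs, h1, hh, hloc⟩, t, ht⟩ v hv' ⟨s', hs', hvs'⟩
    obtain ⟨P, rfl, rfl⟩ := hloc s' hs'
    have := hv P s hh t ht v (mem_cell_of_vertex hvs')
    rwa [← feDispDeriv_eq P (mem_cell_of_vertex hvs') lt ht] at this

end ExtensionProblems

/-! ### Bounds for the extension. -/

section ExtensionBounds

variable {d : ℕ} {Ω : Set (Space d)} {qs qt ℓ m r : ℕ} {c : Consts} {Cb Cv E Ccfl κ : ℝ}

local notation "FP" => CflProblem Ω qs qt ℓ m c Cb Cv E Ccfl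
local notation "EP" => ExtProblem Ω qs qt ℓ m c Cb Cv E Ccfl κ

theorem ExtProblem.diam_pos (i : EP) : 0 < Metric.diam (cell i.s) :=
  shapeFamily_extProblem.diam_pos i

theorem ExtProblem.diam_le (i : EP) : Metric.diam (cell i.s) ≤ i.D.h :=
  i.adm.mesh.diam_le_meshSize i.facet

theorem u1_disp_timeDeriv (hΩ : IsOpen Ω) (hℓ : qt + 2 ≤ ℓ) (hm1 : 1 ≤ m) (hm : m ≤ ℓ) {n lt : ℕ}
    (hn : n + lt ≤ m) : U1 n (fun p : Σ P : FP, P.1.1.D.I => p.1.1.1.N)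
      (fun p x => iteratedDerivWithin lt (p.1.1.1.disp x) p.1.1.1.D.I p.2) :=
  U1.slice (f := fun (P : FP) x t => iteratedDerivWithin lt (P.1.1.disp x) P.1.1.D.I t)
    (fun P : FP => P.1.1.isOpen_N.uniqueDiffOn) (fun P => P.1.1.hI)
    (UB.iterTimeDeriv lt (fun P : FP => P.1.1.isOpen_N.uniqueDiffOn) (fun P => P.1.1.hI)
      (UB.of_le ((u1_disp (Ω := Ω) (qs := qs) (qt := qt) (c := c) (Cb := Cb) (Cv := Cv) (E := E)
        hΩ hℓ hm1 hm).reindex fun P : FP => P.1) hn))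

theorem contDiffOn_feDisp (hΩ : IsOpen Ω) (hℓ : qt + 2 ≤ ℓ) (hm1 : 1 ≤ m) (hm : m ≤ ℓ) {n : ℕ}
    (hn : n ≤ m) (i : EP) {p : Space d} (hp : p ∈ region (i.D.cutCells Ω)) :
    ContDiffOn ℝ n (i.D.feDisp Ω p) i.D.I := by
  obtain ⟨s', hs', hps⟩ := mem_region.1 hp
  obtain ⟨P, hD, rfl⟩ := i.loc s' hs'
  rw [← hD]
  refine (contDiffOn_time (UB.of_le (u1_disp (Ω := Ω) (qs := qs) (qt := qt) (c := c) (Cb := Cb)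
    (Cv := Cv) (E := E) hΩ hℓ hm1 hm) hn |>.1 P.1) (P.1.1.cell_subset_N hps)).congr
    fun t ht => feDisp_eq P hps ht

theorem extRegular_of_ub {N lt : ℕ} (hqs : 1 ≤ qs) (hr : qs ≤ r) (hN : N ≤ r)
    {K : Slab d → ℝ} (hK : ∀ i : EP, 0 ≤ K i.D)
    (hU : UB N (fun p : Σ P : FP, P.1.1.D.I => p.1.1.1.N) (fun p _ => K p.1.1.1.D)
      (fun p _ => p.1.1.1.D.h)
      (fun p x => iteratedDerivWithin lt (p.1.1.1.disp x) p.1.1.1.D.I p.2)) (j : ℕ) :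
    ExtRegular qs N (fun q : (Σ i : EP, i.D.I) => q.1.s) (fun q => q.1.s)
      (fun q _ => K q.1.D) (fun q => K q.1.D)
      (fun q => extLevel (q.1.D.cutCells Ω) qs r q.1.s (q.1.D.feDispDeriv Ω lt q.2) j) := by
  obtain ⟨C, hC, hb⟩ := hU.bound
  refine extRegular_feDispDeriv (cf := fun D _ _ => K D) (K := fun D _ => K D) hqs hr hN
    (fun i _ => hK i) hK (fun P t hD hP => ?_) hC
    (fun P s _ t ht x hx => hb ⟨P, t, ht⟩ x (P.1.1.cell_subset_N hx)) j
  refine (shapeFamily_extProblem.reindex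
    fun p : ExtFace Ω qs qt ℓ m c Cb Cv E Ccfl κ => p.1.1).extRegular (fun p => p.2.2.2.1)
    (fun p => p.2.2.1) (T := fun p => (P p).1.1.N)
    (fun p => (cell_mono (hP p)).trans (P p).1.1.cell_subset_N)
    (fun p => (P p).1.1.isOpen_N.uniqueDiffOn) (fun p _ => hK p.1.1) (fun p => hK p.1.1) ?_
  refine (hU.reindex fun p : ExtFace Ω qs qt ℓ m c Cb Cv E Ccfl κ =>
    (⟨P p, t p⟩ : Σ P : FP, P.1.1.D.I)).weight 1 zero_le_one fun p x _ j _ => ?_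
  simp only [hD p]
  rw [one_mul]
  refine mul_le_mul_of_nonneg_left (pow_le_pow_left₀ (inv_nonneg.2 p.1.1.adm.h_pos.le) ?_ _)
    (hK p.1.1)
  exact inv_anti₀ p.1.1.diam_pos p.1.1.diam_le

/-- Here the coarse variant is enough: values lose nothing, and the gradient loses 1/diam, which is
why it appears multiplied by h ≤ κ diam. -/
theorem exists_extLevel_bounds (hΩ : IsOpen Ω) (hℓ : qt + 2 ≤ ℓ) (hqs : 1 ≤ qs) (hqt : 1 ≤ qt)
    (hm1 : 1 ≤ m) (hm : m ≤ ℓ) (hr : qs + 1 ≤ r) (j : ℕ) :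
    ∃ C, 0 ≤ C ∧ ∀ i : EP, ∀ t ∈ i.D.I,
      (∀ x ∈ cell i.s, ‖extLevel (i.D.cutCells Ω) qs r i.s (fun y => i.D.feDisp Ω y t) j x‖ ≤
        C * (i.D.h ^ 2 + i.D.τ ^ (qt + 1))) ∧
      (∀ x ∈ cell i.s, ‖extLevel (i.D.cutCells Ω) qs r i.s (i.D.feDispDeriv Ω 1 t) j x‖ ≤
        C * (i.D.h ^ 2 + i.D.τ ^ qt)) ∧
      ∀ x ∈ interior (cell i.s),
        DifferentiableAt ℝ
          (extLevel (i.D.cutCells Ω) qs r i.s (fun y => i.D.feDisp Ω y t) j) x ∧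
        i.D.h * ‖fderiv ℝ
          (extLevel (i.D.cutCells Ω) qs r i.s (fun y => i.D.feDisp Ω y t) j) x‖ ≤
          C * (i.D.h ^ 2 + i.D.τ ^ (qt + 1)) := by
  obtain ⟨C, hC, hb⟩ := exists_disp_bounds (Ω := Ω) (qs := qs) (qt := qt) (m := m) (c := c)
    (Cb := Cb) (Cv := Cv) (ℓ := ℓ) (E := E) hℓ hqs hqt hΩ hm1 hm
  have hK : ∀ (k : ℕ) (i : EP), 0 ≤ i.D.h ^ 2 + i.D.τ ^ k := fun k i => by
    have := i.adm.τ_pos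
    positivity
  have hu0 := (u1_disp_timeDeriv (Ω := Ω) (qs := qs) (qt := qt) (c := c) (Cb := Cb) (Cv := Cv)
    (E := E) (Ccfl := Ccfl) (n := 1) (lt := 0) hΩ hℓ hm1 hm (by omega)).1
  have hu1 := (u1_disp_timeDeriv (Ω := Ω) (qs := qs) (qt := qt) (c := c) (Cb := Cb) (Cv := Cv)
    (E := E) (Ccfl := Ccfl) (n := 0) (lt := 1) hΩ hℓ hm1 hm (by omega)).1
  have hU0 : UB 1 (fun p : Σ P : FP, P.1.1.D.I => p.1.1.1.N)
      (fun p _ => p.1.1.1.D.h ^ 2 + p.1.1.1.D.τ ^ (qt + 1)) (fun p _ => p.1.1.1.D.h)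
      (fun p x => iteratedDerivWithin 0 (p.1.1.1.disp x) p.1.1.1.D.I p.2) := by
    refine ⟨hu0, C, hC, ?_⟩
    rintro ⟨P, t, ht⟩ k hk x hx
    have hh := P.1.1.adm.h_pos
    have hτ := P.1.1.adm.τ_pos
    obtain ⟨b1, -, -, b2⟩ := hb P.1 t ht x hx
    interval_cases k
    · rw [norm_iteratedFDerivWithin_zero, pow_zero, mul_one]
      simpa using b1
    · rw [iteratedFDerivWithin_of_isOpen 1 P.1.1.isOpen_N hx, norm_iteratedFDeriv_one, pow_one]
      simp only [iteratedDerivWithin_zero]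
      refine b2.trans (mul_le_mul_of_nonneg_left ?_ hC)
      have h1 : 1 ≤ P.1.1.D.h⁻¹ := (one_le_inv₀ hh).2 P.1.1.h_le
      rw [add_mul, sq, mul_assoc, mul_inv_cancel₀ hh.ne', mul_one]
      have := le_mul_of_one_le_right (pow_nonneg hτ.le (qt + 1)) h1
      linarith
  have hU1 : UB 0 (fun p : Σ P : FP, P.1.1.D.I => p.1.1.1.N)
      (fun p _ => p.1.1.1.D.h ^ 2 + p.1.1.1.D.τ ^ qt) (fun p _ => p.1.1.1.D.h)
      (fun p x => iteratedDerivWithin 1 (p.1.1.1.disp x) p.1.1.1.D.I p.2) := by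
    refine ⟨hu1, C, hC, ?_⟩
    rintro ⟨P, t, ht⟩ k hk x hx
    obtain rfl : k = 0 := by omega
    rw [norm_iteratedFDerivWithin_zero, pow_zero, mul_one]
    beta_reduce
    rw [iteratedDerivWithin_one]
    exact (hb P.1 t ht x hx).2.1.2
  have h0 := extRegular_of_ub (κ := κ) (r := r) (K := fun D => D.h ^ 2 + D.τ ^ (qt + 1)) hqs
    (by omega) (by omega) (hK (qt + 1)) hU0 j
  have h1 := extRegular_of_ub (κ := κ) (r := r) (K := fun D => D.h ^ 2 + D.τ ^ qt) hqs
    (by omega) (by omega) (hK qt) hU1 j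
  have hs := shapeFamily_extProblem.reindex (fun q : (Σ i : EP, i.D.I) => q.1)
  obtain ⟨⟨C₀, hC₀, hb0⟩, hU, C₂, hC₂, hb2⟩ := ExtRegular.bounds hs (fun q => hK (qt + 1) q.1) h0
  obtain ⟨⟨C₁, hC₁, hb1⟩, -⟩ := ExtRegular.bounds hs (fun q => hK qt q.1) h1
  have he : ∀ (i : EP) t, i.D.feDispDeriv Ω 0 t = fun y => i.D.feDisp Ω y t := fun i t => by
    funext y
    simp [Slab.feDispDeriv]
  refine ⟨C₀ + C₁ + C₂ * |κ|, by positivity, fun i t ht => ⟨fun x hx => ?_, fun x hx => ?_,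
    fun x hx => ?_⟩⟩
  · have := hb0 ⟨i, t, ht⟩ x hx
    rw [he] at this
    refine this.trans (mul_le_mul_of_nonneg_right ?_ (hK _ i))
    have : 0 ≤ C₂ * |κ| := by positivity
    linarith
  · refine (hb1 ⟨i, t, ht⟩ x hx).trans (mul_le_mul_of_nonneg_right ?_ (hK _ i))
    have : 0 ≤ C₂ * |κ| := by positivity
    linarith
  · have h2 := hU ⟨i, t, ht⟩
    have h3 := hb2 ⟨i, t, ht⟩ 1 le_rfl x hx
    simp only [he] at h2 h3
    refine ⟨(h2.differentiableOn (by simp)).differentiableAt (isOpen_interior.mem_nhds hx), ?_⟩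
    rw [iteratedFDerivWithin_of_isOpen 1 isOpen_interior hx, norm_iteratedFDeriv_one, pow_one] at h3
    have hd := i.diam_pos
    calc _ ≤ (|κ| * Metric.diam (cell i.s)) * (C₂ * ((i.D.h ^ 2 + i.D.τ ^ (qt + 1)) *
          (Metric.diam (cell i.s))⁻¹)) := by
          refine mul_le_mul (i.h_le.trans ?_) h3 (norm_nonneg _) (by positivity)
          exact mul_le_mul_of_nonneg_right (le_abs_self κ) hd.le
      _ = C₂ * |κ| * (i.D.h ^ 2 + i.D.τ ^ (qt + 1)) := by field_simp
      _ ≤ _ := mul_le_mul_of_nonneg_right (by linarith) (hK _ i)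

/-- Uses the Taylor splitting. Its data need qs + 1 spatial derivatives of ∂_t^lt w, hence qs + 1 +
qt ≤ m, and the vertex values must be O(diam), which `ub_disp_time` and h ≤ κ diam provide. -/
theorem u1_extLevel (hΩ : IsOpen Ω) (hℓ : qt + 2 ≤ ℓ) (hqs : 1 ≤ qs) (hm1 : qs + 1 + qt ≤ m)
    (hm : m ≤ ℓ) (hr : qs + 1 ≤ r) (j : ℕ) {lt : ℕ} (hlt : lt ≤ qt) :
    U1 (qs + 1) (fun q : (Σ i : EP, i.D.I) => interior (cell q.1.s))
      (fun q => extLevel (q.1.D.cutCells Ω) qs r q.1.s (q.1.D.feDispDeriv Ω lt q.2) j) := by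
  obtain ⟨C, hC, hb⟩ := ub_disp_time (Ω := Ω) (c := c) (Cb := Cb) (Cv := Cv)
    (E := E) (Ccfl := Ccfl) hℓ hqs hΩ (by omega : qt + 1 ≤ m) hm
  have hu := u1_disp_timeDeriv (Ω := Ω) (qs := qs) (qt := qt) (c := c) (Cb := Cb) (Cv := Cv)
    (E := E) (Ccfl := Ccfl) (n := qs + 1) (lt := lt) hΩ hℓ (by omega) hm (by omega)
  refine ExtRegular.u1 (k := qs) (shapeFamily_extProblem.reindex
    fun q : (Σ i : EP, i.D.I) => q.1) (B := 1) (fun q => ?_)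
    (extRegular_feDispDeriv (cf := fun _ s l => Metric.diam (cell s) ^ l)
      (K := fun _ s => Metric.diam (cell s) ^ (qs + 1)) hqs (by omega) hr
      (fun i l => pow_nonneg i.diam_pos.le _) (fun i => pow_nonneg i.diam_pos.le _)
      (fun P t hD hP => ?_) (C := C * |κ|) (by positivity) (fun P s hs t ht x hx => ?_) j)
  · exact q.1.diam_le.trans q.1.h_le_one
  · refine (shapeFamily_extProblem.reindex
      fun p : ExtFace Ω qs qt ℓ m c Cb Cv E Ccfl κ => p.1.1).extRegular_taylor
      (fun p => p.2.2.2.1) (fun p => p.2.2.1) (T := fun p => (P p).1.1.N)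
      (fun p => (cell_mono (hP p)).trans (P p).1.1.cell_subset_N)
      (fun p => (P p).1.1.isOpen_N) (fun p => (P p).1.1.convex_N) (B := 2 * κ)
      (fun p a ha x hx => ?_)
      (hu.reindex fun p : ExtFace Ω qs qt ℓ m c Cb Cv E Ccfl κ =>
        (⟨P p, t p⟩ : Σ P : FP, P.1.1.D.I))
    have h1 := (P p).1.1.dist_vertex_le hx (hP p ha)
    have h2 := (P p).1.1.μ_le
    have h3 := p.1.1.h_le
    rw [hD p] at h2
    rw [norm_sub_rev]
    linarith
  · refine (hb P lt hlt x (P.1.1.cell_subset_N hx) t ht).trans ?_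
    rw [mul_assoc, pow_one]
    refine mul_le_mul_of_nonneg_left (hs.trans ?_) hC
    exact mul_le_mul_of_nonneg_right (le_abs_self κ) Metric.diam_nonneg

/-- The extension commutes with time derivatives, so a mixed derivative is a spatial derivative of
the extension of ∂_t^lt w. -/
theorem exists_mixedDeriv_extLevel_bound (hΩ : IsOpen Ω) (hℓ : qt + 2 ≤ ℓ) (hqs : 1 ≤ qs)
    (hm1 : qs + 1 + qt ≤ m) (hm : m ≤ ℓ) (hr : qs + 1 ≤ r) (j : ℕ) :
    ∃ C, 0 ≤ C ∧ ∀ ls ≤ qs + 1, ∀ lt ≤ qt, ∀ i : EP,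
      HasMixedDerivOn (interior (cell i.s)) i.D.I ls lt
        (fun x t => extLevel (i.D.cutCells Ω) qs r i.s (fun y => i.D.feDisp Ω y t) j x) ∧
      ∀ t ∈ i.D.I, ∀ x ∈ interior (cell i.s), ‖mixedDeriv i.D.I ls lt
        (fun x t => extLevel (i.D.cutCells Ω) qs r i.s (fun y => i.D.feDisp Ω y t) j x) x t‖ ≤ C := by
  refine exists_bound_of_finite₂ (p := fun ls lt C => ∀ i : EP,
      HasMixedDerivOn (interior (cell i.s)) i.D.I ls lt
        (fun x t => extLevel (i.D.cutCells Ω) qs r i.s (fun y => i.D.feDisp Ω y t) j x) ∧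
      ∀ t ∈ i.D.I, ∀ x ∈ interior (cell i.s), ‖mixedDeriv i.D.I ls lt
        (fun x t => extLevel (i.D.cutCells Ω) qs r i.s (fun y => i.D.feDisp Ω y t) j x) x t‖ ≤ C)
    (fun ls lt C C' hCC h i => ⟨(h i).1, fun t ht x hx => ((h i).2 t ht x hx).trans hCC⟩)
    (qs + 1) qt fun ls hls lt hlt => ?_
  obtain ⟨h1, C, hC, h2⟩ := u1_iff.1 (UB.of_le (u1_extLevel (Ω := Ω) (qs := qs) (qt := qt) (c := c)
    (Cb := Cb) (Cv := Cv) (E := E) (Ccfl := Ccfl) (κ := κ) hΩ hℓ hqs hm1 hm hr j hlt) hls)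
  have ht : ∀ i : EP, ∀ x ∈ interior (cell i.s), _ := fun i x hx =>
    extLevel_time (A := i.D.cutCells Ω) (j := j) (n := lt) (i.adm.mesh.isSimplex i.facet) hqs
      (by omega : 1 ≤ r) (interior_subset hx) i.D.uniqueDiffOn_I (W := i.D.feDisp Ω)
      fun p hp => contDiffOn_feDisp hΩ hℓ (by omega) hm (by omega) i hp
  have he : ∀ i : EP, ∀ t ∈ i.D.I, ∀ x ∈ interior (cell i.s), _ := fun i t htI x hx =>
    (ht i x hx).2 lt le_rfl t htI
  refine ⟨C, fun i => ⟨⟨fun x hx => (ht i x hx).1, fun t htI => ?_⟩, fun t htI x hx => ?_⟩⟩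
  · exact (h1 ⟨i, t, htI⟩).congr (he i t htI)
  · have h3 := h2 ⟨i, t, htI⟩ ls le_rfl x hx
    rw [mixedDeriv, ← iteratedFDerivWithin_of_isOpen ls isOpen_interior hx,
      iteratedFDerivWithin_congr (he i t htI) hx]
    exact h3

end ExtensionBounds

/-! ### Finite element blending. -/

section FiniteElement

variable {d : ℕ} {Ω : Set (Space d)} {qs qt ℓ m r : ℕ} {c : Consts} {κ Ccfl : ℝ} {D : Slab d}

/-- The Lipschitz constant of the interpolation error on quasi-uniform meshes. -/
noncomputable def feConst (c : Consts) (κ Ccfl : ℝ) : ℝ := 2 * (|c.Cap| * ((1 + |Ccfl|) * |κ|))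

/-- No gradient bound is available for higher time derivatives of φ − φh. Instead h^(qs+1) +
τ^(qt+1−k) is O(h) for k ≤ qt by τ ≤ C h, and O(diam) by quasi-uniformity; the factor 2 in `feConst`
counts the two vertices. -/
theorem UnfittedSpaceTime.FEBlending.localProblem (hA : Admissible Ω qs qt ℓ m c D)
    (hℓ : qt + 2 ≤ ℓ) (hF : FEBlending Ω c κ Ccfl D) (hh : D.h ≤ 1) (hτ : D.τ ≤ 1)
    {s : Finset (Space d)} (hs : s ∈ D.cutCells Ω)
    (hball : ∀ x ∈ cell s, Metric.ball x (2 * D.h) ⊆ interior (region (D.cellsU Ω c.δU))) :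
    ∃ P : LocalProblem Ω qs qt ℓ m c 0 (feConst c κ Ccfl), P.D = D ∧ P.b = 0 ∧ P.s = s := by
  have e0 : Function.uncurry (0 : Space d → ℝ → ℝ) = fun _ => 0 := rfl
  refine ⟨⟨D, 0, s, hA, hh, hτ, hF.active hs, hball, fun x _ t _ => by simp, ?_, ?_, ?_⟩,
    rfl, rfl, rfl⟩
  · rw [e0]
    exact contDiffOn_const
  · intro k _ p _
    rw [e0, iteratedFDerivWithin_fun_zero]
    simp
  intro k hk t ht u hu v hv
  have h0 := hA.h_pos
  have h1 := hA.τ_pos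
  have hsum : D.h ^ (qs + 1) + D.τ ^ (qt + 1 - k) ≤ (1 + |Ccfl|) * |κ| * Metric.diam (cell s) := by
    have h2 : D.h ^ (qs + 1) ≤ D.h := pow_le_of_le_one h0.le hh (by omega)
    have h3 : D.τ ^ (qt + 1 - k) ≤ D.τ := pow_le_of_le_one h1.le hτ (by omega)
    have h4 : D.τ ≤ |Ccfl| * D.h :=
      hF.cfl.trans (mul_le_mul_of_nonneg_right (le_abs_self _) h0.le)
    have h5 : D.h ≤ |κ| * Metric.diam (cell s) :=
      (hF.quasi_uniform s hs.1).trans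
        (mul_le_mul_of_nonneg_right (le_abs_self _) Metric.diam_nonneg)
    calc _ ≤ (1 + |Ccfl|) * D.h := by linarith
      _ ≤ _ := by
        rw [mul_assoc]
        exact mul_le_mul_of_nonneg_left h5 (by positivity)
  have he : ∀ w ∈ s, |iteratedDerivWithin k (D.φ w) D.I t - iteratedDerivWithin k (D.φh w) D.I t| ≤
      |c.Cap| * ((1 + |Ccfl|) * |κ| * Metric.diam (cell s)) := fun w hw =>
    (hA.error_le (hF.active hs) hℓ (by omega) (mem_cell_of_vertex hw) ht).trans
      (mul_le_mul (le_abs_self _) hsum (by positivity) (abs_nonneg _))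
  refine (abs_sub _ _).trans ((add_le_add (he u hu) (he v hv)).trans (le_of_eq ?_))
  rw [feConst]
  ring

/-- On inactive elements the mapping is given by the extension. -/
theorem ΨFE_eq_extLevel (hmesh : IsMesh Ω D.K) (hd : d ≠ 0) (hqs : 1 ≤ qs) (hr : 1 ≤ r)
    {s : Finset (Space d)} (hs : s ∈ D.K.facets) (hsA : s ∉ D.cutCells Ω) {x : Space d}
    (hx : x ∈ cell s) (t : ℝ) : D.ΨFE Ω qs r x t =
      x + extLevel (D.cutCells Ω) qs r s (fun y => D.feDisp Ω y t) (d - 1) x := by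
  classical
  have hS := hmesh.isSimplex hs
  by_cases hxr : x ∈ region (D.cutCells Ω)
  · obtain ⟨s', hs', hxs'⟩ := mem_region.1 hxr
    -- An inactive element meets an active one in a proper face, which has at most d vertices and is
    -- reached at level d − 1.
    have hc : (s ∩ s').card ≤ d - 1 + 1 := by
      by_contra! h
      have h1 := hmesh.pure s hs
      have h2 : s ∩ s' = s := Finset.eq_of_subset_of_card_le Finset.inter_subset_left (by omega)
      have h3 : s = s' := Finset.eq_of_subset_of_card_le (Finset.inter_eq_left.1 h2) (by
        rw [h1, hmesh.pure s' hs'.1])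
      exact hsA (h3 ▸ hs')
    rw [extLevel_eq_of_face hS hqs hr Finset.inter_subset_left
      ⟨s', hs', Finset.inter_subset_right⟩ hc (IsMesh.mem_cell_inter hs hs'.1 hx hxs')]
    simp only [Slab.ΨFE, if_pos hxr, Slab.feDisp, add_sub_cancel]
  · by_cases h : ∃ s' ∈ D.K.facets, x ∈ cell s' ∧ (cell s' ∩ region (D.cutCells Ω)).Nonempty
    · simp only [Slab.ΨFE, if_neg hxr, dif_pos h, boundaryExt]
      obtain ⟨h1, h2, -⟩ := h.choose_spec
      -- The element picked in the definition may differ from s, but both extensions agree on the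
      -- common face containing x.
      have h3 := IsMesh.mem_cell_inter hs h1 hx h2
      rw [extLevel_face hS hqs hr Finset.inter_subset_left h3,
        extLevel_face (hmesh.isSimplex h1) hqs hr Finset.inter_subset_right h3]
      rfl
    · simp only [Slab.ΨFE, if_neg hxr, dif_neg h]
      rw [extLevel_eq_zero, add_zero]
      intro v hv s' hs' hvs'
      exact h ⟨s, hs, hx, v, mem_cell_of_vertex hv, cell_subset_region hs' (mem_cell_of_vertex hvs')⟩

theorem feBlending_bounds (hΩ : IsOpen Ω) (hΩb : Bornology.IsBounded Ω)
    (hqs : 1 ≤ qs) (hqt : 1 ≤ qt) (hℓ : qt + 2 ≤ ℓ) (hm1 : qs + 1 + qt ≤ m) (hm : m ≤ ℓ)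
    (hr : qs + 1 ≤ r) (c : Consts) (κ Ccfl : ℝ) :
    ∃ C h₀ τ₀ : ℝ, 0 < C ∧ 0 < h₀ ∧ 0 < τ₀ ∧
      ∀ D : Slab d, Admissible Ω qs qt ℓ m c D →
        FEBlending Ω c κ Ccfl D → D.h ≤ h₀ → D.τ ≤ τ₀ →
        D.WellPosed Ω 0 (D.cutCells Ω) ∧
        LowOrderBounds Ω qt D (D.ΨFE Ω qs r) C ∧
        GradBound D (D.ΨFE Ω qs r) D.h (C * (D.h ^ 2 + D.τ ^ (qt + 1))) ∧
        ∀ ls lt : ℕ, ls ≤ qs + 1 → lt ≤ qt → HighOrderBound D (D.ΨFE Ω qs r) ls lt C := by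
  obtain ⟨ρ₁, hρ₁, hball⟩ := ball_subset_region_cellsU (m := m) hΩ hqs hqt hℓ c
    (lt_min c.δΩ_pos c.δU_pos)
  obtain ⟨E, ρ₂, hρ₂, hsmall⟩ := exists_small (Ω := Ω) (qs := qs) (qt := qt) (m := m) (c := c)
    (Cb := 0) (Cv := feConst c κ Ccfl) (ℓ := ℓ) hℓ hqs
  obtain ⟨C₁, hC₁, hlow⟩ := exists_disp_bounds (Ω := Ω) (qs := qs) (qt := qt) (m := m) (c := c)
    (Cb := 0) (Cv := feConst c κ Ccfl) (ℓ := ℓ) (E := E) hℓ hqs hqt hΩ (by omega) hm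
  obtain ⟨C₂, hC₂, hhigh⟩ := exists_mixedDeriv_disp_bound (Ω := Ω) (qs := qs) (qt := qt) (m := m)
    (c := c) (Cb := 0) (Cv := feConst c κ Ccfl) (ℓ := ℓ) (E := E) hΩ hℓ (by omega) hm (qs + 1) qt
  obtain ⟨C₃, hC₃, hid⟩ := exists_bound_of_finite₂ (p := fun ls lt C => ∀ S ⊆ closure Ω,
      IsOpen S → ∀ I : Set ℝ, UniqueDiffOn ℝ I →
      HasMixedDerivOn S I ls lt (fun x _ => x) ∧
      ∀ t ∈ I, ∀ x ∈ S, ‖mixedDeriv I ls lt (fun (x : Space d) _ => x) x t‖ ≤ C)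
    (fun ls lt C C' hCC h S hS hSo I hI => ⟨(h S hS hSo I hI).1,
      fun t ht x hx => ((h S hS hSo I hI).2 t ht x hx).trans hCC⟩) (qs + 1) qt
    (fun ls _ lt _ => (exists_mixedDeriv_id_bound hΩb ls lt).imp fun _ h => h.2)
  obtain ⟨C₄, hC₄, hlow'⟩ := exists_extLevel_bounds (Ω := Ω) (qs := qs) (qt := qt) (m := m) (c := c)
    (Cb := 0) (Cv := feConst c κ Ccfl) (ℓ := ℓ) (E := E) (Ccfl := Ccfl) (κ := κ) hΩ hℓ hqs hqt
    (by omega) hm hr (d - 1)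
  obtain ⟨C₅, hC₅, hhigh'⟩ := exists_mixedDeriv_extLevel_bound (Ω := Ω) (qs := qs) (qt := qt)
    (m := m) (c := c) (Cb := 0) (Cv := feConst c κ Ccfl) (ℓ := ℓ) (E := E) (Ccfl := Ccfl) (κ := κ)
    hΩ hℓ hqs hm1 hm hr (d - 1)
  refine ⟨C₁ + C₂ + C₃ + C₄ + C₅ + 1, min (min (ρ₁ / 2) ρ₂) 1, min (ρ₁ / 2) 1, by positivity,
    by positivity, by positivity, fun D hA hF hh hτ => ?_⟩
  have hh1 : D.h ≤ 1 := hh.trans (min_le_right _ _)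
  have hτ1 : D.τ ≤ 1 := hτ.trans (min_le_right _ _)
  have hh0 := hA.h_pos
  have hτ0 := hA.τ_pos
  have hρ : D.h + D.τ ≤ ρ₁ := by
    linarith [hh.trans ((min_le_left _ _).trans (min_le_left _ _)), hτ.trans (min_le_left _ _)]
  have hI := D.uniqueDiffOn_I
  have hP : ∀ s ∈ D.cutCells Ω,
      ∃ P : CflProblem Ω qs qt ℓ m c 0 (feConst c κ Ccfl) E Ccfl, P.1.1.D = D ∧ P.1.1.s = s := by
    intro s hs
    obtain ⟨t, ht, z, hz1, hz2⟩ := hs.2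
    obtain ⟨P, e1, e2, e3⟩ := hF.localProblem hA hℓ hh1 hτ1 hs (hball D hA hF.active hρ s hs.1
      ⟨t, ht, z, hz2, z, hz1, by rw [dist_self, zero_add]; exact hh0⟩)
    exact ⟨⟨⟨P, hsmall P (by rw [e1]; exact hh.trans ((min_le_left _ _).trans (min_le_right _ _)))⟩,
      e2, by rw [e1]; exact hF.cfl⟩, e1, e3⟩
  have hact : ∀ s ∈ D.cutCells Ω,
      ∃ P : CflProblem Ω qs qt ℓ m c 0 (feConst c κ Ccfl) E Ccfl,
      P.1.1.D = D ∧ cell s ⊆ P.1.1.N ∧ ∀ x ∈ cell s, ∀ t ∈ D.I,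
        D.ΨFE Ω qs r x t = x + P.1.1.disp x t := fun s hs => by
    obtain ⟨P, rfl, rfl⟩ := hP s hs
    refine ⟨P, rfl, P.1.1.cell_subset_N, fun x hx t ht => ?_⟩
    rw [← feDisp_eq P hx ht]
    simp only [Slab.ΨFE, if_pos (cell_subset_region hs hx), Slab.feDisp, add_sub_cancel]
  -- All inactive elements are treated alike; away from the active ones the extension is zero.
  have hinact : ∀ s ∈ D.K.facets, s ∉ D.cutCells Ω →
      ∃ i : ExtProblem Ω qs qt ℓ m c 0 (feConst c κ Ccfl) E Ccfl κ, i.D = D ∧ i.s = s ∧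
        ∀ x ∈ cell s, ∀ t, D.ΨFE Ω qs r x t =
          x + extLevel (i.D.cutCells Ω) qs r i.s (fun y => i.D.feDisp Ω y t) (d - 1) x :=
    fun s hs hsA => ⟨⟨D, s, hA, hs, hh1, hF.quasi_uniform s hs, hP⟩, rfl, rfl, fun x hx t =>
      ΨFE_eq_extLevel hA.mesh hA.dim_ne_zero hqs (by omega) hs hsA hx t⟩
  refine ⟨?_, ⟨?_, ?_, ?_⟩, ?_, ?_⟩
  · intro x hx t ht
    obtain ⟨s, hs, hxs⟩ := mem_region.1 hx
    obtain ⟨P, rfl, rfl⟩ := hP s hs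
    have h := P.1.2.existsUnique hxs ht
    rwa [P.2.1] at h
  · intro t ht
    refine hA.mesh.continuousOn_of_cells_inter fun s hs => ?_
    by_cases hsb : s ∈ D.cutCells Ω
    · obtain ⟨P, rfl, hN, hΨ⟩ := hact s hsb
      have : ContinuousOn (fun x => x + P.1.1.disp x t) (cell s ∩ Ω) := fun x hx =>
        (continuousAt_id.add
          ((hlow P.1 t ht x (hN hx.1)).2.2.1.continuousAt)).continuousWithinAt
      exact this.congr fun x hx => hΨ x hx.1 t ht
    · obtain ⟨i, rfl, rfl, hΨ⟩ := hinact s hs hsb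
      have : ContinuousOn (extLevel (i.D.cutCells Ω) qs r i.s (fun y => i.D.feDisp Ω y t) (d - 1))
          (cell i.s) := by
        refine continuousOn_extLevel (hA.mesh.isSimplex hs) (by omega) fun s' hs' => ?_
        obtain ⟨P, hD, rfl⟩ := hP s' hs'
        rw [← hD] at ht ⊢
        intro x hx
        exact ((hlow P.1 t ht x (P.1.1.cell_subset_N hx)).2.2.1.continuousAt.continuousWithinAt).congr
          (fun y hy => feDisp_eq P hy ht) (feDisp_eq P hx ht)
      exact ((continuousOn_id.add this).mono Set.inter_subset_left).congr
        fun x hx => hΨ x hx.1 t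
  · intro t ht x hx
    obtain ⟨s, hs, hxs⟩ := hA.mesh.exists_facet (subset_closure hx)
    by_cases hsb : s ∈ D.cutCells Ω
    · obtain ⟨P, rfl, hN, hΨ⟩ := hact s hsb
      rw [hΨ x hxs t ht, add_sub_cancel_left]
      exact (hlow P.1 t ht x (hN hxs)).1.trans
        (mul_le_mul_of_nonneg_right (by linarith) (by positivity))
    · obtain ⟨i, rfl, rfl, hΨ⟩ := hinact s hs hsb
      rw [hΨ x hxs t, add_sub_cancel_left]
      exact ((hlow' i t ht).1 x hxs).trans
        (mul_le_mul_of_nonneg_right (by linarith) (by positivity))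
  · intro x hx t ht
    obtain ⟨s, hs, hxs⟩ := hA.mesh.exists_facet (subset_closure hx)
    by_cases hsb : s ∈ D.cutCells Ω
    · obtain ⟨P, rfl, hN, hΨ⟩ := hact s hsb
      obtain ⟨h1, h2⟩ := (hlow P.1 t ht x (hN hxs)).2.1
      obtain ⟨h3, h4⟩ := derivWithin_of_add hI (hΨ x hxs) ht h1
      refine ⟨h3, ?_⟩
      rw [h4]
      exact h2.trans (mul_le_mul_of_nonneg_right (by linarith) (by positivity))
    · obtain ⟨i, rfl, rfl, hΨ⟩ := hinact s hs hsb
      obtain ⟨h1, h2⟩ := extLevel_time (A := i.D.cutCells Ω) (j := d - 1) (n := 1) (k := qs) (r := r)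
        (hA.mesh.isSimplex hs) hqs (by omega) hxs hI (W := i.D.feDisp Ω)
        fun p hp => contDiffOn_feDisp hΩ hℓ (by omega) hm (by omega) i hp
      obtain ⟨h3, h4⟩ := derivWithin_of_add hI (fun t _ => hΨ x hxs t) ht
        (h1.differentiableOn (by simp) t ht)
      refine ⟨h3, ?_⟩
      have h5 := h2 1 le_rfl t ht
      rw [iteratedDerivWithin_one] at h5
      rw [h4, h5]
      exact ((hlow' i t ht).2.1 x hxs).trans
        (mul_le_mul_of_nonneg_right (by linarith) (by positivity))
  · intro t ht s hs x hx
    by_cases hsb : s ∈ D.cutCells Ω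
    · obtain ⟨P, rfl, hN, hΨ⟩ := hact s hsb
      obtain ⟨h1, h2⟩ := (hlow P.1 t ht x (hN (interior_subset hx))).2.2
      obtain ⟨h3, h4⟩ := fderiv_of_add isOpen_interior (Ψ := fun y => P.1.1.D.ΨFE Ω qs r y t)
        (fun y hy => hΨ y (interior_subset hy) t ht) hx h1
      refine ⟨h3, ?_⟩
      rw [h4]
      calc _ ≤ P.1.1.D.h * (C₁ * (P.1.1.D.h + P.1.1.D.τ ^ (qt + 1))) :=
            mul_le_mul_of_nonneg_left h2 hh0.le
        _ ≤ C₁ * (P.1.1.D.h ^ 2 + P.1.1.D.τ ^ (qt + 1)) := by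
            rw [mul_left_comm, mul_add, sq]
            have := mul_le_of_le_one_left (pow_nonneg hτ0.le (qt + 1)) hh1
            exact mul_le_mul_of_nonneg_left (by linarith) hC₁
        _ ≤ _ := mul_le_mul_of_nonneg_right (by linarith) (by positivity)
    · obtain ⟨i, rfl, rfl, hΨ⟩ := hinact s hs hsb
      obtain ⟨h1, h2⟩ := (hlow' i t ht).2.2 x hx
      obtain ⟨h3, h4⟩ := fderiv_of_add isOpen_interior (Ψ := fun y => i.D.ΨFE Ω qs r y t)
        (fun y hy => hΨ y (interior_subset hy) t) hx h1
      refine ⟨h3, ?_⟩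
      rw [h4]
      exact h2.trans (mul_le_mul_of_nonneg_right (by linarith) (by positivity))
  · intro ls lt hls hlt s hs
    have hi := hid ls hls lt hlt (interior (cell s))
      (interior_subset.trans (hA.mesh.cell_subset hs)) isOpen_interior D.I hI
    by_cases hsb : s ∈ D.cutCells Ω
    · obtain ⟨P, rfl, hN, hΨ⟩ := hact s hsb
      obtain ⟨h1, h2⟩ := hhigh ls hls lt hlt (by omega) P.1
      obtain ⟨h3, h4⟩ := highOrder_of_add isOpen_interior hI (interior_subset.trans hN) hi
        ⟨h1, fun t ht x hx => h2 t ht x (hN (interior_subset hx))⟩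
        (fun x hx t ht => hΨ x (interior_subset hx) t ht)
      exact ⟨h3, fun t ht x hx => (h4 t ht x hx).trans (by linarith)⟩
    · obtain ⟨i, rfl, rfl, hΨ⟩ := hinact s hs hsb
      obtain ⟨h3, h4⟩ := highOrder_of_add isOpen_interior hI subset_rfl hi
        (hhigh' ls hls lt hlt i) (fun x hx t _ => hΨ x (interior_subset hx) t)
      exact ⟨h3, fun t ht x hx => (h4 t ht x hx).trans (by linarith)⟩

end FiniteElement

/-- For finite element blending, ℓ ≥ qs + qt + 2 and m ≥ ℓ − 1 give qs + 1 + qt ≤ m, the joint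
smoothness needed for the extended data. All constants are fixed before the slab is introduced. -/
theorem mainTheorem2 {d : ℕ} (Ω : Set (Space d)) (hΩ : IsOpen Ω) (hΩb : Bornology.IsBounded Ω)
    (qs qt ℓ m r : ℕ) (hqs : 1 ≤ qs) (hqt : 1 ≤ qt) (hℓ : max qs qt + 2 ≤ ℓ)
    (hm : m = ℓ - 1 ∨ m = ℓ) (hr : qs + 1 ≤ r) (c : Consts) :
    (∀ wb Cb : ℝ, 0 < wb → wb < min c.δΩ c.δU →
      ∃ C h₀ τ₀ : ℝ, 0 < C ∧ 0 < h₀ ∧ 0 < τ₀ ∧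
        ∀ (D : Slab d) (b : Space d → ℝ → ℝ), Admissible Ω qs qt ℓ m c D →
          SmoothBlending Ω qs qt ℓ c wb Cb D b → D.h ≤ h₀ → D.τ ≤ τ₀ →
          D.WellPosed Ω b (D.blendCells Ω b) ∧
          LowOrderBounds Ω qt D (D.ΨSmooth Ω b) C ∧
          GradBound D (D.ΨSmooth Ω b) 1 (C * (D.h + D.τ ^ (qt + 1))) ∧
          ∀ ls lt : ℕ, ls ≤ qs + 1 → lt ≤ qt + 1 → ls + lt ≤ m →
            HighOrderBound D (D.ΨSmooth Ω b) ls lt C) ∧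
    (qs + qt + 2 ≤ ℓ → ∀ κ Ccfl : ℝ,
      ∃ C h₀ τ₀ : ℝ, 0 < C ∧ 0 < h₀ ∧ 0 < τ₀ ∧
        ∀ D : Slab d, Admissible Ω qs qt ℓ m c D →
          FEBlending Ω c κ Ccfl D → D.h ≤ h₀ → D.τ ≤ τ₀ →
          D.WellPosed Ω 0 (D.cutCells Ω) ∧
          LowOrderBounds Ω qt D (D.ΨFE Ω qs r) C ∧
          GradBound D (D.ΨFE Ω qs r) D.h (C * (D.h ^ 2 + D.τ ^ (qt + 1))) ∧
          ∀ ls lt : ℕ, ls ≤ qs + 1 → lt ≤ qt → HighOrderBound D (D.ΨFE Ω qs r) ls lt C) := by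
  have h1 : qt + 2 ≤ ℓ := by omega
  refine ⟨fun wb Cb hwb0 hwb => smoothBlending_bounds hΩ hΩb hqs hqt h1 (by omega) (by omega) c
    wb Cb hwb0 hwb, fun hℓ' κ Ccfl => feBlending_bounds hΩ hΩb hqs hqt h1 (by omega) (by omega) hr c
    κ Ccfl⟩
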